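/- Let $M$ be a $3$-manifold with a contact form $\lambda$, that is, a smooth $1$-form with $\lambda\wedge d\lambda\neq 0$ everywhere. Let $\xi=\ker\lambda$ be the contact structure; orient $M$ by $\lambda\wedge d\lambda$ and $\xi$ by $d\lambda|_\xi$. Let $\Gamma\subset M$ be a Legendrian graph, i.e. a finite embedded graph with smooth edges tangent to $\xi$ and with vertices of valence at most three. Let $S\subset M$ be an embedded oriented surface (without boundary, not necessarily closed) that contains $\Gamma$ and satisfies $T_pS=\xi_p$, as oriented planes, at every $p\in\Gamma$. Then there is an open neighbourhood $V$ of $\Gamma$ in $S$ such that the following holds for every compact subsurface $\Sigma_\Gamma\subset V$ with smooth boundary that contains $\Gamma$ in its interior and whose boundary $K=\partial\Sigma_\Gamma$, oriented as the boundary of $\Sigma_\Gamma$, is a link all of whose components are positive transverse knots, i.e. $\lambda(\dot\gamma)>0$ for positive parametrizations $\gamma$ (in other words, for every Legendrian ribbon $\Sigma_\Gamma$ of $\Gamma$ in $S$ that is sufficiently small): $$\operatorname{sl}(K,\Sigma_\Gamma)=-\chi(\Sigma_\Gamma).$$ Here the self-linking number $\operatorname{sl}(K,\Sigma_\Gamma)$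 is the algebraic intersection number with $\Sigma_\Gamma$ of a small push-off $K'$ of $K$ in the direction of a nowhere vanishing section $v$ of $\xi|_{\Sigma_\Gamma}$, where $K'$ is disjoint from $K$ and transverse to $\Sigma_\Gamma$; the equality holds for every choice of $v$ and of such push-offs. The Euler characteristic $\chi(\Sigma_\Gamma)$ is the number of vertices minus the number of edges plus the number of triangles of any smooth triangulation of $\Sigma_\Gamma$. -/

import Mathlib

open Set Filter
open scoped Manifold ContDiff Topology

namespace LegendrianRibbon

/-- The model of 3-manifolds. -/
abbrev E3 := EuclideanSpace ℝ (Fin 3)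

/-- The model of surfaces. -/
abbrev E2 := EuclideanSpace ℝ (Fin 2)

noncomputable section

/-! ### Contact forms on 3-manifolds -/

section Contact

variable {M : Type*} [TopologicalSpace M] [ChartedSpace E3 M]

/-- The 1-form `α` expressed in the chart centred at `x₀`: the pullback of `α` under the inverse
of that chart, a 1-form on (an open subset of) `ℝ³`. -/
def localForm (α : ∀ x : M, TangentSpace (𝓡 3) x →L[ℝ] ℝ) (x₀ : M) (y : E3) : E3 →L[ℝ] ℝ :=
  (α ((extChartAt (𝓡 3) x₀).symm y)).comp (mfderiv (𝓡 3) (𝓡 3) (extChartAt (𝓡 3) x₀).symm y)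

/-- A 1-form is smooth if all its chart expressions are. -/
def IsSmoothOneForm (α : ∀ x : M, TangentSpace (𝓡 3) x →L[ℝ] ℝ) : Prop :=
  ∀ x₀ : M, ContDiffOn ℝ ∞ (localForm α x₀) (extChartAt (𝓡 3) x₀).target

/-- The exterior derivative `dα` at `x`, evaluated on two tangent vectors. It is computed in the
preferred chart at `x`, the chart through which `T_x M` is identified with `ℝ³`. -/
def extDer (α : ∀ x : M, TangentSpace (𝓡 3) x →L[ℝ] ℝ) (x : M)
    (a b : TangentSpace (𝓡 3) x) : ℝ :=
  fderiv ℝ (localForm α x) (extChartAt (𝓡 3) x x) a b -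
    fderiv ℝ (localForm α x) (extChartAt (𝓡 3) x x) b a

/-- The 3-form `α ∧ dα` at `x`, evaluated on three tangent vectors. -/
def contactVolume (α : ∀ x : M, TangentSpace (𝓡 3) x →L[ℝ] ℝ) (x : M)
    (a b c : TangentSpace (𝓡 3) x) : ℝ :=
  α x a * extDer α x b c + α x b * extDer α x c a + α x c * extDer α x a b

/-- A (smooth) contact form: `α ∧ dα` vanishes nowhere. The contact structure is `ξ = ker α`,
cooriented by `α` and oriented by the restriction of `dα`; the manifold is oriented by
`α ∧ dα`. -/
def IsContactForm (α : ∀ x : M, TangentSpace (𝓡 3) x →L[ℝ] ℝ) : Prop :=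
  IsSmoothOneForm α ∧ ∀ x : M, ∃ a b c : TangentSpace (𝓡 3) x, contactVolume α x a b c ≠ 0

/-- The velocity of a curve in `M`, a tangent vector at `c s`. -/
def velocity (c : ℝ → M) (s : ℝ) : TangentSpace (𝓡 3) (c s) :=
  mfderiv 𝓘(ℝ, ℝ) (𝓡 3) c s (1 : ℝ)

/-- A finite embedded graph in `M` whose edges are smooth immersed arcs tangent to `ker α`, and
whose vertices have valence at most three. -/
structure LegendrianGraph (α : ∀ x : M, TangentSpace (𝓡 3) x →L[ℝ] ℝ) where
  /-- the vertices -/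
  vertices : Finset M
  /-- the number of edges -/
  numEdges : ℕ
  /-- the edges, parametrized by `[0, 1]` -/
  edge : Fin numEdges → ℝ → M
  smooth : ∀ i, ContMDiffOn 𝓘(ℝ, ℝ) (𝓡 3) ∞ (edge i) (Icc 0 1)
  immersed : ∀ i, ∀ t ∈ Icc (0 : ℝ) 1,
    mfderivWithin 𝓘(ℝ, ℝ) (𝓡 3) (edge i) (Icc 0 1) t (1 : ℝ) ≠ 0
  tangent : ∀ i, ∀ t ∈ Icc (0 : ℝ) 1,
    α (edge i t) (mfderivWithin 𝓘(ℝ, ℝ) (𝓡 3) (edge i) (Icc 0 1) t (1 : ℝ)) = 0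
  start_mem : ∀ i, edge i 0 ∈ vertices
  end_mem : ∀ i, edge i 1 ∈ vertices
  interior_notMem : ∀ i, ∀ t ∈ Ioo (0 : ℝ) 1, edge i t ∉ vertices
  embedded : ∀ i j, ∀ s ∈ Ioo (0 : ℝ) 1, ∀ t ∈ Ioo (0 : ℝ) 1,
    edge i s = edge j t → i = j ∧ s = t
  valence : ∀ x ∈ vertices,
    {e : Fin numEdges × Fin 2 | edge e.1 ((e.2 : ℕ) : ℝ) = x}.ncard ≤ 3

/-- The subset of `M` covered by a graph. -/
def LegendrianGraph.carrier {α : ∀ x : M, TangentSpace (𝓡 3) x →L[ℝ] ℝ}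
    (Γ : LegendrianGraph α) : Set M :=
  {x | x ∈ Γ.vertices} ∪ ⋃ i, Γ.edge i '' Icc 0 1

end Contact

/-! ### Oriented surfaces, compact domains in them, Euler characteristic -/

section Surface

variable {S : Type*} [TopologicalSpace S] [ChartedSpace E2 S]

/-- `(a, b)` is a positive basis of the oriented plane `(P, o)`. -/
def IsPositivePair {P : Type*} [AddCommGroup P] [Module ℝ P]
    (o : Orientation ℝ P (Fin 2)) (a b : P) : Prop :=
  ∃ B : Module.Basis (Fin 2) ℝ P, B 0 = a ∧ B 1 = b ∧ B.orientation = o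

/-- A pointwise choice of orientations of the tangent planes is an orientation of the surface if
it is locally constant, as seen in the charts. -/
def IsSurfaceOrientation
    (o : ∀ p : S, Orientation ℝ (TangentSpace (𝓡 2) p) (Fin 2)) : Prop :=
  ∀ x : S, ∃ o₀ : Orientation ℝ E2 (Fin 2), ∀ᶠ q in 𝓝 x, ∀ a b : TangentSpace (𝓡 2) q,
    IsPositivePair (o q) a b →
      IsPositivePair o₀ (mfderiv (𝓡 2) (𝓡 2) (extChartAt (𝓡 2) x) q a : E2)
        (mfderiv (𝓡 2) (𝓡 2) (extChartAt (𝓡 2) x) q b : E2)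

/-- `g` is a local defining function of `D` at the boundary point `p`: near `p`, the set `D` is
`{g ≤ 0}`, and `g` is smooth with `g p = 0` and `dg_p ≠ 0`. -/
def IsDefiningFunctionAt (D : Set S) (p : S) (g : S → ℝ) : Prop :=
  ContMDiffAt (𝓡 2) 𝓘(ℝ, ℝ) ∞ g p ∧ g p = 0 ∧ mfderiv (𝓡 2) 𝓘(ℝ, ℝ) g p ≠ 0 ∧
    ∀ᶠ q in 𝓝 p, q ∈ D ↔ g q ≤ 0

/-- A compact subsurface of `S` with smooth boundary (the boundary is the frontier). -/
def IsCompactSubsurface (D : Set S) : Prop :=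
  IsCompact D ∧ ∀ p ∈ frontier D, ∃ g : S → ℝ, IsDefiningFunctionAt D p g

/-- The tangent vector `w` at the boundary point `p` of `D` points out of `D`. -/
def IsOutward (D : Set S) (p : S) (w : TangentSpace (𝓡 2) p) : Prop :=
  ∃ g : S → ℝ, IsDefiningFunctionAt D p g ∧
    (0 : ℝ) < mfderiv (𝓡 2) 𝓘(ℝ, ℝ) g p w

/-- The velocity of a curve in a surface. -/
def velocity₂ (c : ℝ → S) (s : ℝ) : TangentSpace (𝓡 2) (c s) :=
  mfderiv 𝓘(ℝ, ℝ) (𝓡 2) c s (1 : ℝ)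

/-- `γ 0, …, γ (m - 1)` are positive parametrizations, by `ℝ / ℤ`, of the components of the
boundary of `D`, where the boundary is oriented by: (outward vector, velocity) is positive. -/
structure IsOrientedBoundary (o : ∀ p : S, Orientation ℝ (TangentSpace (𝓡 2) p) (Fin 2))
    (D : Set S) {m : ℕ} (γ : Fin m → ℝ → S) : Prop where
  smooth : ∀ i, ContMDiff 𝓘(ℝ, ℝ) (𝓡 2) ∞ (γ i)
  periodic : ∀ i, Function.Periodic (γ i) 1
  immersed : ∀ i s, velocity₂ (γ i) s ≠ 0
  embedded : ∀ i j, ∀ s ∈ Ico (0 : ℝ) 1, ∀ s' ∈ Ico (0 : ℝ) 1,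
    γ i s = γ j s' → i = j ∧ s = s'
  covers : ⋃ i, range (γ i) = frontier D
  oriented : ∀ i s, ∀ w : TangentSpace (𝓡 2) (γ i s), IsOutward D (γ i s) w →
    IsPositivePair (o (γ i s)) w (velocity₂ (γ i) s)

/-- The three barycentric coordinates on the standard triangle. -/
def bary (k : Fin 3) (x : E2) : ℝ :=
  ![1 - x 0 - x 1, x 0, x 1] k

/-- The standard closed triangle in the plane. -/
def stdTriangle : Set E2 := {x | ∀ k, 0 ≤ bary k x}

/-- The `k`-th vertex of the standard triangle (as a one-point set). -/
def stdVertex (k : Fin 3) : Set E2 := {x ∈ stdTriangle | bary k x = 1}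

/-- The edge of the standard triangle opposite to the `k`-th vertex. -/
def stdEdge (k : Fin 3) : Set E2 := {x ∈ stdTriangle | bary k x = 0}

/-- A finite smooth triangulation of the subset `D` of `S`: smoothly embedded closed triangles
with union `D`, any two of which are disjoint or meet exactly in a common vertex or exactly in
a common edge. -/
structure IsSmoothTriangulation (D : Set S) {n : ℕ} (σ : Fin n → E2 → S) : Prop where
  smooth : ∀ j, ContMDiffOn (𝓡 2) (𝓡 2) ∞ (σ j) stdTriangle
  injective : ∀ j, InjOn (σ j) stdTriangle
  immersed : ∀ j, ∀ x ∈ stdTriangle,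
    Function.Injective (mfderivWithin (𝓡 2) (𝓡 2) (σ j) stdTriangle x)
  covers : ⋃ j, σ j '' stdTriangle = D
  intersections : ∀ i j, i ≠ j →
    (σ i '' stdTriangle ∩ σ j '' stdTriangle = ∅) ∨
    (∃ k l, σ i '' stdTriangle ∩ σ j '' stdTriangle = σ i '' stdVertex k ∧
      σ i '' stdVertex k = σ j '' stdVertex l) ∨
    (∃ k l, σ i '' stdTriangle ∩ σ j '' stdTriangle = σ i '' stdEdge k ∧
      σ i '' stdEdge k = σ j '' stdEdge l)

/-- The number of vertices of a triangulation (each vertex is counted once). -/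
def numVertices {n : ℕ} (σ : Fin n → E2 → S) : ℕ :=
  {A : Set S | ∃ j k, A = σ j '' stdVertex k}.ncard

/-- The number of edges of a triangulation (each edge is counted once). -/
def numEdges {n : ℕ} (σ : Fin n → E2 → S) : ℕ :=
  {A : Set S | ∃ j k, A = σ j '' stdEdge k}.ncard

/-- `χ` is the Euler characteristic of the compact surface `D`: the number of vertices, minus
the number of edges, plus the number of triangles of a smooth triangulation. -/
def IsEulerCharacteristic (D : Set S) (χ : ℤ) : Prop :=
  ∃ (n : ℕ) (σ : Fin n → E2 → S), IsSmoothTriangulation D σ ∧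
    χ = (numVertices σ : ℤ) - numEdges σ + n

end Surface

/-! ### Self-linking numbers and Legendrian ribbons -/

section Ribbon

variable {M : Type*} [TopologicalSpace M] [ChartedSpace E3 M]
  {S : Type*} [TopologicalSpace S] [ChartedSpace E2 S]

/-- The closed curves `c i` are transverse to the surface `f '' D`. -/
def IsTransverseTo (f : S → M) (D : Set S) {m : ℕ} (c : Fin m → ℝ → M) : Prop :=
  ∀ i s, ∀ q ∈ D, f q = c i s →
    ∀ a : TangentSpace (𝓡 2) q, (mfderiv (𝓡 2) (𝓡 3) f q a : E3) ≠ (velocity (c i) s : E3)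

/-- The parameters `(i, s)`, `0 ≤ s < 1`, at which the curve `c i` crosses `f '' D` with the sign
of `ε`: for a positive basis `(a, b)` of the tangent plane, (velocity, `a`, `b`) is a basis of the
tangent space of `M` with that sign, where `M` is oriented by `α ∧ dα`. -/
def crossings (α : ∀ x : M, TangentSpace (𝓡 3) x →L[ℝ] ℝ)
    (o : ∀ p : S, Orientation ℝ (TangentSpace (𝓡 2) p) (Fin 2))
    (f : S → M) (D : Set S) {m : ℕ} (c : Fin m → ℝ → M) (ε : ℝ) : Set (Fin m × ℝ) :=
  {u | u.2 ∈ Ico (0 : ℝ) 1 ∧ ∃ q ∈ D, f q = c u.1 u.2 ∧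
    ∀ a b : TangentSpace (𝓡 2) q, IsPositivePair (o q) a b →
      0 < ε * contactVolume α (f q) (velocity (c u.1) u.2 : E3)
        (mfderiv (𝓡 2) (𝓡 3) f q a) (mfderiv (𝓡 2) (𝓡 3) f q b)}

/-- `n` is the algebraic intersection number with `f '' D` of the closed curves `c i`, which are
required to avoid the boundary of the surface and to be transverse to the surface. -/
def IsIntersectionNumber (α : ∀ x : M, TangentSpace (𝓡 3) x →L[ℝ] ℝ)
    (o : ∀ p : S, Orientation ℝ (TangentSpace (𝓡 2) p) (Fin 2))
    (f : S → M) (D : Set S) {m : ℕ} (c : Fin m → ℝ → M) (n : ℤ) : Prop :=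
  (∀ i s, c i s ∉ f '' frontier D) ∧ IsTransverseTo f D c ∧
    n = ((crossings α o f D c 1).ncard : ℤ) - (crossings α o f D c (-1)).ncard

/-- `v` is a nowhere vanishing (continuous) section over `D` of the pullback of `ker α`
by `f`. -/
structure IsNonvanishingSection [IsManifold (𝓡 3) ∞ M] (α : ∀ x : M, TangentSpace (𝓡 3) x →L[ℝ] ℝ)
    (f : S → M) (D : Set S) (v : ∀ p : S, TangentSpace (𝓡 3) (f p)) : Prop where
  continuousOn : ContinuousOn (fun p => (⟨f p, v p⟩ : TangentBundle (𝓡 3) M)) D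
  mem_ker : ∀ p ∈ D, α (f p) (v p) = 0
  ne_zero : ∀ p ∈ D, v p ≠ 0

/-- `φ i t` is a smooth family of closed curves, defined for small `t`, that starts at the closed
curve `f ∘ γ i` and moves it in the direction of `v`. -/
structure IsPushOff (f : S → M) {m : ℕ} (γ : Fin m → ℝ → S)
    (v : ∀ p : S, TangentSpace (𝓡 3) (f p)) (φ : Fin m → ℝ → ℝ → M) : Prop where
  smooth : ∃ δ > 0, ∀ i, ContMDiffOn 𝓘(ℝ, ℝ × ℝ) (𝓡 3) ∞ (fun z : ℝ × ℝ => φ i z.1 z.2)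
    (Ioo (-δ) δ ×ˢ univ)
  periodic : ∀ i t, Function.Periodic (φ i t) 1
  start : ∀ i s, φ i 0 s = f (γ i s)
  direction : ∀ i s, (velocity (fun t => φ i t s) 0 : E3) = (v (γ i s) : E3)

/-- `n` is the self-linking number of the transverse link `K`, with components `f ∘ γ i`, with
respect to the surface `f '' D` that it bounds: for some nowhere vanishing section `v` of the
contact structure over the surface, `n` is the algebraic intersection number with the surface of
arbitrarily small push-offs of `K` in the direction of `v`. -/
def IsSelfLinkingNumber [IsManifold (𝓡 3) ∞ M] (α : ∀ x : M, TangentSpace (𝓡 3) x →L[ℝ] ℝ)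
    (o : ∀ p : S, Orientation ℝ (TangentSpace (𝓡 2) p) (Fin 2))
    (f : S → M) (D : Set S) {m : ℕ} (γ : Fin m → ℝ → S) (n : ℤ) : Prop :=
  ∃ (v : ∀ p : S, TangentSpace (𝓡 3) (f p)) (φ : Fin m → ℝ → ℝ → M),
    IsNonvanishingSection α f D v ∧ IsPushOff f γ v φ ∧
      ∃ᶠ t in 𝓝[>] (0 : ℝ), IsIntersectionNumber α o f D (fun i => φ i t) n

/-- The oriented surface `f : S → M` contains the graph `Γ` and is tangent to the contact
structure at every point of `Γ`, where the two orientations agree. -/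
structure IsTangentAlong {α : ∀ x : M, TangentSpace (𝓡 3) x →L[ℝ] ℝ} (Γ : LegendrianGraph α)
    (o : ∀ p : S, Orientation ℝ (TangentSpace (𝓡 2) p) (Fin 2)) (f : S → M) : Prop where
  contains : Γ.carrier ⊆ range f
  tangent : ∀ p : S, f p ∈ Γ.carrier → ∀ a : TangentSpace (𝓡 2) p,
    α (f p) (mfderiv (𝓡 2) (𝓡 3) f p a) = 0
  oriented : ∀ p : S, f p ∈ Γ.carrier → ∀ a b : TangentSpace (𝓡 2) p,
    IsPositivePair (o p) a b →
      0 < extDer α (f p) (mfderiv (𝓡 2) (𝓡 3) f p a) (mfderiv (𝓡 2) (𝓡 3) f p b)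

/-- The compact subsurface `D` of `f : S → M` is a neighbourhood of the graph `Γ`, and the
components `f ∘ γ i` of its oriented boundary are positive transverse knots. -/
structure IsRibbonNeighbourhood {α : ∀ x : M, TangentSpace (𝓡 3) x →L[ℝ] ℝ}
    (Γ : LegendrianGraph α) (o : ∀ p : S, Orientation ℝ (TangentSpace (𝓡 2) p) (Fin 2))
    (f : S → M) (D : Set S) {m : ℕ} (γ : Fin m → ℝ → S) : Prop where
  subsurface : IsCompactSubsurface D
  contains : f ⁻¹' Γ.carrier ⊆ interior D
  boundary : IsOrientedBoundary o D γ
  transverse : ∀ i s, 0 < α (f (γ i s)) (velocity (fun s' => f (γ i s')) s)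

end Ribbon

end

end LegendrianRibbon

/-!
The neighbourhood `V` consists of the points near which `dα` is a positive area form on the
surface; it contains the graph because there the surface is tangent to the contact planes, with
the same orientation. Let `D` be a compact domain in `V` with positively transverse boundary, and
`v` a nowhere vanishing section of the contact structure over `D`. Both sides of the asserted
equation are winding numbers along `∂D`, taken in one frame of `TD`.

**The frame.** The 1-form `η = dα(v, ·)` vanishes nowhere on `D`: as `dα` is nondegenerate on the
tangent plane, a vector that is `dα`-orthogonal to this plane lies in the kernel of `dα`, which
meets `ker α` only in zero. A partition of unity gives a 1-form `μ` with `μ ∧ η > 0`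
(`IsNonvanishingSection.exists_frame`), and `Φ = μ + iη` identifies each tangent plane of `D` with
`ℂ`, preserving orientation.

**The Euler characteristic.** For any such frame the tangent vector of `∂D` has total winding
number `χ(D)` (`IsSmoothTriangulation.sum_argVar_boundary`). This is the Gauss–Bonnet argument for
the flat connection that the frame defines. In a single triangle the rotations of the three sides
and the exterior angles at the corners sum to `2π` (`sum_argVar_eq_sum_cornerAngle`). Summed over
all triangles, the rotations along an interior edge cancel, those along boundary edges give the
winding of the boundary curves, and the corner angles at a vertex add up to `2π` in the interior
and to `π` on the boundary (`IsSmoothTriangulation.sum_cornerAngle`). The angle sums come from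
measuring directions: the tangent cones of the triangles at a point have disjoint interiors and
cover the tangent cone of `D` (`sum_angle_eq`, `IsSmoothTriangulation.sum_angle`). An edge lies in
two triangles or in one by the same measurement with half planes in place of corners
(`IsSmoothTriangulation.card_edge`), and it remains to count vertices, edges and triangles.

**The self-linking number.** Near `∂D` the surface is `z = 0` and `D` is `z = 0, h ≤ 0`, for two
functions `z`, `h` on a neighbourhood in the 3-manifold (`IsCollar`, `exists_isCollar_frontier`).
A push-off meets `D` where the loop `(z, h)`, evaluated along it, crosses the ray `z = 0, h < 0`,
with the sign of the crossing; the signed number of crossings is the winding number of the loop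
(`ncard_crossings_eq_argVar`). Divided by the parameter `t` of the push-off the loop converges to
`dz(v) + i dh(v)` along `∂D`, so the self-linking number is the total winding number of the latter
(`IsCollar.intersectionNumber_eq`).

**The comparison.** Along a boundary curve `γ`, consider the three loops `dz(v) + i dh(v)`,
`dz(v) + i η(γ')` and `-μ(γ') + i η(γ')`. The first two have the same real part, and where it
vanishes their imaginary parts have the same sign; the last two have the same imaginary part, and
where it vanishes their real parts have the same sign. This is where positivity of `dα` on the
surface and of `α` on `γ'` enter. Hence consecutive loops never point in opposite directions and
have the same winding number. The last loop is `-conj Φ(γ')`, whose winding number is minus that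
of `Φ(γ')` (`IsCollar.argVar_collarDeriv`). Therefore `sl = -χ`.
-/

/-! ### Continuous arguments and winding -/

namespace LegendrianRibbon

/-- `θ` is a continuous argument of the complex-valued function `c` on `A`. -/
def IsArgOn {X : Type*} [TopologicalSpace X] (θ : X → ℝ) (c : X → ℂ) (A : Set X) : Prop :=
  ContinuousOn θ A ∧ ∀ x ∈ A, c x = ‖c x‖ * Complex.exp (θ x * Complex.I)

theorem exists_isArgOn_univ {X : Type*} [TopologicalSpace X] [SimplyConnectedSpace X]
    [LocallyPathConnectedSpace X] {c : X → ℂ} (hc : Continuous c) (h0 : ∀ x, c x ≠ 0) :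
    ∃ θ : X → ℝ, IsArgOn θ c univ := by
  obtain ⟨f, hf, hfe⟩ := Complex.exists_continuousOn_eqOn_exp_comp
    (U := (univ : Set X))
    ((Homeomorph.Set.univ X).toHomotopyEquiv.simplyConnectedSpace_iff.mpr inferInstance)
    isOpen_univ hc.continuousOn
    (by simpa using h0)
  refine ⟨fun x => (f x).im, Complex.continuous_im.comp_continuousOn hf, fun x hx => ?_⟩
  have h : Complex.exp (f x) = c x := hfe hx
  rw [← h, Complex.norm_exp, Complex.ofReal_exp, ← Complex.exp_add, Complex.re_add_im]

theorem exists_isArgOn_Icc {c : ℝ → ℂ} {a b : ℝ} (hab : a ≤ b) (hc : ContinuousOn c (Icc a b))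
    (h0 : ∀ s ∈ Icc a b, c s ≠ 0) : ∃ θ : ℝ → ℝ, IsArgOn θ c (Icc a b) := by
  obtain ⟨θ, hθ, hθe⟩ := exists_isArgOn_univ (X := ℝ) (c := IccExtend hab ((Icc a b).domRestrict c))
    (Continuous.Icc_extend' (continuousOn_iff_continuous_domRestrict.mp hc))
    (fun x => h0 _ (projIcc a b hab x).2)
  refine ⟨θ, hθ.mono (subset_univ _), fun x hx => ?_⟩
  have := hθe x (mem_univ _)
  rwa [IccExtend_of_mem hab _ hx] at this

/-- A continuous function with values in a discrete set of multiples of `π` is constant on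
connected sets. -/
theorem eq_of_forall_int_mul_pi {X : Type*} [TopologicalSpace X] {A : Set X}
    (hA : IsPreconnected A) {f : X → ℝ} (hf : ContinuousOn f A)
    (h : ∀ x ∈ A, ∃ n : ℤ, n * Real.pi = f x) {x y : X} (hx : x ∈ A) (hy : y ∈ A) : f x = f y := by
  have hcont : ContinuousOn (fun x => round (f x / Real.pi)) A := by
    intro z hz
    obtain ⟨n, hn⟩ := h z hz
    have h1 : ∀ᶠ w in 𝓝[A] z, |f w - f z| < Real.pi := by
      have := (hf z hz).sub (continuousWithinAt_const (b := f z))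
      have h2 := this.abs.eventually_lt_const (u := Real.pi) (by simpa using Real.pi_pos)
      simpa using h2
    refine ContinuousWithinAt.congr_of_eventuallyEq
      (continuousWithinAt_const (b := round (f z / Real.pi))) ?_ rfl
    filter_upwards [h1, self_mem_nhdsWithin] with w hw hwA
    obtain ⟨m, hm⟩ := h w hwA
    rw [← hn, ← hm, ← sub_mul, abs_mul, abs_of_pos Real.pi_pos] at hw
    have hw' : |((m : ℝ) - n)| < 1 := by
      by_contra! hcon
      nlinarith [Real.pi_pos]
    have : |m - n| < 1 := by exact_mod_cast hw'
    have hmn : m = n := by have := Int.abs_lt_one_iff.mp this; omega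
    rw [← hn, ← hm, hmn]
  have key := hA.constant hcont hx hy
  obtain ⟨n, hn⟩ := h x hx
  obtain ⟨m, hm⟩ := h y hy
  simp only [← hn, ← hm, mul_div_cancel_right₀ _ Real.pi_ne_zero, round_intCast] at key
  rw [← hn, ← hm, key]

/-- Continuous arguments of two everywhere parallel functions differ by a constant. -/
theorem IsArgOn.sub_eq_of_parallel {X : Type*} [TopologicalSpace X] {A : Set X}
    (hA : IsPreconnected A) {θ₁ θ₂ : X → ℝ} {c₁ c₂ : X → ℂ} (h₁ : IsArgOn θ₁ c₁ A)
    (h₂ : IsArgOn θ₂ c₂ A) (n₁ : ∀ x ∈ A, c₁ x ≠ 0) (n₂ : ∀ x ∈ A, c₂ x ≠ 0)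
    (hp : ∀ x ∈ A, (c₁ x * (starRingEnd ℂ) (c₂ x)).im = 0) {x y : X} (hx : x ∈ A) (hy : y ∈ A) :
    θ₁ x - θ₁ y = θ₂ x - θ₂ y := by
  have := eq_of_forall_int_mul_pi hA (h₁.1.sub h₂.1) (fun z hz => ?_) hx hy
  · simp only [Pi.sub_apply] at this; linarith
  rw [← Real.sin_eq_zero_iff, Pi.sub_apply, Real.sin_sub]
  have e := hp z hz
  rw [h₁.2 z hz, h₂.2 z hz] at e
  simp only [Complex.exp_mul_I, ← Complex.ofReal_cos, ← Complex.ofReal_sin, Complex.mul_im,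
    Complex.mul_re, Complex.conj_re, Complex.conj_im, Complex.add_re, Complex.add_im,
    Complex.ofReal_re, Complex.ofReal_im, Complex.I_re, Complex.I_im] at e
  have a1 : ‖c₁ z‖ ≠ 0 := norm_ne_zero_iff.mpr (n₁ z hz)
  have a2 : ‖c₂ z‖ ≠ 0 := norm_ne_zero_iff.mpr (n₂ z hz)
  have : ‖c₁ z‖ * ‖c₂ z‖ * (Real.sin (θ₁ z) * Real.cos (θ₂ z) - Real.cos (θ₁ z) * Real.sin (θ₂ z))
    = 0 := by linarith
  exact (mul_eq_zero.mp this).resolve_left (mul_ne_zero a1 a2)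

open Classical in
/-- The variation of the argument of `c` over the interval `[a, b]`. -/
noncomputable def argVar (c : ℝ → ℂ) (a b : ℝ) : ℝ :=
  if h : ∃ θ : ℝ → ℝ, IsArgOn θ c (Icc a b) then h.choose b - h.choose a else 0

theorem im_mul_conj_self (z : ℂ) : (z * (starRingEnd ℂ) z).im = 0 := by
  simp [Complex.mul_im]; ring

theorem IsArgOn.argVar_eq {θ : ℝ → ℝ} {c : ℝ → ℂ} {a b : ℝ} (h : IsArgOn θ c (Icc a b))
    (hab : a ≤ b) (h0 : ∀ s ∈ Icc a b, c s ≠ 0) : argVar c a b = θ b - θ a := by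
  have hex : ∃ θ : ℝ → ℝ, IsArgOn θ c (Icc a b) := ⟨θ, h⟩
  rw [argVar, dif_pos hex]
  exact hex.choose_spec.sub_eq_of_parallel isPreconnected_Icc h h0 h0
    (fun _ _ => im_mul_conj_self _) (right_mem_Icc.mpr hab) (left_mem_Icc.mpr hab)

/-- Reparametrization invariance, also up to pointwise real factors. -/
theorem argVar_eq_of_parallel_comp {c₁ c₂ : ℝ → ℂ} {a b a' b' : ℝ} (hab : a < b) (hab' : a' ≤ b')
    (h₁ : ContinuousOn c₁ (Icc a b)) (h₂ : ContinuousOn c₂ (Icc a' b'))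
    (n₁ : ∀ s ∈ Icc a b, c₁ s ≠ 0) (n₂ : ∀ s ∈ Icc a' b', c₂ s ≠ 0)
    {ψ : ℝ → ℝ} (hψ : ContinuousOn ψ (Icc a b)) (hm : MapsTo ψ (Icc a b) (Icc a' b'))
    (hp : ∀ s ∈ Ioo a b, (c₁ s * (starRingEnd ℂ) (c₂ (ψ s))).im = 0) :
    (ψ a = a' → ψ b = b' → argVar c₁ a b = argVar c₂ a' b') ∧
    (ψ a = b' → ψ b = a' → argVar c₁ a b = - argVar c₂ a' b') := by
  obtain ⟨θ₁, hθ₁⟩ := exists_isArgOn_Icc hab.le h₁ n₁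
  obtain ⟨θ₂, hθ₂⟩ := exists_isArgOn_Icc hab' h₂ n₂
  have hp' : ∀ s ∈ Icc a b, (c₁ s * (starRingEnd ℂ) (c₂ (ψ s))).im = 0 := by
    have hcont : ContinuousOn (fun s => (c₁ s * (starRingEnd ℂ) (c₂ (ψ s))).im) (Icc a b) :=
      Complex.continuous_im.comp_continuousOn
        (h₁.mul (Complex.continuous_conj.comp_continuousOn (h₂.comp hψ hm)))
    have := (show EqOn (fun s => (c₁ s * (starRingEnd ℂ) (c₂ (ψ s))).im) (fun _ => 0) (Ioo a b)
      from hp).of_subset_closure hcont continuousOn_const Ioo_subset_Icc_self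
      (by rw [closure_Ioo hab.ne])
    exact this
  have hθ : IsArgOn (θ₂ ∘ ψ) (c₂ ∘ ψ) (Icc a b) :=
    ⟨hθ₂.1.comp hψ hm, fun x hx => hθ₂.2 _ (hm hx)⟩
  have key := hθ₁.sub_eq_of_parallel isPreconnected_Icc hθ n₁ (fun x hx => n₂ _ (hm hx)) hp'
    (right_mem_Icc.mpr hab.le) (left_mem_Icc.mpr hab.le)
  rw [hθ₁.argVar_eq hab.le n₁, hθ₂.argVar_eq hab' n₂, key]
  simp only [Function.comp]
  constructor
  · intro e1 e2; rw [e1, e2]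
  · intro e1 e2; rw [e1, e2]; ring

theorem IsArgOn.conj {X : Type*} [TopologicalSpace X] {θ : X → ℝ} {c : X → ℂ} {A : Set X}
    (h : IsArgOn θ c A) : IsArgOn (fun x => -θ x) (fun x => (starRingEnd ℂ) (c x)) A := by
  refine ⟨h.1.neg, fun x hx => ?_⟩
  show (starRingEnd ℂ) (c x) = _
  conv_lhs => rw [h.2 x hx]
  rw [map_mul, ← Complex.exp_conj]
  simp

theorem argVar_conj {c : ℝ → ℂ} {a b : ℝ} (hab : a ≤ b) (hc : ContinuousOn c (Icc a b))
    (h0 : ∀ s ∈ Icc a b, c s ≠ 0) :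
    argVar (fun s => (starRingEnd ℂ) (c s)) a b = - argVar c a b := by
  obtain ⟨θ, hθ⟩ := exists_isArgOn_Icc hab hc h0
  rw [hθ.argVar_eq hab h0, hθ.conj.argVar_eq hab (fun s hs => by simpa using h0 s hs)]
  ring

theorem argVar_neg {c : ℝ → ℂ} {a b : ℝ} (hab : a < b) (hc : ContinuousOn c (Icc a b))
    (h0 : ∀ s ∈ Icc a b, c s ≠ 0) : argVar (fun s => - c s) a b = argVar c a b := by
  refine (argVar_eq_of_parallel_comp hab hab.le hc.neg hc (by simpa using h0) h0 continuousOn_id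
    (mapsTo_id _) (fun s _ => ?_)).1 rfl rfl
  have := im_mul_conj_self (c s)
  simp only [Pi.neg_apply, id, neg_mul, Complex.neg_im, this, neg_zero]

theorem IsArgOn.add_arg {X : Type*} [TopologicalSpace X] {θ : X → ℝ} {c d : X → ℂ} {A : Set X}
    (h : IsArgOn θ c A) (hc : ContinuousOn c A) (hd : ContinuousOn d A) (h0 : ∀ x ∈ A, c x ≠ 0)
    (hcd : ∀ x ∈ A, d x / c x ∈ Complex.slitPlane) :
    IsArgOn (fun x => θ x + (d x / c x).arg) d A := by
  refine ⟨h.1.add (fun x hx => ?_), fun x hx => ?_⟩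
  · exact ContinuousAt.comp_continuousWithinAt (f := fun y => d y / c y)
      (Complex.continuousAt_arg (hcd x hx)) ((hd.div hc h0) x hx)
  · have e1 := h.2 x hx
    have e2 := Complex.norm_mul_exp_arg_mul_I (d x / c x)
    have e3 : d x = c x * (d x / c x) := by field_simp [h0 x hx]
    have hn : (‖c x‖ : ℂ) ≠ 0 := by simpa using h0 x hx
    rw [Complex.ofReal_add, add_mul, Complex.exp_add]
    calc d x = c x * (d x / c x) := e3
      _ = (‖c x‖ * Complex.exp (θ x * Complex.I)) *
          (‖d x / c x‖ * Complex.exp ((d x / c x).arg * Complex.I)) := by rw [e2, ← e1]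
      _ = _ := by rw [norm_div, Complex.ofReal_div]; field_simp

/-- Two closed curves that are nowhere opposite have the same winding. -/
theorem argVar_eq_of_slitPlane {c d : ℝ → ℂ} {a b : ℝ} (hab : a ≤ b) (hc : ContinuousOn c (Icc a b))
    (hd : ContinuousOn d (Icc a b)) (h0 : ∀ s ∈ Icc a b, c s ≠ 0)
    (hcd : ∀ s ∈ Icc a b, d s / c s ∈ Complex.slitPlane) (ec : c a = c b) (ed : d a = d b) :
    argVar d a b = argVar c a b := by
  obtain ⟨θ, hθ⟩ := exists_isArgOn_Icc hab hc h0
  have hd0 : ∀ s ∈ Icc a b, d s ≠ 0 := by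
    intro s hs h
    have := hcd s hs
    simp [h] at this
  rw [(hθ.add_arg hc hd h0 hcd).argVar_eq hab hd0, hθ.argVar_eq hab h0, ec, ed]
  ring

/-! ### Counting signed crossings of a ray -/

/-- The values of a continuous function at integer levels, crossed upwards at `Up` and downwards at
`Dn`: the signed number of crossings over a period is the increment of the function. -/
theorem ncard_up_sub_ncard_down {ψ : ℝ → ℝ} (hψ : Continuous ψ) {Up Dn : Set ℝ}
    (hdisj : Disjoint Up Dn) (hlev : ∀ s, (s ∈ Up ∨ s ∈ Dn) ↔ ∃ n : ℤ, ψ s = n)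
    (hUp : ∀ s ∈ Up, (∀ᶠ t in 𝓝[>] s, ψ s < ψ t) ∧ ∀ᶠ t in 𝓝[<] s, ψ t < ψ s)
    (hDn : ∀ s ∈ Dn, (∀ᶠ t in 𝓝[>] s, ψ t < ψ s) ∧ ∀ᶠ t in 𝓝[<] s, ψ s < ψ t)
    {W : ℤ} (hW : ψ 1 = ψ 0 + W) (hper : (1 : ℝ) ∈ Up ↔ (0 : ℝ) ∈ Up) :
    (Up ∩ Ico 0 1).Finite ∧ (Dn ∩ Ico 0 1).Finite ∧
      ((Up ∩ Ico 0 1).ncard : ℤ) - (Dn ∩ Ico 0 1).ncard = W := by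
  classical
  have hdis : ∀ s, s ∈ Up → s ∉ Dn := fun s h h' => disjoint_left.mp hdisj h h'
  -- near `s`, the integer part changes only at `s`
  have near : ∀ s, ∀ᶠ t in 𝓝 s, |ψ t - ψ s| < 1 := fun s => by
    have := (hψ.sub (continuous_const (y := ψ s))).abs.continuousAt (x := s)
    have h2 := this.eventually_lt_const (u := 1) (by simp)
    simpa using h2
  set lev : ℝ → ℤ := fun s => ⌊ψ s⌋ - if s ∈ Up then 1 else 0 with hlevdef
  have noncross : ∀ s, s ∉ Up → s ∉ Dn → ∀ᶠ t in 𝓝 s, t ∉ Up ∧ t ∉ Dn ∧ lev t = lev s := by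
    intro s h1 h2
    have h3 : ¬ ∃ n : ℤ, ψ s = n := fun h => by
      rcases (hlev s).mpr h with h | h
      exacts [h1 h, h2 h]
    have l1 : (⌊ψ s⌋ : ℝ) < ψ s := lt_of_le_of_ne (Int.floor_le _) (fun h => h3 ⟨_, h.symm⟩)
    filter_upwards [hψ.continuousAt.eventually_const_lt l1,
      hψ.continuousAt.eventually_lt_const (Int.lt_floor_add_one (ψ s))] with t t1 t2
    have hfl : ⌊ψ t⌋ = ⌊ψ s⌋ := by
      rw [Int.floor_eq_iff]; exact ⟨t1.le, t2⟩
    have hn : ¬ ∃ n : ℤ, ψ t = n := by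
      rintro ⟨n, hn⟩
      rw [hn] at hfl t1
      rw [Int.floor_intCast] at hfl
      rw [hfl] at t1
      exact lt_irrefl _ t1
    have g1 : t ∉ Up := fun h => hn ((hlev t).mp (Or.inl h))
    have g2 : t ∉ Dn := fun h => hn ((hlev t).mp (Or.inr h))
    refine ⟨g1, g2, ?_⟩
    simp only [hlevdef, hfl, if_neg g1, if_neg h1]
  -- one-sided behaviour at any point
  have right : ∀ s, ∀ᶠ t in 𝓝[>] s, t ∉ Up ∧ t ∉ Dn ∧
      lev t = lev s + (if s ∈ Up then 1 else 0) - (if s ∈ Dn then 1 else 0) := by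
    intro s
    by_cases h1 : s ∈ Up
    · obtain ⟨n, hn⟩ := (hlev s).mp (Or.inl h1)
      filter_upwards [(hUp s h1).1, nhdsWithin_le_nhds (near s)] with t t1 t2
      rw [abs_lt] at t2
      have hfl : ⌊ψ t⌋ = n := by rw [Int.floor_eq_iff]; rw [hn] at *; constructor <;> linarith
      have hni : ¬ ∃ m : ℤ, ψ t = m := by
        rintro ⟨m, hm⟩
        rw [hm, Int.floor_intCast] at hfl
        rw [hm, hfl, hn] at t1; exact lt_irrefl _ t1
      have g1 : t ∉ Up := fun h => hni ((hlev t).mp (Or.inl h))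
      have g2 : t ∉ Dn := fun h => hni ((hlev t).mp (Or.inr h))
      refine ⟨g1, g2, ?_⟩
      simp [hlevdef, hfl, if_neg g1, h1, hdis s h1, hn]
    by_cases h2 : s ∈ Dn
    · obtain ⟨n, hn⟩ := (hlev s).mp (Or.inr h2)
      filter_upwards [(hDn s h2).1, nhdsWithin_le_nhds (near s)] with t t1 t2
      rw [abs_lt] at t2
      have hfl : ⌊ψ t⌋ = n - 1 := by
        rw [Int.floor_eq_iff]; rw [hn] at *; push_cast; constructor <;> linarith
      have hni : ¬ ∃ m : ℤ, ψ t = m := by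
        rintro ⟨m, hm⟩
        rw [hm, Int.floor_intCast] at hfl
        rw [hm, hfl, hn] at t2; push_cast at t2; linarith
      have g1 : t ∉ Up := fun h => hni ((hlev t).mp (Or.inl h))
      have g2 : t ∉ Dn := fun h => hni ((hlev t).mp (Or.inr h))
      refine ⟨g1, g2, ?_⟩
      simp [hlevdef, hfl, if_neg g1, h1, h2, hn]
    · filter_upwards [nhdsWithin_le_nhds (noncross s h1 h2)] with t ht
      simpa [h1, h2] using ht
  have left : ∀ s, ∀ᶠ t in 𝓝[<] s, t ∉ Up ∧ t ∉ Dn ∧ lev t = lev s := by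
    intro s
    by_cases h1 : s ∈ Up
    · obtain ⟨n, hn⟩ := (hlev s).mp (Or.inl h1)
      filter_upwards [(hUp s h1).2, nhdsWithin_le_nhds (near s)] with t t1 t2
      rw [abs_lt] at t2
      have hfl : ⌊ψ t⌋ = n - 1 := by
        rw [Int.floor_eq_iff]; rw [hn] at *; push_cast; constructor <;> linarith
      have hni : ¬ ∃ m : ℤ, ψ t = m := by
        rintro ⟨m, hm⟩
        rw [hm, Int.floor_intCast] at hfl
        rw [hm, hfl, hn] at t2; push_cast at t2; linarith
      have g1 : t ∉ Up := fun h => hni ((hlev t).mp (Or.inl h))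
      have g2 : t ∉ Dn := fun h => hni ((hlev t).mp (Or.inr h))
      refine ⟨g1, g2, ?_⟩
      simp [hlevdef, hfl, if_neg g1, h1, hn]
    by_cases h2 : s ∈ Dn
    · obtain ⟨n, hn⟩ := (hlev s).mp (Or.inr h2)
      filter_upwards [(hDn s h2).2, nhdsWithin_le_nhds (near s)] with t t1 t2
      rw [abs_lt] at t2
      have hfl : ⌊ψ t⌋ = n := by rw [Int.floor_eq_iff]; rw [hn] at *; constructor <;> linarith
      have hni : ¬ ∃ m : ℤ, ψ t = m := by
        rintro ⟨m, hm⟩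
        rw [hm, Int.floor_intCast] at hfl
        rw [hm, hfl, hn] at t1; exact lt_irrefl _ t1
      have g1 : t ∉ Up := fun h => hni ((hlev t).mp (Or.inl h))
      have g2 : t ∉ Dn := fun h => hni ((hlev t).mp (Or.inr h))
      refine ⟨g1, g2, ?_⟩
      simp [hlevdef, hfl, if_neg g1, h1, hn]
    · filter_upwards [nhdsWithin_le_nhds (noncross s h1 h2)] with t ht
      exact ht
  have hfin : ((Up ∪ Dn) ∩ Icc 0 1).Finite := by
    have := isCompact_Icc (a := (0 : ℝ)) (b := 1) |>.induction_on
      (p := fun A => ((Up ∪ Dn) ∩ A).Finite) (by simp)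
      (fun A B hAB hB => hB.subset (inter_subset_inter_right _ hAB))
      (fun A B hA hB => by rw [inter_union_distrib_left]; exact hA.union hB)
      (fun s _ => by
        have hh : ∀ᶠ t in 𝓝 s, t ∈ (Up ∪ Dn)ᶜ ∪ {s} := by
          rw [← nhdsNE_sup_pure, eventually_sup, ← nhdsLT_sup_nhdsGT, eventually_sup]
          refine ⟨⟨?_, ?_⟩, by simp⟩
          · filter_upwards [left s] with t ht; simp [ht.1, ht.2.1]
          · filter_upwards [right s] with t ht; simp [ht.1, ht.2.1]
        refine ⟨_, nhdsWithin_le_nhds hh, (finite_singleton s).subset ?_⟩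
        rintro t ⟨t1, t2 | t2⟩
        · exact absurd t1 t2
        · exact t2)
    exact this
  have fU : ∀ A ⊆ Icc (0 : ℝ) 1, (Up ∩ A).Finite := fun A hA =>
    hfin.subset (inter_subset_inter subset_union_left hA)
  have fD : ∀ A ⊆ Icc (0 : ℝ) 1, (Dn ∩ A).Finite := fun A hA =>
    hfin.subset (inter_subset_inter subset_union_right hA)
  refine ⟨fU _ Ico_subset_Icc_self, fD _ Ico_subset_Icc_self, ?_⟩
  have step_r : ∀ (C : Set ℝ) (s t : ℝ), 0 ≤ s → s < t → (∀ r ∈ Ioo s t, r ∉ C) →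
      (C ∩ Ico 0 s).Finite →
      ((C ∩ Ico 0 t).ncard : ℤ) = (C ∩ Ico 0 s).ncard + if s ∈ C then 1 else 0 := by
    intro C s t hs hst hC hf
    by_cases h : s ∈ C
    · have : C ∩ Ico 0 t = insert s (C ∩ Ico 0 s) := by
        ext r
        simp only [mem_inter_iff, mem_Ico, mem_insert_iff]
        constructor
        · rintro ⟨r1, r2, r3⟩
          rcases lt_trichotomy r s with g | g | g
          · exact Or.inr ⟨r1, r2, g⟩
          · exact Or.inl g
          · exact absurd r1 (hC r ⟨g, r3⟩)
        · rintro (rfl | ⟨r1, r2, r3⟩)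
          · exact ⟨h, hs, hst⟩
          · exact ⟨r1, r2, r3.trans hst⟩
      rw [this, ncard_insert_of_notMem (by simp) hf, if_pos h]; push_cast; ring
    · have : C ∩ Ico 0 t = C ∩ Ico 0 s := by
        ext r
        simp only [mem_inter_iff, mem_Ico]
        constructor
        · rintro ⟨r1, r2, r3⟩
          rcases lt_trichotomy r s with g | g | g
          · exact ⟨r1, r2, g⟩
          · exact absurd (g ▸ r1) h
          · exact absurd r1 (hC r ⟨g, r3⟩)
        · rintro ⟨r1, r2, r3⟩
          exact ⟨r1, r2, r3.trans hst⟩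
      rw [this, if_neg h]; simp
  set F : ℝ → ℤ := fun b => lev b - (Up ∩ Ico 0 b).ncard + (Dn ∩ Ico 0 b).ncard with hF
  have Fstep : ∀ s t, 0 ≤ s → s < t → t ≤ 1 → (∀ r ∈ Ioo s t, r ∉ Up ∧ r ∉ Dn) →
      F t = lev t - (Up ∩ Ico 0 s).ncard - (if s ∈ Up then 1 else 0)
        + (Dn ∩ Ico 0 s).ncard + (if s ∈ Dn then 1 else 0) := by
    intro s t h0 hst h1 hr
    simp only [hF]
    rw [step_r Up s t h0 hst (fun r hr' => (hr r hr').1)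
        (fU _ (fun r hr => ⟨hr.1, by linarith [hr.2]⟩)),
      step_r Dn s t h0 hst (fun r hr' => (hr r hr').2)
        (fD _ (fun r hr => ⟨hr.1, by linarith [hr.2]⟩))]
    ring
  have hFc : ContinuousOn F (Icc 0 1) := by
    intro s hs
    refine ContinuousWithinAt.congr_of_eventuallyEq
      (continuousWithinAt_const (b := F s)) ?_ rfl
    have : ∀ᶠ t in 𝓝 s, t ∈ Icc (0 : ℝ) 1 → F t = F s := by
      rw [← nhdsNE_sup_pure, eventually_sup, ← nhdsLT_sup_nhdsGT, eventually_sup]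
      refine ⟨⟨?_, ?_⟩, by simp⟩
      · obtain ⟨l, hl, hl'⟩ := (mem_nhdsLT_iff_exists_Ioo_subset).mp (left s)
        filter_upwards [Ioo_mem_nhdsLT hl] with t ht htI
        have := Fstep t s htI.1 ht.2 hs.2 (fun r hr => by
          have := hl' (show r ∈ Ioo l s from ⟨ht.1.trans hr.1, hr.2⟩)
          exact ⟨this.1, this.2.1⟩)
        obtain ⟨g1, g2, g3⟩ := hl' ht
        rw [this, if_neg g1, if_neg g2, ← g3]
        simp only [hF]; ring
      · obtain ⟨l, hl, hl'⟩ := (mem_nhdsGT_iff_exists_Ioo_subset).mp (right s)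
        filter_upwards [Ioo_mem_nhdsGT hl] with t ht htI
        have := Fstep s t hs.1 ht.1 htI.2 (fun r hr => by
          have := hl' (show r ∈ Ioo s l from ⟨hr.1, hr.2.trans ht.2⟩)
          exact ⟨this.1, this.2.1⟩)
        obtain ⟨g1, g2, g3⟩ := hl' ht
        rw [this, g3]
        simp only [hF]; ring
    filter_upwards [nhdsWithin_le_nhds this, self_mem_nhdsWithin] with t ht htI using ht htI
  have key := isPreconnected_Icc.constant hFc (left_mem_Icc.mpr zero_le_one)
    (right_mem_Icc.mpr (zero_le_one (α := ℝ)))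
  have l1 : lev 1 = lev 0 + W := by
    simp only [hlevdef, hW, Int.floor_add_intCast, hper]; ring
  simp only [hF, Ico_self, inter_empty, ncard_empty, l1] at key
  push_cast at key
  linarith

/-- The winding of a closed curve in `ℂ ∖ {0}` is the number of its crossings of the negative
imaginary half-axis, counted with sign, as soon as they are all transverse. -/
theorem ncard_crossings_eq_argVar {U : ℝ → ℂ} (hU : Continuous U) (h0 : ∀ s, U s ≠ 0)
    (hper : Function.Periodic U 1)
    (htr : ∀ s, (U s).re = 0 → (U s).im < 0 → deriv (fun t => (U t).re) s ≠ 0) :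
    {s ∈ Ico (0 : ℝ) 1 | (U s).re = 0 ∧ (U s).im < 0 ∧ 0 < deriv (fun t => (U t).re) s}.Finite ∧
    {s ∈ Ico (0 : ℝ) 1 | (U s).re = 0 ∧ (U s).im < 0 ∧ deriv (fun t => (U t).re) s < 0}.Finite ∧
    (({s ∈ Ico (0 : ℝ) 1 | (U s).re = 0 ∧ (U s).im < 0 ∧
        0 < deriv (fun t => (U t).re) s}.ncard : ℝ) -
      ({s ∈ Ico (0 : ℝ) 1 | (U s).re = 0 ∧ (U s).im < 0 ∧
        deriv (fun t => (U t).re) s < 0}.ncard : ℝ)) * (2 * Real.pi) = argVar U 0 1 := by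
  obtain ⟨θ, hθc, hθ⟩ := exists_isArgOn_univ hU h0
  rw [continuousOn_univ] at hθc
  have hpi := Real.pi_pos
  have hre : ∀ s, (U s).re = ‖U s‖ * Real.cos (θ s) := fun s => by
    have := congrArg Complex.re (hθ s (mem_univ _))
    rwa [Complex.re_ofReal_mul, Complex.exp_ofReal_mul_I_re] at this
  have him : ∀ s, (U s).im = ‖U s‖ * Real.sin (θ s) := fun s => by
    have := congrArg Complex.im (hθ s (mem_univ _))
    rwa [Complex.im_ofReal_mul, Complex.exp_ofReal_mul_I_im] at this
  have hpos : ∀ s, 0 < ‖U s‖ := fun s => norm_pos_iff.mpr (h0 s)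
  set ψ : ℝ → ℝ := fun s => (θ s + Real.pi / 2) / (2 * Real.pi) with hψ
  have hθψ : ∀ s, θ s = ψ s * (2 * Real.pi) - Real.pi / 2 := fun s => by
    simp only [hψ]; field_simp; ring
  have hψc : Continuous ψ := (hθc.add continuous_const).div_const _
  have hcos : ∀ s, Real.cos (θ s) = Real.sin (ψ s * (2 * Real.pi)) := fun s => by
    rw [hθψ, Real.cos_sub_pi_div_two]
  have hsin : ∀ s, Real.sin (θ s) = - Real.cos (ψ s * (2 * Real.pi)) := fun s => by
    rw [hθψ, Real.sin_sub_pi_div_two]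
  have hlev : ∀ s, ((U s).re = 0 ∧ (U s).im < 0) ↔ ∃ n : ℤ, ψ s = n := by
    intro s
    constructor
    · rintro ⟨h1, h2⟩
      rw [hre, hcos, mul_eq_zero, or_iff_right (hpos s).ne'] at h1
      rw [him, hsin] at h2
      have h2 : 0 < Real.cos (ψ s * (2 * Real.pi)) := by
        by_contra! h; nlinarith [hpos s]
      obtain ⟨n, hn⟩ := (Real.cos_eq_one_iff (ψ s * (2 * Real.pi))).mp (by
        nlinarith [Real.sin_sq_add_cos_sq (ψ s * (2 * Real.pi))])
      exact ⟨n, by field_simp at hn; linarith⟩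
    · rintro ⟨n, hn⟩
      rw [hre, hcos, him, hsin, hn]
      have e : Real.sin (n * (2 * Real.pi)) = 0 := by
        rw [← mul_assoc, mul_right_comm]; simpa [mul_right_comm] using Real.sin_int_mul_pi (n * 2)
      simp [e, Real.cos_int_mul_two_pi, h0]
  -- the sign of the real part near a crossing
  have hloc : ∀ s, (∃ n : ℤ, ψ s = n) → ∀ᶠ t in 𝓝 s,
      (0 < (U t).re → ψ s < ψ t) ∧ ((U t).re < 0 → ψ t < ψ s) := by
    rintro s ⟨n, hn⟩
    have := (hψc.sub (continuous_const (y := ψ s))).abs.continuousAt (x := s)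
    have h2 := this.eventually_lt_const (u := 1 / 2) (by simp)
    filter_upwards [h2] with t ht
    simp only [Pi.sub_apply] at ht
    rw [abs_lt] at ht
    have e : Real.sin (ψ t * (2 * Real.pi)) = Real.sin ((ψ t - ψ s) * (2 * Real.pi)) := by
      rw [sub_mul, hn, Real.sin_sub_int_mul_two_pi]
    rw [hre, hcos, e]
    constructor
    · intro h
      by_contra! hcon
      have : Real.sin ((ψ t - ψ s) * (2 * Real.pi)) ≤ 0 :=
        Real.sin_nonpos_of_nonpos_of_neg_pi_le (by nlinarith) (by nlinarith [ht.1])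
      nlinarith [hpos t]
    · intro h
      by_contra! hcon
      have : 0 ≤ Real.sin ((ψ t - ψ s) * (2 * Real.pi)) :=
        Real.sin_nonneg_of_nonneg_of_le_pi (by nlinarith) (by nlinarith [ht.2])
      nlinarith [hpos t]
  have hθ1 : ∃ W : ℤ, ψ 1 = ψ 0 + W := by
    have e : Complex.exp (θ 1 * Complex.I) = Complex.exp (θ 0 * Complex.I) := by
      have e1 := hθ 1 (mem_univ _)
      have e0 := hθ 0 (mem_univ _)
      have ep : U 1 = U 0 := by simpa using hper 0
      rw [ep] at e1
      rw [e0, norm_mul, Complex.norm_exp_ofReal_mul_I] at e1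
      simp only [mul_one] at e1
      have hn : ((‖((‖U 0‖ : ℝ) : ℂ)‖ : ℝ) : ℂ) ≠ 0 := by simp [h0]
      simp only [Complex.norm_real, norm_norm] at e1
      exact (mul_left_cancel₀ (by simp [h0]) e1).symm
    rw [Complex.exp_eq_exp_iff_exists_int] at e
    obtain ⟨W, hW⟩ := e
    refine ⟨W, ?_⟩
    have : θ 1 = θ 0 + W * (2 * Real.pi) := by
      have := congrArg Complex.im hW
      simpa using this
    simp only [hψ, this]; field_simp; ring
  obtain ⟨W, hW⟩ := hθ1
  have hsign : ∀ s, (U s).re = 0 → (0 < deriv (fun t => (U t).re) s →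
      (∀ᶠ t in 𝓝[>] s, 0 < (U t).re) ∧ ∀ᶠ t in 𝓝[<] s, (U t).re < 0) ∧
      (deriv (fun t => (U t).re) s < 0 →
      (∀ᶠ t in 𝓝[>] s, (U t).re < 0) ∧ ∀ᶠ t in 𝓝[<] s, 0 < (U t).re) := by
    intro s hs
    constructor
    · intro h
      have := eventually_nhdsWithin_sign_eq_of_deriv_pos (f := fun t => (U t).re) h hs
      constructor
      · filter_upwards [nhdsWithin_le_nhds this, self_mem_nhdsWithin] with t t1 t2
        exact sign_eq_one_iff.mp (t1.trans (sign_pos (sub_pos.mpr t2)))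
      · filter_upwards [nhdsWithin_le_nhds this, self_mem_nhdsWithin] with t t1 t2
        exact sign_eq_neg_one_iff.mp (t1.trans (sign_neg (sub_neg.mpr t2)))
    · intro h
      have := eventually_nhdsWithin_sign_eq_of_deriv_neg (f := fun t => (U t).re) h hs
      constructor
      · filter_upwards [nhdsWithin_le_nhds this, self_mem_nhdsWithin] with t t1 t2
        exact sign_eq_neg_one_iff.mp (t1.trans (sign_neg (sub_neg.mpr t2)))
      · filter_upwards [nhdsWithin_le_nhds this, self_mem_nhdsWithin] with t t1 t2
        exact sign_eq_one_iff.mp (t1.trans (sign_pos (sub_pos.mpr t2)))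
  have hd01 : deriv (fun t => (U t).re) 1 = deriv (fun t => (U t).re) 0 := by
    have : (fun t => (U t).re) = fun t => (U (t + 1)).re := by
      funext t; rw [hper t]
    conv_rhs => rw [this]
    rw [deriv_comp_add_const (f := fun t => (U t).re)]; simp
  obtain ⟨f1, f2, hc⟩ := ncard_up_sub_ncard_down hψc
    (Up := {s | (U s).re = 0 ∧ (U s).im < 0 ∧ 0 < deriv (fun t => (U t).re) s})
    (Dn := {s | (U s).re = 0 ∧ (U s).im < 0 ∧ deriv (fun t => (U t).re) s < 0})
    (disjoint_left.mpr fun s h1 h2 => lt_asymm h1.2.2 h2.2.2)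
    (fun s => by
      rw [← hlev s]
      constructor
      · rintro (h | h) <;> exact ⟨h.1, h.2.1⟩
      · rintro ⟨h1, h2⟩
        rcases (htr s h1 h2).lt_or_gt with h | h
        exacts [Or.inr ⟨h1, h2, h⟩, Or.inl ⟨h1, h2, h⟩])
    (fun s h => by
      have hl := hloc s ((hlev s).mp ⟨h.1, h.2.1⟩)
      obtain ⟨a1, a2⟩ := (hsign s h.1).1 h.2.2
      constructor
      · filter_upwards [a1, nhdsWithin_le_nhds hl] with t t1 t2 using t2.1 t1
      · filter_upwards [a2, nhdsWithin_le_nhds hl] with t t1 t2 using t2.2 t1)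
    (fun s h => by
      have hl := hloc s ((hlev s).mp ⟨h.1, h.2.1⟩)
      obtain ⟨a1, a2⟩ := (hsign s h.1).2 h.2.2
      constructor
      · filter_upwards [a1, nhdsWithin_le_nhds hl] with t t1 t2 using t2.2 t1
      · filter_upwards [a2, nhdsWithin_le_nhds hl] with t t1 t2 using t2.1 t1)
    hW (by
      have ep : U 1 = U 0 := by simpa using hper 0
      simp only [mem_ofPred_eq, ep, hd01])
  have c1 : ∀ P : ℝ → Prop, {s | P s} ∩ Ico (0 : ℝ) 1 = {s ∈ Ico (0 : ℝ) 1 | P s} := fun P => by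
    ext s; simp only [mem_inter_iff, mem_ofPred_eq]; tauto
  rw [c1] at f1 f2
  rw [c1, c1] at hc
  refine ⟨f1, f2, ?_⟩
  rw [IsArgOn.argVar_eq ⟨hθc.continuousOn, fun x _ => hθ x (mem_univ _)⟩ zero_le_one
    (fun s _ => h0 s), hθψ 1, hθψ 0, hW, ← hc]
  push_cast
  ring

end LegendrianRibbon

namespace LegendrianRibbon

/-! ### The standard triangle and the rotation of its edges -/

/-- The oriented area `det (z, w)` spanned by two complex numbers. -/
def cross (z w : ℂ) : ℝ := z.re * w.im - z.im * w.re

theorem cross_comm (z w : ℂ) : cross w z = - cross z w := by simp only [cross]; ring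

theorem cross_smul_right (z w : ℂ) (r : ℝ) : cross z (r • w) = r * cross z w := by
  simp [cross]; ring

theorem cross_smul_left (z w : ℂ) (r : ℝ) : cross (r • z) w = r * cross z w := by
  simp [cross]; ring

@[fun_prop]
theorem continuous_cross {X : Type*} [TopologicalSpace X] {f g : X → ℂ} (hf : Continuous f)
    (hg : Continuous g) : Continuous (fun x => cross (f x) (g x)) := by
  unfold cross; fun_prop

theorem im_div_pos {z w : ℂ} (h : 0 < cross z w) : 0 < (w / z).im := by
  have hz : z ≠ 0 := by rintro rfl; simp [cross] at h
  rw [Complex.div_im, ← sub_div]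
  refine div_pos ?_ (Complex.normSq_pos.mpr hz)
  simp only [cross] at h; linarith

theorem arg_div_mem {z w : ℂ} (h : 0 < cross z w) : (w / z).arg ∈ Ioo 0 Real.pi := by
  have := im_div_pos h
  refine ⟨?_, ?_⟩
  · rcases (Complex.arg_nonneg_iff.mpr this.le).lt_or_eq with g | g
    · exact g
    · have := Complex.arg_eq_zero_iff.mp g.symm
      linarith [this.2]
  · refine lt_of_le_of_ne (Complex.arg_le_pi _) (fun g => ?_)
    have := Complex.arg_eq_pi_iff.mp g
    linarith [this.2]

/-- The directions of the sides of a positively oriented triangle turn once around. -/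
theorem arg_add_arg_add_arg {z₀ z₁ z₂ : ℂ} (h₀ : 0 < cross z₀ z₁) (h₁ : 0 < cross z₁ z₂)
    (h₂ : 0 < cross z₂ z₀) :
    (z₁ / z₀).arg + (z₂ / z₁).arg + (z₀ / z₂).arg = 2 * Real.pi := by
  have n₀ : z₀ ≠ 0 := by rintro rfl; simp [cross] at h₀
  have n₁ : z₁ ≠ 0 := by rintro rfl; simp [cross] at h₁
  have n₂ : z₂ ≠ 0 := by rintro rfl; simp [cross] at h₂
  have m₀ := arg_div_mem h₀
  have m₁ := arg_div_mem h₁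
  have m₂ := arg_div_mem h₂
  have e : Complex.exp (((z₁ / z₀).arg + (z₂ / z₁).arg + (z₀ / z₂).arg : ℝ) * Complex.I) = 1 := by
    have hex : ∀ z : ℂ, z ≠ 0 → Complex.exp (z.arg * Complex.I) = z / ‖z‖ := fun z hz => by
      have := Complex.norm_mul_exp_arg_mul_I z
      have hz' : (‖z‖ : ℂ) ≠ 0 := by simpa using hz
      field_simp
      linear_combination this
    push_cast
    rw [add_mul, add_mul, Complex.exp_add, Complex.exp_add, hex _ (div_ne_zero n₁ n₀),
      hex _ (div_ne_zero n₂ n₁), hex _ (div_ne_zero n₀ n₂)]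
    have a₀ : (‖z₀‖ : ℂ) ≠ 0 := by simpa using n₀
    have a₁ : (‖z₁‖ : ℂ) ≠ 0 := by simpa using n₁
    have a₂ : (‖z₂‖ : ℂ) ≠ 0 := by simpa using n₂
    simp only [norm_div, Complex.ofReal_div]
    field_simp
  rw [Complex.exp_eq_one_iff] at e
  obtain ⟨n, hn⟩ := e
  have hn' : (z₁ / z₀).arg + (z₂ / z₁).arg + (z₀ / z₂).arg = n * (2 * Real.pi) := by
    have := congrArg Complex.im hn
    simpa using this
  have hpi := Real.pi_pos
  have l1 : (0 : ℝ) < n := by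
    by_contra! h
    nlinarith [m₀.1, m₁.1, m₂.1]
  have l2 : (n : ℝ) < 2 := by
    by_contra! h
    nlinarith [m₀.2, m₁.2, m₂.2]
  have : n = 1 := by
    have a : (0 : ℤ) < n := by exact_mod_cast l1
    have b : n < (2 : ℤ) := by exact_mod_cast l2
    omega
  rw [hn', this]; simp

theorem arg_neg_div {z w : ℂ} (h : 0 < cross z w) : (-z / w).arg = Real.pi - (w / z).arg := by
  have h1 := im_div_pos h
  have h2 : (-z / w) = - (w / z)⁻¹ := by rw [inv_div, neg_div]
  have h3 : ((w / z)⁻¹).im < 0 := by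
    rw [Complex.inv_im]
    exact div_neg_of_neg_of_pos (by linarith) (Complex.normSq_pos.mpr (fun h => by simp [h] at h1))
  rw [h2, Complex.arg_neg_eq_arg_add_pi_of_im_neg h3, Complex.arg_inv,
    if_neg (arg_div_mem h).2.ne]
  ring

noncomputable section

/-- The vertices of the standard triangle. -/
def vtx (k : Fin 3) : E2 := ![!₂[0, 0], !₂[1, 0], !₂[0, 1]] k

/-- The direction of the side opposite to the `k`-th vertex, in the counterclockwise order. -/
def dir (k : Fin 3) : E2 := vtx (k + 2) - vtx (k + 1)

/-- Affine parametrization by `[0, 1]` of the side opposite to the `k`-th vertex. -/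
def edgePt (k : Fin 3) (t : ℝ) : E2 := vtx (k + 1) + t • dir k

/-- The differential of the `k`-th barycentric coordinate. -/
def dbary (k : Fin 3) (u : E2) : ℝ := ![- u 0 - u 1, u 0, u 1] k

theorem bary_add_smul (k : Fin 3) (x u : E2) (t : ℝ) :
    bary k (x + t • u) = bary k x + t * dbary k u := by
  fin_cases k <;> simp [bary, dbary] <;> ring

theorem dbary_sub (k : Fin 3) (x y : E2) : dbary k (x - y) = bary k x - bary k y := by
  fin_cases k <;> simp [bary, dbary] <;> ring

theorem dbary_smul (k : Fin 3) (r : ℝ) (x : E2) : dbary k (r • x) = r * dbary k x := by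
  fin_cases k <;> simp [dbary] <;> ring

theorem continuous_bary (k : Fin 3) : Continuous (bary k) := by
  fin_cases k
  · show Continuous fun x : E2 => 1 - x 0 - x 1
    fun_prop
  · show Continuous fun x : E2 => x 0
    fun_prop
  · show Continuous fun x : E2 => x 1
    fun_prop

theorem continuous_dbary (k : Fin 3) : Continuous (dbary k) := by
  fin_cases k
  · show Continuous fun x : E2 => -x 0 - x 1
    fun_prop
  · show Continuous fun x : E2 => x 0
    fun_prop
  · show Continuous fun x : E2 => x 1
    fun_prop

theorem bary_sum (x : E2) : bary 0 x + bary 1 x + bary 2 x = 1 := by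
  simp [bary]; ring

theorem bary_vtx (k l : Fin 3) : bary k (vtx l) = if k = l then 1 else 0 := by
  fin_cases k <;> fin_cases l <;> simp [bary, vtx]

theorem dbary_dir (k l : Fin 3) :
    dbary k (dir l) = (if k = l + 2 then 1 else 0) - if k = l + 1 then 1 else 0 := by
  rw [dir, dbary_sub, bary_vtx, bary_vtx]

theorem bary_ext {x y : E2} (h : ∀ k, bary k x = bary k y) : x = y := by
  have h1 := h 1
  have h2 := h 2
  simp [bary] at h1 h2
  ext i
  fin_cases i
  exacts [h1, h2]

theorem fin3_cases (k l : Fin 3) : l = k ∨ l = k + 1 ∨ l = k + 2 := by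
  fin_cases k <;> fin_cases l <;> simp

theorem bary_edgePt (k : Fin 3) (t : ℝ) : bary k (edgePt k t) = 0 ∧
    bary (k + 1) (edgePt k t) = 1 - t ∧ bary (k + 2) (edgePt k t) = t := by
  simp only [edgePt, bary_add_smul, dbary_dir, bary_vtx]
  fin_cases k <;> simp <;> ring

theorem vtx_mem (k : Fin 3) : vtx k ∈ stdTriangle := by
  intro l; rw [bary_vtx]; split_ifs <;> norm_num

theorem edgePt_mem (k : Fin 3) {t : ℝ} (ht : t ∈ Icc (0 : ℝ) 1) : edgePt k t ∈ stdTriangle := by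
  obtain ⟨h0, h1, h2⟩ := bary_edgePt k t
  intro l
  rcases fin3_cases k l with rfl | rfl | rfl
  · rw [h0]
  · rw [h1]; linarith [ht.2]
  · rw [h2]; exact ht.1

theorem edgePt_zero (k : Fin 3) : edgePt k 0 = vtx (k + 1) := by simp [edgePt]

theorem edgePt_one (k : Fin 3) : edgePt k 1 = vtx (k + 2) := by simp [edgePt, dir]

theorem stdVertex_eq (k : Fin 3) : stdVertex k = {vtx k} := by
  ext x
  simp only [stdVertex, mem_ofPred_eq, mem_singleton_iff]
  constructor
  · rintro ⟨h, hk⟩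
    have hs := bary_sum x
    have h0 := h 0
    have h1 := h 1
    have h2 := h 2
    apply bary_ext
    intro l
    rw [bary_vtx]
    fin_cases k <;> fin_cases l <;> simp at hk ⊢ <;> linarith
  · rintro rfl
    exact ⟨vtx_mem k, by simp [bary_vtx]⟩

theorem stdEdge_eq (k : Fin 3) : stdEdge k = edgePt k '' Icc 0 1 := by
  ext x
  simp only [stdEdge, mem_ofPred_eq, mem_image]
  constructor
  · rintro ⟨h, hk⟩
    have hs : bary (k + 1) x + bary (k + 2) x = 1 := by
      have := bary_sum x
      fin_cases k <;> simp at hk ⊢ <;> linarith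
    refine ⟨bary (k + 2) x, ⟨h _, by linarith [h (k + 1)]⟩, bary_ext fun l => ?_⟩
    obtain ⟨h0, h1, h2⟩ := bary_edgePt k (bary (k + 2) x)
    rcases fin3_cases k l with rfl | rfl | rfl
    · rw [h0, hk]
    · rw [h1]; linarith
    · rw [h2]
  · rintro ⟨t, ht, rfl⟩
    exact ⟨edgePt_mem k ht, (bary_edgePt k t).1⟩

theorem continuous_edgePt (k : Fin 3) : Continuous (edgePt k) := by
  unfold edgePt; fun_prop

theorem edgePt_injective (k : Fin 3) : Function.Injective (edgePt k) := fun s t h => by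
  rw [← (bary_edgePt k s).2.2, h, (bary_edgePt k t).2.2]

theorem convex_stdTriangle : Convex ℝ stdTriangle := by
  intro x hx y hy a b ha hb hab k
  have e : bary k (a • x + b • y) = a * bary k x + b * bary k y := by
    fin_cases k
    · simp [bary]; linear_combination -hab
    · simp [bary]
    · simp [bary]
  rw [e]
  exact add_nonneg (mul_nonneg ha (hx k)) (mul_nonneg hb (hy k))

theorem isClosed_stdTriangle : IsClosed stdTriangle := by
  have : stdTriangle = ⋂ k, bary k ⁻¹' Ici 0 := by ext; simp [stdTriangle]
  rw [this]
  exact isClosed_iInter fun k => isClosed_Ici.preimage (continuous_bary k)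

theorem isCompact_stdTriangle : IsCompact stdTriangle := by
  refine Metric.isCompact_of_isClosed_isBounded isClosed_stdTriangle ?_
  refine (Metric.isBounded_closedBall (x := (0 : E2)) (r := 2)).subset fun x hx => ?_
  rw [mem_closedBall_zero_iff, EuclideanSpace.norm_eq, Real.sqrt_le_left (by norm_num)]
  have h0 := hx 0
  have h1 := hx 1
  have h2 := hx 2
  simp [bary] at h0 h1 h2
  simp only [Fin.sum_univ_two, Real.norm_eq_abs, sq_abs]
  nlinarith

/-- A continuous retraction of the plane onto the standard triangle. -/
def retr (x : E2) : E2 :=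
  (max 1 (max (x 0) 0 + max (x 1) 0))⁻¹ • !₂[max (x 0) 0, max (x 1) 0]

theorem continuous_retr : Continuous retr := by
  unfold retr
  refine Continuous.smul (Continuous.inv₀
    (f := fun x : E2 => max 1 (max (x 0) 0 + max (x 1) 0)) (by fun_prop) fun x => ?_) ?_
  · exact (lt_of_lt_of_le one_pos (le_max_left _ _)).ne'
  · refine (PiLp.continuous_toLp 2 _).comp (continuous_pi fun i => ?_)
    fin_cases i
    · show Continuous fun x : E2 => max (x 0) 0
      fun_prop
    · show Continuous fun x : E2 => max (x 1) 0
      fun_prop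

theorem retr_mem (x : E2) : retr x ∈ stdTriangle := by
  have hm : 0 < max 1 (max (x 0) 0 + max (x 1) 0) := lt_of_lt_of_le one_pos (le_max_left _ _)
  have h0 : 0 ≤ max (x 0) 0 := le_max_right _ _
  have h1 : 0 ≤ max (x 1) 0 := le_max_right _ _
  have hle : max (x 0) 0 + max (x 1) 0 ≤ max 1 (max (x 0) 0 + max (x 1) 0) := le_max_right _ _
  intro k
  fin_cases k
  · simp only [bary, retr]
    simp
    have : (max 1 (max (x 0) 0 + max (x 1) 0))⁻¹ * (max (x 0) 0 + max (x 1) 0) ≤ 1 := by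
      rw [inv_mul_le_iff₀ hm]; linarith
    linarith
  · simp only [bary, retr]; simp
  · simp only [bary, retr]; simp

theorem retr_eq {x : E2} (hx : x ∈ stdTriangle) : retr x = x := by
  have h0 := hx 0
  have h1 := hx 1
  have h2 := hx 2
  simp [bary] at h0 h1 h2
  have hm : max 1 (x 0 + x 1) = 1 := max_eq_left (by linarith)
  ext i
  fin_cases i <;> simp [retr, max_eq_left h1, max_eq_left h2, hm]

theorem exists_isArgOn_stdTriangle {c : E2 → ℂ} (hc : ContinuousOn c stdTriangle)
    (h0 : ∀ x ∈ stdTriangle, c x ≠ 0) : ∃ θ : E2 → ℝ, IsArgOn θ c stdTriangle := by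
  obtain ⟨θ, hθ, hθe⟩ := exists_isArgOn_univ (X := E2) (c := c ∘ retr)
    (hc.comp_continuous continuous_retr retr_mem) (fun x => h0 _ (retr_mem x))
  refine ⟨θ, hθ.mono (subset_univ _), fun x hx => ?_⟩
  have := hθe x (mem_univ _)
  rwa [Function.comp, retr_eq hx] at this

/-- The Jacobian determinant of a real-linear map from the plane to `ℂ`. -/
def jac (L : E2 →L[ℝ] ℂ) : ℝ := cross (L !₂[1, 0]) (L !₂[0, 1])

theorem cross_map (L : E2 →L[ℝ] ℂ) (x y : E2) :
    cross (L x) (L y) = (x 0 * y 1 - x 1 * y 0) * jac L := by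
  have key : ∀ z : E2, L z = z 0 • L !₂[1, 0] + z 1 • L !₂[0, 1] := fun z => by
    rw [← map_smul, ← map_smul, ← map_add]
    congr 1
    ext i; fin_cases i <;> simp
  rw [key x, key y, jac]
  simp only [cross, Complex.add_re, Complex.add_im, Complex.real_smul, Complex.mul_re,
    Complex.mul_im, Complex.ofReal_re, Complex.ofReal_im]
  ring

theorem cross_dir (L : E2 →L[ℝ] ℂ) (k : Fin 3) (u : E2) :
    cross (L (dir k)) (L u) = dbary k u * jac L := by
  rw [cross_map]
  congr 1
  fin_cases k <;> simp [dir, dbary, vtx] <;> ring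

theorem injective_of_jac_ne_zero {L : E2 →L[ℝ] ℂ} (h : jac L ≠ 0) : Function.Injective L := by
  rw [injective_iff_map_eq_zero]
  intro u hu
  have h1 := cross_map L !₂[1, 0] u
  have h2 := cross_map L !₂[0, 1] u
  rw [hu] at h1 h2
  simp [cross, h] at h1 h2
  ext i; fin_cases i
  exacts [h2, h1]

theorem jac_ne_zero_of_injective {L : E2 →L[ℝ] ℂ} (h : Function.Injective L) : jac L ≠ 0 := by
  intro h0
  rw [jac] at h0
  set z := L !₂[1, 0] with hz
  set w := L !₂[0, 1] with hw
  have hz0 : z ≠ 0 := fun e => by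
    have := congrArg (fun v : E2 => v 0) (h (e.trans (map_zero L).symm))
    simp at this
  have e : L ((z.re ^ 2 + z.im ^ 2) • !₂[0, 1] - (z.re * w.re + z.im * w.im) • !₂[1, 0]) = L 0 := by
    rw [map_sub, map_smul, map_smul, ← hz, ← hw, map_zero]
    simp only [cross] at h0
    apply Complex.ext
    · simp only [Complex.sub_re, Complex.smul_re, smul_eq_mul, Complex.zero_re]
      linear_combination (-z.im) * h0
    · simp only [Complex.sub_im, Complex.smul_im, smul_eq_mul, Complex.zero_im]
      linear_combination (z.re) * h0
  have := congrArg (fun v : E2 => v 1) (h e)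
  simp at this
  apply hz0
  apply Complex.ext
  · simp; nlinarith
  · simp; nlinarith

theorem surjective_of_jac_ne_zero {L : E2 →L[ℝ] ℂ} (h : jac L ≠ 0) : Function.Surjective L :=
  (LinearMap.injective_iff_surjective_of_finrank_eq_finrank (f := (L : E2 →ₗ[ℝ] ℂ))
    (by simp [Complex.finrank_real_complex])).mp (injective_of_jac_ne_zero h)

/-- The rotation of the sides of a triangle in a frame equals its angle excess: the case of a
frame that preserves the orientation. -/
theorem sum_argVar_of_jac_pos {Ψ : E2 → E2 →L[ℝ] ℂ} (hΨ : ContinuousOn Ψ stdTriangle)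
    (hJ : ∀ x ∈ stdTriangle, 0 < jac (Ψ x)) :
    ∑ k, argVar (fun t => Ψ (edgePt k t) (dir k)) 0 1 =
      ∑ k, (Ψ (vtx k) (-dir (k + 1)) / Ψ (vtx k) (dir (k + 2))).arg - Real.pi := by
  have hc : ∀ k, ContinuousOn (fun x => Ψ x (dir k)) stdTriangle := fun k =>
    hΨ.clm_apply continuousOn_const
  have hcr : ∀ k, ∀ x ∈ stdTriangle, 0 < cross (Ψ x (dir k)) (Ψ x (dir (k + 1))) := by
    intro k x hx
    rw [cross_dir, dbary_dir]
    have := hJ x hx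
    fin_cases k <;> simp [this]
  have h0 : ∀ k, ∀ x ∈ stdTriangle, Ψ x (dir k) ≠ 0 := by
    intro k x hx h
    have := hcr k x hx
    simp [h, cross] at this
  have hslit : ∀ k, ∀ x ∈ stdTriangle, Ψ x (dir (k + 1)) / Ψ x (dir k) ∈ Complex.slitPlane :=
    fun k x hx => Or.inr (im_div_pos (hcr k x hx)).ne'
  obtain ⟨θ, hθ⟩ := exists_isArgOn_stdTriangle (hc 0) (h0 0)
  have hθ1 := hθ.add_arg (hc 0) (hc 1) (h0 0) (hslit 0)
  have hθ2 := hθ1.add_arg (hc 1) (hc 2) (h0 1) (hslit 1)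
  have var : ∀ k (η : E2 → ℝ), IsArgOn η (fun x => Ψ x (dir k)) stdTriangle →
      argVar (fun t => Ψ (edgePt k t) (dir k)) 0 1 = η (vtx (k + 2)) - η (vtx (k + 1)) := by
    intro k η hη
    have : IsArgOn (η ∘ edgePt k) (fun t => Ψ (edgePt k t) (dir k)) (Icc 0 1) :=
      ⟨hη.1.comp (continuous_edgePt k).continuousOn fun t ht => edgePt_mem k ht,
        fun t ht => hη.2 _ (edgePt_mem k ht)⟩
    rw [this.argVar_eq zero_le_one fun t ht => h0 k _ (edgePt_mem k ht)]
    simp only [Function.comp, edgePt_zero, edgePt_one]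
  have hsum : ∀ x ∈ stdTriangle, (Ψ x (dir 1) / Ψ x (dir 0)).arg +
      (Ψ x (dir 2) / Ψ x (dir 1)).arg + (Ψ x (dir 0) / Ψ x (dir 2)).arg = 2 * Real.pi :=
    fun x hx => arg_add_arg_add_arg (hcr 0 x hx) (hcr 1 x hx) (hcr 2 x hx)
  have hang : ∀ k, ∀ x ∈ stdTriangle, (Ψ x (-dir (k + 1)) / Ψ x (dir (k + 2))).arg =
      Real.pi - (Ψ x (dir (k + 2)) / Ψ x (dir (k + 1))).arg := by
    intro k x hx
    rw [map_neg]
    have := hcr (k + 1) x hx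
    rw [add_assoc] at this
    exact arg_neg_div this
  rw [Fin.sum_univ_three, Fin.sum_univ_three, var 0 _ hθ, var 1 _ hθ1, var 2 _ hθ2,
    hang 0 _ (vtx_mem 0), hang 1 _ (vtx_mem 1), hang 2 _ (vtx_mem 2)]
  have s0 := hsum _ (vtx_mem 0)
  have s1 := hsum _ (vtx_mem 1)
  have s2 := hsum _ (vtx_mem 2)
  simp only [Fin.isValue, zero_add, Fin.reduceAdd] at *
  linarith

/-- The interior angle at the `k`-th corner of the standard triangle, measured by a linear
map to `ℂ`. -/
def cornerAngle (L : E2 →L[ℝ] ℂ) (k : Fin 3) : ℝ :=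
  |(L (-dir (k + 1)) / L (dir (k + 2))).arg|

theorem cross_corner (L : E2 →L[ℝ] ℂ) (k : Fin 3) :
    cross (L (dir (k + 2))) (L (-dir (k + 1))) = jac L := by
  rw [cross_map]
  fin_cases k <;> simp [dir, vtx]

/-- The rotation of the sides of a triangle in a frame equals its angle excess; `ε` is the sign of
the orientation of the frame. -/
theorem sum_argVar_eq_sum_cornerAngle {Ψ : E2 → E2 →L[ℝ] ℂ} (hΨ : ContinuousOn Ψ stdTriangle)
    {ε : ℝ} (hε : ε = 1 ∨ ε = -1) (hJ : ∀ x ∈ stdTriangle, 0 < ε * jac (Ψ x)) :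
    ∑ k, ε * argVar (fun t => Ψ (edgePt k t) (dir k)) 0 1 =
      ∑ k, cornerAngle (Ψ (vtx k)) k - Real.pi := by
  rcases hε with rfl | rfl
  · simp only [one_mul] at hJ ⊢
    rw [sum_argVar_of_jac_pos hΨ hJ]
    congr 1
    refine Finset.sum_congr rfl fun k _ => ?_
    rw [cornerAngle, abs_of_pos]
    exact (arg_div_mem (by rw [cross_corner]; exact hJ _ (vtx_mem k))).1
  · set Ψ' : E2 → E2 →L[ℝ] ℂ := fun x => (Complex.conjCLE : ℂ →L[ℝ] ℂ).comp (Ψ x) with hΨ'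
    have hval : ∀ x u, Ψ' x u = (starRingEnd ℂ) (Ψ x u) := fun x u => rfl
    have hj : ∀ x, jac (Ψ' x) = - jac (Ψ x) := fun x => by
      simp only [jac, hval, cross, Complex.conj_re, Complex.conj_im]; ring
    have hJ' : ∀ x ∈ stdTriangle, 0 < jac (Ψ' x) := fun x hx => by
      rw [hj]; linarith [hJ x hx]
    have := sum_argVar_of_jac_pos (Ψ := Ψ') (continuousOn_const.clm_comp hΨ) hJ'
    have e1 : ∑ k, argVar (fun t => Ψ' (edgePt k t) (dir k)) 0 1 =
        ∑ k, -1 * argVar (fun t => Ψ (edgePt k t) (dir k)) 0 1 := by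
      refine Finset.sum_congr rfl fun k _ => ?_
      simp only [hval]
      rw [argVar_conj zero_le_one, neg_one_mul]
      · exact (hΨ.comp (continuous_edgePt k).continuousOn fun t ht => edgePt_mem k ht).clm_apply
          continuousOn_const
      · intro t ht h
        have h1 := cross_dir (Ψ (edgePt k t)) k (dir (k + 1))
        rw [h] at h1
        have h2 := hJ _ (edgePt_mem k ht)
        rw [dbary_dir] at h1
        have h3 : jac (Ψ (edgePt k t)) = 0 := by
          fin_cases k <;> simp [cross] at h1 <;> exact h1.symm
        rw [h3] at h2
        simp at h2
    have e2 : ∑ k, (Ψ' (vtx k) (-dir (k + 1)) / Ψ' (vtx k) (dir (k + 2))).arg =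
        ∑ k, cornerAngle (Ψ (vtx k)) k := by
      refine Finset.sum_congr rfl fun k _ => ?_
      simp only [hval, cornerAngle, ← map_div₀]
      have h1 := arg_div_mem (z := Ψ' (vtx k) (dir (k + 2))) (w := Ψ' (vtx k) (-dir (k + 1)))
        (by rw [cross_corner]; exact hJ' _ (vtx_mem k))
      simp only [hval, ← map_div₀] at h1
      rw [Complex.arg_conj] at h1 ⊢
      split_ifs at h1 ⊢ with h
      · exact absurd h1.2 (lt_irrefl _)
      · rw [abs_of_neg (by linarith [h1.1])]
    rw [← e1, this, e2]

/-! ### The angle of a plane sector -/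

/-- The set of directions (in angular measure) that belong to a subset of `ℂ`. -/
def angSize (C : Set ℂ) : ENNReal :=
  MeasureTheory.volume ({t : ℝ | Complex.exp (t * Complex.I) ∈ C} ∩ Ioc (-Real.pi) Real.pi)

theorem continuous_exp_mul_I : Continuous fun t : ℝ => Complex.exp (t * Complex.I) := by fun_prop

theorem angSize_eq {C : Set ℂ} (hC : MeasurableSet C) (a : ℝ) :
    angSize C = MeasureTheory.volume
      ({t : ℝ | Complex.exp (t * Complex.I) ∈ C} ∩ Ioc (a - Real.pi) (a + Real.pi)) := by
  have h1 := isAddFundamentalDomain_Ioc Real.two_pi_pos (-Real.pi) MeasureTheory.volume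
  have h2 := isAddFundamentalDomain_Ioc Real.two_pi_pos (a - Real.pi) MeasureTheory.volume
  rw [show -Real.pi + 2 * Real.pi = Real.pi by ring] at h1
  rw [show a - Real.pi + 2 * Real.pi = a + Real.pi by ring] at h2
  refine h1.measure_set_eq h2 (continuous_exp_mul_I.measurable hC) fun g => ?_
  obtain ⟨g, n, rfl⟩ := g
  ext t
  simp only [mem_preimage, mem_ofPred_eq]
  have : ((⟨_, ⟨n, rfl⟩⟩ : AddSubgroup.zmultiples (2 * Real.pi)) +ᵥ t : ℝ) =
      t + n * (2 * Real.pi) := by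
    show n • (2 * Real.pi) + t = _
    rw [zsmul_eq_mul]; ring
  rw [this]
  have e : Complex.exp (((t + n * (2 * Real.pi) : ℝ) : ℂ) * Complex.I) =
      Complex.exp (t * Complex.I) := by
    rw [Complex.exp_eq_exp_iff_exists_int]
    exact ⟨n, by push_cast; ring⟩
  rw [e]

theorem cross_exp (P : ℂ) (t : ℝ) :
    cross P (Complex.exp (t * Complex.I)) = ‖P‖ * Real.sin (t - P.arg) := by
  conv_lhs => rw [← Complex.norm_mul_exp_arg_mul_I P]
  simp only [cross, Complex.re_ofReal_mul, Complex.im_ofReal_mul, Complex.exp_ofReal_mul_I_re,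
    Complex.exp_ofReal_mul_I_im, Real.sin_sub]
  ring

theorem measurableSet_cross (P : ℂ) : MeasurableSet {ζ | 0 ≤ cross P ζ} ∧
    MeasurableSet {ζ | 0 < cross P ζ} :=
  ⟨(isClosed_Ici.preimage (continuous_cross continuous_const continuous_id)).measurableSet,
   (isOpen_Ioi.preimage (continuous_cross continuous_const continuous_id)).measurableSet⟩

theorem sin_nonneg_iff_of_mem {x : ℝ} (h : x ∈ Ioc (-Real.pi) Real.pi) :
    (0 ≤ Real.sin x ↔ 0 ≤ x) ∧ (0 < Real.sin x ↔ 0 < x ∧ x < Real.pi) := by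
  refine ⟨⟨fun h1 => ?_, fun h1 => Real.sin_nonneg_of_nonneg_of_le_pi h1 h.2⟩,
    ⟨fun h1 => ⟨?_, ?_⟩, fun h1 => Real.sin_pos_of_pos_of_lt_pi h1.1 h1.2⟩⟩
  · by_contra! h2
    linarith [Real.sin_neg_of_neg_of_neg_pi_lt h2 h.1]
  · by_contra! h2
    linarith [Real.sin_nonpos_of_nonpos_of_neg_pi_le h2 h.1.le]
  · refine lt_of_le_of_ne h.2 (fun e => ?_)
    rw [e, Real.sin_pi] at h1; exact lt_irrefl _ h1

theorem angSize_halfPlane {P : ℂ} (hP : P ≠ 0) :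
    angSize {ζ | 0 ≤ cross P ζ} = ENNReal.ofReal Real.pi ∧
    angSize {ζ | 0 < cross P ζ} = ENNReal.ofReal Real.pi := by
  have hn : 0 < ‖P‖ := norm_pos_iff.mpr hP
  have hpi := Real.pi_pos
  rw [angSize_eq (measurableSet_cross P).1 P.arg, angSize_eq (measurableSet_cross P).2 P.arg]
  constructor
  · have : {t : ℝ | Complex.exp (t * Complex.I) ∈ {ζ | 0 ≤ cross P ζ}} ∩
        Ioc (P.arg - Real.pi) (P.arg + Real.pi) = Icc P.arg (P.arg + Real.pi) := by
      ext t
      simp only [mem_inter_iff, mem_ofPred_eq, cross_exp, mem_Ioc, mem_Icc,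
        mul_nonneg_iff_of_pos_left hn]
      constructor
      · rintro ⟨h1, h2, h3⟩
        have := (sin_nonneg_iff_of_mem (x := t - P.arg) ⟨by linarith, by linarith⟩).1.mp h1
        exact ⟨by linarith, h3⟩
      · rintro ⟨h1, h2⟩
        exact ⟨Real.sin_nonneg_of_nonneg_of_le_pi (by linarith) (by linarith), by linarith, h2⟩
    rw [this, Real.volume_Icc]; simp
  · have : {t : ℝ | Complex.exp (t * Complex.I) ∈ {ζ | 0 < cross P ζ}} ∩
        Ioc (P.arg - Real.pi) (P.arg + Real.pi) = Ioo P.arg (P.arg + Real.pi) := by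
      ext t
      simp only [mem_inter_iff, mem_ofPred_eq, cross_exp, mem_Ioc, mem_Ioo,
        mul_pos_iff_of_pos_left hn]
      constructor
      · rintro ⟨h1, h2, h3⟩
        have := (sin_nonneg_iff_of_mem (x := t - P.arg) ⟨by linarith, by linarith⟩).2.mp h1
        exact ⟨by linarith, by linarith⟩
      · rintro ⟨h1, h2⟩
        exact ⟨Real.sin_pos_of_pos_of_lt_pi (by linarith) (by linarith), by linarith, h2.le⟩
    rw [this, Real.volume_Ioo]; simp

theorem angSize_sector {P Q : ℂ} (h : 0 < cross P Q) :
    angSize {ζ | 0 ≤ cross P ζ ∧ 0 ≤ cross ζ Q} = ENNReal.ofReal (Q / P).arg ∧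
    angSize {ζ | 0 < cross P ζ ∧ 0 < cross ζ Q} = ENNReal.ofReal (Q / P).arg := by
  have hP : P ≠ 0 := by rintro rfl; simp [cross] at h
  have hQ : Q ≠ 0 := by rintro rfl; simp [cross] at h
  have hn : 0 < ‖P‖ := norm_pos_iff.mpr hP
  have hnQ : 0 < ‖Q‖ := norm_pos_iff.mpr hQ
  have hpi := Real.pi_pos
  obtain ⟨hθ0, hθ1⟩ := arg_div_mem h
  set θ := (Q / P).arg with hθ
  have hQe : Q = ‖Q‖ * Complex.exp ((P.arg + θ : ℝ) * Complex.I) := by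
    have e1 := Complex.norm_mul_exp_arg_mul_I P
    have e2 := Complex.norm_mul_exp_arg_mul_I (Q / P)
    have hn' : (‖P‖ : ℂ) ≠ 0 := by simpa using hP
    calc Q = P * (Q / P) := by field_simp
      _ = (‖P‖ * Complex.exp (P.arg * Complex.I)) *
          (‖Q / P‖ * Complex.exp (θ * Complex.I)) := by rw [e1, e2]
      _ = _ := by
        rw [norm_div, Complex.ofReal_div, Complex.ofReal_add, add_mul, Complex.exp_add]
        field_simp
  have hcQ : ∀ t : ℝ, cross (Complex.exp (t * Complex.I)) Q = ‖Q‖ * Real.sin (P.arg + θ - t) := by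
    intro t
    conv_lhs => rw [hQe]
    simp only [cross, Complex.re_ofReal_mul, Complex.im_ofReal_mul, Complex.exp_ofReal_mul_I_re,
      Complex.exp_ofReal_mul_I_im, Real.sin_sub]
    ring
  have m1 : MeasurableSet {ζ | 0 ≤ cross P ζ ∧ 0 ≤ cross ζ Q} :=
    (measurableSet_cross P).1.inter
      (isClosed_Ici.preimage (continuous_cross continuous_id continuous_const)).measurableSet
  have m2 : MeasurableSet {ζ | 0 < cross P ζ ∧ 0 < cross ζ Q} :=
    (measurableSet_cross P).2.inter
      (isOpen_Ioi.preimage (continuous_cross continuous_id continuous_const)).measurableSet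
  rw [angSize_eq m1 P.arg, angSize_eq m2 P.arg]
  constructor
  · have : {t : ℝ | Complex.exp (t * Complex.I) ∈ {ζ | 0 ≤ cross P ζ ∧ 0 ≤ cross ζ Q}} ∩
        Ioc (P.arg - Real.pi) (P.arg + Real.pi) = Icc P.arg (P.arg + θ) := by
      ext t
      simp only [mem_inter_iff, mem_ofPred_eq, cross_exp, hcQ, mem_Ioc, mem_Icc,
        mul_nonneg_iff_of_pos_left hn, mul_nonneg_iff_of_pos_left hnQ]
      constructor
      · rintro ⟨⟨h1, h4⟩, h2, h3⟩
        have a := (sin_nonneg_iff_of_mem (x := t - P.arg) ⟨by linarith, by linarith⟩).1.mp h1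
        have b := (sin_nonneg_iff_of_mem (x := P.arg + θ - t)
          ⟨by linarith, by linarith⟩).1.mp h4
        exact ⟨by linarith, by linarith⟩
      · rintro ⟨h1, h2⟩
        exact ⟨⟨Real.sin_nonneg_of_nonneg_of_le_pi (by linarith) (by linarith),
          Real.sin_nonneg_of_nonneg_of_le_pi (by linarith) (by linarith)⟩, by linarith,
          by linarith⟩
    rw [this, Real.volume_Icc]; simp
  · have : {t : ℝ | Complex.exp (t * Complex.I) ∈ {ζ | 0 < cross P ζ ∧ 0 < cross ζ Q}} ∩
        Ioc (P.arg - Real.pi) (P.arg + Real.pi) = Ioo P.arg (P.arg + θ) := by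
      ext t
      simp only [mem_inter_iff, mem_ofPred_eq, cross_exp, hcQ, mem_Ioc, mem_Ioo,
        mul_pos_iff_of_pos_left hn, mul_pos_iff_of_pos_left hnQ]
      constructor
      · rintro ⟨⟨h1, h4⟩, h2, h3⟩
        have a := (sin_nonneg_iff_of_mem (x := t - P.arg) ⟨by linarith, by linarith⟩).2.mp h1
        have b := (sin_nonneg_iff_of_mem (x := P.arg + θ - t)
          ⟨by linarith, by linarith⟩).2.mp h4
        exact ⟨by linarith, by linarith⟩
      · rintro ⟨h1, h2⟩
        exact ⟨⟨Real.sin_pos_of_pos_of_lt_pi (by linarith) (by linarith),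
          Real.sin_pos_of_pos_of_lt_pi (by linarith) (by linarith)⟩, by linarith,
          by linarith⟩
    rw [this, Real.volume_Ioo]; simp

theorem image_eq_of_surjective {L : E2 →L[ℝ] ℂ} (h : Function.Surjective L) {K : Set E2}
    {C : Set ℂ} (hK : ∀ u, u ∈ K ↔ L u ∈ C) : L '' K = C := by
  ext ζ
  constructor
  · rintro ⟨u, hu, rfl⟩; exact (hK u).mp hu
  · intro hζ
    obtain ⟨u, rfl⟩ := h ζ
    exact ⟨u, (hK u).mpr hζ, rfl⟩

theorem angSize_corner {L : E2 →L[ℝ] ℂ} (h : jac L ≠ 0) (k : Fin 3) :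
    angSize (L '' {u | 0 ≤ dbary (k + 1) u ∧ 0 ≤ dbary (k + 2) u}) =
      ENNReal.ofReal (cornerAngle L k) ∧
    angSize (L '' {u | 0 < dbary (k + 1) u ∧ 0 < dbary (k + 2) u}) =
      ENNReal.ofReal (cornerAngle L k) := by
  set P := L (dir (k + 2)) with hP
  set Q := L (-dir (k + 1)) with hQ
  have hPQ : cross P Q = jac L := cross_corner L k
  have hPu : ∀ u, cross P (L u) = dbary (k + 2) u * jac L := cross_dir L _
  have huQ : ∀ u, cross (L u) Q = dbary (k + 1) u * jac L := fun u => by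
    rw [hQ, map_neg, ← cross_dir]; simp only [cross, Complex.neg_re, Complex.neg_im]; ring
  have hs := surjective_of_jac_ne_zero h
  rcases h.lt_or_gt with hj | hj
  · have hQP : 0 < cross Q P := by rw [cross_comm, hPQ]; linarith
    have ea : cornerAngle L k = (P / Q).arg := by
      have h1 := arg_div_mem hQP
      have : (Q / P).arg = - (P / Q).arg := by
        rw [← inv_div, Complex.arg_inv, if_neg h1.2.ne]
      rw [cornerAngle, this, abs_neg, abs_of_pos h1.1]
    rw [ea, image_eq_of_surjective hs (C := {ζ | 0 ≤ cross Q ζ ∧ 0 ≤ cross ζ P}),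
      image_eq_of_surjective hs (C := {ζ | 0 < cross Q ζ ∧ 0 < cross ζ P})]
    · exact angSize_sector hQP
    · intro u
      simp only [mem_ofPred_eq]
      rw [cross_comm (L u) Q, cross_comm P (L u), hPu, huQ]
      constructor
      · rintro ⟨a, b⟩; constructor <;> nlinarith
      · rintro ⟨a, b⟩; constructor <;> nlinarith
    · intro u
      simp only [mem_ofPred_eq]
      rw [cross_comm (L u) Q, cross_comm P (L u), hPu, huQ]
      constructor
      · rintro ⟨a, b⟩; constructor <;> nlinarith
      · rintro ⟨a, b⟩; constructor <;> nlinarith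
  · have hPQ' : 0 < cross P Q := by rw [hPQ]; exact hj
    have ea : cornerAngle L k = (Q / P).arg := by
      rw [cornerAngle, abs_of_pos (arg_div_mem hPQ').1]
    rw [ea, image_eq_of_surjective hs (C := {ζ | 0 ≤ cross P ζ ∧ 0 ≤ cross ζ Q}),
      image_eq_of_surjective hs (C := {ζ | 0 < cross P ζ ∧ 0 < cross ζ Q})]
    · exact angSize_sector hPQ'
    · intro u
      simp only [mem_ofPred_eq, hPu, huQ, mul_pos_iff_of_pos_right hj]; tauto
    · intro u
      simp only [mem_ofPred_eq, hPu, huQ, mul_nonneg_iff_of_pos_right hj]; tauto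

theorem angSize_side {L : E2 →L[ℝ] ℂ} (h : jac L ≠ 0) (k : Fin 3) :
    angSize (L '' {u | 0 ≤ dbary k u}) = ENNReal.ofReal Real.pi ∧
    angSize (L '' {u | 0 < dbary k u}) = ENNReal.ofReal Real.pi := by
  have hs := surjective_of_jac_ne_zero h
  have h2 : (jac L) ^ 2 > 0 := by positivity
  have hPu : ∀ u, cross ((jac L) • L (dir k)) (L u) = (jac L) ^ 2 * dbary k u := fun u => by
    rw [cross_smul_left, cross_dir]; ring
  have hP : (jac L) • L (dir k) ≠ 0 := by
    intro h0
    have := hPu (dir (k + 1))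
    rw [h0, dbary_dir] at this
    fin_cases k <;> simp [cross] at this <;> exact h2.ne this
  rw [image_eq_of_surjective hs (C := {ζ | 0 ≤ cross ((jac L) • L (dir k)) ζ}),
    image_eq_of_surjective hs (C := {ζ | 0 < cross ((jac L) • L (dir k)) ζ})]
  · exact angSize_halfPlane hP
  · intro u; simp only [mem_ofPred_eq, hPu, mul_pos_iff_of_pos_left h2]
  · intro u; simp only [mem_ofPred_eq, hPu, mul_nonneg_iff_of_pos_left h2]

/-- If closed sectors cover an open sector `A₀`, with closure `A`, and their interiors are disjoint
and contained in `A`, then their angles add up to the angle of `A`. -/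
theorem sum_angle_eq {ι : Type*} (s : Finset ι) {C O : ι → Set ℂ} {θ : ι → ℝ} {A₀ A : Set ℂ} {τ : ℝ}
    (hτ : 0 ≤ τ) (hθ : ∀ i ∈ s, 0 ≤ θ i) (hC : ∀ i ∈ s, angSize (C i) = ENNReal.ofReal (θ i))
    (hO : ∀ i ∈ s, angSize (O i) = ENNReal.ofReal (θ i)) (hOo : ∀ i ∈ s, IsOpen (O i))
    (hdisj : ∀ i ∈ s, ∀ j ∈ s, i ≠ j → Disjoint (O i) (O j))
    (hA₀ : angSize A₀ = ENNReal.ofReal τ) (hA : angSize A = ENNReal.ofReal τ)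
    (hcov : A₀ ⊆ ⋃ i ∈ s, C i) (hsub : ∀ i ∈ s, O i ⊆ A) : ∑ i ∈ s, θ i = τ := by
  have hle : ENNReal.ofReal τ ≤ ∑ i ∈ s, ENNReal.ofReal (θ i) := by
    rw [← hA₀, ← Finset.sum_congr rfl hC]
    refine le_trans (MeasureTheory.measure_mono ?_) (MeasureTheory.measure_biUnion_finset_le s _)
    rintro t ⟨h1, h2⟩
    obtain ⟨i, hi, hti⟩ := mem_iUnion₂.mp (hcov h1)
    exact mem_iUnion₂.mpr ⟨i, hi, hti, h2⟩
  have hge : ∑ i ∈ s, ENNReal.ofReal (θ i) ≤ ENNReal.ofReal τ := by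
    rw [← hA, ← Finset.sum_congr rfl hO]
    simp only [angSize]
    rw [← MeasureTheory.measure_biUnion_finset]
    · refine MeasureTheory.measure_mono ?_
      intro t ht
      obtain ⟨i, hi, hti⟩ := mem_iUnion₂.mp ht
      exact ⟨hsub i hi hti.1, hti.2⟩
    · intro i hi j hj hij
      refine disjoint_left.mpr fun t h1 h2 => ?_
      exact disjoint_left.mp (hdisj i hi j hj hij) h1.1 h2.1
    · intro i hi
      exact (continuous_exp_mul_I.measurable (hOo i hi).measurableSet).inter measurableSet_Ioc
  have := le_antisymm hge hle
  rw [← ENNReal.ofReal_sum_of_nonneg hθ] at this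
  exact (ENNReal.ofReal_eq_ofReal_iff (Finset.sum_nonneg hθ) hτ).mp this

theorem angSize_compl_zero : angSize {0}ᶜ = ENNReal.ofReal (2 * Real.pi) := by
  have : {t : ℝ | Complex.exp (t * Complex.I) ∈ ({0}ᶜ : Set ℂ)} = univ := by
    ext t; simp
  rw [angSize, this, univ_inter, Real.volume_Ioc]
  congr 1; ring

end

end LegendrianRibbon

namespace LegendrianRibbon

noncomputable section

/-! ### Derivatives of maps between manifolds, in charts -/

section Charts

variable {E E' E'' : Type*} [NormedAddCommGroup E] [NormedSpace ℝ E]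
  [NormedAddCommGroup E'] [NormedSpace ℝ E'] [NormedAddCommGroup E''] [NormedSpace ℝ E'']
  {N N' N'' : Type*} [TopologicalSpace N] [ChartedSpace E N]
  [TopologicalSpace N'] [ChartedSpace E' N'] [TopologicalSpace N''] [ChartedSpace E'' N'']

variable (E E') in
/-- The derivative of a map of manifolds within a set, as a map of the model spaces. -/
def tDW (f : N → N') (X : Set N) (x : N) : E →L[ℝ] E' :=
  mfderivWithin 𝓘(ℝ, E) 𝓘(ℝ, E') f X x

variable (E E') in
/-- The derivative of a map of manifolds, as a map of the model spaces. -/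
def tD (f : N → N') (x : N) : E →L[ℝ] E' := mfderiv 𝓘(ℝ, E) 𝓘(ℝ, E') f x

theorem tD_comp {f : N → N'} {g : N' → N''} {x : N}
    (hg : MDifferentiableAt 𝓘(ℝ, E') 𝓘(ℝ, E'') g (f x))
    (hf : MDifferentiableAt 𝓘(ℝ, E) 𝓘(ℝ, E') f x) :
    tD E E'' (g ∘ f) x = (tD E' E'' g (f x)).comp (tD E E' f x) :=
  mfderiv_comp x hg hf

theorem tD_eq_fderiv (f : E → E') (x : E) : tD E E' f x = fderiv ℝ f x :=
  mfderiv_eq_fderiv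

theorem tDW_univ (f : N → N') (x : N) : tDW E E' f univ x = tD E E' f x := by
  unfold tDW tD; rw [mfderivWithin_univ]

theorem tD_congr {f g : N → N'} {x : N} (h : f =ᶠ[𝓝 x] g) : tD E E' f x = tD E E' g x :=
  h.mfderiv_eq

variable [IsManifold 𝓘(ℝ, E) ∞ N] [IsManifold 𝓘(ℝ, E') ∞ N']

theorem mdiffAt_chart {p q : N} (hq : q ∈ (extChartAt 𝓘(ℝ, E) p).source) :
    MDifferentiableAt 𝓘(ℝ, E) 𝓘(ℝ, E) (extChartAt 𝓘(ℝ, E) p) q :=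
  have : IsManifold 𝓘(ℝ, E) 1 N := IsManifold.of_le (n := ∞) (by simp)
  mdifferentiableAt_extChartAt (by rwa [extChartAt_source] at hq)

theorem mdiffAt_chart_symm {p : N} {y : E} (hy : y ∈ (extChartAt 𝓘(ℝ, E) p).target) :
    MDifferentiableAt 𝓘(ℝ, E) 𝓘(ℝ, E) (extChartAt 𝓘(ℝ, E) p).symm y := by
  have : IsManifold 𝓘(ℝ, E) 1 N := IsManifold.of_le (n := ∞) (by simp)
  have := mdifferentiableWithinAt_extChartAt_symm (I := 𝓘(ℝ, E)) hy
  rwa [ModelWithCorners.range_eq_univ, mdifferentiableWithinAt_univ] at this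

theorem tD_chart_symm_comp {p q : N} (hq : q ∈ (extChartAt 𝓘(ℝ, E) p).source) :
    (tD E E (extChartAt 𝓘(ℝ, E) p).symm (extChartAt 𝓘(ℝ, E) p q)).comp
      (tD E E (extChartAt 𝓘(ℝ, E) p) q) = ContinuousLinearMap.id ℝ E := by
  rw [← tD_comp (mdiffAt_chart_symm ((extChartAt 𝓘(ℝ, E) p).map_source hq)) (mdiffAt_chart hq)]
  have : (extChartAt 𝓘(ℝ, E) p).symm ∘ (extChartAt 𝓘(ℝ, E) p) =ᶠ[𝓝 q] id := by
    filter_upwards [(isOpen_extChartAt_source p).mem_nhds hq] with z hz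
    exact (extChartAt 𝓘(ℝ, E) p).left_inv hz
  rw [tD_congr this]
  exact mfderiv_id

theorem tD_chart_comp_symm {p : N} {y : E} (hy : y ∈ (extChartAt 𝓘(ℝ, E) p).target) :
    (tD E E (extChartAt 𝓘(ℝ, E) p) ((extChartAt 𝓘(ℝ, E) p).symm y)).comp
      (tD E E (extChartAt 𝓘(ℝ, E) p).symm y) = ContinuousLinearMap.id ℝ E := by
  rw [← tD_comp (mdiffAt_chart ((extChartAt 𝓘(ℝ, E) p).map_target hy)) (mdiffAt_chart_symm hy)]
  have : (extChartAt 𝓘(ℝ, E) p) ∘ (extChartAt 𝓘(ℝ, E) p).symm =ᶠ[𝓝 y] id := by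
    filter_upwards [(isOpen_extChartAt_target p).mem_nhds hy] with z hz
    exact (extChartAt 𝓘(ℝ, E) p).right_inv hz
  rw [tD_congr this]
  exact mfderiv_id

theorem tD_chart_surjective {p q : N} (hq : q ∈ (extChartAt 𝓘(ℝ, E) p).source) :
    Function.Surjective (tD E E (extChartAt 𝓘(ℝ, E) p) q) := by
  have h := tD_chart_comp_symm ((extChartAt 𝓘(ℝ, E) p).map_source hq)
  rw [(extChartAt 𝓘(ℝ, E) p).left_inv hq] at h
  intro v
  exact ⟨_, by simpa using congrArg (fun L : E →L[ℝ] E => L v) h⟩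

/-- The chart centred at `p` identifies `T_p N` with the model space by the identity. -/
theorem tD_chart_self (p : N) :
    tD E E (extChartAt 𝓘(ℝ, E) p) p = ContinuousLinearMap.id ℝ E := by
  have h := (mdiffAt_chart (N := N) (mem_extChartAt_source (I := 𝓘(ℝ, E)) p)).hasMFDerivAt.2
  rw [ModelWithCorners.range_eq_univ] at h
  have h' : HasFDerivAt (writtenInExtChartAt 𝓘(ℝ, E) 𝓘(ℝ, E) p (extChartAt 𝓘(ℝ, E) p))
    (tD E E (extChartAt 𝓘(ℝ, E) p) p) (extChartAt 𝓘(ℝ, E) p p) := hasFDerivWithinAt_univ.mp h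
  refine (h'.congr_of_eventuallyEq ?_).unique (hasFDerivAt_id (extChartAt 𝓘(ℝ, E) p p))
  filter_upwards [(isOpen_extChartAt_target p).mem_nhds (mem_extChartAt_target p)] with z hz
  have := (extChartAt 𝓘(ℝ, E) p).right_inv hz
  rw [writtenInExtChartAt, extChartAt_self_eq]
  simpa using this.symm

theorem hasFDerivWithinAt_chart_comp {c : E' → N} {X : Set E'} {x : E'} {p : N}
    (hc : MDifferentiableWithinAt 𝓘(ℝ, E') 𝓘(ℝ, E) c X x)
    (hp : c x ∈ (extChartAt 𝓘(ℝ, E) p).source) :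
    HasFDerivWithinAt (extChartAt 𝓘(ℝ, E) p ∘ c)
      ((tD E E (extChartAt 𝓘(ℝ, E) p) (c x)).comp (tDW E' E c X x)) X x :=
  ((mdiffAt_chart hp).hasMFDerivAt.comp_hasMFDerivWithinAt x
    hc.hasMFDerivWithinAt).hasFDerivWithinAt

omit [IsManifold 𝓘(ℝ, E') ∞ N'] in
/-- The differential of a map computed through the chart centred at `p`. -/
theorem tD_eq_comp_chart {h : N → N'} {p q : N}
    (hh : MDifferentiableAt 𝓘(ℝ, E) 𝓘(ℝ, E') h q) (hq : q ∈ (extChartAt 𝓘(ℝ, E) p).source) :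
    tD E E' h q = (tD E E' (h ∘ (extChartAt 𝓘(ℝ, E) p).symm) (extChartAt 𝓘(ℝ, E) p q)).comp
      (tD E E (extChartAt 𝓘(ℝ, E) p) q) := by
  have hl := (extChartAt 𝓘(ℝ, E) p).left_inv hq
  rw [tD_comp (by rwa [hl]) (mdiffAt_chart_symm ((extChartAt 𝓘(ℝ, E) p).map_source hq)), hl,
    ContinuousLinearMap.comp_assoc, tD_chart_symm_comp hq, ContinuousLinearMap.comp_id]

theorem contMDiffAt_chart {p q : N} (hq : q ∈ (extChartAt 𝓘(ℝ, E) p).source) :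
    ContMDiffAt 𝓘(ℝ, E) 𝓘(ℝ, E) ∞ (extChartAt 𝓘(ℝ, E) p) q :=
  contMDiffAt_extChartAt' (by rwa [extChartAt_source] at hq)

theorem contMDiffAt_chart_symm {p : N} {y : E} (hy : y ∈ (extChartAt 𝓘(ℝ, E) p).target) :
    ContMDiffAt 𝓘(ℝ, E) 𝓘(ℝ, E) ∞ (extChartAt 𝓘(ℝ, E) p).symm y :=
  (contMDiffOn_extChartAt_symm p).contMDiffAt ((isOpen_extChartAt_target p).mem_nhds hy)

/-- A field of linear maps on tangent spaces (a 1-form with values in `F`) is continuous on `D` if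
it is so in charts. -/
def IsContForm {F : Type*} [NormedAddCommGroup F] [NormedSpace ℝ F] (D : Set N)
    (κ : N → E →L[ℝ] F) : Prop :=
  ∀ p ∈ D, ∃ Ψ : N → E →L[ℝ] F, ContinuousWithinAt Ψ D p ∧
    ∀ᶠ q in 𝓝[D] p, κ q = (Ψ q).comp (tD E E (extChartAt 𝓘(ℝ, E) p) q)

variable {F : Type*} [NormedAddCommGroup F] [NormedSpace ℝ F]

/-- Continuous 1-forms are continuous along continuously differentiable maps. -/
theorem IsContForm.continuousOn_comp_tDW {D : Set N} {κ : N → E →L[ℝ] F} (hκ : IsContForm D κ)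
    {c : E' → N} {X : Set E'} (hX : UniqueDiffOn ℝ X)
    (hc : ContMDiffOn 𝓘(ℝ, E') 𝓘(ℝ, E) ∞ c X) (hm : MapsTo c X D) :
    ContinuousOn (fun x => (κ (c x)).comp (tDW E' E c X x)) X := by
  intro x hx
  obtain ⟨Ψ, hΨ, hκ⟩ := hκ (c x) (hm hx)
  set χ := extChartAt 𝓘(ℝ, E) (c x) with hχ
  have hcont : ContinuousWithinAt c X x := (hc x hx).continuousWithinAt
  have htend : Tendsto c (𝓝[X] x) (𝓝[D] (c x)) :=
    tendsto_nhdsWithin_of_tendsto_nhds_of_eventually_within _ hcont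
      (eventually_mem_nhdsWithin.mono fun y hy => hm hy)
  have hsrc : ∀ᶠ y in 𝓝[X] x, c y ∈ χ.source :=
    hcont ((isOpen_extChartAt_source (c x)).mem_nhds (mem_extChartAt_source (c x)))
  have hg : ContDiffWithinAt ℝ ∞ (χ ∘ c) X x :=
    contMDiffWithinAt_iff_contDiffWithinAt.mp
      ((contMDiffAt_chart (mem_extChartAt_source (c x))).comp_contMDiffWithinAt x (hc x hx))
  have hgc : ContinuousWithinAt (fun y => fderivWithin ℝ (χ ∘ c) X y) X x :=
    (hg.fderivWithin_right hX (m := 0) (by simp) hx).continuousWithinAt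
  have hlim : ContinuousWithinAt (fun y => (Ψ (c y)).comp (fderivWithin ℝ (χ ∘ c) X y)) X x :=
    ContinuousWithinAt.clm_comp (hΨ.tendsto.comp htend) hgc
  have hev : ∀ᶠ y in 𝓝[X] x, (κ (c y)).comp (tDW E' E c X y) =
      (Ψ (c y)).comp (fderivWithin ℝ (χ ∘ c) X y) := by
    filter_upwards [htend.eventually hκ, hsrc, self_mem_nhdsWithin] with y h1 h2 hy
    rw [h1, (hasFDerivWithinAt_chart_comp ((hc y hy).mdifferentiableWithinAt (by simp))
      h2).fderivWithin (hX y hy), ContinuousLinearMap.comp_assoc]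
  exact hlim.congr_of_eventuallyEq hev (hev.self_of_nhdsWithin hx)

/-- The differential of a smooth function is a continuous 1-form. -/
theorem isContForm_tD {h : N → F} {D : Set N} (hh : ContMDiff 𝓘(ℝ, E) 𝓘(ℝ, F) ∞ h) :
    IsContForm D (tD E F h) := by
  intro p _
  refine ⟨fun q => tD E F (h ∘ (extChartAt 𝓘(ℝ, E) p).symm) (extChartAt 𝓘(ℝ, E) p q), ?_, ?_⟩
  · have h1 : ContDiffAt ℝ ∞ (h ∘ (extChartAt 𝓘(ℝ, E) p).symm) (extChartAt 𝓘(ℝ, E) p p) :=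
      contMDiffAt_iff_contDiffAt.mp (hh.contMDiffAt.comp _
        (contMDiffAt_chart_symm (mem_extChartAt_target p)))
    have h2 : ContinuousAt (fderiv ℝ (h ∘ (extChartAt 𝓘(ℝ, E) p).symm))
      (extChartAt 𝓘(ℝ, E) p p) := (h1.fderiv_right (m := 0) (by simp)).continuousAt
    have h3 := h2.comp (continuousAt_extChartAt (I := 𝓘(ℝ, E)) p)
    refine (h3.congr (Eventually.of_forall fun q => ?_)).continuousWithinAt
    exact (tD_eq_fderiv _ _).symm
  · filter_upwards [nhdsWithin_le_nhds ((isOpen_extChartAt_source (I := 𝓘(ℝ, E)) p).mem_nhds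
      (mem_extChartAt_source p))] with q hq
    exact tD_eq_comp_chart (hh.mdifferentiableAt (by simp)) hq

omit [IsManifold 𝓘(ℝ, E) ∞ N] in
theorem IsContForm.smul {D : Set N} {κ : N → E →L[ℝ] F} (hκ : IsContForm D κ) {r : N → ℝ}
    (hr : ContinuousOn r D) : IsContForm D (fun p => r p • κ p) := fun p hp => by
  obtain ⟨Ψ, h1, h2⟩ := hκ p hp
  refine ⟨fun q => r q • Ψ q, (hr p hp).smul h1, ?_⟩
  filter_upwards [h2] with q hq
  rw [hq, ContinuousLinearMap.smul_comp]

omit [IsManifold 𝓘(ℝ, E) ∞ N] in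
theorem IsContForm.add {D : Set N} {κ κ' : N → E →L[ℝ] F} (hκ : IsContForm D κ)
    (hκ' : IsContForm D κ') : IsContForm D (fun p => κ p + κ' p) := fun p hp => by
  obtain ⟨Ψ, h1, h2⟩ := hκ p hp
  obtain ⟨Ψ', h1', h2'⟩ := hκ' p hp
  refine ⟨fun q => Ψ q + Ψ' q, h1.add h1', ?_⟩
  filter_upwards [h2, h2'] with q hq hq'
  rw [hq, hq', ContinuousLinearMap.add_comp]

omit [IsManifold 𝓘(ℝ, E) ∞ N] in
theorem IsContForm.sum {D : Set N} {ι : Type*} (s : Finset ι) {κ : ι → N → E →L[ℝ] F}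
    (h : ∀ i ∈ s, IsContForm D (κ i)) : IsContForm D (fun p => ∑ i ∈ s, κ i p) := by
  classical
  induction s using Finset.induction_on with
  | empty => exact fun p _ => ⟨0, continuousWithinAt_const, by simp⟩
  | insert i s hi ih =>
    simp only [Finset.sum_insert hi]
    exact (h i (by simp)).add (ih fun j hj => h j (by simp [hj]))

omit [IsManifold 𝓘(ℝ, E) ∞ N] in
theorem IsContForm.postcomp {G : Type*} [NormedAddCommGroup G] [NormedSpace ℝ G] {D : Set N}
    {κ : N → E →L[ℝ] F} (hκ : IsContForm D κ) (L : F →L[ℝ] G) :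
    IsContForm D (fun p => L.comp (κ p)) := fun p hp => by
  obtain ⟨Ψ, h1, h2⟩ := hκ p hp
  refine ⟨fun q => L.comp (Ψ q), continuousWithinAt_const.clm_comp h1, ?_⟩
  filter_upwards [h2] with q hq
  rw [hq, ContinuousLinearMap.comp_assoc]

end Charts

/-! ### Tangent cones of a smoothly embedded triangle -/

/-- The closed tangent cone of the standard triangle at one of its points. -/
def tCone (x : E2) : Set E2 := {u | ∀ k, bary k x = 0 → 0 ≤ dbary k u}

/-- The interior of the tangent cone of the standard triangle at one of its points. -/
def tConeInt (x : E2) : Set E2 := {u | ∀ k, bary k x = 0 → 0 < dbary k u}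

theorem tConeInt_subset (x : E2) : tConeInt x ⊆ tCone x := fun _ hu k hk => (hu k hk).le

theorem isOpen_tConeInt (x : E2) : IsOpen (tConeInt x) := by
  have : tConeInt x = ⋂ k, {u | bary k x = 0 → 0 < dbary k u} := by ext; simp [tConeInt]
  rw [this]
  refine isOpen_iInter_of_finite fun k => ?_
  by_cases h : bary k x = 0
  · simp only [h, forall_const]
    exact isOpen_Ioi.preimage (continuous_dbary k)
  · simp [h]

theorem eventually_mem_of_mem_tCone {x u : E2} (hx : x ∈ stdTriangle) (hu : u ∈ tCone x) :
    ∀ᶠ t in 𝓝[>] (0 : ℝ), x + t • u ∈ stdTriangle := by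
  have : ∀ k, ∀ᶠ t in 𝓝[>] (0 : ℝ), 0 ≤ bary k (x + t • u) := by
    intro k
    rcases (hx k).lt_or_eq with h | h
    · have hc : ContinuousAt (fun t : ℝ => bary k (x + t • u)) 0 :=
        ((continuous_bary k).comp (by fun_prop)).continuousAt
      have := hc.eventually_const_lt (u := 0) (by simpa using h)
      filter_upwards [nhdsWithin_le_nhds this] with t ht using ht.le
    · filter_upwards [self_mem_nhdsWithin] with t ht
      rw [bary_add_smul, ← h, zero_add]
      exact mul_nonneg (le_of_lt ht) (hu k h.symm)
  filter_upwards [eventually_all.mpr this] with t ht using ht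

theorem abs_dbary_le (k : Fin 3) (u : E2) : |dbary k u| ≤ 2 * ‖u‖ := by
  have h0 : |u 0| ≤ ‖u‖ := by simpa using PiLp.norm_apply_le u 0
  have h1 : |u 1| ≤ ‖u‖ := by simpa using PiLp.norm_apply_le u 1
  have hn := norm_nonneg u
  rw [abs_le] at *
  fin_cases k
  · simp [dbary]; constructor <;> linarith
  · simp [dbary]; constructor <;> linarith
  · simp [dbary]; constructor <;> linarith

theorem interior_stdTriangle_nonempty : (interior stdTriangle).Nonempty := by
  have : tConeInt (vtx 0) ∩ {x | 0 < bary 0 x} ⊆ stdTriangle := by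
    rintro x ⟨hx, h0⟩ k
    have h1 := hx 1 (by simp [bary_vtx])
    have h2 := hx 2 (by simp [bary_vtx])
    fin_cases k
    · exact le_of_lt h0
    · exact h1.le
    · exact h2.le
  refine ⟨!₂[1 / 4, 1 / 4], interior_mono this ?_⟩
  have ho : IsOpen (tConeInt (vtx 0) ∩ {x | 0 < bary 0 x}) :=
    (isOpen_tConeInt _).inter (isOpen_Ioi.preimage (continuous_bary 0))
  rw [ho.interior_eq]
  refine ⟨fun k => ?_, ?_⟩
  · fin_cases k <;> simp [bary_vtx, dbary]
  · simp [bary]; norm_num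

theorem uniqueDiffOn_stdTriangle : UniqueDiffOn ℝ stdTriangle :=
  uniqueDiffOn_convex convex_stdTriangle interior_stdTriangle_nonempty

/-- A continuously differentiable map on the triangle is approximated by its derivative near a
point. -/
theorem exists_approximatesLinearOn {F : Type*} [NormedAddCommGroup F] [NormedSpace ℝ F]
    {h : E2 → F} {x : E2} (hx : x ∈ stdTriangle) (hh : ContDiffWithinAt ℝ ∞ h stdTriangle x)
    {ε : NNReal} (hε : 0 < ε) : ∃ ρ > 0, ApproximatesLinearOn h (fderivWithin ℝ h stdTriangle x)
      (stdTriangle ∩ Metric.ball x ρ) ε := by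
  have hd : ∀ᶠ z in 𝓝[stdTriangle] x, DifferentiableWithinAt ℝ h stdTriangle z := by
    have := (hh.of_le (m := 1) (by simp)).eventually (by simp)
    rw [insert_eq_of_mem hx] at this
    filter_upwards [this] with z hz using hz.differentiableWithinAt one_ne_zero
  have hc : ContinuousWithinAt (fun z => fderivWithin ℝ h stdTriangle z) stdTriangle x :=
    (hh.fderivWithin_right uniqueDiffOn_stdTriangle (m := 0) (by simp) hx).continuousWithinAt
  have hb : ∀ᶠ z in 𝓝[stdTriangle] x,
      ‖fderivWithin ℝ h stdTriangle z - fderivWithin ℝ h stdTriangle x‖ ≤ ε := by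
    have := (hc.sub continuousWithinAt_const (g := fun _ => fderivWithin ℝ h stdTriangle x)).norm
    have h2 := this.eventually_lt_const (u := (ε : ℝ)) (by simpa using hε)
    filter_upwards [h2] with z hz using le_of_lt hz
  obtain ⟨ρ, hρ, hball⟩ := Metric.mem_nhdsWithin_iff.mp (hd.and hb)
  refine ⟨ρ, hρ, fun y hy z hz => ?_⟩
  have key := (convex_stdTriangle.inter (convex_ball x ρ)).norm_image_sub_le_of_norm_hasFDerivWithin_le'
    (f := h) (f' := fun z => fderivWithin ℝ h stdTriangle z)
    (φ := fderivWithin ℝ h stdTriangle x) (C := ε) (fun w hw => ?_) (fun w hw => ?_) hz hy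
  · exact key
  · exact (hball ⟨hw.2, hw.1⟩).1.hasFDerivWithinAt.mono inter_subset_left
  · exact (hball ⟨hw.2, hw.1⟩).2

/-- The image of a smooth immersion of the triangle contains the short segments that start in
directions of the interior of the tangent cone. -/
theorem eventually_exists_eq_add_smul {h : E2 → E2} {x k : E2} (hx : x ∈ stdTriangle)
    (hh : ContDiffWithinAt ℝ ∞ h stdTriangle x)
    (hinj : Function.Injective (fderivWithin ℝ h stdTriangle x)) (hk : k ∈ tConeInt x)
    {Nb : Set E2} (hN : Nb ∈ 𝓝 x) :
    ∀ᶠ t in 𝓝[>] (0 : ℝ), ∃ z ∈ stdTriangle, (∀ l, 0 < bary l z) ∧ z ∈ Nb ∧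
      h z = h x + t • fderivWithin ℝ h stdTriangle x k := by
  set A := fderivWithin ℝ h stdTriangle x with hA
  let Ae : E2 ≃L[ℝ] E2 :=
    (LinearEquiv.ofInjectiveEndo (A : E2 →ₗ[ℝ] E2) hinj).toContinuousLinearEquiv
  have hAe : (Ae : E2 →L[ℝ] E2) = A := by ext v; rfl
  let inv : (A : E2 →L[ℝ] E2).NonlinearRightInverse := hAe ▸ Ae.toNonlinearRightInverse
  -- `c`: aperture of a cone around `k` within the tangent cone
  obtain ⟨c, hc0, hc⟩ : ∃ c > 0, ∀ l, bary l x = 0 → 4 * c ≤ dbary l k := by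
    have : ∀ l, ∃ c > 0, bary l x = 0 → 4 * c ≤ dbary l k := fun l => by
      by_cases hl : bary l x = 0
      · exact ⟨dbary l k / 4, by have := hk l hl; positivity, fun _ => by linarith⟩
      · exact ⟨1, one_pos, fun h => absurd h hl⟩
    choose c hc0 hc using this
    refine ⟨min (c 0) (min (c 1) (c 2)), lt_min (hc0 0) (lt_min (hc0 1) (hc0 2)), fun l hl => ?_⟩
    refine le_trans (mul_le_mul_of_nonneg_left ?_ (by norm_num)) (hc l hl)
    fin_cases l <;> simp
  set ν : ℝ := (inv.nnnorm : ℝ)⁻¹ with hν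
  have hνpos : 0 < ν := by
    refine inv_pos.mpr (lt_of_le_of_ne inv.nnnorm.2 fun h0 => ?_)
    have hb := inv.bound (A !₂[1, 0])
    have e : A (inv (A !₂[1, 0])) = A !₂[1, 0] := inv.right_inv _
    rw [← h0, zero_mul] at hb
    have : inv (A !₂[1, 0]) = 0 := norm_le_zero_iff.mp hb
    rw [this, map_zero] at e
    have := congrArg (fun v : E2 => v 0) (hinj (e.symm.trans (map_zero A).symm))
    simp at this
  obtain ⟨ε, hε0, hε1, hε2⟩ : ∃ ε : NNReal, 0 < ε ∧ (ε : ℝ) ≤ ν / 2 ∧ ε * ‖k‖ ≤ ν / 2 * c := by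
    refine ⟨⟨min (ν / 2) (ν / 2 * c / (‖k‖ + 1)), by positivity⟩, ?_, min_le_left _ _, ?_⟩
    · have : (0 : ℝ) < min (ν / 2) (ν / 2 * c / (‖k‖ + 1)) :=
        lt_min (by positivity) (by positivity)
      exact this
    · show min _ _ * _ ≤ _
      calc min (ν / 2) (ν / 2 * c / (‖k‖ + 1)) * ‖k‖ ≤ ν / 2 * c / (‖k‖ + 1) * (‖k‖ + 1) := by
            gcongr
            · exact min_le_right _ _
            · linarith
        _ = _ := by field_simp
  obtain ⟨ρ, hρ, happ⟩ := exists_approximatesLinearOn hx hh hε0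
  obtain ⟨ρ', hρ', hball'⟩ := Metric.mem_nhds_iff.mp hN
  have hpos : ∀ l, ∀ᶠ t in 𝓝[>] (0 : ℝ), ∀ w : E2, ‖w‖ ≤ c * t →
      0 < bary l (x + t • k + w) := by
    intro l
    have e : ∀ (t : ℝ) (w : E2), bary l (x + t • k + w) = bary l x + t * dbary l k + dbary l w :=
      fun t w => by
        have := bary_add_smul l (x + t • k) w 1
        rw [one_smul, one_mul] at this
        rw [this, bary_add_smul]
    rcases (hx l).lt_or_eq with hl | hl
    · have hcont : ContinuousAt (fun t : ℝ => bary l x + t * dbary l k - 2 * (c * t)) 0 := by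
        fun_prop
      filter_upwards [nhdsWithin_le_nhds (hcont.eventually_const_lt (u := 0) (by simpa using hl))]
        with t ht w hw
      rw [e]
      have := (abs_le.mp (abs_dbary_le l w)).1
      linarith
    · filter_upwards [self_mem_nhdsWithin] with t ht w hw
      have ht : 0 < t := ht
      rw [e, ← hl]
      have := (abs_le.mp (abs_dbary_le l w)).1
      have h2 := hc l hl.symm
      nlinarith [mul_pos hc0 ht]
  have hsmall : ∀ᶠ t in 𝓝[>] (0 : ℝ), t * (‖k‖ + c) < min ρ ρ' := by
    have hcont : ContinuousAt (fun t : ℝ => t * (‖k‖ + c)) 0 := by fun_prop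
    exact nhdsWithin_le_nhds (hcont.eventually_lt_const (by simpa using ⟨hρ, hρ'⟩))
  filter_upwards [eventually_all.mpr hpos, hsmall, self_mem_nhdsWithin] with t ht1 ht2 ht0
  have ht0 : 0 < t := ht0
  have hdist : ∀ z ∈ Metric.closedBall (x + t • k) (c * t), dist z x < min ρ ρ' ∧
      ∀ l, 0 < bary l z := by
    intro z hz
    rw [mem_closedBall_iff_norm] at hz
    constructor
    · refine lt_of_le_of_lt ?_ ht2
      rw [dist_eq_norm]
      calc ‖z - x‖ = ‖(z - (x + t • k)) + t • k‖ := by congr 1; abel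
        _ ≤ c * t + ‖t • k‖ := (norm_add_le _ _).trans (by gcongr)
        _ = t * (‖k‖ + c) := by rw [norm_smul, Real.norm_of_nonneg ht0.le]; ring
    · intro l
      have := ht1 l (z - (x + t • k)) hz
      rwa [add_sub_cancel] at this
  have hsub : Metric.closedBall (x + t • k) (c * t) ⊆ stdTriangle ∩ Metric.ball x ρ := fun z hz =>
    ⟨fun l => ((hdist z hz).2 l).le, (hdist z hz).1.trans_le (min_le_left _ _)⟩
  have hsurj := happ.surjOn_closedBall_of_nonlinearRightInverse inv (b := x + t • k)
    (ε := c * t) (by positivity) hsub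
  have hmem : h x + t • A k ∈ Metric.closedBall (h (x + t • k))
      (((inv.nnnorm : ℝ)⁻¹ - ε) * (c * t)) := by
    rw [mem_closedBall_iff_norm, ← norm_neg]
    have := happ (x := x + t • k) (y := x) (hsub (Metric.mem_closedBall_self (by positivity)))
      ⟨hx, Metric.mem_ball_self hρ⟩
    rw [add_sub_cancel_left, map_smul] at this
    calc ‖-(h x + t • A k - h (x + t • k))‖ = ‖h (x + t • k) - h x - t • A k‖ := by
          congr 1; abel
      _ ≤ ε * ‖t • k‖ := this
      _ = (ε * ‖k‖) * t := by rw [norm_smul, Real.norm_of_nonneg ht0.le]; ring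
      _ ≤ (ν / 2 * c) * t := by gcongr
      _ ≤ (ν - ε) * (c * t) := by
        have : ν / 2 ≤ ν - ε := by linarith
        have h2 : 0 < c * t := by positivity
        nlinarith
  obtain ⟨z, hz, hze⟩ := hsurj hmem
  exact ⟨z, (hsub hz).1, (hdist z hz).2,
    hball' ((hdist z hz).1.trans_le (min_le_right _ _)), hze⟩

/-- Limits of directions of points in the image of the triangle belong to the image of the tangent
cone. -/
theorem exists_mem_tCone_of_tendsto {h : E2 → E2} {x u : E2} {A : E2 →L[ℝ] E2}
    (hh : HasFDerivWithinAt h A stdTriangle x)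
    (hinj : Function.Injective A) {t : ℕ → ℝ} {z : ℕ → E2} (ht0 : ∀ n, 0 < t n)
    (hz : ∀ n, z n ∈ stdTriangle) (hzx : Tendsto z atTop (𝓝 x))
    (hhz : ∀ n, h (z n) = h x + t n • u) : ∃ k ∈ tCone x, A k = u := by
  let Ae : E2 ≃L[ℝ] E2 :=
    (LinearEquiv.ofInjectiveEndo (A : E2 →ₗ[ℝ] E2) hinj).toContinuousLinearEquiv
  have hAe : ∀ v, Ae v = A v := fun v => rfl
  set w : ℕ → E2 := fun n => (t n)⁻¹ • (z n - x) with hw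
  have hto : Tendsto z atTop (𝓝[stdTriangle] x) :=
    tendsto_nhdsWithin_iff.mpr ⟨hzx, Eventually.of_forall hz⟩
  have hlo : (fun n => h (z n) - h x - A (z n - x)) =o[atTop] fun n => z n - x :=
    hh.isLittleO.comp_tendsto hto
  -- the differences `z n - x` are controlled by `t n`
  have hbig : (fun n => z n - x) =O[atTop] t := by
    have h1 : (fun n => z n - x) =O[atTop] fun n => A (z n - x) := by
      refine Asymptotics.IsBigO.of_bound ‖(Ae.symm : E2 →L[ℝ] E2)‖ (Eventually.of_forall fun n => ?_)
      have h := (Ae.symm : E2 →L[ℝ] E2).le_opNorm (Ae (z n - x))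
      rwa [ContinuousLinearEquiv.coe_coe, ContinuousLinearEquiv.symm_apply_apply, hAe] at h
    have h2 : (fun n => A (z n - x)) =O[atTop] fun n => h (z n) - h x := by
      have h3 : (fun n => A (z n - x) - (h (z n) - h x)) =o[atTop] fun n => A (z n - x) := by
        refine ((hlo.trans_isBigO h1).neg_left).congr_left fun n => ?_
        abel
      exact h3.right_isBigO_sub.trans (by
        refine Asymptotics.IsBigO.congr_left (f₁ := fun n => h (z n) - h x)
          (Asymptotics.isBigO_refl _ _) fun n => ?_
        simp) 
    refine (h1.trans h2).trans ?_
    refine Asymptotics.IsBigO.of_bound ‖u‖ (Eventually.of_forall fun n => ?_)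
    rw [hhz, add_sub_cancel_left, norm_smul, mul_comm]
  have hlim : Tendsto (fun n => A (w n)) atTop (𝓝 u) := by
    have h1 := hlo.trans_isBigO hbig
    have h2 : Tendsto (fun n => (t n)⁻¹ • (h (z n) - h x - A (z n - x))) atTop (𝓝 0) := by
      have := h1.norm_left.tendsto_div_nhds_zero
      rw [tendsto_zero_iff_norm_tendsto_zero]
      refine this.norm.congr' (Eventually.of_forall fun n => ?_) |>.trans (by simp)
      rw [norm_smul, norm_div, norm_norm, norm_inv]; field_simp
    have h3 : ∀ n, A (w n) = u - (t n)⁻¹ • (h (z n) - h x - A (z n - x)) := fun n => by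
      rw [hhz, add_sub_cancel_left, smul_sub, smul_smul, inv_mul_cancel₀ (ht0 n).ne', one_smul,
        hw, map_smul]
      abel
    simp only [h3]
    simpa using tendsto_const_nhds.sub h2
  have hwlim : Tendsto w atTop (𝓝 (Ae.symm u)) := by
    have := (Ae.symm.continuous.tendsto u).comp hlim
    refine this.congr fun n => ?_
    simp only [Function.comp, ← hAe, ContinuousLinearEquiv.symm_apply_apply]
  refine ⟨Ae.symm u, fun l hl => ?_, ?_⟩
  · refine ge_of_tendsto' (((continuous_dbary l).tendsto _).comp hwlim) fun n => ?_
    simp only [Function.comp, hw, dbary_smul, dbary_sub, hl, sub_zero]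
    exact mul_nonneg (inv_nonneg.mpr (ht0 n).le) (hz n l)
  · rw [← hAe, ContinuousLinearEquiv.apply_symm_apply]

end

end LegendrianRibbon

namespace LegendrianRibbon

noncomputable section

/-! ### Angles around a point of a triangulated surface -/

section Tiling

variable {S : Type*} [TopologicalSpace S] [ChartedSpace E2 S]
  {D : Set S} {n : ℕ} {σ : Fin n → E2 → S}

theorem IsSmoothTriangulation.mdiff (hσ : IsSmoothTriangulation D σ) (j : Fin n) {x : E2}
    (hx : x ∈ stdTriangle) :
    MDifferentiableWithinAt 𝓘(ℝ, E2) 𝓘(ℝ, E2) (σ j) stdTriangle x :=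
  (hσ.smooth j x hx).mdifferentiableWithinAt (by simp)

theorem IsSmoothTriangulation.injective_tDW (hσ : IsSmoothTriangulation D σ) (j : Fin n) {x : E2}
    (hx : x ∈ stdTriangle) : Function.Injective (tDW E2 E2 (σ j) stdTriangle x) :=
  hσ.immersed j x hx

theorem IsSmoothTriangulation.mem (hσ : IsSmoothTriangulation D σ) (j : Fin n) {x : E2}
    (hx : x ∈ stdTriangle) : σ j x ∈ D := by
  rw [← hσ.covers]; exact mem_iUnion.mpr ⟨j, x, hx, rfl⟩

/-- An interior point of a triangle belongs to no other triangle. -/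
theorem IsSmoothTriangulation.eq_of_interior (hσ : IsSmoothTriangulation D σ) {i j : Fin n}
    {z w : E2} (hz : z ∈ stdTriangle) (hz' : ∀ l, 0 < bary l z) (hw : w ∈ stdTriangle)
    (h : σ i z = σ j w) : i = j := by
  by_contra hij
  have hmem : σ i z ∈ σ i '' stdTriangle ∩ σ j '' stdTriangle := ⟨⟨z, hz, rfl⟩, ⟨w, hw, h.symm⟩⟩
  rcases hσ.intersections i j hij with h0 | ⟨k, l, h0, -⟩ | ⟨k, l, h0, -⟩
  · rw [h0] at hmem; exact hmem
  · rw [h0] at hmem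
    obtain ⟨y, hy, hyz⟩ := hmem
    obtain rfl := hσ.injective i hy.1 hz hyz
    have := bary_sum y
    have h1 := hy.2
    have h2 := hz' 0
    have h3 := hz' 1
    have h4 := hz' 2
    fin_cases k <;> simp at h1 <;> linarith
  · rw [h0] at hmem
    obtain ⟨y, hy, hyz⟩ := hmem
    obtain rfl := hσ.injective i hy.1 hz hyz
    exact (hz' k).ne' hy.2

variable [IsManifold (𝓡 2) ∞ S]

theorem IsSmoothTriangulation.hasFDeriv (hσ : IsSmoothTriangulation D σ) (j : Fin n) {x : E2}
    (hx : x ∈ stdTriangle) :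
    HasFDerivWithinAt (extChartAt 𝓘(ℝ, E2) (σ j x) ∘ σ j) (tDW E2 E2 (σ j) stdTriangle x)
      stdTriangle x := by
  have := hasFDerivWithinAt_chart_comp (hσ.mdiff j hx) (mem_extChartAt_source (I := 𝓘(ℝ, E2)) _)
  rwa [tD_chart_self, ContinuousLinearMap.id_comp] at this

/-- Interiors of tangent cones of different triangles at a common point are disjoint. -/
theorem IsSmoothTriangulation.disjoint_tConeInt (hσ : IsSmoothTriangulation D σ) {i j : Fin n}
    (hij : i ≠ j) {x y : E2} (hx : x ∈ stdTriangle) (hy : y ∈ stdTriangle) (hxy : σ i x = σ j y) :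
    Disjoint (tDW E2 E2 (σ i) stdTriangle x '' tConeInt x)
      (tDW E2 E2 (σ j) stdTriangle y '' tConeInt y) := by
  rw [Set.disjoint_left]
  rintro u ⟨k, hk, rfl⟩ ⟨k', hk', hkk⟩
  have key : ∀ (j : Fin n) (x : E2), x ∈ stdTriangle → ∀ k ∈ tConeInt x,
      ∀ᶠ t in 𝓝[>] (0 : ℝ), ∃ z ∈ stdTriangle, (∀ l, 0 < bary l z) ∧
        σ j z ∈ (extChartAt 𝓘(ℝ, E2) (σ j x)).source ∧
        extChartAt 𝓘(ℝ, E2) (σ j x) (σ j z) = extChartAt 𝓘(ℝ, E2) (σ j x) (σ j x) +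
          t • tDW E2 E2 (σ j) stdTriangle x k := by
    intro j x hx k hk
    have hsrc : σ j ⁻¹' (extChartAt 𝓘(ℝ, E2) (σ j x)).source ∈ 𝓝[stdTriangle] x :=
      (hσ.smooth j x hx).continuousWithinAt
        ((isOpen_extChartAt_source (σ j x)).mem_nhds (mem_extChartAt_source (σ j x)))
    obtain ⟨N, hN, hxN, hNs⟩ := mem_nhdsWithin.mp hsrc
    have hd := (hσ.hasFDeriv j hx).fderivWithin (uniqueDiffOn_stdTriangle x hx)
    have hcd : ContDiffWithinAt ℝ ∞ (extChartAt 𝓘(ℝ, E2) (σ j x) ∘ σ j) stdTriangle x :=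
      contMDiffWithinAt_iff_contDiffWithinAt.mp
        ((contMDiffAt_chart (mem_extChartAt_source (σ j x))).comp_contMDiffWithinAt x
          (hσ.smooth j x hx))
    filter_upwards [eventually_exists_eq_add_smul hx hcd (by rw [hd]; exact hσ.injective_tDW j hx)
      hk (hN.mem_nhds hxN)] with t ht
    obtain ⟨z, hz, hz1, hz2, hz3⟩ := ht
    exact ⟨z, hz, hz1, hNs ⟨hz2, hz⟩, by rw [hd] at hz3; exact hz3⟩
  obtain ⟨t, ⟨z, hz, hz1, hz2, hz3⟩, ⟨z', hz', -, hz2', hz3'⟩⟩ :=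
    ((key i x hx k hk).and (key j y hy k' hk')).exists
  rw [← hxy, hkk, ← hz3] at hz3'
  rw [← hxy] at hz2'
  exact hij (hσ.eq_of_interior hz hz1 hz'
    ((extChartAt 𝓘(ℝ, E2) (σ i x)).injOn hz2' hz2 hz3').symm)

omit [IsManifold (𝓡 2) ∞ S] in
/-- The chart expression of a segment issued from `p`. -/
theorem tendsto_chart_symm (p : S) (u : E2) :
    Tendsto (fun t : ℝ => (extChartAt 𝓘(ℝ, E2) p).symm (extChartAt 𝓘(ℝ, E2) p p + t • u))
      (𝓝 0) (𝓝 p) := by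
  have h1 : ContinuousAt (fun t : ℝ => extChartAt 𝓘(ℝ, E2) p p + t • u) 0 := by fun_prop
  have h2 := continuousAt_extChartAt_symm (I := 𝓘(ℝ, E2)) p
  have h3 : Tendsto (fun t : ℝ => extChartAt 𝓘(ℝ, E2) p p + t • u) (𝓝 0)
      (𝓝 (extChartAt 𝓘(ℝ, E2) p p)) := by simpa using h1.tendsto
  have := h2.tendsto.comp h3
  rwa [(extChartAt 𝓘(ℝ, E2) p).left_inv (mem_extChartAt_source p)] at this

/-- Every direction that points into the triangulated set belongs to the tangent cone of one of the
triangles. -/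
theorem IsSmoothTriangulation.exists_mem_tCone [T2Space S] (hσ : IsSmoothTriangulation D σ) {p : S}
    {u : E2} (hu : ∀ᶠ t in 𝓝[>] (0 : ℝ),
      (extChartAt 𝓘(ℝ, E2) p).symm (extChartAt 𝓘(ℝ, E2) p p + t • u) ∈ D) :
    ∃ j, ∃ x ∈ stdTriangle, σ j x = p ∧ ∃ k ∈ tCone x, tDW E2 E2 (σ j) stdTriangle x k = u := by
  set c := fun t : ℝ => (extChartAt 𝓘(ℝ, E2) p).symm (extChartAt 𝓘(ℝ, E2) p p + t • u) with hc
  have htgt : ∀ᶠ t in 𝓝[>] (0 : ℝ),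
      extChartAt 𝓘(ℝ, E2) p p + t • u ∈ (extChartAt 𝓘(ℝ, E2) p).target := by
    have h1 : ContinuousAt (fun t : ℝ => extChartAt 𝓘(ℝ, E2) p p + t • u) 0 := by fun_prop
    exact nhdsWithin_le_nhds (h1.eventually ((isOpen_extChartAt_target p).mem_nhds
      (by simp)))
  obtain ⟨j, hj⟩ : ∃ j, ∃ᶠ t in 𝓝[>] (0 : ℝ), c t ∈ σ j '' stdTriangle ∧ 0 < t ∧
      extChartAt 𝓘(ℝ, E2) p p + t • u ∈ (extChartAt 𝓘(ℝ, E2) p).target := by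
    by_contra hne
    replace hne : ∀ j, _ := fun j => not_frequently.mp fun h => hne ⟨j, h⟩
    obtain ⟨t, h1, h2, h3, h4⟩ := (((eventually_all.mpr hne).and hu).and
      (htgt.and (self_mem_nhdsWithin (s := Ioi (0 : ℝ))))).exists.imp fun t h =>
        (⟨h.1.1, h.1.2, h.2.1, h.2.2⟩ : _ ∧ _ ∧ _ ∧ _)
    rw [← hσ.covers] at h2
    obtain ⟨j, hj⟩ := mem_iUnion.mp h2
    exact h1 j ⟨hj, h4, h3⟩
  obtain ⟨t, ht, htn⟩ := exists_seq_forall_of_frequently hj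
  choose z hz hzt using fun n => (htn n).1
  obtain ⟨x, hx, φ, hφ, hlim⟩ := isCompact_stdTriangle.tendsto_subseq hz
  have hp : σ j x = p := by
    have h1 : Tendsto (fun n => σ j (z (φ n))) atTop (𝓝 (σ j x)) :=
      (hσ.smooth j x hx).continuousWithinAt.tendsto.comp
        (tendsto_nhdsWithin_iff.mpr ⟨hlim, Eventually.of_forall fun n => hz _⟩)
    have h2 : Tendsto (fun n => σ j (z (φ n))) atTop (𝓝 p) := by
      simp only [hzt]
      exact (tendsto_chart_symm p u).comp
        ((ht.mono_right nhdsWithin_le_nhds).comp hφ.tendsto_atTop)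
    exact tendsto_nhds_unique h1 h2
  subst hp
  refine ⟨j, x, hx, rfl, exists_mem_tCone_of_tendsto (hσ.hasFDeriv j hx) (hσ.injective_tDW j hx)
    (t := t ∘ φ) (z := z ∘ φ) (fun n => (htn _).2.1) (fun n => hz _) hlim fun n => ?_⟩
  simp only [Function.comp, hzt]
  exact (extChartAt 𝓘(ℝ, E2) (σ j x)).right_inv (htn (φ n)).2.2

omit [IsManifold (𝓡 2) ∞ S] in
/-- At a boundary point, tangent cones of triangles lie in the inner half-plane. -/
theorem IsSmoothTriangulation.tD_nonpos (hσ : IsSmoothTriangulation D σ) {p : S} {g : S → ℝ}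
    (hg : IsDefiningFunctionAt D p g) {j : Fin n} {x : E2} (hx : x ∈ stdTriangle) (hp : σ j x = p)
    {k : E2} (hk : k ∈ tCone x) : tD E2 ℝ g p (tDW E2 E2 (σ j) stdTriangle x k) ≤ 0 := by
  subst hp
  obtain ⟨h1, h2, -, h3⟩ := hg
  have hm := eventually_mem_of_mem_tCone hx hk
  have hd : HasFDerivWithinAt (g ∘ σ j)
      ((tD E2 ℝ g (σ j x)).comp (tDW E2 E2 (σ j) stdTriangle x)) stdTriangle x :=
    ((h1.mdifferentiableAt (by simp)).hasMFDerivAt.comp_hasMFDerivWithinAt x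
      (hσ.mdiff j hx).hasMFDerivWithinAt).hasFDerivWithinAt
  have hzero : Tendsto (fun t : ℝ => t • k) (𝓝[>] (0 : ℝ)) (𝓝 0) := by
    have : ContinuousAt (fun t : ℝ => t • k) 0 := by fun_prop
    have := this.tendsto
    rw [zero_smul] at this
    exact this.mono_left nhdsWithin_le_nhds
  have hone : Tendsto (fun t : ℝ => t⁻¹ • t • k) (𝓝[>] (0 : ℝ)) (𝓝 k) := by
    refine tendsto_const_nhds.congr' ?_
    filter_upwards [self_mem_nhdsWithin] with t ht0
    have ht0 : 0 < t := ht0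
    rw [smul_smul, inv_mul_cancel₀ ht0.ne', one_smul]
  have hlim := hd.lim hzero hm hone
  refine le_of_tendsto hlim ?_
  have hto : Tendsto (fun t : ℝ => σ j (x + t • k)) (𝓝[>] (0 : ℝ)) (𝓝 (σ j x)) := by
    refine (hσ.smooth j x hx).continuousWithinAt.tendsto.comp
      (tendsto_nhdsWithin_iff.mpr ⟨?_, hm⟩)
    simpa using tendsto_const_nhds.add hzero
  filter_upwards [hm, hto.eventually h3, self_mem_nhdsWithin] with t ht1 ht2 ht0
  have ht0 : 0 < t := ht0
  have := ht2.mp (hσ.mem j ht1)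
  simp only [Function.comp, h2, sub_zero, smul_eq_mul]
  exact mul_nonpos_of_nonneg_of_nonpos (inv_nonneg.mpr ht0.le) this

/-- A function that vanishes at `p` is negative in the directions on which its differential is
negative. -/
theorem eventually_neg_of_tD_neg {p : S} {g : S → ℝ} (h1 : MDifferentiableAt 𝓘(ℝ, E2) 𝓘(ℝ, ℝ) g p)
    (h2 : g p = 0) {u : E2} (hu : tD E2 ℝ g p u < 0) : ∀ᶠ t in 𝓝[>] (0 : ℝ),
      g ((extChartAt 𝓘(ℝ, E2) p).symm (extChartAt 𝓘(ℝ, E2) p p + t • u)) < 0 := by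
  have hs := tD_chart_symm_comp (mem_extChartAt_source (I := 𝓘(ℝ, E2)) p)
  rw [tD_chart_self, ContinuousLinearMap.comp_id] at hs
  have hl := (extChartAt 𝓘(ℝ, E2) p).left_inv (mem_extChartAt_source p)
  have hgd : MDifferentiableAt 𝓘(ℝ, E2) 𝓘(ℝ, ℝ) g
      ((extChartAt 𝓘(ℝ, E2) p).symm (extChartAt 𝓘(ℝ, E2) p p)) := by
    rw [hl]; exact h1
  have hsd := mdiffAt_chart_symm (mem_extChartAt_target (I := 𝓘(ℝ, E2)) p)
  have hd : HasFDerivAt (g ∘ (extChartAt 𝓘(ℝ, E2) p).symm) (tD E2 ℝ g p)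
      (extChartAt 𝓘(ℝ, E2) p p) := by
    have h := (hgd.comp (extChartAt 𝓘(ℝ, E2) p p) hsd).differentiableAt.hasFDerivAt
    rwa [← tD_eq_fderiv, tD_comp hgd hsd, hl, hs, ContinuousLinearMap.comp_id] at h
  have hline : HasDerivAt (fun t : ℝ => g ((extChartAt 𝓘(ℝ, E2) p).symm
      (extChartAt 𝓘(ℝ, E2) p p + t • u))) (tD E2 ℝ g p u) 0 := by
    have hl' : HasDerivAt (fun t : ℝ => extChartAt 𝓘(ℝ, E2) p p + t • u) u 0 := by
      simpa using ((hasDerivAt_id (0 : ℝ)).smul_const u).const_add (extChartAt 𝓘(ℝ, E2) p p)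
    exact HasFDerivAt.comp_hasDerivAt (x := (0 : ℝ))
      (l := g ∘ (extChartAt 𝓘(ℝ, E2) p).symm) (f := fun t : ℝ => extChartAt 𝓘(ℝ, E2) p p + t • u)
      (by simpa using hd) hl'
  have hsl := (hasDerivAt_iff_tendsto_slope.mp hline).eventually_lt_const hu
  have hsl' : ∀ᶠ t in 𝓝[>] (0 : ℝ), slope (fun t : ℝ => g ((extChartAt 𝓘(ℝ, E2) p).symm
      (extChartAt 𝓘(ℝ, E2) p p + t • u))) 0 t < 0 :=
    hsl.filter_mono (nhdsWithin_mono _ fun t ht => ne_of_gt ht)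
  filter_upwards [hsl', self_mem_nhdsWithin] with t ht1 ht0
  have ht0 : 0 < t := ht0
  simp only [slope, sub_zero, zero_smul, add_zero, hl, h2, vsub_eq_sub, smul_eq_mul] at ht1
  by_contra hcon
  push Not at hcon
  exact absurd ht1 (not_lt.mpr (mul_nonneg (inv_nonneg.mpr ht0.le) hcon))

/-- Directions on which the differential of a defining function is negative point into the
domain. -/
theorem eventually_mem_of_tD_neg {p : S} {g : S → ℝ} (hg : IsDefiningFunctionAt D p g) {u : E2}
    (hu : tD E2 ℝ g p u < 0) : ∀ᶠ t in 𝓝[>] (0 : ℝ),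
      (extChartAt 𝓘(ℝ, E2) p).symm (extChartAt 𝓘(ℝ, E2) p p + t • u) ∈ D := by
  filter_upwards [eventually_neg_of_tD_neg (hg.1.mdifferentiableAt (by simp)) hg.2.1 hu,
    nhdsWithin_le_nhds ((tendsto_chart_symm p u).eventually hg.2.2.2)] with t ht1 ht2
  exact ht2.mpr ht1.le

/-- The angles at `p` of the triangles that contain `p` add up to `2π` if `p` is an interior point
and to `π` if `p` is a boundary point. Angles are measured by means of a linear isomorphism `L` of
the tangent plane with `ℂ`; the points `x i` of the triangles `J i` are the preimages of `p`. -/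
theorem IsSmoothTriangulation.sum_angle [T2Space S] (hσ : IsSmoothTriangulation D σ) {p : S}
    {L : E2 →L[ℝ] ℂ} (hL : Function.Injective L) {ι : Type*} (s : Finset ι) (J : ι → Fin n)
    (x : ι → E2) (hx : ∀ i ∈ s, x i ∈ stdTriangle ∧ σ (J i) (x i) = p)
    (hJ : ∀ i ∈ s, ∀ j ∈ s, J i = J j → i = j)
    (hall : ∀ j, ∀ y ∈ stdTriangle, σ j y = p → ∃ i ∈ s, J i = j ∧ x i = y)
    {θ : ι → ℝ} (hθ : ∀ i ∈ s, 0 ≤ θ i)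
    (hC : ∀ i ∈ s, angSize (L.comp (tDW E2 E2 (σ (J i)) stdTriangle (x i)) '' tCone (x i)) =
      ENNReal.ofReal (θ i))
    (hO : ∀ i ∈ s, angSize (L.comp (tDW E2 E2 (σ (J i)) stdTriangle (x i)) '' tConeInt (x i)) =
      ENNReal.ofReal (θ i)) :
    (p ∈ interior D → ∑ i ∈ s, θ i = 2 * Real.pi) ∧
    (∀ g, IsDefiningFunctionAt D p g → ∑ i ∈ s, θ i = Real.pi) := by
  have hLs : Function.Surjective L := surjective_of_jac_ne_zero (jac_ne_zero_of_injective hL)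
  have hOo : ∀ i ∈ s,
      IsOpen (L.comp (tDW E2 E2 (σ (J i)) stdTriangle (x i)) '' tConeInt (x i)) := by
    intro i hi
    have hinj : Function.Injective (L.comp (tDW E2 E2 (σ (J i)) stdTriangle (x i))) :=
      hL.comp (hσ.injective_tDW (J i) (hx i hi).1)
    exact (L.comp (tDW E2 E2 (σ (J i)) stdTriangle (x i))).isOpenMap
      (surjective_of_jac_ne_zero (jac_ne_zero_of_injective hinj)) _ (isOpen_tConeInt _)
  have hdisj : ∀ i ∈ s, ∀ j ∈ s, i ≠ j →
      Disjoint (L.comp (tDW E2 E2 (σ (J i)) stdTriangle (x i)) '' tConeInt (x i))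
        (L.comp (tDW E2 E2 (σ (J j)) stdTriangle (x j)) '' tConeInt (x j)) := by
    intro i hi j hj hij
    have := hσ.disjoint_tConeInt (fun h => hij (hJ i hi j hj h)) (hx i hi).1 (hx j hj).1
      ((hx i hi).2.trans (hx j hj).2.symm)
    rw [ContinuousLinearMap.coe_comp, ContinuousLinearMap.coe_comp, image_comp, image_comp]
    exact disjoint_image_of_injective hL this
  have hcov : ∀ u : E2, (∀ᶠ t in 𝓝[>] (0 : ℝ),
      (extChartAt 𝓘(ℝ, E2) p).symm (extChartAt 𝓘(ℝ, E2) p p + t • u) ∈ D) →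
      L u ∈ ⋃ i ∈ s, L.comp (tDW E2 E2 (σ (J i)) stdTriangle (x i)) '' tCone (x i) := by
    intro u hu
    obtain ⟨j, y, hy, hyp, k, hk, rfl⟩ := hσ.exists_mem_tCone hu
    obtain ⟨i, hi, rfl, rfl⟩ := hall j y hy hyp
    exact mem_iUnion₂.mpr ⟨i, hi, k, hk, rfl⟩
  have hUniv : angSize univ = ENNReal.ofReal (2 * Real.pi) := by
    rw [← angSize_compl_zero]
    unfold angSize
    congr 1
    ext t
    simp
  constructor
  · intro hp
    refine sum_angle_eq s (by positivity) hθ hC hO hOo hdisj angSize_compl_zero hUniv ?_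
      fun i _ => subset_univ _
    intro ζ _
    obtain ⟨u, rfl⟩ := hLs ζ
    exact hcov u (nhdsWithin_le_nhds ((tendsto_chart_symm p u).eventually
      (mem_interior_iff_mem_nhds.mp hp)))
  · intro g hg
    obtain ⟨e1, he1⟩ := hLs 1
    obtain ⟨eI, heI⟩ := hLs Complex.I
    set P : ℂ := ⟨- tD E2 ℝ g p eI, tD E2 ℝ g p e1⟩ with hP
    have hcross : ∀ u, cross P (L u) = - tD E2 ℝ g p u := by
      intro u
      have : u = (L u).re • e1 + (L u).im • eI := by
        apply hL
        rw [map_add, map_smul, map_smul, he1, heI]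
        apply Complex.ext <;> simp
      conv_rhs => rw [this]
      rw [map_add, map_smul, map_smul]
      simp only [cross, hP, smul_eq_mul]; ring
    have hP0 : P ≠ 0 := by
      intro h0
      apply hg.2.2.1
      have : ∀ u, tD E2 ℝ g p u = 0 := fun u => by
        have := hcross u
        rw [h0] at this
        simp [cross] at this
        exact this
      exact ContinuousLinearMap.ext this
    have hpi := angSize_halfPlane hP0
    refine sum_angle_eq s Real.pi_nonneg hθ hC hO hOo hdisj hpi.2 hpi.1 ?_ ?_
    · intro ζ hζ
      obtain ⟨u, rfl⟩ := hLs ζ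
      rw [mem_ofPred_eq, hcross] at hζ
      exact hcov u (eventually_mem_of_tD_neg hg (by linarith))
    · rintro i hi _ ⟨k, hk, rfl⟩
      have := hσ.tD_nonpos hg (hx i hi).1 (hx i hi).2 (tConeInt_subset _ hk)
      rw [mem_ofPred_eq]
      show 0 ≤ cross P (L _)
      rw [hcross]
      exact neg_nonneg.mpr this

end Tiling

end

end LegendrianRibbon

namespace LegendrianRibbon

noncomputable section

/-! ### Arcs with the same image -/

section Arcs

/-- A curve in the image of an embedded arc lifts to the parameter interval of the arc. -/
theorem exists_arc_lift {Y : Type*} [TopologicalSpace Y] [T2Space Y] {c₁ c₂ : ℝ → Y} {X : Set ℝ}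
    {a b : ℝ} (h₁ : ContinuousOn c₁ X) (h₂ : ContinuousOn c₂ (Icc a b)) (inj : InjOn c₂ (Icc a b))
    (hsub : ∀ s ∈ X, c₁ s ∈ c₂ '' Icc a b) :
    ∃ ψ : ℝ → ℝ, ContinuousOn ψ X ∧ MapsTo ψ X (Icc a b) ∧ ∀ s ∈ X, c₂ (ψ s) = c₁ s := by
  have hm : ∀ s ∈ X, Function.invFunOn c₂ (Icc a b) (c₁ s) ∈ Icc a b := fun s hs =>
    Function.invFunOn_mem (hsub s hs)
  have he : ∀ s ∈ X, c₂ (Function.invFunOn c₂ (Icc a b) (c₁ s)) = c₁ s := fun s hs =>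
    Function.invFunOn_eq (hsub s hs)
  refine ⟨fun s => Function.invFunOn c₂ (Icc a b) (c₁ s), ?_, hm, he⟩
  have hemb : Topology.IsClosedEmbedding ((Icc a b).domRestrict c₂) :=
    (continuousOn_iff_continuous_domRestrict.mp h₂).isClosedEmbedding
      (injOn_iff_injective.mp inj)
  have hcont : Continuous (fun s : X =>
      (⟨Function.invFunOn c₂ (Icc a b) (c₁ s), hm s s.2⟩ : Icc a b)) := by
    rw [hemb.isInducing.continuous_iff]
    refine (continuousOn_iff_continuous_domRestrict.mp h₁).congr fun s => ?_
    exact (he s s.2).symm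
  exact continuousOn_iff_continuous_domRestrict.mpr (continuous_subtype_val.comp hcont)

theorem endpoints_of_lift {ψ : ℝ → ℝ} {a b a' b' : ℝ} (hab : a < b)
    (hψ : ContinuousOn ψ (Icc a b)) (hm : MapsTo ψ (Icc a b) (Icc a' b'))
    (hinj : InjOn ψ (Icc a b)) (ha : a' ∈ ψ '' Icc a b) (hb : b' ∈ ψ '' Icc a b) :
    (StrictMonoOn ψ (Icc a b) ∧ ψ a = a' ∧ ψ b = b') ∨
    (StrictAntiOn ψ (Icc a b) ∧ ψ a = b' ∧ ψ b = a') := by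
  have hA := left_mem_Icc.mpr hab.le
  have hB := right_mem_Icc.mpr hab.le
  obtain ⟨s, hs, hsa⟩ := ha
  obtain ⟨s', hs', hsb⟩ := hb
  rcases hψ.strictMonoOn_of_injOn_Icc' hab.le hinj with h | h
  · refine Or.inl ⟨h, le_antisymm ?_ (hm hA).1, le_antisymm (hm hB).2 ?_⟩
    · rw [← hsa]; exact h.monotoneOn hA hs hs.1
    · rw [← hsb]; exact h.monotoneOn hs' hB hs'.2
  · refine Or.inr ⟨h, le_antisymm (hm hA).2 ?_, le_antisymm ?_ (hm hB).1⟩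
    · rw [← hsb]; exact h.antitoneOn hA hs' hs'.1
    · rw [← hsa]; exact h.antitoneOn hs hB hs.2

/-- A closed curve is not injective if it takes values in an interval. -/
theorem false_of_injOn_loop {ψ : ℝ → ℝ} {a b : ℝ} (hab : a < b) (hψ : ContinuousOn ψ (Icc a b))
    (hinj : InjOn ψ (Ico a b)) (h : ψ a = ψ b) : False := by
  set m := (a + b) / 2 with hm
  have ham : a < m := by rw [hm]; linarith
  have hmb : m < b := by rw [hm]; linarith
  have hne : ψ a ≠ ψ m := fun e => ham.ne (hinj ⟨le_rfl, hab⟩ ⟨ham.le, hmb⟩ e)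
  set y := (ψ a + ψ m) / 2 with hy
  have h1 : y ∈ ψ '' Icc a m :=
    (isPreconnected_Icc.image ψ (hψ.mono (Icc_subset_Icc le_rfl hmb.le))).ordConnected.uIcc_subset
      ⟨a, ⟨le_rfl, ham.le⟩, rfl⟩ ⟨m, ⟨ham.le, le_rfl⟩, rfl⟩ (by
        rw [mem_uIcc]; rcases le_total (ψ a) (ψ m) with h | h
        · left; constructor <;> linarith
        · right; constructor <;> linarith)
  have h2 : y ∈ ψ '' Icc m b :=
    (isPreconnected_Icc.image ψ (hψ.mono (Icc_subset_Icc ham.le le_rfl))).ordConnected.uIcc_subset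
      ⟨m, ⟨le_rfl, hmb.le⟩, rfl⟩ ⟨b, ⟨hmb.le, le_rfl⟩, rfl⟩ (by
        rw [mem_uIcc, ← h]; rcases le_total (ψ a) (ψ m) with h | h
        · right; constructor <;> linarith
        · left; constructor <;> linarith)
  obtain ⟨s, hs, hsy⟩ := h1
  obtain ⟨s', hs', hsy'⟩ := h2
  have hsb' : s' ≠ b := by
    rintro rfl
    rw [← h] at hsy'
    apply hne; linarith
  have := hinj ⟨hs.1, hs.2.trans_lt hmb⟩ ⟨ham.le.trans hs'.1, lt_of_le_of_ne hs'.2 hsb'⟩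
    (hsy.trans hsy'.symm)
  have : s = m := le_antisymm hs.2 (this ▸ hs'.1)
  rw [this] at hsy
  apply hne; linarith

/-- If `h₁ = h₂ ∘ ψ` with `ψ` increasing, then parallel velocities of `h₁` and `h₂` have the same
direction. -/
theorem nonneg_of_eventuallyEq_comp {h₁ h₂ : ℝ → E2} {a b : E2} {t s r : ℝ} {ψ : ℝ → ℝ}
    (hd₁ : HasDerivAt h₁ a t) (hd₂ : HasDerivAt h₂ b s) (hab : a = r • b) (hb : b ≠ 0)
    (hψ : Tendsto ψ (𝓝[>] t) (𝓝[>] s)) (h0 : h₁ t = h₂ s)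
    (he : ∀ᶠ t' in 𝓝[>] t, h₁ t' = h₂ (ψ t')) : 0 ≤ r := by
  have key : ∀ {h : ℝ → E2} {v : E2} {x : ℝ}, HasDerivAt h v x →
      Tendsto (slope (fun y => inner ℝ b (h y)) x) (𝓝[>] x) (𝓝 (inner ℝ b v)) := by
    intro h v x hd
    have : HasDerivAt (fun y => inner ℝ b (h y)) (inner ℝ b v) x := by
      have := (innerSL ℝ b).hasFDerivAt.comp_hasDerivAt x hd
      exact this
    exact (hasDerivAt_iff_tendsto_slope.mp this).mono_left
      (nhdsWithin_mono _ fun t ht => ne_of_gt ht)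
  have hbb : (0 : ℝ) < inner ℝ b b := real_inner_self_pos.mpr hb
  have h2 := hψ.eventually ((key hd₂).eventually_const_lt hbb)
  have h3 : (0 : ℝ) ≤ inner ℝ b a := by
    refine ge_of_tendsto (key hd₁) ?_
    filter_upwards [h2, he, hψ.eventually self_mem_nhdsWithin, self_mem_nhdsWithin]
      with t' ht' he' hst htt
    have hst : s < ψ t' := hst
    have htt : t < t' := htt
    simp only [slope, vsub_eq_sub, smul_eq_mul] at ht' ⊢
    rw [he', h0]
    have h4 : 0 < (ψ t' - s)⁻¹ := inv_pos.mpr (by linarith)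
    exact mul_nonneg (inv_nonneg.mpr (by linarith)) (pos_of_mul_pos_right ht' h4.le).le
  rw [hab, inner_smul_right] at h3
  exact nonneg_of_mul_nonneg_left h3 hbb

variable {S : Type*} [TopologicalSpace S] [ChartedSpace E2 S]

/-- Two parametrizations of an arc, with velocities `v₁` and `v₂` that point in the same direction
if `δ = 1` and in opposite directions if `δ = -1`: the variations of the argument of the velocity
agree up to the sign `δ`. -/
theorem argVar_eq_of_arcs [T2Space S] {c₁ c₂ : ℝ → S} {v₁ v₂ : ℝ → E2} {Φ : S → E2 →L[ℝ] ℂ}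
    {a b a' b' : ℝ} (hab : a < b) (hab' : a' < b')
    (hc₁ : ContinuousOn c₁ (Icc a b)) (hc₂ : ContinuousOn c₂ (Icc a' b'))
    (inj₁ : InjOn c₁ (Icc a b)) (inj₂ : InjOn c₂ (Icc a' b'))
    (him : c₁ '' Icc a b = c₂ '' Icc a' b')
    (hd₁ : ContinuousOn (fun s => Φ (c₁ s) (v₁ s)) (Icc a b))
    (hd₂ : ContinuousOn (fun s => Φ (c₂ s) (v₂ s)) (Icc a' b'))
    (n₁ : ∀ s ∈ Icc a b, Φ (c₁ s) (v₁ s) ≠ 0) (n₂ : ∀ s ∈ Icc a' b', Φ (c₂ s) (v₂ s) ≠ 0)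
    (hv₁ : ∀ s ∈ Ioo a b, HasDerivAt (extChartAt 𝓘(ℝ, E2) (c₁ s) ∘ c₁) (v₁ s) s)
    (hv₂ : ∀ s ∈ Ioo a' b', HasDerivAt (extChartAt 𝓘(ℝ, E2) (c₂ s) ∘ c₂) (v₂ s) s)
    (hΦ : ∀ s ∈ Ioo a b, Function.Injective (Φ (c₁ s))) {δ : ℝ} (hδ : δ = 1 ∨ δ = -1)
    (hpar : ∀ s ∈ Ioo a b, ∀ s' ∈ Ioo a' b', c₁ s = c₂ s' →
      ∃ r > 0, Φ (c₁ s) (v₁ s) = (δ * r) • Φ (c₂ s') (v₂ s')) :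
    argVar (fun s => Φ (c₁ s) (v₁ s)) a b = δ * argVar (fun s => Φ (c₂ s) (v₂ s)) a' b' := by
  obtain ⟨ψ, hψ, hm, he⟩ := exists_arc_lift hc₁ hc₂ inj₂ fun s hs => him ▸ ⟨s, hs, rfl⟩
  have hinj : InjOn ψ (Icc a b) := fun s hs t ht h =>
    inj₁ hs ht (by rw [← he s hs, ← he t ht, h])
  have hon : ∀ s' ∈ Icc a' b', s' ∈ ψ '' Icc a b := fun s' hs' => by
    obtain ⟨s, hs, hss⟩ : c₂ s' ∈ c₁ '' Icc a b := him ▸ ⟨s', hs', rfl⟩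
    exact ⟨s, hs, inj₂ (hm hs) hs' ((he s hs).trans hss)⟩
  have hend := endpoints_of_lift hab hψ hm hinj (hon _ (left_mem_Icc.mpr hab'.le))
    (hon _ (right_mem_Icc.mpr hab'.le))
  have hA := left_mem_Icc.mpr hab.le
  have hB := right_mem_Icc.mpr hab.le
  have hoo : ∀ s ∈ Ioo a b, ψ s ∈ Ioo a' b' := by
    intro s hs
    have hs' := Ioo_subset_Icc_self hs
    rcases hend with ⟨h, h1, h2⟩ | ⟨h, h1, h2⟩
    · exact ⟨h1 ▸ h hA hs' hs.1, h2 ▸ h hs' hB hs.2⟩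
    · exact ⟨h2 ▸ h hs' hB hs.2, h1 ▸ h hA hs' hs.1⟩
  have hpc := argVar_eq_of_parallel_comp hab hab'.le hd₁ hd₂ n₁ n₂ hψ hm fun s hs => by
    obtain ⟨r, -, hr⟩ := hpar s hs (ψ s) (hoo s hs) (he s (Ioo_subset_Icc_self hs)).symm
    rw [hr, smul_mul_assoc, Complex.smul_im, im_mul_conj_self, smul_zero]
  -- the sign is determined at one interior point
  obtain ⟨t, ht⟩ := exists_between hab
  have htI := Ioo_subset_Icc_self (show t ∈ Ioo a b from ht)
  obtain ⟨r, hr0, hr⟩ := hpar t ht (ψ t) (hoo t ht) (he t htI).symm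
  rw [he t htI] at hr
  have hvv : v₁ t = (δ * r) • v₂ (ψ t) := hΦ t ht (by rw [hr, map_smul])
  have hv2 : v₂ (ψ t) ≠ 0 := fun h0 => n₂ _ (hm htI) (by rw [h0, map_zero])
  have hD₂ : HasDerivAt (extChartAt 𝓘(ℝ, E2) (c₁ t) ∘ c₂) (v₂ (ψ t)) (ψ t) := by
    have := hv₂ (ψ t) (hoo t ht)
    rwa [he t htI] at this
  have hev : ∀ᶠ t' in 𝓝[>] t, t' ∈ Icc a b ∧ t < t' := by
    filter_upwards [nhdsWithin_le_nhds (Icc_mem_nhds ht.1 ht.2), self_mem_nhdsWithin]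
      with t' h1 h2 using ⟨h1, h2⟩
  have hcψ : Tendsto ψ (𝓝[>] t) (𝓝 (ψ t)) :=
    ((hψ.continuousAt (Icc_mem_nhds ht.1 ht.2)).tendsto).mono_left nhdsWithin_le_nhds
  have h0 : (extChartAt 𝓘(ℝ, E2) (c₁ t) ∘ c₁) t = (extChartAt 𝓘(ℝ, E2) (c₁ t) ∘ c₂) (ψ t) := by
    simp only [Function.comp, he t htI]
  have heq : ∀ᶠ t' in 𝓝[>] t, (extChartAt 𝓘(ℝ, E2) (c₁ t) ∘ c₁) t' =
      (extChartAt 𝓘(ℝ, E2) (c₁ t) ∘ c₂) (ψ t') := by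
    filter_upwards [hev] with t' ht'
    simp only [Function.comp, he t' ht'.1]
  rcases hend with ⟨h, h1, h2⟩ | ⟨h, h1, h2⟩
  · have := nonneg_of_eventuallyEq_comp (hv₁ t ht) hD₂ hvv hv2
      (tendsto_nhdsWithin_iff.mpr ⟨hcψ, hev.mono fun t' ht' => h htI ht'.1 ht'.2⟩) h0 heq
    rcases hδ with rfl | rfl
    · rw [one_mul]; exact hpc.1 h1 h2
    · linarith
  · have hD₂' : HasDerivAt ((extChartAt 𝓘(ℝ, E2) (c₁ t) ∘ c₂) ∘ fun y => -y) (-v₂ (ψ t))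
        (-ψ t) := by
      have := HasDerivAt.scomp (-ψ t) (by rw [neg_neg]; exact hD₂) (hasDerivAt_neg (-ψ t))
      simpa using this
    have := nonneg_of_eventuallyEq_comp (r := -(δ * r)) (ψ := fun y => -ψ y) (hv₁ t ht) hD₂'
      (by rw [hvv, smul_neg, neg_smul, neg_neg])
      (neg_ne_zero.mpr hv2)
      (tendsto_nhdsWithin_iff.mpr ⟨hcψ.neg, hev.mono fun t' ht' =>
        (neg_lt_neg (h htI ht'.1 ht'.2) : -ψ t < -ψ t')⟩)
      (by simpa using h0) (by simpa using heq)
    rcases hδ with rfl | rfl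
    · linarith
    · rw [neg_one_mul]; exact hpc.2 h1 h2

end Arcs

/-! ### Incidences in a triangulation -/

section Incidence

theorem edgePt_ne_vtx {k l : Fin 3} {t : ℝ} (ht : t ∈ Ioo (0 : ℝ) 1) : edgePt k t ≠ vtx l := by
  intro h
  have h1 := (bary_edgePt k t).2.2
  rw [h, bary_vtx] at h1
  have := ht.1
  have := ht.2
  split_ifs at h1 <;> linarith

theorem vtx_injective : Function.Injective vtx := by
  intro k l h
  have := bary_vtx k l
  rw [← h, bary_vtx] at this
  by_contra hkl
  simp [hkl] at this

theorem bary_edgePt_eq_zero_iff {k l : Fin 3} {t : ℝ} (ht : t ∈ Ioo (0 : ℝ) 1) :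
    bary l (edgePt k t) = 0 ↔ l = k := by
  obtain ⟨h0, h1, h2⟩ := bary_edgePt k t
  have := ht.1
  have := ht.2
  rcases fin3_cases k l with rfl | rfl | rfl
  · simp [h0]
  · rw [h1]; simp; linarith
  · rw [h2]
    constructor
    · intro h; linarith
    · intro h; fin_cases k <;> simp at h

theorem stdTriangle_cases {x : E2} (hx : x ∈ stdTriangle) :
    (∀ l, 0 < bary l x) ∨ (∃ k, ∃ t ∈ Ioo (0 : ℝ) 1, x = edgePt k t) ∨ ∃ k, x = vtx k := by
  by_cases h : ∀ l, 0 < bary l x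
  · exact Or.inl h
  right
  push Not at h
  obtain ⟨k, hk⟩ := h
  have hk0 : bary k x = 0 := le_antisymm hk (hx k)
  have : x ∈ stdEdge k := ⟨hx, hk0⟩
  rw [stdEdge_eq] at this
  obtain ⟨t, ht, rfl⟩ := this
  rcases ht.1.eq_or_lt with rfl | h0
  · exact Or.inr ⟨_, edgePt_zero k⟩
  rcases ht.2.eq_or_lt with rfl | h1
  · exact Or.inr ⟨_, edgePt_one k⟩
  · exact Or.inl ⟨k, t, ⟨h0, h1⟩, rfl⟩

theorem tCone_vtx (k : Fin 3) :
    tCone (vtx k) = {u | 0 ≤ dbary (k + 1) u ∧ 0 ≤ dbary (k + 2) u} ∧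
    tConeInt (vtx k) = {u | 0 < dbary (k + 1) u ∧ 0 < dbary (k + 2) u} := by
  have h : ∀ l, bary l (vtx k) = 0 ↔ l = k + 1 ∨ l = k + 2 := by
    intro l
    rw [bary_vtx]
    fin_cases k <;> fin_cases l <;> simp
  constructor <;> ext u <;> simp [tCone, tConeInt, h]

theorem tCone_edgePt (k : Fin 3) {t : ℝ} (ht : t ∈ Ioo (0 : ℝ) 1) :
    tCone (edgePt k t) = {u | 0 ≤ dbary k u} ∧ tConeInt (edgePt k t) = {u | 0 < dbary k u} := by
  constructor <;> ext u <;> simp [tCone, tConeInt, bary_edgePt_eq_zero_iff ht]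

variable {S : Type*} [TopologicalSpace S] [ChartedSpace E2 S]
  {D : Set S} {n : ℕ} {σ : Fin n → E2 → S}

/-- The edges of a family of triangles, indexed by a triangle and one of its sides. -/
def edgeSet (σ : Fin n → E2 → S) (q : Fin n × Fin 3) : Set S := σ q.1 '' stdEdge q.2

/-- The vertices of a family of triangles, indexed by a triangle and one of its corners. -/
def vtxPt (σ : Fin n → E2 → S) (q : Fin n × Fin 3) : S := σ q.1 (vtx q.2)

/-- Parametrizations of the edges of a family of triangles. -/
def edgeCurve (σ : Fin n → E2 → S) (q : Fin n × Fin 3) (t : ℝ) : S := σ q.1 (edgePt q.2 t)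

omit [TopologicalSpace S] [ChartedSpace E2 S] in
theorem edgeSet_eq (q : Fin n × Fin 3) : edgeSet σ q = edgeCurve σ q '' Icc 0 1 := by
  rw [edgeSet, stdEdge_eq, image_image]; rfl

theorem IsSmoothTriangulation.injOn_edgeCurve (hσ : IsSmoothTriangulation D σ)
    (q : Fin n × Fin 3) : InjOn (edgeCurve σ q) (Icc 0 1) := fun _ hs _ ht h =>
  edgePt_injective q.2 (hσ.injective q.1 (edgePt_mem q.2 hs) (edgePt_mem q.2 ht) h)

theorem IsSmoothTriangulation.continuousOn_edgeCurve (hσ : IsSmoothTriangulation D σ)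
    (q : Fin n × Fin 3) : ContinuousOn (edgeCurve σ q) (Icc 0 1) :=
  (hσ.smooth q.1).continuousOn.comp (continuous_edgePt q.2).continuousOn fun _ hs =>
    edgePt_mem q.2 hs

/-- Arcs with the same image have the same endpoints. -/
theorem IsSmoothTriangulation.endpoint_of_edgeSet_eq [T2Space S] (hσ : IsSmoothTriangulation D σ)
    {q r : Fin n × Fin 3} (h : edgeSet σ q = edgeSet σ r) {s t : ℝ} (hs : s ∈ Icc (0 : ℝ) 1)
    (ht : t = 0 ∨ t = 1) (hst : edgeCurve σ q s = edgeCurve σ r t) : s = 0 ∨ s = 1 := by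
  rw [edgeSet_eq, edgeSet_eq] at h
  obtain ⟨ψ, hψ, hm, he⟩ := exists_arc_lift (hσ.continuousOn_edgeCurve r)
    (hσ.continuousOn_edgeCurve q) (hσ.injOn_edgeCurve q) fun s hs => by rw [h]; exact ⟨s, hs, rfl⟩
  have hinj : InjOn ψ (Icc 0 1) := fun s hs t ht h =>
    hσ.injOn_edgeCurve r hs ht (by rw [← he s hs, ← he t ht, h])
  have hon : ∀ s' ∈ Icc (0 : ℝ) 1, s' ∈ ψ '' Icc 0 1 := fun s' hs' => by
    obtain ⟨s, hs, hss⟩ : edgeCurve σ q s' ∈ edgeCurve σ r '' Icc 0 1 := by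
      rw [← h]; exact ⟨s', hs', rfl⟩
    exact ⟨s, hs, hσ.injOn_edgeCurve q (hm hs) hs' ((he s hs).trans hss)⟩
  have htI : t ∈ Icc (0 : ℝ) 1 := by rcases ht with rfl | rfl <;> simp
  have hψt : s = ψ t := hσ.injOn_edgeCurve q hs (hm htI) (by rw [hst, he t htI])
  rcases endpoints_of_lift one_pos hψ hm hinj (hon _ (by simp)) (hon _ (by simp)) with
    ⟨-, h1, h2⟩ | ⟨-, h1, h2⟩ <;> rcases ht with rfl | rfl <;> simp [hψt, h1, h2]

/-- A vertex is a vertex of all the triangles that contain it. -/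
theorem IsSmoothTriangulation.exists_eq_vtx [T2Space S] (hσ : IsSmoothTriangulation D σ)
    {i j : Fin n} {x : E2} {k : Fin 3} (hx : x ∈ stdTriangle) (h : σ i x = σ j (vtx k)) :
    ∃ l, x = vtx l := by
  by_cases hij : i = j
  · subst hij
    exact ⟨k, hσ.injective i hx (vtx_mem k) h⟩
  have hmem : σ i x ∈ σ i '' stdTriangle ∩ σ j '' stdTriangle :=
    ⟨⟨x, hx, rfl⟩, ⟨vtx k, vtx_mem k, h.symm⟩⟩
  rcases hσ.intersections i j hij with h0 | ⟨a, b, h0, -⟩ | ⟨a, b, h0, h1⟩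
  · rw [h0] at hmem; exact hmem.elim
  · rw [h0, stdVertex_eq] at hmem
    obtain ⟨y, hy, hyz⟩ := hmem
    obtain rfl : y = vtx a := hy
    exact ⟨a, (hσ.injective i (vtx_mem a) hx hyz).symm⟩
  · rw [h0] at hmem
    have hmem' := hmem
    rw [h1] at hmem'
    rw [stdEdge_eq] at hmem hmem'
    obtain ⟨_, ⟨s, hs, rfl⟩, hsx⟩ := hmem
    obtain ⟨_, ⟨t, ht, rfl⟩, htx⟩ := hmem'
    obtain rfl := hσ.injective i (edgePt_mem a hs) hx hsx
    have htk := hσ.injective j (edgePt_mem b ht) (vtx_mem k) (htx.trans h)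
    have ht01 : t = 0 ∨ t = 1 := by
      by_contra hcon
      push Not at hcon
      exact edgePt_ne_vtx ⟨lt_of_le_of_ne ht.1 hcon.1.symm, lt_of_le_of_ne ht.2 hcon.2⟩ htk
    rcases hσ.endpoint_of_edgeSet_eq (q := (i, a)) (r := (j, b)) h1 hs ht01 htx.symm with
      rfl | rfl
    · exact ⟨_, edgePt_zero a⟩
    · exact ⟨_, edgePt_one a⟩

/-- A point in the interior of an edge is so for all the triangles that contain it. -/
theorem IsSmoothTriangulation.exists_eq_edgePt [T2Space S] (hσ : IsSmoothTriangulation D σ)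
    {i j : Fin n} {x : E2} {k : Fin 3} {t : ℝ} (ht : t ∈ Ioo (0 : ℝ) 1) (hx : x ∈ stdTriangle)
    (h : σ i x = σ j (edgePt k t)) :
    ∃ l, ∃ t' ∈ Ioo (0 : ℝ) 1, x = edgePt l t' ∧ edgeSet σ (i, l) = edgeSet σ (j, k) := by
  have htm := edgePt_mem k (Ioo_subset_Icc_self ht)
  by_cases hij : i = j
  · subst hij
    exact ⟨k, t, ht, hσ.injective i hx htm h, rfl⟩
  have hmem : σ i x ∈ σ i '' stdTriangle ∩ σ j '' stdTriangle :=
    ⟨⟨x, hx, rfl⟩, ⟨_, htm, h.symm⟩⟩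
  rcases hσ.intersections i j hij with h0 | ⟨a, b, h0, h1⟩ | ⟨a, b, h0, h1⟩
  · rw [h0] at hmem; exact hmem.elim
  · rw [h0, h1, stdVertex_eq] at hmem
    obtain ⟨y, hy, hyz⟩ := hmem
    obtain rfl : y = vtx b := hy
    exact (edgePt_ne_vtx ht (hσ.injective j (vtx_mem b) htm (hyz.trans h)).symm).elim
  · rw [h0] at hmem
    have hmem' := hmem
    rw [h1] at hmem'
    obtain ⟨y, hy, hyx⟩ := hmem'
    obtain rfl := hσ.injective j hy.1 htm (hyx.trans h)
    obtain rfl := (bary_edgePt_eq_zero_iff ht).mp hy.2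
    rw [stdEdge_eq] at hmem
    obtain ⟨_, ⟨s, hs, rfl⟩, hsx⟩ := hmem
    obtain rfl := hσ.injective i (edgePt_mem a hs) hx hsx
    refine ⟨a, s, ?_, rfl, h1⟩
    by_contra hcon
    have : ∃ l, edgePt a s = vtx l := by
      rcases hs.1.eq_or_lt with rfl | h0
      · exact ⟨_, edgePt_zero a⟩
      rcases hs.2.eq_or_lt with rfl | h1
      · exact ⟨_, edgePt_one a⟩
      · exact (hcon ⟨h0, h1⟩).elim
    obtain ⟨l, hl⟩ := this
    rw [hl] at h
    obtain ⟨l', hl'⟩ := hσ.exists_eq_vtx htm h.symm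
    exact edgePt_ne_vtx ht hl'

theorem IsSmoothTriangulation.eq_of_edgeSet_eq (hσ : IsSmoothTriangulation D σ) {j : Fin n}
    {k l : Fin 3} (h : edgeSet σ (j, k) = edgeSet σ (j, l)) : k = l := by
  have ht : (1 / 2 : ℝ) ∈ Ioo (0 : ℝ) 1 := by constructor <;> norm_num
  have htm := edgePt_mem k (Ioo_subset_Icc_self ht)
  have : σ j (edgePt k (1 / 2)) ∈ edgeSet σ (j, l) := by
    rw [← h]; exact ⟨_, ⟨htm, (bary_edgePt k _).1⟩, rfl⟩
  obtain ⟨y, hy, hyx⟩ := this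
  obtain rfl := hσ.injective j hy.1 htm hyx
  exact ((bary_edgePt_eq_zero_iff ht).mp hy.2).symm

theorem IsCompactSubsurface.exists_defining [T2Space S] (hD : IsCompactSubsurface D) {p : S}
    (hp : p ∈ D) :
    p ∈ interior D ∨ p ∈ frontier D ∧ ∃ g, IsDefiningFunctionAt D p g := by
  by_cases h : p ∈ interior D
  · exact Or.inl h
  · have hf : p ∈ frontier D := by rw [hD.1.isClosed.frontier_eq]; exact ⟨hp, h⟩
    exact Or.inr ⟨hf, hD.2 p hf⟩

variable [IsManifold (𝓡 2) ∞ S]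

open Classical in
/-- The corners at a vertex `p` have total angle `2π` or `π`. -/
theorem IsSmoothTriangulation.sum_cornerAngle [T2Space S] (hσ : IsSmoothTriangulation D σ)
    {L : E2 →L[ℝ] ℂ} (hL : Function.Injective L) (r : Fin n × Fin 3) :
    (vtxPt σ r ∈ interior D → ∑ q ∈ Finset.univ.filter (fun q => vtxPt σ q = vtxPt σ r),
      cornerAngle (L.comp (tDW E2 E2 (σ q.1) stdTriangle (vtx q.2))) q.2 = 2 * Real.pi) ∧
    (∀ g, IsDefiningFunctionAt D (vtxPt σ r) g →
      ∑ q ∈ Finset.univ.filter (fun q => vtxPt σ q = vtxPt σ r),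
      cornerAngle (L.comp (tDW E2 E2 (σ q.1) stdTriangle (vtx q.2))) q.2 = Real.pi) := by
  have hjac : ∀ q : Fin n × Fin 3, jac (L.comp (tDW E2 E2 (σ q.1) stdTriangle (vtx q.2))) ≠ 0 :=
    fun q => jac_ne_zero_of_injective (hL.comp (hσ.injective_tDW q.1 (vtx_mem q.2)))
  refine hσ.sum_angle hL (Finset.univ.filter (fun q => vtxPt σ q = vtxPt σ r)) Prod.fst
    (fun q => vtx q.2) (fun q hq => ⟨vtx_mem q.2, (Finset.mem_filter.mp hq).2⟩) ?_ ?_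
    (fun q _ => abs_nonneg _) (fun q _ => ?_) (fun q _ => ?_)
  · rintro ⟨i, k⟩ hi ⟨j, l⟩ hj rfl
    have h1 : σ i (vtx k) = σ i (vtx l) :=
      (Finset.mem_filter.mp hi).2.trans (Finset.mem_filter.mp hj).2.symm
    rw [vtx_injective (hσ.injective i (vtx_mem k) (vtx_mem l) h1)]
  · intro j y hy hyp
    obtain ⟨l, rfl⟩ := hσ.exists_eq_vtx hy hyp
    exact ⟨(j, l), Finset.mem_filter.mpr ⟨Finset.mem_univ _, hyp⟩, rfl, rfl⟩
  · rw [(tCone_vtx q.2).1]; exact (angSize_corner (hjac q) q.2).1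
  · rw [(tCone_vtx q.2).2]; exact (angSize_corner (hjac q) q.2).2

open Classical in
/-- An edge belongs to two triangles if it contains an interior point of the surface in its
interior, and to one triangle if it contains a boundary point in its interior. -/
theorem IsSmoothTriangulation.card_edge [T2Space S] (hσ : IsSmoothTriangulation D σ)
    (r : Fin n × Fin 3) {t : ℝ} (ht : t ∈ Ioo (0 : ℝ) 1) :
    (edgeCurve σ r t ∈ interior D →
      (Finset.univ.filter (fun q => edgeSet σ q = edgeSet σ r)).card = 2) ∧
    (∀ g, IsDefiningFunctionAt D (edgeCurve σ r t) g →
      (Finset.univ.filter (fun q => edgeSet σ q = edgeSet σ r)).card = 1) := by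
  set s := Finset.univ.filter (fun q => edgeSet σ q = edgeSet σ r) with hs
  set p := edgeCurve σ r t with hp
  have htm := edgePt_mem r.2 (Ioo_subset_Icc_self ht)
  have hpt : ∀ q ∈ s, ∃ t' ∈ Ioo (0 : ℝ) 1, σ q.1 (edgePt q.2 t') = p := by
    intro q hq
    have hq' := (Finset.mem_filter.mp hq).2
    have : p ∈ edgeSet σ q := by
      rw [hq', edgeSet_eq]; exact ⟨t, Ioo_subset_Icc_self ht, rfl⟩
    obtain ⟨y, hy, hyp⟩ := this
    obtain ⟨l, t', ht', rfl, -⟩ := hσ.exists_eq_edgePt ht hy.1 hyp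
    obtain hl := (bary_edgePt_eq_zero_iff ht').mp hy.2
    exact ⟨t', ht', by rw [hl]; exact hyp⟩
  choose! T hT hTp using hpt
  obtain ⟨L⟩ : Nonempty (E2 ≃L[ℝ] ℂ) :=
    ⟨ContinuousLinearEquiv.ofFinrankEq (by simp)⟩
  have hL : Function.Injective (L : E2 →L[ℝ] ℂ) := L.injective
  have hjac : ∀ q ∈ s,
      jac ((L : E2 →L[ℝ] ℂ).comp (tDW E2 E2 (σ q.1) stdTriangle (edgePt q.2 (T q)))) ≠ 0 :=
    fun q hq => jac_ne_zero_of_injective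
      (hL.comp (hσ.injective_tDW q.1 (edgePt_mem q.2 (Ioo_subset_Icc_self (hT q hq)))))
  have key := hσ.sum_angle hL (p := p) s Prod.fst (fun q => edgePt q.2 (T q))
    (fun q hq => ⟨edgePt_mem q.2 (Ioo_subset_Icc_self (hT q hq)), hTp q hq⟩) ?_ ?_
    (θ := fun _ => Real.pi) (fun q _ => Real.pi_nonneg) (fun q hq => ?_) (fun q hq => ?_)
  · simp only [Finset.sum_const, nsmul_eq_mul] at key
    constructor
    · intro hpi
      have := mul_right_cancel₀ Real.pi_ne_zero (key.1 hpi)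
      exact_mod_cast this
    · intro g hg
      have := key.2 g hg
      rw [mul_eq_right₀ Real.pi_ne_zero] at this
      exact_mod_cast this
  · rintro ⟨i, k⟩ hi ⟨j, l⟩ hj rfl
    rw [hσ.eq_of_edgeSet_eq ((Finset.mem_filter.mp hi).2.trans (Finset.mem_filter.mp hj).2.symm)]
  · intro j y hy hyp
    obtain ⟨l, t', ht', rfl, h⟩ := hσ.exists_eq_edgePt ht hy hyp
    have hm : (j, l) ∈ s := Finset.mem_filter.mpr ⟨Finset.mem_univ _, h⟩
    refine ⟨(j, l), hm, rfl, hσ.injective j (edgePt_mem l (Ioo_subset_Icc_self (hT _ hm))) hy ?_⟩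
    rw [hTp _ hm, hyp]
  · rw [(tCone_edgePt q.2 (hT q hq)).1]; exact (angSize_side (hjac q hq) q.2).1
  · rw [(tCone_edgePt q.2 (hT q hq)).2]; exact (angSize_side (hjac q hq) q.2).2

omit [IsManifold (𝓡 2) ∞ S] in
/-- Boundary points do not lie in the interior of a triangle. -/
theorem IsSmoothTriangulation.not_pos_of_defining (hσ : IsSmoothTriangulation D σ)
    {j : Fin n} {x : E2} (hx : x ∈ stdTriangle) {g : S → ℝ}
    (hg : IsDefiningFunctionAt D (σ j x) g) : ¬ ∀ l, 0 < bary l x := by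
  intro hpos
  apply hg.2.2.1
  have hsurj : Function.Surjective (tDW E2 E2 (σ j) stdTriangle x) :=
    LinearMap.surjective_of_injective (f := (tDW E2 E2 (σ j) stdTriangle x : E2 →ₗ[ℝ] E2))
      (hσ.injective_tDW j hx)
  have hle : ∀ u, tD E2 ℝ g (σ j x) u ≤ 0 := by
    intro u
    obtain ⟨k, rfl⟩ := hsurj u
    exact hσ.tD_nonpos hg hx rfl fun l hl => absurd hl (hpos l).ne'
  have : ∀ u, tD E2 ℝ g (σ j x) u = 0 := fun u => by
    refine le_antisymm (hle u) ?_
    have := hle (-u)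
    rw [map_neg] at this
    linarith
  exact ContinuousLinearMap.ext this

end Incidence

end

end LegendrianRibbon

namespace LegendrianRibbon

noncomputable section

/-! ### The argument along the edges of a triangulation -/

section Cyclic

/-- The variation of the argument of a periodic function over a period, as a telescoping sum. -/
theorem sum_argVar_eq {c : ℝ → ℂ} (hc : Continuous c) (h0 : ∀ s, c s ≠ 0)
    (hper : Function.Periodic c 1) {N : ℕ} {T : ℕ → ℝ} (hT : ∀ k < N, T k ≤ T (k + 1))
    (hN : T N = T 0 + 1) :
    ∑ k ∈ Finset.range N, argVar c (T k) (T (k + 1)) = argVar c 0 1 := by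
  obtain ⟨θ, hθ⟩ := exists_isArgOn_univ hc h0
  have hv : ∀ a b : ℝ, a ≤ b → argVar c a b = θ b - θ a := fun a b hab =>
    IsArgOn.argVar_eq ⟨hθ.1.mono (subset_univ _), fun x _ => hθ.2 x (mem_univ x)⟩ hab
      fun s _ => h0 s
  rw [Finset.sum_congr rfl fun k hk => hv _ _ (hT k (Finset.mem_range.mp hk)),
    Finset.sum_range_sub (fun k => θ (T k)), hN, hv 0 1 zero_le_one]
  have hθ' : IsArgOn (fun s => θ (s + 1)) c univ := by
    refine ⟨hθ.1.comp (by fun_prop) (mapsTo_univ _ _), fun x _ => ?_⟩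
    have := hθ.2 (x + 1) (mem_univ _)
    rwa [hper] at this
  have := hθ'.sub_eq_of_parallel isPreconnected_univ hθ (fun s _ => h0 s) (fun s _ => h0 s)
    (fun _ _ => im_mul_conj_self _) (mem_univ (T 0)) (mem_univ 0)
  simp only [zero_add] at this
  linarith

/-- A finite subset of `ℝ / ℤ` with at least two elements, enumerated in cyclic order. -/
theorem exists_cyclic_enum {B : Finset ℝ} (hB : ∀ b ∈ B, b ∈ Ico (0 : ℝ) 1) (h2 : 2 ≤ B.card) :
    ∃ T : ℕ → ℝ, T B.card = T 0 + 1 ∧ StrictMonoOn T (Iic B.card) ∧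
      (∀ k < B.card, T k ∈ B) ∧ (∀ k < B.card, T (k + 1) < T k + 1) ∧
      (∀ k < B.card, ∀ s ∈ Ioo (T k) (T (k + 1)), Int.fract s ∉ B) ∧
      ∀ s : ℝ, ∃ k < B.card, ∃ z : ℤ, s + z ∈ Ico (T k) (T (k + 1)) := by
  set N := B.card with hN
  set e := B.orderEmbOfFin hN.symm with he
  have hNpos : 0 < N := by omega
  set T : ℕ → ℝ := fun k => if h : k < N then e ⟨k, h⟩ else e ⟨0, hNpos⟩ + 1 with hT
  have hTlt : ∀ k (h : k < N), T k = e ⟨k, h⟩ := fun k h => by simp [hT, h]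
  have hTN : T N = T 0 + 1 := by simp [hT, hNpos]
  have hmem : ∀ i, e i ∈ B := fun i => B.orderEmbOfFin_mem hN.symm i
  have hmono : StrictMonoOn T (Iic N) := by
    intro k hk l hl hkl
    have hl : l ≤ N := hl
    have hkN : k < N := lt_of_lt_of_le hkl hl
    rcases hl.lt_or_eq with h | rfl
    · rw [hTlt k hkN, hTlt l h]
      exact e.strictMono hkl
    · rw [hTN, hTlt k hkN, hTlt 0 hNpos]
      have h1 := (hB _ (hmem ⟨k, hkN⟩)).2
      have h2 := (hB _ (hmem ⟨0, hNpos⟩)).1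
      linarith
  refine ⟨T, hTN, hmono, fun k hk => hTlt k hk ▸ hmem _, fun k hk => ?_, ?_, ?_⟩
  · rcases Nat.lt_or_ge (k + 1) N with h | h
    · rw [hTlt _ h, hTlt k hk]
      have h1 := (hB _ (hmem ⟨k + 1, h⟩)).2
      have h2 := (hB _ (hmem ⟨k, hk⟩)).1
      linarith
    · have hk1 : k + 1 = N := by omega
      rw [hk1, hTN]
      have : T 0 < T k := hmono (mem_Iic.mpr hNpos.le) (mem_Iic.mpr hk.le) (by omega)
      linarith
  · intro k hk s hs hsB
    obtain ⟨⟨l, hl⟩, hls⟩ : Int.fract s ∈ range e := by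
      rw [he, Finset.range_orderEmbOfFin]; exact hsB
    have hTl : T l = Int.fract s := (hTlt l hl).trans hls
    have h0 : 0 ≤ T k := hTlt k hk ▸ (hB _ (hmem _)).1
    have h1 : T (k + 1) ≤ T 0 + 1 :=
      hTN ▸ hmono.monotoneOn (mem_Iic.mpr hk) (mem_Iic.mpr le_rfl) hk
    have h3 : T 0 < 1 := hTlt 0 hNpos ▸ (hB _ (hmem _)).2
    have hfl := Int.self_sub_floor s
    have hfl0 : 0 ≤ ⌊s⌋ := Int.floor_nonneg.mpr (h0.trans hs.1.le)
    have hfl1 : ⌊s⌋ < 2 := Int.floor_lt.mpr (by push_cast; linarith [hs.2])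
    have hcases : ⌊s⌋ = 0 ∨ ⌊s⌋ = 1 := by omega
    rcases hcases with h | h
    · rw [h, Int.cast_zero, sub_zero] at hfl
      rw [← hfl] at hTl
      have a1 : k < l := by
        by_contra hcon
        have := hmono.monotoneOn (mem_Iic.mpr hl.le) (mem_Iic.mpr hk.le) (not_lt.mp hcon)
        linarith [hs.1]
      have a2 : l < k + 1 := by
        by_contra hcon
        have := hmono.monotoneOn (mem_Iic.mpr hk) (mem_Iic.mpr hl.le) (not_lt.mp hcon)
        linarith [hs.2]
      omega
    · rw [h, Int.cast_one] at hfl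
      have := hmono.monotoneOn (mem_Iic.mpr hNpos.le) (mem_Iic.mpr hl.le) (Nat.zero_le l)
      linarith [hs.2]
  · intro s
    have hy : s + (-⌊s - T 0⌋ : ℤ) ∈ Ico (T 0) (T N) := by
      have h1 := Int.floor_le (s - T 0)
      have h2 := Int.lt_floor_add_one (s - T 0)
      rw [hTN]
      push_cast
      constructor <;> linarith
    have key : ∀ (y : ℝ) (M : ℕ), y ∈ Ico (T 0) (T M) → ∃ k < M, y ∈ Ico (T k) (T (k + 1)) := by
      intro y M
      induction M with
      | zero => intro h; exact absurd h.2 (not_lt.mpr h.1)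
      | succ M ih =>
        intro h
        by_cases hM : y < T M
        · obtain ⟨k, hk, hk'⟩ := ih ⟨h.1, hM⟩
          exact ⟨k, hk.trans (Nat.lt_succ_self M), hk'⟩
        · exact ⟨M, Nat.lt_succ_self M, not_lt.mp hM, h.2⟩
    obtain ⟨k, hk, hk'⟩ := key _ N hy
    exact ⟨k, hk, _, hk'⟩

/-- Two open half-planes that do not meet are opposite. -/
theorem exists_eq_neg_smul {P Q : ℂ} (hP : P ≠ 0) (hQ : Q ≠ 0)
    (h : ∀ ζ, 0 < cross P ζ → ¬ 0 < cross Q ζ) : ∃ c : ℝ, 0 < c ∧ Q = (-c) • P := by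
  have hd : cross P Q = 0 := by
    by_contra hne
    refine h (cross P Q • (Q - P)) ?_ ?_
    · rw [cross_smul_right]
      have : cross P (Q - P) = cross P Q := by simp [cross]; ring
      rw [this]; exact mul_self_pos.mpr hne
    · rw [cross_smul_right]
      have : cross Q (Q - P) = cross P Q := by simp [cross]; ring
      rw [this]; exact mul_self_pos.mpr hne
  have hN : 0 < Complex.normSq P := Complex.normSq_pos.mpr hP
  set c : ℝ := (P.re * Q.re + P.im * Q.im) / Complex.normSq P with hc
  have hQc : Q = c • P := by
    have hns := Complex.normSq_apply P
    apply Complex.ext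
    · simp only [Complex.smul_re, smul_eq_mul]
      rw [hc, div_mul_eq_mul_div, eq_div_iff hN.ne', hns]
      simp only [cross] at hd
      linear_combination (-P.im) * hd
    · simp only [Complex.smul_im, smul_eq_mul]
      rw [hc, div_mul_eq_mul_div, eq_div_iff hN.ne', hns]
      simp only [cross] at hd
      linear_combination P.re * hd
  have hPI : cross P (Complex.I * P) = Complex.normSq P := by
    rw [Complex.normSq_apply]; simp [cross]
  refine ⟨-c, ?_, by rw [neg_neg]; exact hQc⟩
  have hle : c ≤ 0 := by
    by_contra hcon
    refine h (Complex.I * P) (hPI ▸ hN) ?_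
    rw [hQc, cross_smul_left, hPI]
    exact mul_pos (not_le.mp hcon) hN
  have : c ≠ 0 := by
    intro h0
    rw [h0, zero_smul] at hQc
    exact hQ hQc
  have := lt_of_le_of_ne hle this
  linarith

end Cyclic

section Edges

variable {S : Type*} [TopologicalSpace S] [ChartedSpace E2 S]
  {D : Set S} {n : ℕ} {σ : Fin n → E2 → S}

/-- The velocities of the edge parametrizations. -/
def edgeVel (σ : Fin n → E2 → S) (q : Fin n × Fin 3) (t : ℝ) : E2 :=
  tDW E2 E2 (σ q.1) stdTriangle (edgePt q.2 t) (dir q.2)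

theorem hasDerivAt_edgePt (k : Fin 3) (t : ℝ) : HasDerivAt (edgePt k) (dir k) t := by
  have := ((hasDerivAt_id t).smul_const (dir k)).const_add (vtx (k + 1))
  rw [one_smul] at this
  exact this

variable [IsManifold (𝓡 2) ∞ S]

theorem IsSmoothTriangulation.hasDerivAt_edgeCurve (hσ : IsSmoothTriangulation D σ)
    (q : Fin n × Fin 3) {t : ℝ} (ht : t ∈ Ioo (0 : ℝ) 1) :
    HasDerivAt (extChartAt 𝓘(ℝ, E2) (edgeCurve σ q t) ∘ edgeCurve σ q) (edgeVel σ q t) t := by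
  have htm := edgePt_mem q.2 (Ioo_subset_Icc_self ht)
  have h1 := hσ.hasFDeriv q.1 htm
  have h2 : HasDerivWithinAt (edgePt q.2) (dir q.2) (Icc 0 1) t :=
    (hasDerivAt_edgePt q.2 t).hasDerivWithinAt
  have := h1.comp_hasDerivWithinAt t h2 fun s hs => edgePt_mem q.2 hs
  exact this.hasDerivAt (Icc_mem_nhds ht.1 ht.2)

variable {Φ : S → E2 →L[ℝ] ℂ}

theorem IsSmoothTriangulation.continuousOn_form (hσ : IsSmoothTriangulation D σ)
    (hΦ : IsContForm D Φ) (j : Fin n) :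
    ContinuousOn (fun x => (Φ (σ j x)).comp (tDW E2 E2 (σ j) stdTriangle x)) stdTriangle :=
  hΦ.continuousOn_comp_tDW uniqueDiffOn_stdTriangle (hσ.smooth j) fun _ hx => hσ.mem j hx

theorem IsSmoothTriangulation.continuousOn_edge (hσ : IsSmoothTriangulation D σ)
    (hΦ : IsContForm D Φ) (q : Fin n × Fin 3) :
    ContinuousOn (fun t => Φ (edgeCurve σ q t) (edgeVel σ q t)) (Icc 0 1) := by
  have h := (hσ.continuousOn_form hΦ q.1).comp (continuous_edgePt q.2).continuousOn
    fun t (ht : t ∈ Icc (0 : ℝ) 1) => edgePt_mem q.2 ht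
  exact h.clm_apply continuousOn_const

theorem dir_ne_zero (k : Fin 3) : dir k ≠ 0 := by
  intro h
  have := dbary_dir (k + 2) k
  rw [h] at this
  fin_cases k <;> simp [dbary] at this

omit [IsManifold (𝓡 2) ∞ S] in
theorem IsSmoothTriangulation.edge_ne_zero (hσ : IsSmoothTriangulation D σ)
    (hΦi : ∀ p ∈ D, Function.Injective (Φ p)) (q : Fin n × Fin 3) {t : ℝ}
    (ht : t ∈ Icc (0 : ℝ) 1) : Φ (edgeCurve σ q t) (edgeVel σ q t) ≠ 0 := by
  have htm := edgePt_mem q.2 ht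
  intro h
  have h1 := hΦi _ (hσ.mem q.1 htm) (h.trans (map_zero _).symm)
  exact dir_ne_zero q.2 (hσ.injective_tDW q.1 htm (h1.trans (map_zero _).symm))

/-- The sign of the Jacobian of a triangle with respect to a frame. -/
theorem IsSmoothTriangulation.exists_sign (hσ : IsSmoothTriangulation D σ)
    (hΦ : IsContForm D Φ) (hΦi : ∀ p ∈ D, Function.Injective (Φ p)) (j : Fin n) :
    ∃ ε : ℝ, (ε = 1 ∨ ε = -1) ∧ ∀ x ∈ stdTriangle,
      0 < ε * jac ((Φ (σ j x)).comp (tDW E2 E2 (σ j) stdTriangle x)) := by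
  set J := fun x => jac ((Φ (σ j x)).comp (tDW E2 E2 (σ j) stdTriangle x)) with hJ
  have hc : ContinuousOn J stdTriangle := by
    have h := hσ.continuousOn_form hΦ j
    have h1 := h.clm_apply (continuousOn_const (c := (!₂[1, 0] : E2)))
    have h2 := h.clm_apply (continuousOn_const (c := (!₂[0, 1] : E2)))
    exact ((Complex.continuous_re.comp_continuousOn h1).mul
      (Complex.continuous_im.comp_continuousOn h2)).sub
      ((Complex.continuous_im.comp_continuousOn h1).mul (Complex.continuous_re.comp_continuousOn h2))
  have hne : ∀ x ∈ stdTriangle, J x ≠ 0 := fun x hx =>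
    jac_ne_zero_of_injective ((hΦi _ (hσ.mem j hx)).comp (hσ.injective_tDW j hx))
  have hconn : IsPreconnected (J '' stdTriangle) := convex_stdTriangle.isPreconnected.image J hc
  have hnz : (0 : ℝ) ∉ J '' stdTriangle := fun ⟨x, hx, h⟩ => hne x hx h
  have h0 := vtx_mem 0
  rcases (hne _ h0).lt_or_gt with h | h
  · refine ⟨-1, Or.inr rfl, fun x hx => ?_⟩
    have : J x < 0 := by
      by_contra hcon
      exact hnz (hconn.ordConnected.out ⟨_, h0, rfl⟩ ⟨x, hx, rfl⟩ ⟨h.le, not_lt.mp hcon⟩)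
    show 0 < -1 * J x
    linarith
  · refine ⟨1, Or.inl rfl, fun x hx => ?_⟩
    have : 0 < J x := by
      by_contra hcon
      exact hnz (hconn.ordConnected.out ⟨x, hx, rfl⟩ ⟨_, h0, rfl⟩ ⟨not_lt.mp hcon, h.le⟩)
    show 0 < 1 * J x
    linarith

theorem dbary_pos_iff {L : E2 →L[ℝ] ℂ} {ε : ℝ} (hJ : 0 < ε * jac L) (k : Fin 3) (u : E2) :
    0 < dbary k u ↔ 0 < cross (ε • L (dir k)) (L u) := by
  rw [cross_smul_left, cross_dir, show ε * (dbary k u * jac L) = dbary k u * (ε * jac L) by ring]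
  exact (mul_pos_iff_of_pos_right hJ).symm

variable [T2Space S]

/-- The contributions of an interior edge from its two sides cancel. -/
theorem IsSmoothTriangulation.edge_cancel (hσ : IsSmoothTriangulation D σ)
    (hΦ : IsContForm D Φ) (hΦi : ∀ p ∈ D, Function.Injective (Φ p)) {ε : Fin n → ℝ}
    (hε : ∀ j, ε j = 1 ∨ ε j = -1)
    (hJ : ∀ j, ∀ x ∈ stdTriangle,
      0 < ε j * jac ((Φ (σ j x)).comp (tDW E2 E2 (σ j) stdTriangle x)))
    {q r : Fin n × Fin 3} (hqr : q ≠ r) (h : edgeSet σ q = edgeSet σ r) :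
    ε q.1 * argVar (fun t => Φ (edgeCurve σ q t) (edgeVel σ q t)) 0 1 +
      ε r.1 * argVar (fun t => Φ (edgeCurve σ r t) (edgeVel σ r t)) 0 1 = 0 := by
  have h1 : q.1 ≠ r.1 := by
    intro h1
    obtain ⟨i, k⟩ := q
    obtain ⟨j, l⟩ := r
    obtain rfl : i = j := h1
    exact hqr (by rw [hσ.eq_of_edgeSet_eq h])
  have hsq : ∀ j, ε j * ε j = 1 := fun j => by rcases hε j with h | h <;> rw [h] <;> norm_num
  have := argVar_eq_of_arcs (Φ := Φ) (δ := -(ε q.1 * ε r.1)) one_pos one_pos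
    (hσ.continuousOn_edgeCurve q) (hσ.continuousOn_edgeCurve r)
    (hσ.injOn_edgeCurve q) (hσ.injOn_edgeCurve r) (by rw [← edgeSet_eq, ← edgeSet_eq, h])
    (hσ.continuousOn_edge hΦ q) (hσ.continuousOn_edge hΦ r)
    (fun s hs => hσ.edge_ne_zero hΦi q hs) (fun s hs => hσ.edge_ne_zero hΦi r hs)
    (fun s hs => hσ.hasDerivAt_edgeCurve q hs) (fun s hs => hσ.hasDerivAt_edgeCurve r hs)
    (fun s hs => hΦi _ (hσ.mem q.1 (edgePt_mem q.2 (Ioo_subset_Icc_self hs))))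
    (by rcases hε q.1 with h | h <;> rcases hε r.1 with h' | h' <;> simp [h, h'])
    (fun s hs s' hs' hss => ?_)
  · rw [this]
    linear_combination (-ε r.1 * argVar (fun t => Φ (edgeCurve σ r t) (edgeVel σ r t)) 0 1) *
      hsq q.1
  · have hxm := edgePt_mem q.2 (Ioo_subset_Icc_self hs)
    have hym := edgePt_mem r.2 (Ioo_subset_Icc_self hs')
    have hdis := hσ.disjoint_tConeInt h1 hxm hym hss
    have hεne : ∀ j, ε j ≠ 0 := fun j h0 => by have := hsq j; rw [h0] at this; norm_num at this
    obtain ⟨c, hc, hce⟩ := exists_eq_neg_smul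
      (P := ε r.1 • Φ (edgeCurve σ r s') (edgeVel σ r s'))
      (Q := ε q.1 • Φ (edgeCurve σ q s) (edgeVel σ q s))
      (smul_ne_zero (hεne _) (hσ.edge_ne_zero hΦi r (Ioo_subset_Icc_self hs')))
      (smul_ne_zero (hεne _) (hσ.edge_ne_zero hΦi q (Ioo_subset_Icc_self hs))) (by
        intro ζ hr hq
        have hinj : Function.Injective (Φ (edgeCurve σ q s)) := hΦi _ (hσ.mem q.1 hxm)
        obtain ⟨w, rfl⟩ := surjective_of_jac_ne_zero (jac_ne_zero_of_injective hinj) ζ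
        have hA : ∀ (j : Fin n) (x : E2), x ∈ stdTriangle →
            Function.Surjective (tDW E2 E2 (σ j) stdTriangle x) := fun j x hx =>
          LinearMap.surjective_of_injective (f := (tDW E2 E2 (σ j) stdTriangle x : E2 →ₗ[ℝ] E2))
            (hσ.injective_tDW j hx)
        obtain ⟨u, hu⟩ := hA q.1 _ hxm w
        obtain ⟨u', hu'⟩ := hA r.1 _ hym w
        refine Set.disjoint_left.mp hdis (show w ∈ _ from ⟨u, ?_, hu⟩) ⟨u', ?_, hu'⟩
        · rw [(tCone_edgePt q.2 hs).2]
          refine (dbary_pos_iff (hJ q.1 _ hxm) q.2 u).mpr ?_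
          rw [← hu] at hq
          exact hq
        · rw [(tCone_edgePt r.2 hs').2]
          refine (dbary_pos_iff (hJ r.1 _ hym) r.2 u').mpr ?_
          rw [← hu', hss] at hr
          exact hr)
    refine ⟨c, hc, ?_⟩
    calc Φ (edgeCurve σ q s) (edgeVel σ q s)
        = ε q.1 • (ε q.1 • Φ (edgeCurve σ q s) (edgeVel σ q s)) := by
          rw [smul_smul, hsq, one_smul]
      _ = _ := by rw [hce, smul_smul, smul_smul]; congr 1; ring

/-- The contribution of a boundary edge, computed along the oriented boundary. -/
theorem IsSmoothTriangulation.edge_boundary (hσ : IsSmoothTriangulation D σ)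
    (hΦ : IsContForm D Φ) (hΦi : ∀ p ∈ D, Function.Injective (Φ p)) {ε : Fin n → ℝ}
    (hε : ∀ j, ε j = 1 ∨ ε j = -1)
    (hJ : ∀ j, ∀ x ∈ stdTriangle,
      0 < ε j * jac ((Φ (σ j x)).comp (tDW E2 E2 (σ j) stdTriangle x)))
    {c : ℝ → S} (hc : ContMDiff 𝓘(ℝ, ℝ) 𝓘(ℝ, E2) ∞ c) (hcD : ∀ s, c s ∈ D)
    (hc0 : ∀ s, tD ℝ E2 c s 1 ≠ 0)
    (hg : ∀ s, ∃ g, IsDefiningFunctionAt D (c s) g)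
    (hout : ∀ s g w, IsDefiningFunctionAt D (c s) g → 0 < tD E2 ℝ g (c s) w →
      0 < cross (Φ (c s) w) (Φ (c s) (tD ℝ E2 c s 1)))
    {a b : ℝ} (hab : a < b) (hinj : InjOn c (Icc a b)) {q : Fin n × Fin 3}
    (him : c '' Icc a b = edgeSet σ q) :
    argVar (fun s => Φ (c s) (tD ℝ E2 c s 1)) a b =
      ε q.1 * argVar (fun t => Φ (edgeCurve σ q t) (edgeVel σ q t)) 0 1 := by
  have hsq : ∀ j, ε j * ε j = 1 := fun j => by rcases hε j with h | h <;> rw [h] <;> norm_num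
  have hεne : ∀ j, ε j ≠ 0 := fun j h0 => by have := hsq j; rw [h0] at this; norm_num at this
  have hcont : ContinuousOn (fun s => Φ (c s) (tD ℝ E2 c s 1)) univ := by
    have h := hΦ.continuousOn_comp_tDW uniqueDiffOn_univ hc.contMDiffOn (fun s _ => hcD s)
    simp only [tDW_univ] at h
    exact h.clm_apply continuousOn_const
  have hne : ∀ s, Φ (c s) (tD ℝ E2 c s 1) ≠ 0 := fun s h =>
    hc0 s (hΦi _ (hcD s) (h.trans (map_zero _).symm))
  refine argVar_eq_of_arcs (Φ := Φ) (v₁ := fun s => tD ℝ E2 c s 1) hab one_pos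
    hc.continuous.continuousOn (hσ.continuousOn_edgeCurve q) hinj
    (hσ.injOn_edgeCurve q) (by rw [← edgeSet_eq, him])
    (hcont.mono (subset_univ _)) (hσ.continuousOn_edge hΦ q) (fun s _ => hne s)
    (fun s hs => hσ.edge_ne_zero hΦi q hs) (fun s _ => ?_)
    (fun s hs => hσ.hasDerivAt_edgeCurve q hs) (fun s _ => hΦi _ (hcD s)) (hε q.1)
    (fun s hs s' hs' hss => ?_)
  · have h := hasFDerivWithinAt_chart_comp (X := univ) (p := c s)
      (hc.contMDiffAt.mdifferentiableAt (by simp)).mdifferentiableWithinAt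
      (mem_extChartAt_source (I := 𝓘(ℝ, E2)) (c s))
    rw [tD_chart_self, ContinuousLinearMap.id_comp, tDW_univ, hasFDerivWithinAt_univ] at h
    exact h.hasDerivAt
  · obtain ⟨g, hg⟩ := hg s
    have hym := edgePt_mem q.2 (Ioo_subset_Icc_self hs')
    have hin : Function.Injective (Φ (c s)) := hΦi _ (hcD s)
    obtain ⟨r, hr, hre⟩ := exists_eq_neg_smul
      (P := ε q.1 • Φ (edgeCurve σ q s') (edgeVel σ q s'))
      (Q := - Φ (c s) (tD ℝ E2 c s 1))
      (smul_ne_zero (hεne _) (hσ.edge_ne_zero hΦi q (Ioo_subset_Icc_self hs')))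
      (neg_ne_zero.mpr (hne s)) (by
        intro ζ hq hc'
        obtain ⟨w, rfl⟩ := surjective_of_jac_ne_zero (jac_ne_zero_of_injective hin) ζ
        have hA : Function.Surjective (tDW E2 E2 (σ q.1) stdTriangle (edgePt q.2 s')) :=
          LinearMap.surjective_of_injective
            (f := (tDW E2 E2 (σ q.1) stdTriangle (edgePt q.2 s') : E2 →ₗ[ℝ] E2))
            (hσ.injective_tDW q.1 hym)
        obtain ⟨u, rfl⟩ := hA w
        -- `u` points into the triangle, so that it does not point out of the domain
        have hdb : 0 < dbary q.2 u := by
          refine (dbary_pos_iff (hJ q.1 _ hym) q.2 u).mpr ?_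
          rw [hss] at hq
          exact hq
        have hle : tD E2 ℝ g (c s) (tDW E2 E2 (σ q.1) stdTriangle (edgePt q.2 s') u) ≤ 0 := by
          refine hσ.tD_nonpos hg hym hss.symm ?_
          rw [(tCone_edgePt q.2 hs').1]
          exact hdb.le
        set w := tDW E2 E2 (σ q.1) stdTriangle (edgePt q.2 s') u with hw
        obtain ⟨w₀, hw₀⟩ : ∃ w₀, 0 < tD E2 ℝ g (c s) w₀ := by
          by_contra hcon
          push Not at hcon
          apply hg.2.2.1
          have : ∀ u, tD E2 ℝ g (c s) u = 0 := fun u => by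
            refine le_antisymm (hcon u) ?_
            have := hcon (-u)
            rw [map_neg] at this
            linarith
          exact ContinuousLinearMap.ext this
        set Q := Φ (c s) (tD ℝ E2 c s 1) with hQ
        have hpos : ∀ η : ℝ, 0 < η →
            0 ≤ cross (Φ (c s) (-w)) Q + η * cross (Φ (c s) w₀) Q := by
          intro η hη
          have := hout s g (-w + η • w₀) hg (by
            rw [map_add, map_neg, map_smul, smul_eq_mul]
            have := mul_pos hη hw₀
            linarith)
          rw [map_add, map_smul] at this
          have e : cross (Φ (c s) (-w) + η • Φ (c s) w₀) Q =
            cross (Φ (c s) (-w)) Q + η * cross (Φ (c s) w₀) Q := by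
            simp [cross]; ring
          rw [← e]; exact this.le
        have hneg : cross (Φ (c s) (-w)) Q < 0 := by
          have e : cross (Φ (c s) (-w)) Q = - cross (-Q) (Φ (c s) w) := by
            rw [map_neg]; simp [cross]; ring
          rw [e]; linarith
        have hlim : Tendsto (fun η : ℝ => cross (Φ (c s) (-w)) Q + η * cross (Φ (c s) w₀) Q)
            (𝓝[>] 0) (𝓝 (cross (Φ (c s) (-w)) Q)) := by
          have : ContinuousAt (fun η : ℝ =>
            cross (Φ (c s) (-w)) Q + η * cross (Φ (c s) w₀) Q) 0 := by fun_prop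
          have := this.tendsto
          rw [zero_mul, add_zero] at this
          exact this.mono_left nhdsWithin_le_nhds
        have := ge_of_tendsto hlim (by
          filter_upwards [self_mem_nhdsWithin] with η hη using hpos η hη)
        linarith)
    refine ⟨r, hr, ?_⟩
    rw [neg_smul, neg_inj] at hre
    show Φ (c s) (tD ℝ E2 c s 1) = _
    rw [hre, smul_smul, mul_comm]

end Edges

end

end LegendrianRibbon

namespace LegendrianRibbon

noncomputable section

/-! ### The Gauss–Bonnet formula for a frame -/

section Boundary

variable {S : Type*} [TopologicalSpace S] [ChartedSpace E2 S]
  {D : Set S} {n : ℕ} {σ : Fin n → E2 → S}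
  {o : ∀ p : S, Orientation ℝ (TangentSpace (𝓡 2) p) (Fin 2)} {m : ℕ} {γ : Fin m → ℝ → S}

theorem IsOrientedBoundary.mem_frontier (hγ : IsOrientedBoundary o D γ) (i : Fin m) (s : ℝ) :
    γ i s ∈ frontier D := by
  rw [← hγ.covers]; exact mem_iUnion.mpr ⟨i, s, rfl⟩

theorem IsOrientedBoundary.apply_fract (hγ : IsOrientedBoundary o D γ) (i : Fin m) (s : ℝ) :
    γ i (Int.fract s) = γ i s := by
  have := ((hγ.periodic i).int_mul ⌊s⌋).sub_eq s
  rwa [mul_one] at this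

theorem IsOrientedBoundary.apply_add_int (hγ : IsOrientedBoundary o D γ) (i : Fin m) (s : ℝ)
    (z : ℤ) : γ i (s + z) = γ i s := by
  have := (hγ.periodic i).int_mul z s
  rwa [mul_one] at this

theorem IsOrientedBoundary.eq_and_fract_eq (hγ : IsOrientedBoundary o D γ) {i j : Fin m} {s t : ℝ}
    (h : γ i s = γ j t) : i = j ∧ Int.fract s = Int.fract t := by
  rw [← hγ.apply_fract i, ← hγ.apply_fract j] at h
  exact hγ.embedded i j _ ⟨Int.fract_nonneg s, Int.fract_lt_one s⟩ _
    ⟨Int.fract_nonneg t, Int.fract_lt_one t⟩ h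

theorem eq_of_fract_eq {s t : ℝ} (h : Int.fract s = Int.fract t) (h1 : s < t + 1) (h2 : t < s + 1) :
    s = t := by
  obtain ⟨z, hz⟩ := Int.fract_eq_fract.mp h
  have a1 : (z : ℝ) < 1 := by linarith
  have a2 : (-1 : ℝ) < z := by linarith
  have b1 : z < 1 := by exact_mod_cast a1
  have b2 : -1 < z := by exact_mod_cast a2
  obtain rfl : z = 0 := by omega
  simp at hz
  linarith

theorem IsOrientedBoundary.injOn_Ico (hγ : IsOrientedBoundary o D γ) (i : Fin m) (a : ℝ) :
    InjOn (γ i) (Ico a (a + 1)) := fun s hs t ht h =>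
  eq_of_fract_eq (hγ.eq_and_fract_eq h).2 (by linarith [hs.2, ht.1]) (by linarith [hs.1, ht.2])

theorem IsOrientedBoundary.exists_defining (hγ : IsOrientedBoundary o D γ)
    (hD : IsCompactSubsurface D) (i : Fin m) (s : ℝ) : ∃ g, IsDefiningFunctionAt D (γ i s) g :=
  hD.2 _ (hγ.mem_frontier i s)

variable [T2Space S]

theorem IsOrientedBoundary.mem (hγ : IsOrientedBoundary o D γ)
    (hD : IsCompactSubsurface D) (i : Fin m) (s : ℝ) : γ i s ∈ D :=
  hD.1.isClosed.frontier_subset (hγ.mem_frontier i s)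

theorem IsSmoothTriangulation.eq_zero_or_one_of_vtx (hσ : IsSmoothTriangulation D σ)
    {q r : Fin n × Fin 3} {t : ℝ} (ht : t ∈ Icc (0 : ℝ) 1) (h : edgeCurve σ q t = vtxPt σ r) :
    t = 0 ∨ t = 1 := by
  obtain ⟨l, hl⟩ := hσ.exists_eq_vtx (edgePt_mem q.2 ht) h
  by_contra hcon
  push Not at hcon
  exact edgePt_ne_vtx ⟨lt_of_le_of_ne ht.1 hcon.1.symm, lt_of_le_of_ne ht.2 hcon.2⟩ hl

omit [T2Space S] in
/-- A point of the boundary that is not a vertex is an inner point of an edge. -/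
theorem IsSmoothTriangulation.exists_eq_edgeCurve (hσ : IsSmoothTriangulation D σ) {p : S}
    (hp : p ∈ D) {g : S → ℝ} (hg : IsDefiningFunctionAt D p g) (hv : p ∉ range (vtxPt σ)) :
    ∃ q, ∃ t ∈ Ioo (0 : ℝ) 1, edgeCurve σ q t = p := by
  rw [← hσ.covers] at hp
  obtain ⟨j, x, hx, rfl⟩ := mem_iUnion.mp hp
  rcases stdTriangle_cases hx with h | ⟨k, t, ht, rfl⟩ | ⟨k, rfl⟩
  · exact (hσ.not_pos_of_defining hx hg h).elim
  · exact ⟨(j, k), t, ht, rfl⟩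
  · exact (hv ⟨(j, k), rfl⟩).elim

/-- A boundary arc without vertices in its interior lies in one edge. -/
theorem IsSmoothTriangulation.arc_subset_edge (hσ : IsSmoothTriangulation D σ)
    (hD : IsCompactSubsurface D) (hγ : IsOrientedBoundary o D γ) (i : Fin m) {a b : ℝ}
    (hab : a < b) (hv : ∀ s ∈ Ioo a b, γ i s ∉ range (vtxPt σ)) :
    ∃ q, ∀ s ∈ Icc a b, γ i s ∈ edgeSet σ q := by
  have hcl : ∀ q, IsClosed (γ i ⁻¹' edgeSet σ q) := fun q => by
    refine IsClosed.preimage (hγ.smooth i).continuous ?_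
    rw [edgeSet_eq]
    exact (isCompact_Icc.image_of_continuousOn (hσ.continuousOn_edgeCurve q)).isClosed
  have hex : ∀ s ∈ Ioo a b, ∃ q, ∃ t ∈ Ioo (0 : ℝ) 1, edgeCurve σ q t = γ i s := fun s hs => by
    obtain ⟨g, hg⟩ := hγ.exists_defining hD i s
    exact hσ.exists_eq_edgeCurve (hγ.mem hD i s) hg (hv s hs)
  obtain ⟨s₀, hs₀⟩ := exists_between hab
  obtain ⟨q, t, ht, hqt⟩ := hex s₀ hs₀
  have hin : ∀ (q : Fin n × Fin 3) {t : ℝ}, t ∈ Ioo (0 : ℝ) 1 → edgeCurve σ q t ∈ edgeSet σ q :=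
    fun q t ht => by rw [edgeSet_eq]; exact ⟨t, Ioo_subset_Icc_self ht, rfl⟩
  set F : Set ℝ := ⋃ r ∈ {r | edgeSet σ r ≠ edgeSet σ q}, γ i ⁻¹' edgeSet σ r with hF
  have hFc : IsClosed F := (toFinite _).isClosed_biUnion fun r _ => hcl r
  have hsub : Ioo a b ⊆ γ i ⁻¹' edgeSet σ q := by
    intro s hs
    by_contra hcon
    obtain ⟨r, t', ht', hrt⟩ := hex s hs
    have hr : edgeSet σ r ≠ edgeSet σ q := fun h => hcon (by
      rw [mem_preimage, ← hrt, ← h]; exact hin r ht')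
    obtain ⟨s', hs', h1, h2⟩ := isPreconnected_closed_iff.mp (isPreconnected_Ioo (a := a) (b := b))
      (γ i ⁻¹' edgeSet σ q) F (hcl q) hFc (fun s hs => by
        obtain ⟨r, t', ht', hrt⟩ := hex s hs
        by_cases h : edgeSet σ r = edgeSet σ q
        · left; rw [mem_preimage, ← hrt, ← h]; exact hin r ht'
        · right; exact mem_iUnion₂.mpr ⟨r, h, by rw [mem_preimage, ← hrt]; exact hin r ht'⟩)
      ⟨s₀, hs₀, by rw [mem_preimage, ← hqt]; exact hin q ht⟩
      ⟨s, hs, mem_iUnion₂.mpr ⟨r, hr, by rw [mem_preimage, ← hrt]; exact hin r ht'⟩⟩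
    obtain ⟨r', hr', h3⟩ := mem_iUnion₂.mp h2
    obtain ⟨r'', t'', ht'', h4⟩ := hex s' hs'
    have huniq : ∀ q', γ i s' ∈ edgeSet σ q' → edgeSet σ q' = edgeSet σ r'' := by
      rintro q' ⟨y, hy, hys⟩
      obtain ⟨l, u, hu, rfl, he⟩ := hσ.exists_eq_edgePt ht'' hy.1 (hys.trans h4.symm)
      have := (bary_edgePt_eq_zero_iff hu).mp hy.2
      rw [← this] at he
      exact he
    exact hr' ((huniq r' h3).trans (huniq q h1).symm)
  refine ⟨q, fun s hs => ?_⟩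
  have := (hcl q).closure_subset_iff.mpr hsub
  rw [closure_Ioo hab.ne] at this
  exact this hs

/-- Every boundary component contains a vertex in each of its fundamental arcs. -/
theorem IsSmoothTriangulation.exists_vertex (hσ : IsSmoothTriangulation D σ)
    (hD : IsCompactSubsurface D) (hγ : IsOrientedBoundary o D γ) (i : Fin m) (a : ℝ) :
    ∃ s ∈ Ioo a (a + 1), γ i s ∈ range (vtxPt σ) := by
  by_contra hcon
  push Not at hcon
  have hab : a < a + 1 := by linarith
  obtain ⟨q, hq⟩ := hσ.arc_subset_edge hD hγ i hab hcon
  rw [edgeSet_eq] at hq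
  obtain ⟨ψ, hψ, hm, he⟩ := exists_arc_lift (hγ.smooth i).continuous.continuousOn
    (hσ.continuousOn_edgeCurve q) (hσ.injOn_edgeCurve q) hq
  refine false_of_injOn_loop hab hψ (fun s hs t ht h => hγ.injOn_Ico i a hs ht ?_) ?_
  · rw [← he s (Ico_subset_Icc_self hs), ← he t (Ico_subset_Icc_self ht), h]
  · refine hσ.injOn_edgeCurve q (hm (left_mem_Icc.mpr hab.le)) (hm (right_mem_Icc.mpr hab.le)) ?_
    rw [he _ (left_mem_Icc.mpr hab.le), he _ (right_mem_Icc.mpr hab.le), hγ.periodic i a]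

/-- Boundary arcs between consecutive vertices are edges. -/
theorem IsSmoothTriangulation.arc_eq_edge (hσ : IsSmoothTriangulation D σ)
    (hD : IsCompactSubsurface D) (hγ : IsOrientedBoundary o D γ) (i : Fin m) {a b : ℝ}
    (hab : a < b) (hb : b < a + 1) (ha : γ i a ∈ range (vtxPt σ)) (hb' : γ i b ∈ range (vtxPt σ))
    (hv : ∀ s ∈ Ioo a b, γ i s ∉ range (vtxPt σ)) :
    ∃ q, γ i '' Icc a b = edgeSet σ q := by
  obtain ⟨q, hq⟩ := hσ.arc_subset_edge hD hγ i hab hv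
  refine ⟨q, Subset.antisymm (by rintro _ ⟨s, hs, rfl⟩; exact hq s hs) ?_⟩
  rw [edgeSet_eq] at hq ⊢
  obtain ⟨ψ, hψ, hm, he⟩ := exists_arc_lift (hγ.smooth i).continuous.continuousOn
    (hσ.continuousOn_edgeCurve q) (hσ.injOn_edgeCurve q) hq
  have hA := left_mem_Icc.mpr hab.le
  have hB := right_mem_Icc.mpr hab.le
  have hend : ∀ s ∈ Icc a b, γ i s ∈ range (vtxPt σ) → ψ s = 0 ∨ ψ s = 1 := by
    rintro s hs ⟨r, hr⟩
    exact hσ.eq_zero_or_one_of_vtx (hm hs) ((he s hs).trans hr.symm)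
  have hne : ψ a ≠ ψ b := by
    intro h
    have : γ i a = γ i b := by rw [← he a hA, ← he b hB, h]
    exact hab.ne (hγ.injOn_Ico i a ⟨le_rfl, by linarith⟩ ⟨hab.le, hb⟩ this)
  have hord := (isPreconnected_Icc.image ψ hψ).ordConnected
  rintro _ ⟨t, ht, rfl⟩
  have h01 : (0 : ℝ) ∈ ψ '' Icc a b ∧ (1 : ℝ) ∈ ψ '' Icc a b := by
    rcases hend a hA ha with h | h <;> rcases hend b hB hb' with h' | h'
    · exact absurd (h.trans h'.symm) hne
    · exact ⟨⟨a, hA, h⟩, ⟨b, hB, h'⟩⟩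
    · exact ⟨⟨b, hB, h'⟩, ⟨a, hA, h⟩⟩
    · exact absurd (h.trans h'.symm) hne
  obtain ⟨s, hs, rfl⟩ := hord.out h01.1 h01.2 ht
  exact ⟨s, hs, (he s hs).symm⟩

/-- The vertices on a boundary component, in cyclic order. -/
theorem IsSmoothTriangulation.exists_enum (hσ : IsSmoothTriangulation D σ)
    (hD : IsCompactSubsurface D) (hγ : IsOrientedBoundary o D γ) (i : Fin m) :
    ∃ (N : ℕ) (T : ℕ → ℝ), T N = T 0 + 1 ∧ StrictMonoOn T (Iic N) ∧
      (∀ k < N, T k ∈ Ico (0 : ℝ) 1 ∧ γ i (T k) ∈ range (vtxPt σ)) ∧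
      (∀ k < N, T (k + 1) < T k + 1) ∧
      (∀ k < N, ∀ s ∈ Ioo (T k) (T (k + 1)), γ i s ∉ range (vtxPt σ)) ∧
      ∀ s : ℝ, ∃ k < N, ∃ z : ℤ, s + z ∈ Ico (T k) (T (k + 1)) := by
  have hfin : {s ∈ Ico (0 : ℝ) 1 | γ i s ∈ range (vtxPt σ)}.Finite := by
    refine Set.Finite.of_finite_image (f := γ i) ((finite_range (vtxPt σ)).subset ?_) ?_
    · rintro _ ⟨s, hs, rfl⟩; exact hs.2
    · intro s hs t ht h
      exact hγ.injOn_Ico i 0 (by simpa using hs.1) (by simpa using ht.1) h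
  set B := hfin.toFinset with hB
  have hBm : ∀ s, s ∈ B ↔ s ∈ Ico (0 : ℝ) 1 ∧ γ i s ∈ range (vtxPt σ) := fun s => by
    rw [hB, Set.Finite.mem_toFinset]; rfl
  have hfr : ∀ s, γ i s ∈ range (vtxPt σ) → Int.fract s ∈ B := fun s hs => by
    rw [hBm, hγ.apply_fract]
    exact ⟨⟨Int.fract_nonneg s, Int.fract_lt_one s⟩, hs⟩
  have h2 : 2 ≤ B.card := by
    obtain ⟨s, -, hs⟩ := hσ.exists_vertex hD hγ i 0
    obtain ⟨t, ht, htv⟩ := hσ.exists_vertex hD hγ i (Int.fract s)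
    refine Finset.one_lt_card.mpr ⟨_, hfr s hs, _, hfr t htv, fun h => ?_⟩
    have := eq_of_fract_eq (s := Int.fract s) (t := t) (by rw [Int.fract_fract, h])
      (by linarith [ht.1]) ht.2
    exact ht.1.ne this
  obtain ⟨T, h1, h2, h3, h4, h5, h6⟩ := exists_cyclic_enum (fun b hb => ((hBm b).mp hb).1) h2
  exact ⟨B.card, T, h1, h2, fun k hk => (hBm _).mp (h3 k hk), h4,
    fun k hk s hs hv => h5 k hk s hs (hfr s hv), h6⟩

variable [IsManifold (𝓡 2) ∞ S]

open Classical in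
/-- The boundary edges contribute the winding numbers of the boundary, and there are as many of them
as there are boundary vertices. -/
theorem IsSmoothTriangulation.sum_boundary (hσ : IsSmoothTriangulation D σ)
    (hD : IsCompactSubsurface D) (hγ : IsOrientedBoundary o D γ) {w : Fin m → ℝ → ℂ}
    (hw : ∀ i, Continuous (w i)) (hw0 : ∀ i s, w i s ≠ 0) (hwp : ∀ i, Function.Periodic (w i) 1)
    {τ : Fin n × Fin 3 → ℝ}
    (hτ : ∀ i a b, a < b → InjOn (γ i) (Icc a b) → ∀ q, γ i '' Icc a b = edgeSet σ q →
      argVar (w i) a b = τ q) :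
    ∑ q ∈ Finset.univ.filter (fun q => edgeCurve σ q (1 / 2) ∈ frontier D), τ q =
      ∑ i, argVar (w i) 0 1 ∧
    (Finset.univ.filter (fun q => edgeCurve σ q (1 / 2) ∈ frontier D)).card =
      ((Finset.univ.image (vtxPt σ)).filter (fun p => p ∈ frontier D)).card := by
  choose N T hTN hmono hTv hTlt hTno hTall using fun i => hσ.exists_enum hD hγ i
  have hhalf : (1 / 2 : ℝ) ∈ Ioo (0 : ℝ) 1 := by constructor <;> norm_num
  have hsucc : ∀ i, ∀ k < N i, T i k < T i (k + 1) := fun i k hk =>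
    hmono i (mem_Iic.mpr hk.le) (mem_Iic.mpr hk) (Nat.lt_succ_self k)
  have hTv' : ∀ i, ∀ k < N i, γ i (T i (k + 1)) ∈ range (vtxPt σ) := by
    intro i k hk
    rcases Nat.lt_or_ge (k + 1) (N i) with h | h
    · exact (hTv i _ h).2
    · have hk1 : k + 1 = N i := by omega
      rw [hk1, hTN, hγ.periodic i]
      exact (hTv i 0 (by omega)).2
  have harc : ∀ i, ∀ k < N i, ∃ q, γ i '' Icc (T i k) (T i (k + 1)) = edgeSet σ q :=
    fun i k hk => hσ.arc_eq_edge hD hγ i (hsucc i k hk) (hTlt i k hk) (hTv i k hk).2 (hTv' i k hk)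
      (hTno i k hk)
  rcases isEmpty_or_nonempty (Fin n × Fin 3) with hemp | hnon
  · have : IsEmpty (Fin m) := ⟨fun i => by
      obtain ⟨k, hk, -⟩ := hTall i 0
      obtain ⟨r, -⟩ := (hTv i k hk).2
      exact isEmptyElim r⟩
    constructor <;> simp [Finset.univ_eq_empty]
  choose! Q hQ using harc
  set I : Finset (Σ _ : Fin m, ℕ) := Finset.univ.sigma fun i => Finset.range (N i) with hI
  have hIm : ∀ u : (Σ _ : Fin m, ℕ), u ∈ I ↔ u.2 < N u.1 := fun u => by
    simp [hI]
  -- the middle point of the edge of an arc is an interior point of the arc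
  have hmid : ∀ i, ∀ k < N i, ∃ s ∈ Ioo (T i k) (T i (k + 1)),
      γ i s = edgeCurve σ (Q i k) (1 / 2) := by
    intro i k hk
    have : edgeCurve σ (Q i k) (1 / 2) ∈ γ i '' Icc (T i k) (T i (k + 1)) := by
      rw [hQ i k hk, edgeSet_eq]; exact ⟨_, Ioo_subset_Icc_self hhalf, rfl⟩
    obtain ⟨s, hs, hse⟩ := this
    have hnv : γ i s ∉ range (vtxPt σ) := by
      rintro ⟨r, hr⟩
      rcases hσ.eq_zero_or_one_of_vtx (Ioo_subset_Icc_self hhalf) (hse.symm.trans hr.symm) with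
        h | h <;> norm_num at h
    refine ⟨s, ⟨lt_of_le_of_ne hs.1 ?_, lt_of_le_of_ne hs.2 ?_⟩, hse⟩
    · rintro rfl; exact hnv (hTv i k hk).2
    · rintro rfl; exact hnv (hTv' i k hk)
  have hT0 : ∀ i, ∀ k ≤ N i, T i 0 ≤ T i k ∧ T i k ≤ T i 0 + 1 := fun i k hk =>
    ⟨(hmono i).monotoneOn (mem_Iic.mpr (Nat.zero_le _)) (mem_Iic.mpr hk) (Nat.zero_le k),
      hTN i ▸ (hmono i).monotoneOn (mem_Iic.mpr hk) (mem_Iic.mpr le_rfl) hk⟩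
  have hmaps : ∀ u ∈ I, Q u.1 u.2 ∈
      Finset.univ.filter (fun q => edgeCurve σ q (1 / 2) ∈ frontier D) := by
    intro u hu
    obtain ⟨s, -, hs⟩ := hmid u.1 u.2 ((hIm u).mp hu)
    refine Finset.mem_filter.mpr ⟨Finset.mem_univ _, ?_⟩
    rw [← hs]; exact hγ.mem_frontier _ _
  have hinj : InjOn (fun u : (Σ _ : Fin m, ℕ) => Q u.1 u.2) I := by
    rintro ⟨i, k⟩ hu ⟨j, l⟩ hv h
    have hk : k < N i := (hIm _).mp hu
    have hl : l < N j := (hIm _).mp hv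
    simp only at h
    obtain ⟨s, hs, hse⟩ := hmid i k hk
    obtain ⟨t, ht, hte⟩ := hmid j l hl
    obtain ⟨rfl, hst⟩ := hγ.eq_and_fract_eq (hse.trans ((by rw [h] : _ = _).trans hte.symm))
    have := eq_of_fract_eq hst
      (by linarith [hs.2, ht.1, (hT0 i (k + 1) hk).2, (hT0 i l hl.le).1])
      (by linarith [ht.2, hs.1, (hT0 i (l + 1) hl).2, (hT0 i k hk.le).1])
    subst this
    rcases lt_trichotomy k l with hkl | rfl | hkl
    · have := (hmono i).monotoneOn (mem_Iic.mpr hk) (mem_Iic.mpr hl.le) hkl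
      linarith [hs.2, ht.1]
    · rfl
    · have := (hmono i).monotoneOn (mem_Iic.mpr hl) (mem_Iic.mpr hk.le) hkl
      linarith [hs.1, ht.2]
  have hsurj : SurjOn (fun u : (Σ _ : Fin m, ℕ) => Q u.1 u.2) I
      (Finset.univ.filter (fun q => edgeCurve σ q (1 / 2) ∈ frontier D) :
        Finset (Fin n × Fin 3)) := by
    intro q hq
    have hqf : edgeCurve σ q (1 / 2) ∈ frontier D := (Finset.mem_filter.mp hq).2
    obtain ⟨g, hg⟩ := hD.2 _ hqf
    have hqf' := hqf
    rw [← hγ.covers] at hqf'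
    obtain ⟨i, s, hs⟩ := mem_iUnion.mp hqf'
    obtain ⟨k, hk, z, hz⟩ := hTall i s
    have hin : edgeCurve σ q (1 / 2) ∈ edgeSet σ (Q i k) := by
      rw [← hQ i k hk, ← hs, ← hγ.apply_add_int i s z]
      exact ⟨_, Ico_subset_Icc_self hz, rfl⟩
    obtain ⟨y, hy, hyq⟩ := hin
    obtain ⟨l, t', ht', rfl, he⟩ := hσ.exists_eq_edgePt hhalf hy.1 hyq
    have hl := (bary_edgePt_eq_zero_iff ht').mp hy.2
    rw [← hl] at he
    obtain ⟨c, hc⟩ := Finset.card_eq_one.mp ((hσ.card_edge q hhalf).2 g hg)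
    have m1 : Q i k ∈ Finset.univ.filter (fun r => edgeSet σ r = edgeSet σ q) :=
      Finset.mem_filter.mpr ⟨Finset.mem_univ _, he⟩
    have m2 : q ∈ Finset.univ.filter (fun r => edgeSet σ r = edgeSet σ q) :=
      Finset.mem_filter.mpr ⟨Finset.mem_univ _, rfl⟩
    rw [hc, Finset.mem_singleton] at m1 m2
    exact ⟨⟨i, k⟩, (hIm _).mpr hk, m1.trans m2.symm⟩
  have hval : ∀ u ∈ I, argVar (w u.1) (T u.1 u.2) (T u.1 (u.2 + 1)) = τ (Q u.1 u.2) := by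
    intro u hu
    have hk := (hIm u).mp hu
    refine hτ u.1 _ _ (hsucc _ _ hk) ((hγ.injOn_Ico u.1 (T u.1 u.2)).mono ?_) _ (hQ _ _ hk)
    exact fun s hs => ⟨hs.1, hs.2.trans_lt (hTlt _ _ hk)⟩
  constructor
  · rw [← Finset.sum_nbij _ hmaps hinj hsurj hval, hI, Finset.sum_sigma]
    exact Finset.sum_congr rfl fun i _ => sum_argVar_eq (hw i) (hw0 i) (hwp i)
      (fun k hk => (hsucc i k hk).le) (hTN i)
  · rw [← Finset.card_nbij _ hmaps hinj hsurj]
    refine Finset.card_nbij (fun u => γ u.1 (T u.1 u.2)) ?_ ?_ ?_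
    · intro u hu
      obtain ⟨r, hr⟩ := (hTv u.1 u.2 ((hIm u).mp hu)).2
      exact Finset.mem_filter.mpr ⟨Finset.mem_image.mpr ⟨r, Finset.mem_univ _, hr⟩,
        hγ.mem_frontier _ _⟩
    · rintro ⟨i, k⟩ hu ⟨j, l⟩ hv h
      have hk : k < N i := (hIm _).mp hu
      have hl : l < N j := (hIm _).mp hv
      obtain ⟨rfl, hst⟩ := hγ.embedded i j _ (hTv i k hk).1 _ (hTv j l hl).1 h
      rw [(hmono i).injOn (mem_Iic.mpr hk.le) (mem_Iic.mpr hl.le) hst]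
    · intro p hp
      obtain ⟨hp1, hp2⟩ := Finset.mem_filter.mp hp
      obtain ⟨r, -, hr⟩ := Finset.mem_image.mp hp1
      rw [← hγ.covers] at hp2
      obtain ⟨i, s, hs⟩ := mem_iUnion.mp hp2
      obtain ⟨k, hk, z, hz⟩ := hTall i s
      refine ⟨⟨i, k⟩, (hIm _).mpr hk, ?_⟩
      have hsz : s + z = T i k := by
        by_contra hcon
        refine hTno i k hk (s + z) ⟨lt_of_le_of_ne hz.1 (Ne.symm hcon), hz.2⟩ ⟨r, ?_⟩
        rw [hγ.apply_add_int, hs, hr]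
      show γ i (T i k) = p
      rw [← hsz, hγ.apply_add_int, hs]

/-- The winding number of the boundary of a triangulated surface with respect to a frame of its
tangent bundle is the Euler characteristic. -/
theorem IsSmoothTriangulation.sum_argVar_boundary (hσ : IsSmoothTriangulation D σ)
    (hD : IsCompactSubsurface D) (hγ : IsOrientedBoundary o D γ) {Φ : S → E2 →L[ℝ] ℂ}
    (hΦ : IsContForm D Φ) (hΦi : ∀ p ∈ D, Function.Injective (Φ p))
    (hout : ∀ i s g u, IsDefiningFunctionAt D (γ i s) g → 0 < tD E2 ℝ g (γ i s) u →
      0 < cross (Φ (γ i s) u) (Φ (γ i s) (tD ℝ E2 (γ i) s 1))) :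
    ∑ i, argVar (fun s => Φ (γ i s) (tD ℝ E2 (γ i) s 1)) 0 1 =
      2 * Real.pi * ((numVertices σ : ℝ) - numEdges σ + n) := by
  classical
  choose ε hε hJ using hσ.exists_sign hΦ hΦi
  set τ : Fin n × Fin 3 → ℝ := fun q =>
    ε q.1 * argVar (fun t => Φ (edgeCurve σ q t) (edgeVel σ q t)) 0 1 with hτ
  set θ : Fin n × Fin 3 → ℝ := fun q =>
    cornerAngle ((Φ (vtxPt σ q)).comp (tDW E2 E2 (σ q.1) stdTriangle (vtx q.2))) q.2 with hθ
  have hhalf : (1 / 2 : ℝ) ∈ Ioo (0 : ℝ) 1 := by constructor <;> norm_num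
  -- the boundary
  have hcont : ∀ i, Continuous (fun s => Φ (γ i s) (tD ℝ E2 (γ i) s 1)) := fun i => by
    have h := hΦ.continuousOn_comp_tDW uniqueDiffOn_univ (hγ.smooth i).contMDiffOn
      (fun s _ => hγ.mem hD i s)
    simp only [tDW_univ] at h
    exact continuousOn_univ.mp (h.clm_apply continuousOn_const)
  have hne : ∀ i s, Φ (γ i s) (tD ℝ E2 (γ i) s 1) ≠ 0 := fun i s h =>
    hγ.immersed i s (hΦi _ (hγ.mem hD i s) (h.trans (map_zero _).symm))
  have hper : ∀ i, Function.Periodic (fun s => Φ (γ i s) (tD ℝ E2 (γ i) s 1)) 1 := fun i s => by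
    have hd : tD ℝ E2 (γ i) (s + 1) 1 = tD ℝ E2 (γ i) s 1 := by
      have h1 : tD ℝ E2 (γ i ∘ fun s => s + 1) s = tD ℝ E2 (γ i) s :=
        tD_congr (Eventually.of_forall fun t => hγ.periodic i t)
      rw [← h1, tD_comp (E' := ℝ) ((hγ.smooth i).contMDiffAt.mdifferentiableAt (by simp))
        (DifferentiableAt.mdifferentiableAt (by fun_prop)), ContinuousLinearMap.comp_apply,
        tD_eq_fderiv]
      simp
    show Φ (γ i (s + 1)) (tD ℝ E2 (γ i) (s + 1) 1) = Φ (γ i s) (tD ℝ E2 (γ i) s 1)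
    rw [hd, hγ.periodic i s]
  obtain ⟨hb1, hb2⟩ := hσ.sum_boundary hD hγ hcont hne hper (τ := τ)
    fun i a b hab hinj q hq => hσ.edge_boundary hΦ hΦi hε hJ (hγ.smooth i) (hγ.mem hD i)
      (hγ.immersed i) (hγ.exists_defining hD i) (hout i) hab hinj hq
  rw [← hb1]
  -- the triangles
  have htri : ∑ q, τ q = ∑ q, θ q - n * Real.pi := by
    rw [Fintype.sum_prod_type, Fintype.sum_prod_type]
    have : ∀ j, ∑ k, τ (j, k) = ∑ k, θ (j, k) - Real.pi := fun j =>
      sum_argVar_eq_sum_cornerAngle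
        (Ψ := fun x => (Φ (σ j x)).comp (tDW E2 E2 (σ j) stdTriangle x))
        (hσ.continuousOn_form hΦ j) (hε j) (hJ j)
    rw [Finset.sum_congr rfl fun j _ => this j, Finset.sum_sub_distrib]
    simp
  -- the vertices
  set Vx := Finset.univ.image (vtxPt σ) with hVx
  set Eg := Finset.univ.image (edgeSet σ) with hEg
  have hVD : ∀ p ∈ Vx, p ∈ D := fun p hp => by
    obtain ⟨r, -, rfl⟩ := Finset.mem_image.mp hp
    exact hσ.mem r.1 (vtx_mem r.2)
  have hvert : ∑ q, θ q = 2 * Real.pi * Vx.card -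
      Real.pi * (Vx.filter (fun p => p ∈ frontier D)).card := by
    rw [← Finset.sum_fiberwise_of_maps_to (t := Vx) (g := vtxPt σ)
      (fun q _ => Finset.mem_image_of_mem _ (Finset.mem_univ q))]
    have hfib : ∀ p ∈ Vx, ∑ q ∈ Finset.univ.filter (fun q => vtxPt σ q = p), θ q =
        2 * Real.pi - if p ∈ frontier D then Real.pi else 0 := by
      intro p hp
      have hpD := hVD p hp
      obtain ⟨r, -, rfl⟩ := Finset.mem_image.mp hp
      have key := hσ.sum_cornerAngle (L := Φ (vtxPt σ r)) (hΦi _ hpD) r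
      have he : ∑ q ∈ Finset.univ.filter (fun q => vtxPt σ q = vtxPt σ r), θ q =
          ∑ q ∈ Finset.univ.filter (fun q => vtxPt σ q = vtxPt σ r),
            cornerAngle ((Φ (vtxPt σ r)).comp (tDW E2 E2 (σ q.1) stdTriangle (vtx q.2))) q.2 :=
        Finset.sum_congr rfl fun q hq => by rw [hθ, ← (Finset.mem_filter.mp hq).2]
      rw [he]
      rcases hD.exists_defining hpD with h | ⟨h, g, hg⟩
      · rw [key.1 h, if_neg fun hf => hf.2 h, sub_zero]
      · rw [key.2 g hg, if_pos h]; ring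
    rw [Finset.sum_congr rfl hfib, Finset.sum_sub_distrib, Finset.sum_const, nsmul_eq_mul,
      ← Finset.sum_filter, Finset.sum_const, nsmul_eq_mul]
    ring
  -- the edges
  have hED : ∀ r : Fin n × Fin 3, edgeCurve σ r (1 / 2) ∈ D := fun r =>
    hσ.mem r.1 (edgePt_mem r.2 (Ioo_subset_Icc_self hhalf))
  have hmapE : ∀ q ∈ (Finset.univ : Finset (Fin n × Fin 3)), edgeSet σ q ∈ Eg := fun q _ =>
    Finset.mem_image_of_mem _ (Finset.mem_univ q)
  have hfibE : ∀ A ∈ Eg,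
      (∑ q ∈ Finset.univ.filter (fun q => edgeSet σ q = A), τ q =
        ∑ q ∈ Finset.univ.filter (fun q => edgeSet σ q = A),
          if edgeCurve σ q (1 / 2) ∈ frontier D then τ q else 0) ∧
      (∑ q ∈ Finset.univ.filter (fun q => edgeSet σ q = A),
        ((1 : ℝ) + if edgeCurve σ q (1 / 2) ∈ frontier D then 1 else 0)) = 2 := by
    intro A hA
    obtain ⟨r, -, rfl⟩ := Finset.mem_image.mp hA
    have hmem : r ∈ Finset.univ.filter (fun q => edgeSet σ q = edgeSet σ r) :=
      Finset.mem_filter.mpr ⟨Finset.mem_univ _, rfl⟩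
    rcases hD.exists_defining (hED r) with h | ⟨h, g, hg⟩
    · have hc := (hσ.card_edge r hhalf).1 h
      have hnf : ∀ q ∈ Finset.univ.filter (fun q => edgeSet σ q = edgeSet σ r),
          edgeCurve σ q (1 / 2) ∉ frontier D := by
        intro q hq hf
        obtain ⟨g, hg⟩ := hD.2 _ hf
        have := (hσ.card_edge q hhalf).2 g hg
        rw [(Finset.mem_filter.mp hq).2, hc] at this
        norm_num at this
      constructor
      · rw [Finset.sum_congr rfl fun q hq => if_neg (hnf q hq), Finset.sum_const_zero]
        obtain ⟨x, y, hxy, hset⟩ := Finset.card_eq_two.mp hc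
        have hx : x ∈ Finset.univ.filter (fun q => edgeSet σ q = edgeSet σ r) := by
          rw [hset]; simp
        have hy : y ∈ Finset.univ.filter (fun q => edgeSet σ q = edgeSet σ r) := by
          rw [hset]; simp
        rw [hset, Finset.sum_pair hxy]
        exact hσ.edge_cancel hΦ hΦi hε hJ hxy
          ((Finset.mem_filter.mp hx).2.trans (Finset.mem_filter.mp hy).2.symm)
      · rw [Finset.sum_congr rfl fun q hq => by rw [if_neg (hnf q hq)], Finset.sum_const, hc]
        norm_num
    · have hc := (hσ.card_edge r hhalf).2 g hg
      obtain ⟨x, hset⟩ := Finset.card_eq_one.mp hc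
      rw [hset, Finset.mem_singleton] at hmem
      subst hmem
      rw [hset]
      simp only [Finset.sum_singleton, if_pos h]
      norm_num
  have hsumE : ∑ q, τ q =
      ∑ q ∈ Finset.univ.filter (fun q => edgeCurve σ q (1 / 2) ∈ frontier D), τ q := by
    rw [Finset.sum_filter, ← Finset.sum_fiberwise_of_maps_to hmapE,
      Finset.sum_congr rfl fun A hA => (hfibE A hA).1, Finset.sum_fiberwise_of_maps_to hmapE]
  have hcardE : (3 * n : ℝ) +
      (Finset.univ.filter (fun q => edgeCurve σ q (1 / 2) ∈ frontier D)).card = 2 * Eg.card := by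
    have h1 : ∑ q : Fin n × Fin 3,
        ((1 : ℝ) + if edgeCurve σ q (1 / 2) ∈ frontier D then 1 else 0) = 2 * Eg.card := by
      rw [← Finset.sum_fiberwise_of_maps_to hmapE, Finset.sum_congr rfl fun A hA => (hfibE A hA).2,
        Finset.sum_const, nsmul_eq_mul, mul_comm]
    rw [← h1, Finset.sum_add_distrib, ← Finset.sum_filter]
    simp
    ring
  have hnV : numVertices σ = Vx.card := by
    rw [numVertices, ← Set.ncard_coe_finset Vx,
      ← Set.ncard_image_of_injective (Vx : Set S) (singleton_injective (α := S))]
    congr 1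
    ext A
    simp only [stdVertex_eq, image_singleton, mem_ofPred_eq, hVx, Finset.coe_image,
      Finset.coe_univ, image_univ, mem_image, mem_range, Prod.exists]
    constructor
    · rintro ⟨j, k, rfl⟩; exact ⟨_, ⟨j, k, rfl⟩, rfl⟩
    · rintro ⟨_, ⟨j, k, rfl⟩, rfl⟩; exact ⟨j, k, rfl⟩
  have hnE : numEdges σ = Eg.card := by
    rw [numEdges, ← Set.ncard_coe_finset Eg]
    congr 1
    ext A
    simp only [mem_ofPred_eq, hEg, Finset.coe_image, Finset.coe_univ, image_univ, mem_range,
      Prod.exists]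
    constructor
    · rintro ⟨j, k, rfl⟩; exact ⟨j, k, rfl⟩
    · rintro ⟨j, k, rfl⟩; exact ⟨j, k, rfl⟩
  rw [← hsumE, htri, hvert, hnV, hnE, ← hb2]
  linear_combination (-Real.pi) * hcardE

end Boundary

end

end LegendrianRibbon

namespace LegendrianRibbon

noncomputable section

/-! ### Linear algebra of contact forms -/

section Algebra

/-- The value of `α ∧ ω` on three vectors of `ℝ³`, where `ω` is the antisymmetrization of the
bilinear form `B`. -/
def vol3 (α : E3 →L[ℝ] ℝ) (B : E3 →L[ℝ] E3 →L[ℝ] ℝ) (a b c : E3) : ℝ :=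
  α a * (B b c - B c b) + α b * (B c a - B a c) + α c * (B a b - B b a)

theorem vol3_expand (α : E3 →L[ℝ] ℝ) (B : E3 →L[ℝ] E3 →L[ℝ] ℝ) (a b c : E3) (x y z : Fin 3 → ℝ) :
    vol3 α B (x 0 • a + x 1 • b + x 2 • c) (y 0 • a + y 1 • b + y 2 • c)
      (z 0 • a + z 1 • b + z 2 • c) = Matrix.det !![x 0, x 1, x 2; y 0, y 1, y 2; z 0, z 1, z 2] *
        vol3 α B a b c := by
  simp only [vol3, map_add, map_smul, _root_.add_apply, _root_.smul_apply,
    smul_eq_mul, Matrix.det_fin_three, Matrix.of_apply, Matrix.cons_val', Matrix.cons_val_zero,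
    Matrix.cons_val_one, Matrix.cons_val, Matrix.cons_val_fin_one]
  ring

theorem exists_eq_of_linearIndependent {a b c : E3} (h : LinearIndependent ℝ ![a, b, c]) (v : E3) :
    ∃ x : Fin 3 → ℝ, v = x 0 • a + x 1 • b + x 2 • c := by
  set b' := basisOfLinearIndependentOfCardEqFinrank h (by simp) with hb'
  refine ⟨fun i => b'.repr v i, ?_⟩
  have := b'.sum_repr v
  rw [Fin.sum_univ_three] at this
  simpa [hb'] using this.symm

theorem vol3_ne_zero {α : E3 →L[ℝ] ℝ} {B : E3 →L[ℝ] E3 →L[ℝ] ℝ} (h : ∃ a b c, vol3 α B a b c ≠ 0)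
    {a b c : E3} (hli : LinearIndependent ℝ ![a, b, c]) : vol3 α B a b c ≠ 0 := by
  intro h0
  obtain ⟨x, y, z, hxyz⟩ := h
  obtain ⟨x, rfl⟩ := exists_eq_of_linearIndependent hli x
  obtain ⟨y, rfl⟩ := exists_eq_of_linearIndependent hli y
  obtain ⟨z, rfl⟩ := exists_eq_of_linearIndependent hli z
  rw [vol3_expand, h0, mul_zero] at hxyz
  exact hxyz rfl

theorem linearIndependent_of_vol3_ne_zero {α : E3 →L[ℝ] ℝ} {B : E3 →L[ℝ] E3 →L[ℝ] ℝ}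
    {a b c : E3} (h : vol3 α B a b c ≠ 0) : LinearIndependent ℝ ![a, b, c] := by
  rw [Fintype.linearIndependent_iff]
  intro g hg
  simp only [Fin.sum_univ_three, Matrix.cons_val_zero, Matrix.cons_val_one, Matrix.cons_val] at hg
  have h0 : ∀ u v, vol3 α B 0 u v = 0 := fun u v => by simp [vol3]
  have key : ∀ u v : E3, vol3 α B (g 0 • a + g 1 • b + g 2 • c) u v = 0 := fun u v => by
    rw [hg]; exact h0 u v
  have e0 := key b c
  have e1 := key c a
  have e2 := key a b
  simp only [vol3, map_add, map_smul, _root_.add_apply, _root_.smul_apply,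
    smul_eq_mul] at e0 e1 e2 h
  intro i
  fin_cases i
  · refine (mul_eq_zero.mp (?_ : g 0 * _ = 0)).resolve_right h
    linear_combination e0
  · refine (mul_eq_zero.mp (?_ : g 1 * _ = 0)).resolve_right h
    linear_combination e1
  · refine (mul_eq_zero.mp (?_ : g 2 * _ = 0)).resolve_right h
    linear_combination e2

/-- If `ω` is nonzero on the plane spanned by `x` and `y`, then the contraction of `ω` with a
nonzero vector of `ker α` does not vanish on this plane. -/
theorem not_and_eq_zero_of_mem_ker {α : E3 →L[ℝ] ℝ} {B : E3 →L[ℝ] E3 →L[ℝ] ℝ}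
    (h : ∃ a b c, vol3 α B a b c ≠ 0) {v x y : E3} (hv : α v = 0) (hv0 : v ≠ 0)
    (hxy : B x y - B y x ≠ 0) : ¬ (B v x - B x v = 0 ∧ B v y - B y v = 0) := by
  rintro ⟨h1, h2⟩
  refine vol3_ne_zero h (a := v) (b := x) (c := y) ?_ ?_
  · rw [Fintype.linearIndependent_iff]
    intro g hg
    simp only [Fin.sum_univ_three, Matrix.cons_val_zero, Matrix.cons_val_one,
      Matrix.cons_val] at hg
    have e1 : B (g 0 • v + g 1 • x + g 2 • y) y - B y (g 0 • v + g 1 • x + g 2 • y) = 0 := by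
      rw [hg]; simp
    have e2 : B (g 0 • v + g 1 • x + g 2 • y) x - B x (g 0 • v + g 1 • x + g 2 • y) = 0 := by
      rw [hg]; simp
    simp only [map_add, map_smul, _root_.add_apply, _root_.smul_apply,
      smul_eq_mul] at e1 e2
    have g1 : g 1 = 0 := by
      refine (mul_eq_zero.mp (?_ : g 1 * _ = 0)).resolve_right hxy
      linear_combination e1 - g 0 * h2
    have g2 : g 2 = 0 := by
      refine (mul_eq_zero.mp (?_ : g 2 * _ = 0)).resolve_right hxy
      linear_combination -e2 + g 0 * h1
    have g0 : g 0 = 0 := by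
      rw [g1, g2, zero_smul, zero_smul, add_zero, add_zero] at hg
      exact (smul_eq_zero.mp hg).resolve_right hv0
    intro i
    fin_cases i
    · exact g0
    · exact g1
    · exact g2
  · simp only [vol3, hv]
    linear_combination -α x * h2 + α y * h1

end Algebra

/-! ### The exterior derivative in charts -/

section ExtDer

variable {M : Type*} [TopologicalSpace M] [ChartedSpace E3 M]

/-- The contact volume in terms of the bilinear form given by the derivative of the chart
expression. -/
theorem contactVolume_eq_vol3 (α : ∀ x : M, TangentSpace (𝓡 3) x →L[ℝ] ℝ) (x : M) (a b c : E3) :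
    contactVolume α x a b c =
      vol3 (α x) (fderiv ℝ (localForm α x) (extChartAt (𝓡 3) x x)) a b c := rfl

variable [IsManifold (𝓡 3) ∞ M]

/-- The exterior derivative may be computed in any chart. -/
theorem extDer_eq {α : ∀ x : M, TangentSpace (𝓡 3) x →L[ℝ] ℝ} (hα : IsSmoothOneForm α) {x₀ x : M}
    (hx : x ∈ (extChartAt 𝓘(ℝ, E3) x₀).source) (a b : E3) :
    extDer α x a b =
      fderiv ℝ (localForm α x₀) (extChartAt 𝓘(ℝ, E3) x₀ x) (tD E3 E3 (extChartAt 𝓘(ℝ, E3) x₀) x a)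
        (tD E3 E3 (extChartAt 𝓘(ℝ, E3) x₀) x b) -
      fderiv ℝ (localForm α x₀) (extChartAt 𝓘(ℝ, E3) x₀ x) (tD E3 E3 (extChartAt 𝓘(ℝ, E3) x₀) x b)
        (tD E3 E3 (extChartAt 𝓘(ℝ, E3) x₀) x a) := by
  set χ := extChartAt 𝓘(ℝ, E3) x with hχ
  set χ₀ := extChartAt 𝓘(ℝ, E3) x₀ with hχ₀
  set τ : E3 → E3 := χ₀ ∘ χ.symm with hτ
  set y := χ x with hy
  have hyt : y ∈ χ.target := mem_extChartAt_target x
  have hsx : χ.symm y = x := extChartAt_to_inv x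
  have hτs : ContDiffAt ℝ ∞ τ y := contMDiffAt_iff_contDiffAt.mp
    (ContMDiffAt.comp y (by rw [hsx]; exact contMDiffAt_chart hx) (contMDiffAt_chart_symm hyt))
  have hτy : τ y = χ₀ x := by rw [hτ, Function.comp, hsx]
  have hDτ : fderiv ℝ τ y = tD E3 E3 χ₀ x := by
    rw [← tD_eq_fderiv, hτ, tD_comp (by rw [hsx]; exact mdiffAt_chart hx) (mdiffAt_chart_symm hyt),
      hsx]
    have := tD_chart_symm_comp (mem_extChartAt_source (I := 𝓘(ℝ, E3)) x)
    rw [tD_chart_self, ContinuousLinearMap.comp_id] at this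
    rw [hy, this, ContinuousLinearMap.comp_id]
  have hloc : localForm α x =ᶠ[𝓝 y] fun z => (localForm α x₀ (τ z)).comp (fderiv ℝ τ z) := by
    have h1 : ∀ᶠ z in 𝓝 y, z ∈ χ.target := (isOpen_extChartAt_target x).mem_nhds hyt
    have h2 : ∀ᶠ z in 𝓝 y, χ.symm z ∈ χ₀.source :=
      (continuousAt_extChartAt_symm (I := 𝓘(ℝ, E3)) x).eventually
        (by rw [hsx]; exact (isOpen_extChartAt_source x₀).mem_nhds hx)
    filter_upwards [h1, h2] with z hz1 hz2
    have e1 : fderiv ℝ τ z = (tD E3 E3 χ₀ (χ.symm z)).comp (tD E3 E3 χ.symm z) := by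
      rw [← tD_eq_fderiv, hτ, tD_comp (mdiffAt_chart hz2) (mdiffAt_chart_symm hz1)]
    have e2 : χ₀.symm (τ z) = χ.symm z := χ₀.left_inv hz2
    have e3 : localForm α x₀ (τ z) =
        (α (χ₀.symm (τ z)) : E3 →L[ℝ] ℝ).comp (tD E3 E3 χ₀.symm (τ z)) := rfl
    have e4 : localForm α x z = (α (χ.symm z) : E3 →L[ℝ] ℝ).comp (tD E3 E3 χ.symm z) := rfl
    have e5 := tD_chart_symm_comp hz2
    have e6 : (α (χ₀.symm (τ z)) : E3 →L[ℝ] ℝ) = (α (χ.symm z) : E3 →L[ℝ] ℝ) := by rw [e2]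
    rw [e4, e3, e1, e6]
    ext w
    have := congrArg (fun L : E3 →L[ℝ] E3 => L (tD E3 E3 χ.symm z w)) e5
    exact congrArg (α (χ.symm z) : E3 →L[ℝ] ℝ) this.symm
  have hLd : HasFDerivAt (localForm α x₀) (fderiv ℝ (localForm α x₀) (χ₀ x)) (τ y) := by
    rw [hτy]
    exact (((hα x₀).contDiffAt ((isOpen_extChartAt_target x₀).mem_nhds
      (χ₀.map_source hx))).differentiableAt (by simp)).hasFDerivAt
  have hτd : HasFDerivAt τ (fderiv ℝ τ y) y := (hτs.differentiableAt (by simp)).hasFDerivAt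
  have hτd2 : HasFDerivAt (fderiv ℝ τ) (fderiv ℝ (fderiv ℝ τ) y) y :=
    ((hτs.fderiv_right (m := 1) (by norm_cast)).differentiableAt (by simp)).hasFDerivAt
  have hcomp := (hLd.comp y hτd).clm_comp hτd2
  have hfd := hcomp.congr_of_eventuallyEq hloc
  have hsymm : ∀ u v, fderiv ℝ (fderiv ℝ τ) y u v = fderiv ℝ (fderiv ℝ τ) y v u := fun u v =>
    (hτs.isSymmSndFDerivAt (by simp; norm_cast)) u v
  have hval : ∀ u v, fderiv ℝ (localForm α x) y u v =
      fderiv ℝ (localForm α x₀) (χ₀ x) (tD E3 E3 χ₀ x u) (tD E3 E3 χ₀ x v) +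
        localForm α x₀ (τ y) (fderiv ℝ (fderiv ℝ τ) y u v) := by
    intro u v
    rw [hfd.fderiv, ← hDτ]
    simp [add_comm]
  show fderiv ℝ (localForm α x) y a b - fderiv ℝ (localForm α x) y b a = _
  rw [hval, hval, hsymm]
  ring

end ExtDer

/-! ### Positive pairs -/

section Positive

theorem apply_eq_smul_add_smul {F : Type*} [NormedAddCommGroup F] [NormedSpace ℝ F]
    (L : E2 →L[ℝ] F) (x : E2) : L x = x 0 • L !₂[1, 0] + x 1 • L !₂[0, 1] := by
  have : x = x 0 • (!₂[1, 0] : E2) + x 1 • (!₂[0, 1] : E2) := by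
    ext i; fin_cases i <;> simp
  conv_lhs => rw [this]
  rw [map_add, map_smul, map_smul]

theorem exists_isPositivePair (o : Orientation ℝ E2 (Fin 2)) : ∃ a b, IsPositivePair o a b :=
  let B := (EuclideanSpace.basisFun (Fin 2) ℝ).toBasis.adjustToOrientation o
  ⟨B 0, B 1, B, rfl, rfl, Module.Basis.orientation_adjustToOrientation _ _⟩

/-- Positive pairs have determinants of the same sign. -/
theorem IsPositivePair.det_mul_pos {o : Orientation ℝ E2 (Fin 2)} {a b a' b' : E2}
    (h : IsPositivePair o a b) (h' : IsPositivePair o a' b') :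
    0 < (a 0 * b 1 - a 1 * b 0) * (a' 0 * b' 1 - a' 1 * b' 0) := by
  obtain ⟨B, rfl, rfl, hB⟩ := h
  obtain ⟨B', rfl, rfl, hB'⟩ := h'
  set e := (EuclideanSpace.basisFun (Fin 2) ℝ).toBasis with he
  have hdet : ∀ C : Module.Basis (Fin 2) ℝ E2,
      e.det C = C 0 0 * C 1 1 - C 0 1 * C 1 0 := by
    intro C
    rw [Module.Basis.det_apply, Matrix.det_fin_two]
    simp [Module.Basis.toMatrix_apply, he, mul_comm]
  have hpos : 0 < B.det B' := (Module.Basis.orientation_eq_iff_det_pos B B').mp (hB.trans hB'.symm)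
  have hmul : e.det B' = e.det B * B.det B' := by
    have := AlternatingMap.eq_smul_basis_det B e.det
    exact congrArg (fun f : E2 [⋀^Fin 2]→ₗ[ℝ] ℝ => f B') this
  have hne : e.det B ≠ 0 := (e.isUnit_det B).ne_zero
  rw [hdet, hdet] at hmul
  rw [hdet] at hne
  rw [hmul, ← mul_assoc]
  exact mul_pos (mul_self_pos.mpr hne) hpos

variable {S : Type*} [TopologicalSpace S] [ChartedSpace E2 S] [IsManifold (𝓡 2) ∞ S]
  {o : ∀ p : S, Orientation ℝ (TangentSpace (𝓡 2) p) (Fin 2)}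

/-- A continuous field of 2-forms that is positive on positive pairs at `p` is so at the points
near `p`. -/
theorem IsSurfaceOrientation.eventually_pos (ho : IsSurfaceOrientation o) {p : S} {l : Filter S}
    (hl : l ≤ 𝓝 p) {B : S → E2 → E2 → ℝ}
    (hB : ∀ q x y, B q x y = (x 0 * y 1 - x 1 * y 0) * B q !₂[1, 0] !₂[0, 1])
    (hc : Tendsto (fun q => B q !₂[1, 0] !₂[0, 1]) l (𝓝 (B p !₂[1, 0] !₂[0, 1])))
    (hp : ∀ a b : E2, IsPositivePair (o p) a b → 0 < B p a b) :
    ∀ᶠ q in l, ∀ a b : E2, IsPositivePair (o q) a b →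
      0 < B q (tD E2 E2 (extChartAt 𝓘(ℝ, E2) p) q a) (tD E2 E2 (extChartAt 𝓘(ℝ, E2) p) q b) := by
  obtain ⟨o₀, ho₀⟩ := ho p
  obtain ⟨a₀, b₀, h₀⟩ := exists_isPositivePair (o p)
  have h₀' : IsPositivePair o₀ a₀ b₀ := by
    have : IsPositivePair o₀ (tD E2 E2 (extChartAt 𝓘(ℝ, E2) p) p a₀)
        (tD E2 E2 (extChartAt 𝓘(ℝ, E2) p) p b₀) := ho₀.self_of_nhds a₀ b₀ h₀
    rwa [tD_chart_self] at this
  set d := a₀ 0 * b₀ 1 - a₀ 1 * b₀ 0 with hd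
  have hpos : 0 < d * B p !₂[1, 0] !₂[0, 1] := by
    have := hp a₀ b₀ h₀
    rwa [hB] at this
  have hev : ∀ᶠ q in l, 0 < d * B q !₂[1, 0] !₂[0, 1] :=
    (hc.const_mul d).eventually_const_lt hpos
  filter_upwards [hev, hl ho₀] with q hq hoq a b hab
  have h1 : IsPositivePair o₀ (tD E2 E2 (extChartAt 𝓘(ℝ, E2) p) q a)
    (tD E2 E2 (extChartAt 𝓘(ℝ, E2) p) q b) := hoq a b hab
  have h2 := h₀'.det_mul_pos h1
  rw [hB]
  set d' := tD E2 E2 (extChartAt 𝓘(ℝ, E2) p) q a 0 * tD E2 E2 (extChartAt 𝓘(ℝ, E2) p) q b 1 -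
    tD E2 E2 (extChartAt 𝓘(ℝ, E2) p) q a 1 * tD E2 E2 (extChartAt 𝓘(ℝ, E2) p) q b 0 with hd'
  set r := B q !₂[1, 0] !₂[0, 1] with hr
  have h3 : 0 < (d * d') * (d * r) := mul_pos h2 hq
  have h4 : (d * d') * (d * r) = (d * d) * (d' * r) := by ring
  rw [h4] at h3
  exact pos_of_mul_pos_right h3 (mul_self_nonneg d)

/-- A nowhere vanishing continuous 1-form on a compact set of an oriented surface is the imaginary
part of a positive frame. -/
theorem exists_frame [T2Space S] (ho : IsSurfaceOrientation o) {D : Set S} (hD : IsCompact D)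
    {η : S → E2 →L[ℝ] ℝ} (hη : IsContForm D η) (hη0 : ∀ p ∈ D, η p ≠ 0) :
    ∃ μ : S → E2 →L[ℝ] ℝ, IsContForm D μ ∧ ∀ p ∈ D, ∀ a b : E2, IsPositivePair (o p) a b →
      0 < μ p a * η p b - μ p b * η p a := by
  -- near each point, the differential of a linear function in a chart works
  have hloc : ∀ p ∈ D, ∃ (h : S → ℝ) (φ : S → ℝ), ContMDiff 𝓘(ℝ, E2) 𝓘(ℝ, ℝ) ∞ h ∧ Continuous φ ∧
      (∀ q, 0 ≤ φ q) ∧ φ p = 1 ∧ ∀ q ∈ D, φ q ≠ 0 → ∀ a b : E2, IsPositivePair (o q) a b →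
        0 < tD E2 ℝ h q a * η q b - tD E2 ℝ h q b * η q a := by
    intro p hp
    obtain ⟨a₀, b₀, h₀⟩ := exists_isPositivePair (o p)
    set d := a₀ 0 * b₀ 1 - a₀ 1 * b₀ 0 with hd
    have hd0 : d ≠ 0 := fun h => by
      have := IsPositivePair.det_mul_pos (o := o p) h₀ h₀
      rw [← hd, h] at this
      norm_num at this
    -- the rotated form
    set m : E2 →L[ℝ] ℝ := d • (η p !₂[0, 1] • EuclideanSpace.proj (0 : Fin 2) -
      η p !₂[1, 0] • EuclideanSpace.proj (1 : Fin 2)) with hm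
    obtain ⟨Ψ, hΨc, hΨ⟩ := hη p hp
    have hΨp : Ψ p = η p := by
      have := hΨ.self_of_nhdsWithin hp
      rw [tD_chart_self, ContinuousLinearMap.comp_id] at this
      exact this.symm
    have hlin : ∀ (L : E2 →L[ℝ] ℝ) (x : E2), L x = x 0 * L !₂[1, 0] + x 1 * L !₂[0, 1] :=
      apply_eq_smul_add_smul
    have hm0 : m !₂[1, 0] = d * η p !₂[0, 1] := by simp [hm]
    have hm1 : m !₂[0, 1] = - (d * η p !₂[1, 0]) := by simp [hm]
    have hev := ho.eventually_pos (p := p) (l := 𝓝[D] p) nhdsWithin_le_nhds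
      (B := fun q x y => m x * Ψ q y - m y * Ψ q x) (fun q x y => by
        rw [hlin m x, hlin m y, hlin (Ψ q) x, hlin (Ψ q) y]; ring)
      (by
        have h1 : ∀ x : E2, Tendsto (fun q => Ψ q x) (𝓝[D] p) (𝓝 (Ψ p x)) := fun x =>
          (hΨc.clm_apply continuousWithinAt_const).tendsto
        exact ((h1 _).const_mul _).sub ((h1 _).const_mul _))
      (fun a b hab => by
        have h1 := IsPositivePair.det_mul_pos (o := o p) h₀ hab
        rw [← hd] at h1
        simp only [hΨp]
        rw [hlin m a, hlin m b, hlin (η p) a, hlin (η p) b, hm0, hm1]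
        have hne : ¬ ((η p !₂[1, 0]) = 0 ∧ (η p !₂[0, 1]) = 0) := by
          rintro ⟨e0, e1⟩
          refine hη0 p hp (ContinuousLinearMap.ext fun x => ?_)
          rw [hlin, e0, e1]; simp
        generalize (η p !₂[1, 0]) = x at hne ⊢
        generalize (η p !₂[0, 1]) = y at hne ⊢
        have h2 : 0 < x * x + y * y := by
          rcases eq_or_ne x 0 with h | h
          · exact add_pos_of_nonneg_of_pos (mul_self_nonneg x)
              (mul_self_pos.mpr fun h' => hne ⟨h, h'⟩)
          · exact add_pos_of_pos_of_nonneg (mul_self_pos.mpr h) (mul_self_nonneg y)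
        have h3 := mul_pos h1 h2
        linarith)
    have hsrc : (extChartAt 𝓘(ℝ, E2) p).source ∈ 𝓝 p :=
      (isOpen_extChartAt_source p).mem_nhds (mem_extChartAt_source p)
    obtain ⟨ρ, -⟩ := (SmoothBumpFunction.nhds_basis_tsupport (I := 𝓘(ℝ, E2)) p).mem_iff.mp hsrc
    set h : S → ℝ := fun q => ρ q • m (extChartAt 𝓘(ℝ, E2) p q) with hh
    have hhs : ContMDiff 𝓘(ℝ, E2) 𝓘(ℝ, ℝ) ∞ h := by
      refine ρ.contMDiff_smul (g := fun q => m (extChartAt 𝓘(ℝ, E2) p q)) ?_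
      rw [← extChartAt_source 𝓘(ℝ, E2)]
      exact m.contMDiff.comp_contMDiffOn fun q hq => (contMDiffAt_chart hq).contMDiffWithinAt
    have hN : ∀ᶠ q in 𝓝 p, (q ∈ (extChartAt 𝓘(ℝ, E2) p).source ∧
        h =ᶠ[𝓝 q] fun q => m (extChartAt 𝓘(ℝ, E2) p q)) := by
      refine (Filter.Eventually.and hsrc ?_)
      refine Filter.Eventually.eventually_nhds (ρ.eventuallyEq_one.mono fun q hq => ?_)
      simp [hh, hq]
    have hN2 : ∀ᶠ q in 𝓝 p, q ∈ D → (∀ a b : E2, IsPositivePair (o q) a b →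
        0 < tD E2 ℝ h q a * η q b - tD E2 ℝ h q b * η q a) := by
      filter_upwards [hN, eventually_nhdsWithin_iff.mp (hev.and hΨ)] with q hq hq2 hqD a b hab
      have hDh : tD E2 ℝ h q = m.comp (tD E2 E2 (extChartAt 𝓘(ℝ, E2) p) q) := by
        rw [tD_congr hq.2]
        have := tD_comp (E := E2) (E' := E2) (E'' := ℝ) (g := m) (f := extChartAt 𝓘(ℝ, E2) p)
          (x := q) m.differentiableAt.mdifferentiableAt (mdiffAt_chart hq.1)
        rw [tD_eq_fderiv, m.fderiv] at this
        exact this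
      have := (hq2 hqD).1 a b hab
      rw [hDh, (hq2 hqD).2]
      exact this
    obtain ⟨φ, hφ⟩ := (SmoothBumpFunction.nhds_basis_tsupport (I := 𝓘(ℝ, E2)) p).mem_iff.mp hN2
    exact ⟨h, φ, hhs, φ.continuous, fun q => φ.nonneg, φ.eq_one, fun q hqD hq =>
      hφ.2 (subset_tsupport _ hq) hqD⟩
  choose! h φ hh hφc hφ0 hφ1 hpos using hloc
  obtain ⟨t, htD, hcov⟩ := hD.elim_nhds_subcover (fun p => {q | 0 < φ p q}) fun p hp =>
    ((hφc p hp).tendsto p).eventually_const_lt (by rw [hφ1 p hp]; exact one_pos)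
  refine ⟨fun q => ∑ p ∈ t, φ p q • tD E2 ℝ (h p) q, IsContForm.sum t fun p hp =>
    (isContForm_tD (hh p (htD p hp))).smul (hφc p (htD p hp)).continuousOn, fun q hq a b hab => ?_⟩
  have e : (∑ p ∈ t, φ p q • tD E2 ℝ (h p) q) a * η q b -
      (∑ p ∈ t, φ p q • tD E2 ℝ (h p) q) b * η q a =
      ∑ p ∈ t, φ p q * (tD E2 ℝ (h p) q a * η q b - tD E2 ℝ (h p) q b * η q a) := by
    simp only [_root_.sum_apply, _root_.smul_apply, smul_eq_mul,
      Finset.sum_mul, ← Finset.sum_sub_distrib]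
    exact Finset.sum_congr rfl fun p _ => by ring
  rw [e]
  obtain ⟨p, hpt, hpq⟩ := mem_iUnion₂.mp (hcov hq)
  have hpq : 0 < φ p q := hpq
  refine Finset.sum_pos' (fun p hp => ?_) ⟨p, hpt, mul_pos hpq
    (hpos p (htD p hpt) q hq hpq.ne' a b hab)⟩
  rcases (hφ0 p (htD p hp) q).eq_or_lt with h0 | h0
  · rw [← h0, zero_mul]
  · exact (mul_pos h0 (hpos p (htD p hp) q hq h0.ne' a b hab)).le

end Positive

end

end LegendrianRibbon

namespace LegendrianRibbon

noncomputable section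

/-! ### Forms along an immersed surface -/

section Pullback

variable {M : Type*} [TopologicalSpace M] [ChartedSpace E3 M] [IsManifold (𝓡 3) ∞ M]
  {S : Type*} [TopologicalSpace S] [ChartedSpace E2 S] [IsManifold (𝓡 2) ∞ S]

/-- The 1-form `dα(w, ·)` at the point `x`. -/
def contractDer (α : ∀ x : M, TangentSpace (𝓡 3) x →L[ℝ] ℝ) (x : M) (w : E3) : E3 →L[ℝ] ℝ :=
  fderiv ℝ (localForm α x) (extChartAt (𝓡 3) x x) w -
    (fderiv ℝ (localForm α x) (extChartAt (𝓡 3) x x)).flip w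

omit [IsManifold (𝓡 3) ∞ M] in
theorem continuousAt_fderiv_localForm {α : ∀ x : M, TangentSpace (𝓡 3) x →L[ℝ] ℝ}
    (hα : IsSmoothOneForm α) (x : M) :
    ContinuousAt (fun x' => fderiv ℝ (localForm α x) (extChartAt 𝓘(ℝ, E3) x x')) x := by
  have h1 : ContDiffAt ℝ ∞ (localForm α x) (extChartAt 𝓘(ℝ, E3) x x) :=
    (hα x).contDiffAt ((isOpen_extChartAt_target x).mem_nhds (mem_extChartAt_target x))
  exact ((h1.fderiv_right (m := 0) (by simp)).continuousAt).comp
    (continuousAt_extChartAt (I := 𝓘(ℝ, E3)) x)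

/-- The chart expression of a 1-form. -/
theorem apply_eq_localForm (α : ∀ x : M, TangentSpace (𝓡 3) x →L[ℝ] ℝ) {x₀ x : M}
    (hx : x ∈ (extChartAt 𝓘(ℝ, E3) x₀).source) (a : E3) :
    (α x : E3 →L[ℝ] ℝ) a =
      localForm α x₀ (extChartAt 𝓘(ℝ, E3) x₀ x) (tD E3 E3 (extChartAt 𝓘(ℝ, E3) x₀) x a) := by
  have e1 : localForm α x₀ (extChartAt 𝓘(ℝ, E3) x₀ x) =
      (α ((extChartAt 𝓘(ℝ, E3) x₀).symm (extChartAt 𝓘(ℝ, E3) x₀ x)) : E3 →L[ℝ] ℝ).comp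
        (tD E3 E3 (extChartAt 𝓘(ℝ, E3) x₀).symm (extChartAt 𝓘(ℝ, E3) x₀ x)) := rfl
  have e2 := congrArg (fun L : E3 →L[ℝ] E3 => L a) (tD_chart_symm_comp hx)
  have e3 : (α ((extChartAt 𝓘(ℝ, E3) x₀).symm (extChartAt 𝓘(ℝ, E3) x₀ x)) : E3 →L[ℝ] ℝ) =
      (α x : E3 →L[ℝ] ℝ) := by rw [(extChartAt 𝓘(ℝ, E3) x₀).left_inv hx]
  rw [e1, e3]
  exact congrArg (α x : E3 →L[ℝ] ℝ) e2.symm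

/-- The contact volume may be computed in any chart. -/
theorem contactVolume_eq {α : ∀ x : M, TangentSpace (𝓡 3) x →L[ℝ] ℝ} (hα : IsSmoothOneForm α)
    {x₀ x : M} (hx : x ∈ (extChartAt 𝓘(ℝ, E3) x₀).source) (a b c : E3) :
    contactVolume α x a b c =
      vol3 (localForm α x₀ (extChartAt 𝓘(ℝ, E3) x₀ x))
        (fderiv ℝ (localForm α x₀) (extChartAt 𝓘(ℝ, E3) x₀ x))
        (tD E3 E3 (extChartAt 𝓘(ℝ, E3) x₀) x a) (tD E3 E3 (extChartAt 𝓘(ℝ, E3) x₀) x b)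
        (tD E3 E3 (extChartAt 𝓘(ℝ, E3) x₀) x c) := by
  have e : contactVolume α x a b c = (α x : E3 →L[ℝ] ℝ) a * extDer α x b c +
    (α x : E3 →L[ℝ] ℝ) b * extDer α x c a + (α x : E3 →L[ℝ] ℝ) c * extDer α x a b := rfl
  rw [e, apply_eq_localForm α hx, apply_eq_localForm α hx, apply_eq_localForm α hx,
    extDer_eq hα hx, extDer_eq hα hx, extDer_eq hα hx]
  rfl

/-- The derivative of a map into `M`, read in the charts centred at `p` and `f p`. -/
def chartDeriv (f : S → M) (p q : S) : E2 →L[ℝ] E3 :=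
  fderiv ℝ (extChartAt 𝓘(ℝ, E3) (f p) ∘ f ∘ (extChartAt 𝓘(ℝ, E2) p).symm)
    (extChartAt 𝓘(ℝ, E2) p q)

variable {f : S → M}

theorem continuousAt_chartDeriv (hf : ContMDiff (𝓡 2) (𝓡 3) ∞ f) (p : S) :
    ContinuousAt (chartDeriv f p) p := by
  have h1 : ContDiffAt ℝ ∞ (extChartAt 𝓘(ℝ, E3) (f p) ∘ f ∘ (extChartAt 𝓘(ℝ, E2) p).symm)
      (extChartAt 𝓘(ℝ, E2) p p) := by
    refine contMDiffAt_iff_contDiffAt.mp (ContMDiffAt.comp _ ?_ (hf.contMDiffAt.comp _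
      (contMDiffAt_chart_symm (mem_extChartAt_target p))))
    rw [Function.comp, extChartAt_to_inv]
    exact contMDiffAt_chart (mem_extChartAt_source _)
  exact ((h1.fderiv_right (m := 0) (by simp)).continuousAt).comp
    (continuousAt_extChartAt (I := 𝓘(ℝ, E2)) p)

omit [IsManifold (𝓡 3) ∞ M] [IsManifold (𝓡 2) ∞ S] in
theorem eventually_mem_source (hf : ContMDiff (𝓡 2) (𝓡 3) ∞ f) (p : S) :
    ∀ᶠ q in 𝓝 p, f q ∈ (extChartAt 𝓘(ℝ, E3) (f p)).source ∧
      q ∈ (extChartAt 𝓘(ℝ, E2) p).source :=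
  (hf.continuous.continuousAt.eventually ((isOpen_extChartAt_source (I := 𝓘(ℝ, E3))
    (f p)).mem_nhds (mem_extChartAt_source (f p)))).and
    ((isOpen_extChartAt_source (I := 𝓘(ℝ, E2)) p).mem_nhds (mem_extChartAt_source p))

theorem tD_chart_comp_eq (hf : ContMDiff (𝓡 2) (𝓡 3) ∞ f) {p q : S}
    (h1 : f q ∈ (extChartAt 𝓘(ℝ, E3) (f p)).source) (h2 : q ∈ (extChartAt 𝓘(ℝ, E2) p).source)
    (a : E2) : tD E3 E3 (extChartAt 𝓘(ℝ, E3) (f p)) (f q) (tD E2 E3 f q a) =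
      chartDeriv f p q (tD E2 E2 (extChartAt 𝓘(ℝ, E2) p) q a) := by
  have hfq : MDifferentiableAt 𝓘(ℝ, E2) 𝓘(ℝ, E3) f q := hf.mdifferentiableAt (by simp)
  have e1 := tD_comp (mdiffAt_chart h1) hfq
  have e2 := tD_eq_comp_chart (h := extChartAt 𝓘(ℝ, E3) (f p) ∘ f)
    ((mdiffAt_chart h1).comp q hfq) h2
  rw [e1, tD_eq_fderiv] at e2
  exact congrArg (fun L : E2 →L[ℝ] E3 => L a) e2

omit [ChartedSpace E2 S] [IsManifold (𝓡 2) ∞ S] in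
/-- A continuous section is continuous in charts. -/
theorem IsNonvanishingSection.continuousWithinAt_chart
    {α : ∀ x : M, TangentSpace (𝓡 3) x →L[ℝ] ℝ} {D : Set S}
    {v : ∀ p : S, TangentSpace (𝓡 3) (f p)} (hv : IsNonvanishingSection α f D v)
    (hf : Continuous f) {p : S} (hp : p ∈ D) :
    ContinuousWithinAt (fun q => tD E3 E3 (extChartAt 𝓘(ℝ, E3) (f p)) (f q) (v q)) D p := by
  have : IsManifold (𝓡 3) 1 M := IsManifold.of_le (n := ∞) (by simp)
  have h := ((FiberBundle.continuousWithinAt_totalSpace E3 _).mp (hv.continuousOn p hp)).2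
  have key : ∀ q, f q ∈ (chartAt E3 (f p)).source →
      tD E3 E3 (extChartAt 𝓘(ℝ, E3) (f p)) (f q) (v q) =
        (trivializationAt E3 (TangentSpace (𝓡 3)) (f p) ⟨f q, v q⟩).2 := by
    intro q hq
    have hq' : f q ∈ (trivializationAt E3 (TangentSpace (𝓡 3)) (f p)).baseSet := hq
    have e := TangentBundle.continuousLinearMapAt_trivializationAt (I := 𝓡 3) hq
    have e' := congrFun (Bundle.Trivialization.coe_linearMapAt_of_mem (R := ℝ)
      (trivializationAt E3 (TangentSpace (𝓡 3)) (f p)) hq') (v q)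
    exact (congrArg (fun L : E3 →L[ℝ] E3 => L (v q)) e.symm).trans e'
  refine h.congr_of_eventuallyEq ?_ (key p (mem_chart_source _ _))
  filter_upwards [nhdsWithin_le_nhds (hf.continuousAt.eventually
    ((chartAt E3 (f p)).open_source.mem_nhds (mem_chart_source E3 (f p))))] with q hq
  exact key q hq

omit [IsManifold (𝓡 3) ∞ M] [IsManifold (𝓡 2) ∞ S] in
/-- The chart expression of `dα` is continuous along a surface. -/
theorem continuousAt_fderiv_localForm_comp (hf : ContMDiff (𝓡 2) (𝓡 3) ∞ f)
    {α : ∀ x : M, TangentSpace (𝓡 3) x →L[ℝ] ℝ} (hα : IsSmoothOneForm α) (p : S) :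
    ContinuousAt (fun q => fderiv ℝ (localForm α (f p)) (extChartAt 𝓘(ℝ, E3) (f p) (f q))) p :=
  ContinuousAt.comp (f := f) (continuousAt_fderiv_localForm hα (f p)) hf.continuous.continuousAt

/-- If `dα` is a positive area form on the tangent plane at `p`, it is so at the points near `p`. -/
theorem eventually_extDer_pos (hf : ContMDiff (𝓡 2) (𝓡 3) ∞ f)
    {α : ∀ x : M, TangentSpace (𝓡 3) x →L[ℝ] ℝ} (hα : IsSmoothOneForm α)
    {o : ∀ p : S, Orientation ℝ (TangentSpace (𝓡 2) p) (Fin 2)} (ho : IsSurfaceOrientation o)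
    {p : S} (hp : ∀ a b : E2, IsPositivePair (o p) a b →
      0 < extDer α (f p) (tD E2 E3 f p a) (tD E2 E3 f p b)) :
    ∀ᶠ q in 𝓝 p, ∀ a b : E2, IsPositivePair (o q) a b →
      0 < extDer α (f q) (tD E2 E3 f q a) (tD E2 E3 f q b) := by
  set χ := extChartAt 𝓘(ℝ, E3) (f p) with hχ
  set B : S → E2 → E2 → ℝ := fun q x y =>
    fderiv ℝ (localForm α (f p)) (χ (f q)) (chartDeriv f p q x) (chartDeriv f p q y) -
    fderiv ℝ (localForm α (f p)) (χ (f q)) (chartDeriv f p q y) (chartDeriv f p q x) with hB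
  have hcB := continuousAt_fderiv_localForm_comp hf hα p
  have hcA := continuousAt_chartDeriv hf p
  have heq : ∀ q, f q ∈ χ.source → q ∈ (extChartAt 𝓘(ℝ, E2) p).source → ∀ a b : E2,
      extDer α (f q) (tD E2 E3 f q a) (tD E2 E3 f q b) =
        B q (tD E2 E2 (extChartAt 𝓘(ℝ, E2) p) q a) (tD E2 E2 (extChartAt 𝓘(ℝ, E2) p) q b) := by
    intro q h1 h2 a b
    rw [extDer_eq hα h1, tD_chart_comp_eq hf h1 h2, tD_chart_comp_eq hf h1 h2]
  have hev := ho.eventually_pos (p := p) (l := 𝓝 p) le_rfl (B := B) (fun q x y => by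
      simp only [hB]
      rw [apply_eq_smul_add_smul _ x, apply_eq_smul_add_smul _ y]
      simp only [map_add, map_smul, _root_.add_apply, _root_.smul_apply, smul_eq_mul]
      ring)
    (by
      have h1 : ∀ x : E2, ContinuousAt (fun q => chartDeriv f p q x) p := fun x =>
        hcA.clm_apply continuousAt_const
      exact ((hcB.clm_apply (h1 _)).clm_apply (h1 _)).sub
        ((hcB.clm_apply (h1 _)).clm_apply (h1 _)))
    (fun a b hab => by
      have := hp a b hab
      rwa [heq p (mem_extChartAt_source _) (mem_extChartAt_source _), tD_chart_self] at this)
  filter_upwards [hev, eventually_mem_source hf p] with q hq hsrc a b hab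
  rw [heq q hsrc.1 hsrc.2]
  exact hq a b hab

/-- The 1-form `dα(v, ·)` on the surface, for a section `v` of the contact structure. -/
theorem IsNonvanishingSection.isContForm
    {α : ∀ x : M, TangentSpace (𝓡 3) x →L[ℝ] ℝ} (hα : IsSmoothOneForm α) {D : Set S}
    {v : ∀ p : S, TangentSpace (𝓡 3) (f p)} (hv : IsNonvanishingSection α f D v)
    (hf : ContMDiff (𝓡 2) (𝓡 3) ∞ f) :
    IsContForm D (fun q => (contractDer α (f q) (v q)).comp (tD E2 E3 f q)) := by
  intro p hp
  set χ := extChartAt 𝓘(ℝ, E3) (f p) with hχ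
  have hcB := (continuousAt_fderiv_localForm_comp hf hα p).continuousWithinAt (s := D)
  have hcA := (continuousAt_chartDeriv hf p).continuousWithinAt (s := D)
  have hcv := hv.continuousWithinAt_chart hf.continuous hp
  refine ⟨fun q => (fderiv ℝ (localForm α (f p)) (χ (f q)) (tD E3 E3 χ (f q) (v q)) -
    (fderiv ℝ (localForm α (f p)) (χ (f q))).flip (tD E3 E3 χ (f q) (v q))).comp
      (chartDeriv f p q), ?_, ?_⟩
  · refine ContinuousWithinAt.clm_comp ((hcB.clm_apply hcv).sub ?_) hcA
    refine ContinuousWithinAt.clm_apply ?_ hcv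
    exact (ContinuousLinearMap.flipₗᵢ ℝ E3 E3 ℝ).continuous.continuousAt.comp_continuousWithinAt hcB
  · filter_upwards [nhdsWithin_le_nhds (eventually_mem_source hf p)] with q hq
    ext a
    show extDer α (f q) (v q) (tD E2 E3 f q a) = _
    refine (extDer_eq hα hq.1 _ _).trans ?_
    rw [tD_chart_comp_eq hf hq.1 hq.2]
    rfl

/-- If `dα` is a positive area form on a compact part of the surface, the 1-form `dα(v, ·)` is the
imaginary part of a positive frame there. -/
theorem IsNonvanishingSection.exists_frame [T2Space S]
    {α : ∀ x : M, TangentSpace (𝓡 3) x →L[ℝ] ℝ} (hα : IsContactForm α) {D : Set S}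
    {v : ∀ p : S, TangentSpace (𝓡 3) (f p)} (hv : IsNonvanishingSection α f D v)
    (hf : ContMDiff (𝓡 2) (𝓡 3) ∞ f)
    {o : ∀ p : S, Orientation ℝ (TangentSpace (𝓡 2) p) (Fin 2)} (ho : IsSurfaceOrientation o)
    (hD : IsCompact D) (hpos : ∀ p ∈ D, ∀ a b : E2, IsPositivePair (o p) a b →
      0 < extDer α (f p) (tD E2 E3 f p a) (tD E2 E3 f p b)) :
    ∃ μ : S → E2 →L[ℝ] ℝ, IsContForm D μ ∧ ∀ p ∈ D, ∀ a b : E2, IsPositivePair (o p) a b →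
      0 < μ p a * extDer α (f p) (v p) (tD E2 E3 f p b) -
        μ p b * extDer α (f p) (v p) (tD E2 E3 f p a) := by
  refine LegendrianRibbon.exists_frame ho hD (hv.isContForm hα.1 hf) fun p hp h => ?_
  obtain ⟨a, b, hab⟩ := exists_isPositivePair (o p)
  obtain ⟨x, y, z, hxyz⟩ := hα.2 (f p)
  have h0 : ∀ c : E2, extDer α (f p) (v p) (tD E2 E3 f p c) = 0 := fun c =>
    congrArg (fun L : E2 →L[ℝ] ℝ => L c) h
  exact not_and_eq_zero_of_mem_ker ⟨x, y, z, hxyz⟩ (hv.mem_ker p hp) (hv.ne_zero p hp)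
    (hpos p hp a b hab).ne' ⟨h0 a, h0 b⟩

end Pullback

end

end LegendrianRibbon

namespace LegendrianRibbon

noncomputable section

/-! ### Coordinates adapted to an embedded surface -/

section Slice

variable {M : Type*} [TopologicalSpace M] [ChartedSpace E3 M] [IsManifold (𝓡 3) ∞ M]
  {S : Type*} [TopologicalSpace S] [ChartedSpace E2 S] [IsManifold (𝓡 2) ∞ S] {f : S → M}

omit [IsManifold (𝓡 3) ∞ M] [IsManifold (𝓡 2) ∞ S] in
/-- Near each of its points, an embedded surface has a smooth retraction `r` and is contained in
the zero set of a smooth function `z` with nonzero differential. -/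
theorem exists_slice (hf : Manifold.IsSmoothEmbedding (𝓡 2) (𝓡 3) ∞ f) (p : S) :
    ∃ (N : Set M) (z : M → ℝ) (r : M → S), IsOpen N ∧ f p ∈ N ∧
      (∀ x ∈ N, ContMDiffAt 𝓘(ℝ, E3) 𝓘(ℝ, ℝ) ∞ z x) ∧
      (∀ x ∈ N, ContMDiffAt 𝓘(ℝ, E3) 𝓘(ℝ, E2) ∞ r x) ∧
      (∀ q, f q ∈ N → z (f q) = 0 ∧ r (f q) = q) ∧ tD E3 ℝ z (f p) ≠ 0 := by
  have h := hf.isImmersion.isImmersionAt p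
  set d := h.domChart with hd
  set c := h.codChart with hc
  set e := h.equiv with he
  -- the complement of the tangent plane is not trivial
  have hex : ∃ u : h.complement, u ≠ 0 := by
    by_contra! hcon
    have h1 : Function.Injective fun y : E3 => (e.symm y).1 := by
      intro y y' hyy
      refine e.symm.injective (Prod.ext hyy ?_)
      rw [hcon (e.symm y).2, hcon (e.symm y').2]
    have h2 := LinearMap.finrank_le_finrank_of_injective
      (f := (LinearMap.fst ℝ E2 h.complement).comp e.symm.toLinearMap) h1
    simp at h2
  obtain ⟨u, hu⟩ := hex
  obtain ⟨ℓ, -, hℓ⟩ := exists_dual_vector ℝ u (norm_ne_zero_iff.mpr hu)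
  have hℓu : ℓ u ≠ 0 := by rw [hℓ]; simpa using hu
  obtain ⟨O, hO, hOd⟩ := hf.isEmbedding.isOpen_iff.mp d.open_source
  have hcs : ∀ x ∈ c.source, ContMDiffAt 𝓘(ℝ, E3) 𝓘(ℝ, E3) ∞ c x := fun x hx =>
    contMDiffAt_of_mem_maximalAtlas h.codChart_mem_maximalAtlas hx
  have hds : ∀ y ∈ d.target, ContMDiffAt 𝓘(ℝ, E2) 𝓘(ℝ, E2) ∞ d.symm y := fun y hy =>
    contMDiffAt_symm_of_mem_maximalAtlas h.domChart_mem_maximalAtlas hy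
  have hfst : Continuous fun y : E3 => (e.symm y).1 := continuous_fst.comp e.symm.continuous
  set P : E3 →L[ℝ] E2 := (ContinuousLinearMap.fst ℝ E2 h.complement).comp
    (e.symm : E3 →L[ℝ] E2 × h.complement) with hP
  set Q : E3 →L[ℝ] ℝ := ℓ.comp ((ContinuousLinearMap.snd ℝ E2 h.complement).comp
    (e.symm : E3 →L[ℝ] E2 × h.complement)) with hQ
  have hcf : ∀ q ∈ d.source, c (f q) = e (d q, 0) := by
    intro q hq
    have hq' : d q ∈ (d.extend (𝓡 2)).target := by
      rw [OpenPartialHomeomorph.extend_target]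
      simpa using d.map_source hq
    have := h.writtenInCharts hq'
    have hinv : h.domChart.symm (d q) = q := d.left_inv hq
    simpa [OpenPartialHomeomorph.extend, hinv] using this
  have hpd : p ∈ d.source := h.mem_domChart_source
  have hpc : f p ∈ c.source := h.mem_codChart_source
  refine ⟨O ∩ (c.source ∩ c ⁻¹' (P ⁻¹' d.target)), Q ∘ c, d.symm ∘ P ∘ c, ?_, ?_, ?_, ?_, ?_, ?_⟩
  · exact hO.inter (c.isOpen_inter_preimage (d.open_target.preimage P.continuous))
  · refine ⟨?_, hpc, ?_⟩
    · have : p ∈ f ⁻¹' O := by rw [hOd]; exact hpd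
      exact this
    · show P (c (f p)) ∈ d.target
      rw [hcf p hpd]
      simpa [hP] using d.map_source hpd
  · rintro x ⟨-, hx, -⟩
    exact Q.contMDiff.contMDiffAt.comp x (hcs x hx)
  · rintro x ⟨-, hx, hx'⟩
    exact (hds _ hx').comp x (P.contMDiff.contMDiffAt.comp x (hcs x hx))
  · rintro q ⟨hq, -, -⟩
    have hqd : q ∈ d.source := by rw [← hOd]; exact hq
    constructor
    · show Q (c (f q)) = 0
      rw [hcf q hqd]; simp [hQ]
    · show d.symm (P (c (f q))) = q
      rw [hcf q hqd]; simp [hP, d.left_inv hqd]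
  · intro h0
    -- the derivative along the curve that is a straight line in the chart
    have hsymm : ContMDiffAt 𝓘(ℝ, E3) 𝓘(ℝ, E3) ∞ c.symm (c (f p)) :=
      contMDiffAt_symm_of_mem_maximalAtlas h.codChart_mem_maximalAtlas (c.map_source hpc)
    have hz : MDifferentiableAt 𝓘(ℝ, E3) 𝓘(ℝ, ℝ) (Q ∘ c) (c.symm (c (f p))) := by
      rw [c.left_inv hpc]
      exact (Q.contMDiff.contMDiffAt.comp _ (hcs _ hpc)).mdifferentiableAt (by simp)
    have h1 := tD_comp hz (hsymm.mdifferentiableAt (by simp))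
    have h2 : (Q ∘ c) ∘ c.symm =ᶠ[𝓝 (c (f p))] Q := by
      filter_upwards [c.open_target.mem_nhds (c.map_source hpc)] with y hy
      simp [c.right_inv hy]
    rw [tD_congr h2, tD_eq_fderiv, Q.fderiv, c.left_inv hpc, h0, ContinuousLinearMap.zero_comp] at h1
    have h3 := congrArg (fun L : E3 →L[ℝ] ℝ => L (e (0, u))) h1
    simp [hQ] at h3
    exact hℓu h3

omit [IsManifold (𝓡 3) ∞ M] [IsManifold (𝓡 2) ∞ S] in
/-- An embedding is an immersion. -/
theorem tD_injective (hf : Manifold.IsSmoothEmbedding (𝓡 2) (𝓡 3) ∞ f) (p : S) :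
    Function.Injective (tD E2 E3 f p) := by
  obtain ⟨N, z, r, hN, hp, -, hr, hq, -⟩ := exists_slice hf p
  have hfc : ContMDiff 𝓘(ℝ, E2) 𝓘(ℝ, E3) ∞ f := hf.isImmersion.contMDiff
  have h1 : r ∘ f =ᶠ[𝓝 p] id := by
    filter_upwards [hfc.continuous.continuousAt.eventually (hN.mem_nhds hp)] with q h
    exact (hq q h).2
  have h2 := tD_comp ((hr _ hp).mdifferentiableAt (by simp)) (hfc.mdifferentiableAt (by simp) (x := p))
  have h3 : tD E2 E2 (r ∘ f) p = ContinuousLinearMap.id ℝ E2 := by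
    rw [tD_congr h1]
    exact mfderiv_id
  intro a b hab
  have h4 := fun w => congrArg (fun L : E2 →L[ℝ] E2 => L w) (h3.symm.trans h2)
  have h5 : a = _ := h4 a
  have h6 : b = _ := h4 b
  rw [h5, h6]
  simp only [ContinuousLinearMap.comp_apply, hab]

omit [IsManifold (𝓡 3) ∞ M] [IsManifold (𝓡 2) ∞ S] in
/-- A surface point near which a function on `M` vanishes on the surface: its differential vanishes
on tangent vectors. -/
theorem tD_apply_eq_zero (hf : ContMDiff (𝓡 2) (𝓡 3) ∞ f) {z : M → ℝ} {p : S}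
    (hz : MDifferentiableAt 𝓘(ℝ, E3) 𝓘(ℝ, ℝ) z (f p)) (h0 : ∀ᶠ q in 𝓝 p, z (f q) = 0) (a : E2) :
    tD E3 ℝ z (f p) (tD E2 E3 f p a) = 0 := by
  have h1 : z ∘ f =ᶠ[𝓝 p] fun _ => (0 : ℝ) := h0
  have h2 := tD_comp hz (hf.mdifferentiableAt (by simp) (x := p))
  have h3 : tD E2 ℝ (z ∘ f) p = 0 := by
    rw [tD_congr h1]
    exact mfderiv_const
  rw [h3] at h2
  exact (congrArg (fun L : E2 →L[ℝ] ℝ => L a) h2).symm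

end Slice

end

end LegendrianRibbon

namespace LegendrianRibbon

noncomputable section

/-! ### Functions cutting out a surface with boundary -/

section Collar

variable {M : Type*} [TopologicalSpace M] [ChartedSpace E3 M] [IsManifold (𝓡 3) ∞ M]
  {S : Type*} [TopologicalSpace S] [ChartedSpace E2 S] [IsManifold (𝓡 2) ∞ S] {f : S → M}
  {α : ∀ x : M, TangentSpace (𝓡 3) x →L[ℝ] ℝ}
  {o : ∀ p : S, Orientation ℝ (TangentSpace (𝓡 2) p) (Fin 2)} {D : Set S}

/-- Two continuously differentiable functions on the open set `N`, such that `z` vanishes on the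
surface and increases in its positive normal direction, and `D` is given by `h ≤ 0` on the surface,
where `h` increases in the outward direction along the boundary of `D`. -/
structure IsCollar (α : ∀ x : M, TangentSpace (𝓡 3) x →L[ℝ] ℝ)
    (o : ∀ p : S, Orientation ℝ (TangentSpace (𝓡 2) p) (Fin 2)) (f : S → M) (D : Set S)
    (N : Set M) (z h : M → ℝ) : Prop where
  isOpen : IsOpen N
  smooth_z : ∀ x ∈ N, ContMDiffAt 𝓘(ℝ, E3) 𝓘(ℝ, ℝ) 1 z x
  smooth_h : ∀ x ∈ N, ContMDiffAt 𝓘(ℝ, E3) 𝓘(ℝ, ℝ) 1 h x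
  z_eq : ∀ q, f q ∈ N → z (f q) = 0
  mem_iff : ∀ q, f q ∈ N → (q ∈ D ↔ h (f q) ≤ 0)
  h_eq : ∀ q ∈ frontier D, f q ∈ N → h (f q) = 0
  pos_z : ∀ q, f q ∈ N → ∀ a b : E2, IsPositivePair (o q) a b → ∀ n : E3,
    0 < contactVolume α (f q) n (tD E2 E3 f q a) (tD E2 E3 f q b) → 0 < tD E3 ℝ z (f q) n
  pos_h : ∀ q ∈ frontier D, f q ∈ N → ∀ w : E2, IsOutward D q w →
    0 < tD E3 ℝ h (f q) (tD E2 E3 f q w)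

/-- Outward vectors are outward with respect to any function that cuts out the domain. -/
theorem tD_pos_of_isOutward {q : S} {g : S → ℝ} (hg : MDifferentiableAt 𝓘(ℝ, E2) 𝓘(ℝ, ℝ) g q)
    (hgq : g q = 0) (hd : tD E2 ℝ g q ≠ 0) (hev : ∀ᶠ q' in 𝓝 q, q' ∈ D ↔ g q' ≤ 0) {w : E2}
    (hw : IsOutward D q w) : 0 < tD E2 ℝ g q w := by
  obtain ⟨g', hg', hw'⟩ := hw
  have hw' : 0 < tD E2 ℝ g' q w := hw'
  by_contra hcon
  push Not at hcon
  obtain ⟨u, hu⟩ : ∃ u, tD E2 ℝ g q u < 0 := by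
    by_contra! h
    refine hd (ContinuousLinearMap.ext fun u => le_antisymm ?_ (h u))
    have := h (-u)
    rw [map_neg] at this
    simpa using this
  -- a direction on which `g` decreases and `g'` increases
  obtain ⟨ε, hε, hε'⟩ : ∃ ε : ℝ, 0 < ε ∧ 0 < tD E2 ℝ g' q w + ε * tD E2 ℝ g' q u := by
    have h1 : ContinuousAt (fun ε : ℝ => tD E2 ℝ g' q w + ε * tD E2 ℝ g' q u) 0 := by fun_prop
    have h2 := h1.eventually_const_lt (u := 0) (by simpa using hw')
    obtain ⟨ε, h3, h4⟩ := ((h2.filter_mono (nhdsWithin_le_nhds (s := Ioi 0))).and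
      self_mem_nhdsWithin).exists
    exact ⟨ε, h4, h3⟩
  have e1 : tD E2 ℝ g q (w + ε • u) < 0 := by
    rw [map_add, map_smul, smul_eq_mul]
    linarith [mul_neg_of_pos_of_neg hε hu]
  have e2 : tD E2 ℝ (-g') q (w + ε • u) < 0 := by
    have : tD E2 ℝ (-g') q = - tD E2 ℝ g' q :=
      ((hg'.1.mdifferentiableAt (by simp)).hasMFDerivAt.neg).mfderiv
    rw [this, map_add, map_smul]
    simp only [_root_.neg_apply, smul_eq_mul]
    linarith
  obtain ⟨t, h1, h2, h3, h4⟩ := ((eventually_neg_of_tD_neg hg hgq e1).and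
    ((eventually_neg_of_tD_neg (hg'.1.mdifferentiableAt (by simp)).neg
      (by simp [hg'.2.1]) e2).and
      ((((tendsto_chart_symm q _).eventually hev).filter_mono nhdsWithin_le_nhds).and
      (((tendsto_chart_symm q _).eventually hg'.2.2.2).filter_mono nhdsWithin_le_nhds)))).exists
  have h5 := h4.mp (h3.mpr h1.le)
  simp only [Pi.neg_apply] at h2
  linarith

/-- A linear form that vanishes on the tangent plane of the surface and is positive on one positive
normal vector is positive on all of them. -/
theorem pos_of_vol3_pos {β : E3 →L[ℝ] ℝ} {B : E3 →L[ℝ] E3 →L[ℝ] ℝ} {L : E3 →L[ℝ] ℝ}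
    {n₁ n x y : E3} (hx : L x = 0) (hy : L y = 0) (h1 : 0 < vol3 β B n₁ x y) (hL : 0 < L n₁)
    (hn : 0 < vol3 β B n x y) : 0 < L n := by
  obtain ⟨c, rfl⟩ := exists_eq_of_linearIndependent (linearIndependent_of_vol3_ne_zero h1.ne') n
  have e := vol3_expand β B n₁ x y c ![0, 1, 0] ![0, 0, 1]
  simp [Matrix.det_fin_three] at e
  rw [e] at hn
  have hc : 0 < c 0 := pos_of_mul_pos_left hn h1.le
  rw [map_add, map_add, map_smul, map_smul, map_smul, hx, hy]
  simpa using mul_pos hc hL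

omit [IsManifold (𝓡 3) ∞ M] [IsManifold (𝓡 2) ∞ S] in
/-- Tangent vectors of the surface that form a basis, and a transverse vector, form a basis. -/
theorem contactVolume_ne_zero (hf : Manifold.IsSmoothEmbedding (𝓡 2) (𝓡 3) ∞ f)
    (hα : IsContactForm α) {q : S} {a b : E2} (hab : IsPositivePair (o q) a b) {n : E3}
    (hn : ∀ w, tD E2 E3 f q w ≠ n) :
    contactVolume α (f q) n (tD E2 E3 f q a) (tD E2 E3 f q b) ≠ 0 := by
  have hli : LinearIndependent ℝ ![n, tD E2 E3 f q a, tD E2 E3 f q b] := by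
    rw [Fintype.linearIndependent_iff]
    intro g hg
    simp only [Fin.sum_univ_three, Matrix.cons_val_zero, Matrix.cons_val_one,
      Matrix.cons_val] at hg
    have g0 : g 0 = 0 := by
      by_contra hne
      refine hn (-(g 0)⁻¹ • (g 1 • a + g 2 • b)) ?_
      rw [map_smul, map_add, map_smul, map_smul]
      rw [add_assoc] at hg
      rw [neg_smul, ← smul_neg, ← eq_neg_of_add_eq_zero_left hg, smul_smul, inv_mul_cancel₀ hne,
        one_smul]
    rw [g0, zero_smul, zero_add, ← map_smul, ← map_smul, ← map_add] at hg
    have h2 := tD_injective hf q (hg.trans (map_zero _).symm)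
    obtain ⟨C, rfl, rfl, -⟩ := hab
    have h3 := Fintype.linearIndependent_iff.mp C.linearIndependent ![g 1, g 2] (by
      rw [Fin.sum_univ_two]; exact h2)
    intro i
    fin_cases i
    · exact g0
    · exact h3 0
    · exact h3 1
  obtain ⟨x, y, w, hxyw⟩ := hα.2 (f q)
  exact vol3_ne_zero ⟨x, y, w, hxyw⟩ hli

omit [IsManifold (𝓡 3) ∞ M] [IsManifold (𝓡 2) ∞ S] in
theorem contactVolume_neg (q : M) (n x y : E3) :
    contactVolume α q (-n) x y = - contactVolume α q n x y := by
  have e := vol3_expand (α q) (fderiv ℝ (localForm α q) (extChartAt (𝓡 3) q q)) n x y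
    ![-1, 0, 0] ![0, 1, 0] ![0, 0, 1]
  simp [Matrix.det_fin_three] at e
  exact e

/-- A function vanishing on the surface, with nonzero differential, is up to sign increasing in the
positive normal direction. -/
theorem exists_sign (hf : Manifold.IsSmoothEmbedding (𝓡 2) (𝓡 3) ∞ f) (hα : IsContactForm α)
    (ho : IsSurfaceOrientation o) {p : S} {z : M → ℝ}
    (hz : ContMDiffAt 𝓘(ℝ, E3) 𝓘(ℝ, ℝ) ∞ z (f p)) (h0 : ∀ᶠ q in 𝓝 p, z (f q) = 0)
    (hd : tD E3 ℝ z (f p) ≠ 0) :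
    ∃ ε : ℝ, ∀ᶠ q in 𝓝 p, ∀ a b : E2, IsPositivePair (o q) a b → ∀ n : E3,
      0 < contactVolume α (f q) n (tD E2 E3 f q a) (tD E2 E3 f q b) →
        0 < ε * tD E3 ℝ z (f q) n := by
  have hfc : ContMDiff 𝓘(ℝ, E2) 𝓘(ℝ, E3) ∞ f := hf.isImmersion.contMDiff
  set χ := extChartAt 𝓘(ℝ, E3) (f p) with hχ
  have hzd : ∀ᶠ q in 𝓝 p, MDifferentiableAt 𝓘(ℝ, E3) 𝓘(ℝ, ℝ) z (f q) := by
    have : IsManifold 𝓘(ℝ, E3) 1 M := IsManifold.of_le (n := ∞) (by simp)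
    have h1 := (contMDiffAt_iff_contMDiffAt_nhds (n := 1) (by simp)).mp
      (hz.of_le (by norm_cast))
    exact (hfc.continuous.continuousAt.eventually h1).mono fun q hq =>
      hq.mdifferentiableAt (by simp)
  have hvan : ∀ᶠ q in 𝓝 p, ∀ a : E2, tD E3 ℝ z (f q) (tD E2 E3 f q a) = 0 := by
    filter_upwards [hzd, h0.eventually_nhds] with q h1 h2 a
    exact tD_apply_eq_zero hfc h1 h2 a
  obtain ⟨n₀, hn₀⟩ : ∃ n, tD E3 ℝ z (f p) n ≠ 0 := by
    by_contra! h
    exact hd (ContinuousLinearMap.ext h)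
  obtain ⟨a₀, b₀, hab₀⟩ := exists_isPositivePair (o p)
  have hne := contactVolume_ne_zero hf hα hab₀ (n := n₀) fun w hw =>
    hn₀ (hw ▸ hvan.self_of_nhds w)
  -- the positive normal vector
  obtain ⟨n₁, hn₁, hv₁⟩ : ∃ n₁, tD E3 ℝ z (f p) n₁ ≠ 0 ∧ 0 < vol3 (α (f p))
      (fderiv ℝ (localForm α (f p)) (χ (f p))) n₁ (tD E2 E3 f p a₀) (tD E2 E3 f p b₀) := by
    rcases hne.lt_or_gt with h | h
    · refine ⟨-n₀, by simpa using hn₀, ?_⟩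
      have e := contactVolume_neg (α := α) (f p) n₀ (tD E2 E3 f p a₀) (tD E2 E3 f p b₀)
      rw [contactVolume_eq_vol3] at e
      rw [e]
      exact neg_pos.mpr h
    · exact ⟨n₀, hn₀, h⟩
  set ε : ℝ := tD E3 ℝ z (f p) n₁ with hε
  set lf : S → E3 →L[ℝ] ℝ := fun q => localForm α (f p) (χ (f q)) with hlf
  set lB : S → E3 →L[ℝ] E3 →L[ℝ] ℝ := fun q => fderiv ℝ (localForm α (f p)) (χ (f q)) with hlB
  set B : S → E2 → E2 → ℝ := fun q x y =>
    vol3 (lf q) (lB q) n₁ (chartDeriv f p q x) (chartDeriv f p q y) with hB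
  have hcl : ContinuousAt lf p := by
    have h1 : ContDiffAt ℝ ∞ (localForm α (f p)) (χ (f p)) :=
      (hα.1 (f p)).contDiffAt ((isOpen_extChartAt_target (f p)).mem_nhds (mem_extChartAt_target _))
    exact ContinuousAt.comp (f := fun q => χ (f q)) h1.continuousAt
      (ContinuousAt.comp (f := f) (continuousAt_extChartAt (I := 𝓘(ℝ, E3)) (f p))
        hfc.continuous.continuousAt)
  have hcB : ContinuousAt lB p := continuousAt_fderiv_localForm_comp hfc hα.1 p
  have hcA := continuousAt_chartDeriv hfc p
  have hvol : ∀ q, f q ∈ χ.source → q ∈ (extChartAt 𝓘(ℝ, E2) p).source → ∀ (n : E3) (a b : E2),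
      contactVolume α (f q) n (tD E2 E3 f q a) (tD E2 E3 f q b) =
        vol3 (lf q) (lB q) (tD E3 E3 χ (f q) n)
          (chartDeriv f p q (tD E2 E2 (extChartAt 𝓘(ℝ, E2) p) q a))
          (chartDeriv f p q (tD E2 E2 (extChartAt 𝓘(ℝ, E2) p) q b)) := by
    intro q h1 h2 n a b
    rw [contactVolume_eq hα.1 h1, tD_chart_comp_eq hfc h1 h2, tD_chart_comp_eq hfc h1 h2]
  have hBalt : ∀ q x y, B q x y = (x 0 * y 1 - x 1 * y 0) * B q !₂[1, 0] !₂[0, 1] := by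
    intro q x y
    simp only [hB]
    rw [apply_eq_smul_add_smul _ x, apply_eq_smul_add_smul _ y]
    simp only [vol3, map_add, map_smul, _root_.add_apply, _root_.smul_apply, smul_eq_mul]
    ring
  have hev := ho.eventually_pos (p := p) (l := 𝓝 p) le_rfl (B := B) hBalt
    (by
      have h1 : ∀ x : E2, ContinuousAt (fun q => chartDeriv f p q x) p := fun x =>
        hcA.clm_apply continuousAt_const
      have h2 : ∀ {u w : S → E3}, ContinuousAt u p → ContinuousAt w p →
        ContinuousAt (fun q => lB q (u q) (w q)) p := fun hu hw => (hcB.clm_apply hu).clm_apply hw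
      have h3 : ContinuousAt (fun _ : S => n₁) p := continuousAt_const
      exact (((hcl.clm_apply h3).mul ((h2 (h1 _) (h1 _)).sub (h2 (h1 _) (h1 _)))).add
        ((hcl.clm_apply (h1 _)).mul ((h2 (h1 _) h3).sub (h2 h3 (h1 _))))).add
        ((hcl.clm_apply (h1 _)).mul ((h2 h3 (h1 _)).sub (h2 (h1 _) h3))))
    (fun a b hab => by
      have h1 := IsPositivePair.det_mul_pos (o := o p) hab₀ hab
      have h2 : 0 < B p a₀ b₀ := by
        have := hvol p (mem_extChartAt_source _) (mem_extChartAt_source _) n₁ a₀ b₀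
        rw [tD_chart_self, tD_chart_self] at this
        have hv : 0 < contactVolume α (f p) n₁ (tD E2 E3 f p a₀) (tD E2 E3 f p b₀) := hv₁
        rw [this] at hv
        exact hv
      rw [hBalt] at h2 ⊢
      set r := B p !₂[1, 0] !₂[0, 1]
      set d := a₀ 0 * b₀ 1 - a₀ 1 * b₀ 0
      set d' := a 0 * b 1 - a 1 * b 0
      have h3 : (d * d') * (d * r) = (d * d) * (d' * r) := by ring
      exact pos_of_mul_pos_right (h3 ▸ mul_pos h1 h2) (mul_self_nonneg d))
  -- the normal vector that is constant in the chart
  have hdz : ContinuousAt (fun q => fderiv ℝ (z ∘ χ.symm) (χ (f q)) n₁) p := by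
    have h1 : ContDiffAt ℝ ∞ (z ∘ χ.symm) (χ (f p)) := by
      refine contMDiffAt_iff_contDiffAt.mp (ContMDiffAt.comp _ ?_
        (contMDiffAt_chart_symm (mem_extChartAt_target _)))
      rwa [hχ, extChartAt_to_inv]
    have h2 := (h1.fderiv_right (m := 0) (by simp)).continuousAt
    have h3 : ContinuousAt (fun q => χ (f q)) p :=
      ContinuousAt.comp (f := f) (continuousAt_extChartAt (I := 𝓘(ℝ, E3)) (f p))
        hfc.continuous.continuousAt
    exact (ContinuousAt.comp (f := fun q => χ (f q)) h2 h3).clm_apply continuousAt_const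
  have hdz0 : fderiv ℝ (z ∘ χ.symm) (χ (f p)) n₁ = ε := by
    rw [hε, tD_eq_comp_chart hzd.self_of_nhds (mem_extChartAt_source (f p)), tD_chart_self,
      ContinuousLinearMap.comp_id, tD_eq_fderiv]
  have hdzpos : ∀ᶠ q in 𝓝 p, 0 < ε * fderiv ℝ (z ∘ χ.symm) (χ (f q)) n₁ := by
    refine (hdz.const_mul ε).eventually_const_lt ?_
    show 0 < ε * fderiv ℝ (z ∘ χ.symm) (χ (f p)) n₁
    rw [hdz0]
    exact mul_self_pos.mpr hn₁
  refine ⟨ε, ?_⟩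
  filter_upwards [hev, hdzpos, eventually_mem_source hfc p, hzd, hvan] with q h1 h2 h3 h4 h5 a b hab
    n hn
  obtain ⟨n', hn'⟩ := tD_chart_surjective h3.1 n₁
  have e1 : 0 < vol3 (α (f q)) (fderiv ℝ (localForm α (f q)) (extChartAt (𝓡 3) (f q) (f q))) n'
      (tD E2 E3 f q a) (tD E2 E3 f q b) := by
    have e2 := hvol q h3.1 h3.2 n' a b
    rw [hn', contactVolume_eq_vol3] at e2
    rw [e2]
    exact h1 a b hab
  have e3 : 0 < (ε • tD E3 ℝ z (f q)) n' := by
    rw [tD_eq_comp_chart h4 h3.1, tD_eq_fderiv]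
    show 0 < ε * fderiv ℝ (z ∘ χ.symm) (χ (f q)) (tD E3 E3 χ (f q) n')
    rw [hn']
    exact h2
  rw [contactVolume_eq_vol3] at hn
  exact pos_of_vol3_pos (L := ε • tD E3 ℝ z (f q)) (by simp [h5]) (by simp [h5]) e1 e3 hn

/-- Near each boundary point of the domain there are functions cutting it out. -/
theorem exists_isCollar (hf : Manifold.IsSmoothEmbedding (𝓡 2) (𝓡 3) ∞ f) (hα : IsContactForm α)
    (ho : IsSurfaceOrientation o) (hD : IsCompactSubsurface D) {p : S} (hp : p ∈ frontier D) :
    ∃ (N : Set M) (z h : M → ℝ), f p ∈ N ∧ IsCollar α o f D N z h := by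
  have hfc : ContMDiff 𝓘(ℝ, E2) 𝓘(ℝ, E3) ∞ f := hf.isImmersion.contMDiff
  obtain ⟨N, z, r, hN, hpN, hz, hr, hq, hd⟩ := exists_slice hf p
  have hfN : ∀ᶠ q in 𝓝 p, f q ∈ N := hfc.continuous.continuousAt.eventually (hN.mem_nhds hpN)
  obtain ⟨ε, hε⟩ := exists_sign hf hα ho (hz _ hpN) (hfN.mono fun q h => (hq q h).1) hd
  obtain ⟨g, hg1, hg2, hg3, hg4⟩ := hD.2 p hp
  have hg3 : tD E2 ℝ g p ≠ 0 := hg3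
  have : IsManifold 𝓘(ℝ, E2) 1 S := IsManifold.of_le (n := ∞) (by simp)
  have hgc : ∀ᶠ q in 𝓝 p, ContMDiffAt 𝓘(ℝ, E2) 𝓘(ℝ, ℝ) 1 g q :=
    (contMDiffAt_iff_contMDiffAt_nhds (n := 1) (by simp)).mp (hg1.of_le (by norm_cast))
  have hgd : ∀ᶠ q in 𝓝 p, tD E2 ℝ g q ≠ 0 := by
    have h1 : ContDiffAt ℝ ∞ (g ∘ (extChartAt 𝓘(ℝ, E2) p).symm) (extChartAt 𝓘(ℝ, E2) p p) := by
      refine contMDiffAt_iff_contDiffAt.mp (ContMDiffAt.comp _ ?_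
        (contMDiffAt_chart_symm (mem_extChartAt_target _)))
      rwa [extChartAt_to_inv]
    have h2 : ContinuousAt (fun q => fderiv ℝ (g ∘ (extChartAt 𝓘(ℝ, E2) p).symm)
        (extChartAt 𝓘(ℝ, E2) p q)) p :=
      ContinuousAt.comp (f := extChartAt 𝓘(ℝ, E2) p) (h1.fderiv_right (m := 0) (by simp)).continuousAt
        (continuousAt_extChartAt (I := 𝓘(ℝ, E2)) p)
    have h3 : fderiv ℝ (g ∘ (extChartAt 𝓘(ℝ, E2) p).symm) (extChartAt 𝓘(ℝ, E2) p p) ≠ 0 := by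
      rwa [tD_eq_comp_chart (hg1.mdifferentiableAt (by simp)) (mem_extChartAt_source p),
        tD_chart_self, ContinuousLinearMap.comp_id, tD_eq_fderiv] at hg3
    filter_upwards [h2.eventually_ne h3, (isOpen_extChartAt_source (I := 𝓘(ℝ, E2)) p).mem_nhds
      (mem_extChartAt_source p), hgc] with q h4 h5 h6 h7
    rw [tD_eq_comp_chart (h6.mdifferentiableAt (by simp)) h5, tD_eq_fderiv] at h7
    refine h4 (ContinuousLinearMap.ext fun x => ?_)
    obtain ⟨y, rfl⟩ := tD_chart_surjective h5 x
    exact congrArg (fun L : E2 →L[ℝ] ℝ => L y) h7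
  obtain ⟨W, hW, hWo, hpW⟩ := eventually_nhds_iff.mp
    (hε.and (hgc.and (hgd.and hg4.eventually_nhds)))
  have hrc : ContinuousOn r N := fun x hx => (hr x hx).continuousAt.continuousWithinAt
  have hmem : ∀ q, f q ∈ N ∩ r ⁻¹' W → q ∈ W := fun q hqN => by
    have := hqN.2
    rwa [mem_preimage, (hq q hqN.1).2] at this
  -- the boundary of the domain is contained in the zero set of `g`
  have hfr : ∀ q ∈ frontier D, q ∈ W → g q = 0 := by
    intro q hqD hqW
    obtain ⟨-, h1, -, h2⟩ := hW q hqW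
    refine le_antisymm ?_ ?_
    · have hcl : ∃ᶠ q' in 𝓝 q, q' ∈ D := mem_closure_iff_frequently.mp (frontier_subset_closure hqD)
      by_contra hcon
      push Not at hcon
      obtain ⟨q', h3, h4, h5⟩ := (hcl.and_eventually (h2.and
        (h1.continuousAt.eventually_const_lt hcon))).exists
      exact absurd (h4.mp h3) (not_le.mpr h5)
    · have hcl : ∃ᶠ q' in 𝓝 q, q' ∈ Dᶜ := mem_closure_iff_frequently.mp
        (frontier_subset_closure (by rwa [frontier_compl]))
      by_contra hcon
      push Not at hcon
      obtain ⟨q', h3, h4, h5⟩ := (hcl.and_eventually (h2.and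
        (h1.continuousAt.eventually_lt_const hcon))).exists
      exact h3 (h4.mpr h5.le)
  refine ⟨N ∩ r ⁻¹' W, fun x => ε * z x, g ∘ r, ⟨hpN, ?_⟩,
    hrc.isOpen_inter_preimage hN hWo, ?_, ?_, ?_, ?_, ?_, ?_, ?_⟩
  · rw [mem_preimage, (hq p hpN).2]; exact hpW
  · rintro x ⟨hx, -⟩
    exact (((contDiff_const.mul contDiff_id : ContDiff ℝ ∞ fun y : ℝ => ε * y).contMDiff.contMDiffAt
      (x := z x)).comp x (hz x hx)).of_le (by norm_cast)
  · rintro x ⟨hx, hx'⟩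
    exact (hW _ hx').2.1.comp x ((hr x hx).of_le (by norm_cast))
  · rintro q ⟨hqN, -⟩
    show ε * z (f q) = 0
    rw [(hq q hqN).1, mul_zero]
  · intro q hqN
    show q ∈ D ↔ g (r (f q)) ≤ 0
    rw [(hq q hqN.1).2]
    exact (hW q (hmem q hqN)).2.2.2.self_of_nhds
  · intro q hqD hqN
    show g (r (f q)) = 0
    rw [(hq q hqN.1).2]
    exact hfr q hqD (hmem q hqN)
  · intro q hqN a b hab n hn
    have h1 := (hW q (hmem q hqN)).1 a b hab n hn
    have h2 : tD E3 ℝ (fun x => ε * z x) (f q) = ε • tD E3 ℝ z (f q) :=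
      (((hz _ hqN.1).mdifferentiableAt (by simp)).hasMFDerivAt.const_smul ε).mfderiv
    rw [h2]
    exact h1
  · intro q hqD hqN w hw
    have hqW := hmem q hqN
    obtain ⟨-, h1, h2, h3⟩ := hW q hqW
    have h4 := tD_pos_of_isOutward (h1.mdifferentiableAt (by simp)) (hfr q hqD hqW) h2 h3 hw
    have h5 : (g ∘ r) ∘ f =ᶠ[𝓝 q] g := by
      filter_upwards [hfc.continuous.continuousAt.eventually (hN.mem_nhds hqN.1)] with q' hq'
      simp [(hq q' hq').2]
    have h6 : MDifferentiableAt 𝓘(ℝ, E3) 𝓘(ℝ, ℝ) (g ∘ r) (f q) :=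
      ((hW _ hqN.2).2.1.mdifferentiableAt (by simp)).comp (f q)
        ((hr _ hqN.1).mdifferentiableAt (by simp))
    have h7 := tD_comp h6 (hfc.mdifferentiableAt (by simp) (x := q))
    rw [tD_congr h5] at h7
    rw [h7] at h4
    exact h4

end Collar

end

end LegendrianRibbon

namespace LegendrianRibbon

noncomputable section

section Glue

variable {M : Type*} [TopologicalSpace M] [ChartedSpace E3 M] [IsManifold (𝓡 3) ∞ M]
  {S : Type*} [TopologicalSpace S] [ChartedSpace E2 S] [IsManifold (𝓡 2) ∞ S] {f : S → M}
  {α : ∀ x : M, TangentSpace (𝓡 3) x →L[ℝ] ℝ}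
  {o : ∀ p : S, Orientation ℝ (TangentSpace (𝓡 2) p) (Fin 2)} {D : Set S}

omit [IsManifold (𝓡 3) ∞ M] in
theorem hasMFDerivAt_finsetSum {ι : Type*} (t : Finset ι) {k : ι → M → ℝ} {k' : ι → E3 →L[ℝ] ℝ}
    {x : M} (hk : ∀ i ∈ t, HasMFDerivAt 𝓘(ℝ, E3) 𝓘(ℝ, ℝ) (k i) x (k' i)) :
    HasMFDerivAt 𝓘(ℝ, E3) 𝓘(ℝ, ℝ) (∑ i ∈ t, k i) x (∑ i ∈ t, k' i : E3 →L[ℝ] ℝ) := by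
  classical
  induction t using Finset.induction_on with
  | empty => exact hasMFDerivAt_const (0 : ℝ) x
  | insert i t hi ih =>
    rw [Finset.sum_insert hi, Finset.sum_insert hi]
    exact (hk i (Finset.mem_insert_self i t)).add
      (ih fun j hj => hk j (Finset.mem_insert_of_mem hj))

omit [IsManifold (𝓡 3) ∞ M] in
theorem hasMFDerivAt_mul_of_eq_zero {φ k : M → ℝ} {x : M} (hφ : ContMDiff 𝓘(ℝ, E3) 𝓘(ℝ, ℝ) ∞ φ)
    (hk : x ∈ tsupport φ → MDifferentiableAt 𝓘(ℝ, E3) 𝓘(ℝ, ℝ) k x ∧ k x = 0) :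
    HasMFDerivAt 𝓘(ℝ, E3) 𝓘(ℝ, ℝ) (φ * k) x (φ x • tD E3 ℝ k x) := by
  by_cases hx : x ∈ tsupport φ
  · have h : HasMFDerivAt 𝓘(ℝ, E3) 𝓘(ℝ, ℝ) (φ * k) x
        (φ x • tD E3 ℝ k x + k x • tD E3 ℝ φ x : E3 →L[ℝ] ℝ) :=
      (hφ.mdifferentiableAt (by simp) (x := x)).hasMFDerivAt.mul (hk hx).1.hasMFDerivAt
    have e : (φ x • tD E3 ℝ k x + k x • tD E3 ℝ φ x : E3 →L[ℝ] ℝ) = φ x • tD E3 ℝ k x := by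
      rw [(hk hx).2, zero_smul, add_zero]
    rw [e] at h
    exact h
  · have h0 : φ =ᶠ[𝓝 x] 0 := notMem_tsupport_iff_eventuallyEq.mp hx
    have h1 : φ * k =ᶠ[𝓝 x] fun _ => (0 : ℝ) := by
      filter_upwards [h0] with y hy
      simp [hy]
    rw [h0.self_of_nhds]
    have h2 : (0 : M → ℝ) x • tD E3 ℝ k x = 0 := zero_smul _ _
    rw [h2]
    exact (hasMFDerivAt_const (0 : ℝ) x).congr_of_eventuallyEq h1

omit [IsManifold (𝓡 3) ∞ M] in
theorem contMDiff_mul_of_tsupport {φ k : M → ℝ} (hφ : ContMDiff 𝓘(ℝ, E3) 𝓘(ℝ, ℝ) ∞ φ)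
    (hk : ∀ x ∈ tsupport φ, ContMDiffAt 𝓘(ℝ, E3) 𝓘(ℝ, ℝ) 1 k x) :
    ContMDiff 𝓘(ℝ, E3) 𝓘(ℝ, ℝ) 1 (φ * k) :=
  contMDiff_of_tsupport fun x hx =>
    ((hφ.of_le (by norm_cast)).contMDiffAt (x := x)).mul
      (hk x (closure_mono (Function.support_mul_subset_left _ _) hx))

/-- Functions cutting out the domain exist near its whole boundary. -/
theorem exists_isCollar_frontier [T2Space M] [T2Space S]
    (hf : Manifold.IsSmoothEmbedding (𝓡 2) (𝓡 3) ∞ f) (hα : IsContactForm α)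
    (ho : IsSurfaceOrientation o) (hD : IsCompactSubsurface D) :
    ∃ (N : Set M) (z h : M → ℝ), (∀ q ∈ frontier D, f q ∈ N) ∧ IsCollar α o f D N z h := by
  have hfc : ContMDiff 𝓘(ℝ, E2) 𝓘(ℝ, E3) ∞ f := hf.isImmersion.contMDiff
  have hloc : ∀ p ∈ frontier D, ∃ (N : Set M) (z h φ : M → ℝ), IsCollar α o f D N z h ∧
      ContMDiff 𝓘(ℝ, E3) 𝓘(ℝ, ℝ) ∞ φ ∧ (∀ x, 0 ≤ φ x) ∧ tsupport φ ⊆ N ∧ 0 < φ (f p) := by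
    intro p hp
    obtain ⟨N, z, h, hpN, hN⟩ := exists_isCollar hf hα ho hD hp
    obtain ⟨φ, hφ⟩ := (SmoothBumpFunction.nhds_basis_tsupport (I := 𝓘(ℝ, E3)) (f p)).mem_iff.mp
      (hN.isOpen.mem_nhds hpN)
    exact ⟨N, z, h, φ, hN, φ.contMDiff, fun x => φ.nonneg, hφ.2, by rw [φ.eq_one]; exact one_pos⟩
  choose! N z h φ hN hφc hφ0 hφN hφp using hloc
  have hK : IsCompact (frontier D) :=
    hD.1.of_isClosed_subset isClosed_frontier hD.1.isClosed.frontier_subset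
  obtain ⟨t, htD, hcov⟩ := hK.elim_nhds_subcover (fun p => {q | 0 < φ p (f q)}) fun p hp =>
    ((hφc p hp).continuous.comp hfc.continuous).continuousAt.eventually_const_lt (hφp p hp)
  have hsupp : ∀ p ∈ t, ∀ x, φ p x ≠ 0 → x ∈ N p := fun p hp x hx =>
    hφN p (htD p hp) (subset_tsupport _ hx)
  -- a sum of nonnegative terms, one of which is positive
  have hsum : ∀ (x : M) (c : S → ℝ), (∃ p ∈ t, 0 < φ p x) → (∀ p ∈ t, x ∈ N p → 0 < c p) →
      0 < ∑ p ∈ t, φ p x * c p := by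
    rintro x c ⟨p, hp, hpx⟩ hc
    refine Finset.sum_pos' (fun p' hp' => ?_) ⟨p, hp, mul_pos hpx (hc p hp (hsupp p hp x hpx.ne'))⟩
    rcases (hφ0 p' (htD p' hp') x).eq_or_lt with h0 | h0
    · rw [← h0, zero_mul]
    · exact (mul_pos h0 (hc p' hp' (hsupp p' hp' x h0.ne'))).le
  have hzero : ∀ (x : M) (c : S → ℝ), (∀ p ∈ t, x ∈ N p → c p = 0) →
      ∑ p ∈ t, φ p x * c p = 0 := by
    intro x c hc
    refine Finset.sum_eq_zero fun p hp => ?_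
    by_cases h0 : φ p x = 0
    · rw [h0, zero_mul]
    · rw [hc p hp (hsupp p hp x h0), mul_zero]
  have hsm : ∀ k : S → M → ℝ, (∀ p ∈ t, ∀ x ∈ N p, ContMDiffAt 𝓘(ℝ, E3) 𝓘(ℝ, ℝ) 1 (k p) x) →
      ContMDiff 𝓘(ℝ, E3) 𝓘(ℝ, ℝ) 1 (∑ p ∈ t, φ p * k p) := by
    intro k hk
    have : ∀ p ∈ t, ContMDiff 𝓘(ℝ, E3) 𝓘(ℝ, ℝ) 1 (φ p * k p) := fun p hp =>
      contMDiff_mul_of_tsupport (hφc p (htD p hp)) fun x hx => hk p hp x (hφN p (htD p hp) hx)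
    have h1 := contMDiff_finsetSum this
    have h2 : (∑ p ∈ t, φ p * k p) = fun x => ∑ p ∈ t, (φ p * k p) x := by
      ext x; simp
    rw [h2]
    exact h1
  have htD' : ∀ (k : S → M → ℝ) (x : M), (∀ p ∈ t, x ∈ N p →
      MDifferentiableAt 𝓘(ℝ, E3) 𝓘(ℝ, ℝ) (k p) x ∧ k p x = 0) → ∀ n : E3,
      tD E3 ℝ (∑ p ∈ t, φ p * k p) x n = ∑ p ∈ t, φ p x * tD E3 ℝ (k p) x n := by
    intro k x hk n
    have h1 : tD E3 ℝ (∑ p ∈ t, φ p * k p) x = ∑ p ∈ t, φ p x • tD E3 ℝ (k p) x :=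
      (hasMFDerivAt_finsetSum t (k := fun p => φ p * k p) (k' := fun p => φ p x • tD E3 ℝ (k p) x)
        fun p hp => hasMFDerivAt_mul_of_eq_zero (hφc p (htD p hp)) fun hx =>
          hk p hp (hφN p (htD p hp) hx)).mfderiv
    rw [h1]
    simp
  refine ⟨{x | ∃ p ∈ t, 0 < φ p x}, ∑ p ∈ t, φ p * z p, ∑ p ∈ t, φ p * h p, ?_, ?_, ?_, ?_, ?_, ?_,
    ?_, ?_, ?_⟩
  · intro q hq
    obtain ⟨p, hp, hpq⟩ := mem_iUnion₂.mp (hcov hq)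
    exact ⟨p, hp, hpq⟩
  · have : {x | ∃ p ∈ t, 0 < φ p x} = ⋃ p ∈ t, {x | 0 < φ p x} := by ext x; simp
    rw [this]
    exact isOpen_biUnion fun p hp => isOpen_lt continuous_const (hφc p (htD p hp)).continuous
  · exact fun x _ => hsm z (fun p hp => (hN p (htD p hp)).smooth_z) x
  · exact fun x _ => hsm h (fun p hp => (hN p (htD p hp)).smooth_h) x
  · intro q _
    rw [Finset.sum_apply]
    exact hzero (f q) (fun p => z p (f q)) fun p hp hq => (hN p (htD p hp)).z_eq q hq
  · intro q hq
    rw [Finset.sum_apply]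
    constructor
    · intro hqD
      refine Finset.sum_nonpos fun p hp => ?_
      by_cases h0 : φ p (f q) = 0
      · simp [h0]
      · exact mul_nonpos_of_nonneg_of_nonpos (hφ0 p (htD p hp) _)
          (((hN p (htD p hp)).mem_iff q (hsupp p hp _ h0)).mp hqD)
    · intro hle
      by_contra hqD
      refine absurd hle (not_le.mpr (hsum (f q) (fun p => h p (f q)) hq fun p hp hqN => ?_))
      by_contra hcon
      push Not at hcon
      exact hqD (((hN p (htD p hp)).mem_iff q hqN).mpr hcon)
  · intro q hqD _
    rw [Finset.sum_apply]
    exact hzero (f q) (fun p => h p (f q)) fun p hp hq => (hN p (htD p hp)).h_eq q hqD hq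
  · intro q hq a b hab n hn
    rw [htD' z (f q) (fun p hp hqN => ⟨((hN p (htD p hp)).smooth_z _ hqN).mdifferentiableAt
      (by simp), (hN p (htD p hp)).z_eq q hqN⟩)]
    exact hsum (f q) (fun p => tD E3 ℝ (z p) (f q) n) hq fun p hp hqN =>
      (hN p (htD p hp)).pos_z q hqN a b hab n hn
  · intro q hqD hq w hw
    rw [htD' h (f q) (fun p hp hqN => ⟨((hN p (htD p hp)).smooth_h _ hqN).mdifferentiableAt
      (by simp), (hN p (htD p hp)).h_eq q hqD hqN⟩)]
    exact hsum (f q) (fun p => tD E3 ℝ (h p) (f q) (tD E2 E3 f q w)) hq fun p hp hqN =>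
      (hN p (htD p hp)).pos_h q hqD hqN w hw

end Glue

end

end LegendrianRibbon

namespace LegendrianRibbon

noncomputable section

section Local

/-- A map with injective strict derivative is locally injective. -/
theorem exists_injOn_nhds {E F : Type*} [NormedAddCommGroup E] [NormedSpace ℝ E]
    [FiniteDimensional ℝ E] [NormedAddCommGroup F] [NormedSpace ℝ F] {ψ : E → F} {A : E →L[ℝ] F}
    {y : E} (hψ : HasStrictFDerivAt ψ A y) (hA : Function.Injective A) :
    ∃ U ∈ 𝓝 y, InjOn ψ U := by
  obtain ⟨K, hK, hKA⟩ := LinearMap.exists_antilipschitzWith (A : E →ₗ[ℝ] F)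
    (LinearMap.ker_eq_bot.mpr hA)
  have hK' : (0 : ℝ) < (K : ℝ)⁻¹ / 2 := by positivity
  have h1 := hψ.isLittleO.def hK'
  rw [nhds_prod_eq] at h1
  obtain ⟨U, hU, hUs⟩ := mem_prod_self_iff.mp h1
  refine ⟨U, hU, fun a ha b hb hab => ?_⟩
  have h2 := hUs (mk_mem_prod ha hb)
  simp only [mem_ofPred_eq, hab, sub_self, zero_sub, norm_neg] at h2
  have h3 : ‖a - b‖ ≤ K * ‖A (a - b)‖ := by
    have := hKA.le_mul_norm_sub b a
    rw [neg_add_eq_sub, neg_add_eq_sub] at this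
    rw [map_sub]
    exact this
  by_contra hne
  have h4 : 0 < ‖a - b‖ := norm_pos_iff.mpr (sub_ne_zero.mpr hne)
  have h5 : (K : ℝ) * ‖A (a - b)‖ ≤ K * ((K : ℝ)⁻¹ / 2 * ‖a - b‖) :=
    mul_le_mul_of_nonneg_left h2 K.2
  have h6 : (K : ℝ) * ((K : ℝ)⁻¹ / 2 * ‖a - b‖) = ‖a - b‖ / 2 := by
    field_simp
  linarith

variable {M : Type*} [TopologicalSpace M] [ChartedSpace E3 M] [IsManifold (𝓡 3) ∞ M]
  {S : Type*} [TopologicalSpace S] [ChartedSpace E2 S] [IsManifold (𝓡 2) ∞ S] {f : S → M}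
  {α : ∀ x : M, TangentSpace (𝓡 3) x →L[ℝ] ℝ}
  {o : ∀ p : S, Orientation ℝ (TangentSpace (𝓡 2) p) (Fin 2)} {D : Set S} {N : Set M} {z h : M → ℝ}

omit [IsManifold (𝓡 3) ∞ M] [IsManifold (𝓡 2) ∞ S] in
/-- The differential of `z` does not vanish on vectors transverse to the surface. -/
theorem IsCollar.tD_ne_zero (hN : IsCollar α o f D N z h)
    (hf : Manifold.IsSmoothEmbedding (𝓡 2) (𝓡 3) ∞ f) (hα : IsContactForm α) {q : S}
    (hq : f q ∈ N) {n : E3} (hn : ∀ w, tD E2 E3 f q w ≠ n) : tD E3 ℝ z (f q) n ≠ 0 := by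
  obtain ⟨a, b, hab⟩ := exists_isPositivePair (o q)
  rcases (contactVolume_ne_zero hf hα hab hn).lt_or_gt with h1 | h1
  · have h2 := hN.pos_z q hq a b hab (-n) (by rw [contactVolume_neg]; exact neg_pos.mpr h1)
    rw [map_neg] at h2
    exact (neg_pos.mp h2).ne
  · exact (hN.pos_z q hq a b hab n h1).ne'

/-- Near the boundary of the domain, the surface is the zero set of `z`. -/
theorem IsCollar.eventually_exists_eq (hN : IsCollar α o f D N z h)
    (hf : Manifold.IsSmoothEmbedding (𝓡 2) (𝓡 3) ∞ f) (hα : IsContactForm α) {p : S}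
    (hp : f p ∈ N) : ∀ᶠ x in 𝓝 (f p), z x = 0 → ∃ q, f q = x := by
  have hfc : ContMDiff 𝓘(ℝ, E2) 𝓘(ℝ, E3) ∞ f := hf.isImmersion.contMDiff
  obtain ⟨N', z', r, hN', hpN', -, hr, hq, -⟩ := exists_slice hf p
  set χ := extChartAt 𝓘(ℝ, E3) (f p) with hχ
  set χ' := extChartAt 𝓘(ℝ, E2) p with hχ'
  have hrp : r (f p) = p := (hq p hpN').2
  have hinv : χ.symm (χ (f p)) = f p := extChartAt_to_inv _
  have hzs : ContDiffAt ℝ 1 (z ∘ χ.symm) (χ (f p)) := by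
    refine contMDiffAt_iff_contDiffAt.mp (ContMDiffAt.comp _ ?_
      ((contMDiffAt_chart_symm (mem_extChartAt_target _)).of_le (by norm_cast)))
    rw [hinv]; exact hN.smooth_z _ hp
  have hcr : ContMDiffAt 𝓘(ℝ, E3) 𝓘(ℝ, E2) ∞ (χ' ∘ r) (f p) :=
    ContMDiffAt.comp _ (by rw [hrp]; exact contMDiffAt_chart (mem_extChartAt_source p)) (hr _ hpN')
  have hrs : ContDiffAt ℝ ∞ ((χ' ∘ r) ∘ χ.symm) (χ (f p)) := by
    refine contMDiffAt_iff_contDiffAt.mp (ContMDiffAt.comp _ ?_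
      (contMDiffAt_chart_symm (mem_extChartAt_target _)))
    rwa [hinv]
  have hzd : fderiv ℝ (z ∘ χ.symm) (χ (f p)) = tD E3 ℝ z (f p) := by
    rw [tD_eq_comp_chart ((hN.smooth_z _ hp).mdifferentiableAt (by simp))
      (mem_extChartAt_source (f p)), tD_chart_self, ContinuousLinearMap.comp_id, tD_eq_fderiv]
  have hrd : fderiv ℝ ((χ' ∘ r) ∘ χ.symm) (χ (f p)) = tD E3 E2 r (f p) := by
    have h1 : tD E3 E2 (χ' ∘ r) (f p) = tD E3 E2 r (f p) := by
      rw [tD_comp (by rw [hrp]; exact mdiffAt_chart (mem_extChartAt_source p))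
        ((hr _ hpN').mdifferentiableAt (by simp)), hrp, tD_chart_self,
        ContinuousLinearMap.id_comp]
    rw [← h1, tD_eq_comp_chart (hcr.mdifferentiableAt (by simp)) (mem_extChartAt_source (f p)),
      tD_chart_self, ContinuousLinearMap.comp_id, tD_eq_fderiv]
  have hstrict := (hrs.hasStrictFDerivAt (by simp)).prodMk (hzs.hasStrictFDerivAt (by simp))
  obtain ⟨U, hU, hinj⟩ := exists_injOn_nhds hstrict (by
    rw [hrd, hzd]
    rw [injective_iff_map_eq_zero]
    intro w hw
    have hw1 : tD E3 E2 r (f p) w = 0 := congrArg Prod.fst hw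
    have hw2 : tD E3 ℝ z (f p) w = 0 := congrArg Prod.snd hw
    by_contra hne
    refine hN.tD_ne_zero hf hα hp (fun a ha => hne ?_) hw2
    have h1 : r ∘ f =ᶠ[𝓝 p] id := by
      filter_upwards [hfc.continuous.continuousAt.eventually (hN'.mem_nhds hpN')] with q h
      exact (hq q h).2
    have h2 := tD_comp ((hr _ hpN').mdifferentiableAt (by simp))
      (hfc.mdifferentiableAt (by simp) (x := p))
    have h3 : tD E2 E2 (r ∘ f) p = ContinuousLinearMap.id ℝ E2 := by
      rw [tD_congr h1]
      exact mfderiv_id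
    have h4 : a = tD E3 E2 r (f p) (tD E2 E3 f p a) :=
      congrArg (fun L : E2 →L[ℝ] E2 => L a) (h3.symm.trans h2)
    rw [ha, hw1] at h4
    rw [← ha, h4, map_zero])
  have hrc : ContinuousAt r (f p) := (hr _ hpN').continuousAt
  have hfr : Tendsto (fun x => f (r x)) (𝓝 (f p)) (𝓝 (f p)) := by
    have h1 : ContinuousAt f (r (f p)) := hfc.continuous.continuousAt
    have h2 := (ContinuousAt.comp (f := r) h1 hrc).tendsto
    simpa [Function.comp_def, hrp] using h2
  have hχc : ContinuousAt χ (f p) := continuousAt_extChartAt (I := 𝓘(ℝ, E3)) (f p)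
  have hgood : ∀ᶠ x in 𝓝 (f p), x ∈ χ.source ∧ χ x ∈ U ∧ x ∈ N' ∧ x ∈ N := by
    filter_upwards [(isOpen_extChartAt_source (I := 𝓘(ℝ, E3)) (f p)).mem_nhds
      (mem_extChartAt_source (f p)), hχc.eventually hU, hN'.mem_nhds hpN',
      hN.isOpen.mem_nhds hp] with x h1 h2 h3 h4 using ⟨h1, h2, h3, h4⟩
  filter_upwards [hgood, hfr.eventually hgood] with x hx hx' hz0
  refine ⟨r x, χ.injOn hx'.1 hx.1 (hinj hx'.2.1 hx.2.1 ?_)⟩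
  simp only [Function.comp, χ.left_inv hx.1, χ.left_inv hx'.1, (hq _ hx'.2.2.1).2,
    hN.z_eq _ hx'.2.2.2, hz0]

end Local

end

end LegendrianRibbon

namespace LegendrianRibbon

noncomputable section

/-! ### Intersections of a push-off with the surface -/

section Analysis

/-- A function vanishing for `t = 0` is close to `t` times its derivative. -/
theorem eventually_div_mem_slitPlane {W : ℝ × ℝ → ℂ} {W' : ℝ × ℝ →L[ℝ] ℂ} {c : ℝ → ℂ} {s₀ : ℝ}
    (hW : HasStrictFDerivAt W W' (0, s₀)) (h0 : ∀ s, W (0, s) = 0) (hc : ContinuousAt c s₀)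
    (hcW : W' (1, 0) = c s₀) (hc0 : c s₀ ≠ 0) :
    ∀ᶠ x : ℝ × ℝ in 𝓝 (0, s₀), 0 < x.1 → W x / c x.2 ∈ Complex.slitPlane := by
  have hε : 0 < ‖c s₀‖ / 4 := by positivity
  have hto : Tendsto (fun x : ℝ × ℝ => (x, ((0 : ℝ), x.2))) (𝓝 (0, s₀)) (𝓝 ((0, s₀), (0, s₀))) := by
    have : ContinuousAt (fun x : ℝ × ℝ => (x, ((0 : ℝ), x.2))) (0, s₀) := by fun_prop
    exact this
  have h1 := hto.eventually (hW.isLittleO.def hε)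
  have hsnd : Tendsto (fun x : ℝ × ℝ => x.2) (𝓝 (0, s₀)) (𝓝 s₀) :=
    (continuous_snd.tendsto ((0 : ℝ), s₀))
  have h2 : ∀ᶠ x : ℝ × ℝ in 𝓝 (0, s₀), ‖c x.2 - c s₀‖ < ‖c s₀‖ / 4 := by
    have := hsnd.eventually (hc.eventually (Metric.ball_mem_nhds (c s₀) hε))
    filter_upwards [this] with x hx
    rw [← dist_eq_norm_sub]
    exact hx
  filter_upwards [h1, h2] with x hx1 hx2 ht
  have e1 : x - (0, x.2) = (x.1, 0) := by ext <;> simp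
  have e2 : W' (x.1, 0) = x.1 • c s₀ := by
    rw [← hcW, ← map_smul]; simp
  have e3 : ‖((x.1, 0) : ℝ × ℝ)‖ = x.1 := by
    rw [Prod.norm_def]; simp [abs_of_pos ht, ht.le]
  simp only [h0, sub_zero, e1, e2, e3] at hx1
  -- the quotient has positive real part
  have h3 : ‖W x - x.1 • c x.2‖ ≤ ‖c s₀‖ / 2 * x.1 := by
    have e : W x - x.1 • c x.2 = (W x - x.1 • c s₀) - x.1 • (c x.2 - c s₀) := by
      rw [smul_sub]; ring
    rw [e]
    refine (norm_sub_le _ _).trans ?_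
    rw [norm_smul, Real.norm_of_nonneg ht.le]
    nlinarith
  have h4 : ‖c s₀‖ * (3 / 4) < ‖c x.2‖ := by
    have := norm_sub_norm_le (c s₀) (c x.2)
    rw [norm_sub_rev] at this
    linarith
  have hc2 : c x.2 ≠ 0 := by
    intro h
    rw [h, norm_zero] at h4
    linarith [norm_nonneg (c s₀)]
  have h5 : ‖W x / c x.2 - x.1‖ < x.1 := by
    have e : W x / c x.2 - x.1 = (W x - x.1 • c x.2) / c x.2 := by
      rw [Complex.real_smul]; field_simp
    rw [e, norm_div, div_lt_iff₀ (norm_pos_iff.mpr hc2)]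
    refine h3.trans_lt ?_
    rw [mul_comm]
    exact mul_lt_mul_of_pos_left (by linarith [norm_pos_iff.mpr hc0]) ht
  rw [Complex.mem_slitPlane_iff]
  left
  have h6 := (Complex.abs_re_le_norm _).trans_lt h5
  rw [Complex.sub_re, Complex.ofReal_re, abs_lt] at h6
  linarith

theorem ncard_eq_sum_fiber {m : ℕ} {A : Set (Fin m × ℝ)} (hA : ∀ i, {s | (i, s) ∈ A}.Finite) :
    A.ncard = ∑ i, {s | (i, s) ∈ A}.ncard := by
  have hfin : ∀ i, Finite {s | (i, s) ∈ A} := fun i => (hA i).to_subtype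
  have e : A ≃ Σ i, {s | (i, s) ∈ A} :=
    { toFun := fun x => ⟨x.1.1, x.1.2, x.2⟩
      invFun := fun y => ⟨(y.1, y.2.1), y.2.2⟩
      left_inv := fun _ => rfl
      right_inv := fun _ => rfl }
  rw [← Nat.card_coe_set_eq, Nat.card_congr e, Nat.card_sigma]
  rfl

end Analysis

section PushOff

variable {M : Type*} [TopologicalSpace M] [ChartedSpace E3 M] [IsManifold (𝓡 3) ∞ M]
  {S : Type*} [TopologicalSpace S] [ChartedSpace E2 S] [IsManifold (𝓡 2) ∞ S] {f : S → M}
  {α : ∀ x : M, TangentSpace (𝓡 3) x →L[ℝ] ℝ}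
  {o : ∀ p : S, Orientation ℝ (TangentSpace (𝓡 2) p) (Fin 2)} {D : Set S} {N : Set M} {z h : M → ℝ}
  {m : ℕ} {γ : Fin m → ℝ → S} {v : ∀ p : S, TangentSpace (𝓡 3) (f p)} {φ : Fin m → ℝ → ℝ → M}

omit [IsManifold (𝓡 3) ∞ M] in
theorem hasDerivAt_comp {k : M → ℝ} {κ : ℝ → M} {t : ℝ}
    (hk : MDifferentiableAt 𝓘(ℝ, E3) 𝓘(ℝ, ℝ) k (κ t))
    (hκ : MDifferentiableAt 𝓘(ℝ, ℝ) 𝓘(ℝ, E3) κ t) :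
    HasDerivAt (fun t => k (κ t)) (tD E3 ℝ k (κ t) (velocity κ t)) t := by
  have h1 : DifferentiableAt ℝ (k ∘ κ) t := (hk.comp t hκ).differentiableAt
  have h2 := h1.hasDerivAt
  have h3 := tD_comp hk hκ
  rw [tD_eq_fderiv] at h3
  have h4 : deriv (k ∘ κ) t = tD E3 ℝ k (κ t) (velocity κ t) := by
    rw [← fderiv_apply_one_eq_deriv]
    exact congrArg (fun L : ℝ →L[ℝ] ℝ => L 1) h3
  rwa [h4] at h2

/-- The first order approximation of the push-off, in terms of the functions cutting out the
surface. -/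
def collarDeriv (z h : M → ℝ) (f : S → M) (v : ∀ p : S, TangentSpace (𝓡 3) (f p)) (p : S) : ℂ :=
  ⟨tD E3 ℝ z (f p) (v p), tD E3 ℝ h (f p) (v p)⟩

/-- The two functions cutting out the surface, as a complex function of the parameters of the
push-off. -/
def pushOffFun (z h : M → ℝ) (φ : ℝ → ℝ → M) (x : ℝ × ℝ) : ℂ :=
  ⟨z (φ x.1 x.2), h (φ x.1 x.2)⟩

omit [IsManifold (𝓡 3) ∞ M] [TopologicalSpace S] [ChartedSpace E2 S] [IsManifold (𝓡 2) ∞ S] in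
theorem contMDiffAt_pushOff (hφ : IsPushOff f γ v φ) (i : Fin m) :
    ∀ᶠ t in 𝓝 (0 : ℝ), ∀ s, ContMDiffAt 𝓘(ℝ, ℝ × ℝ) 𝓘(ℝ, E3) ∞
      (fun x : ℝ × ℝ => φ i x.1 x.2) (t, s) := by
  obtain ⟨δ, hδ, hs⟩ := hφ.smooth
  filter_upwards [Ioo_mem_nhds (neg_lt_zero.mpr hδ) hδ] with t ht s
  exact (hs i).contMDiffAt ((isOpen_Ioo.prod isOpen_univ).mem_nhds ⟨ht, mem_univ _⟩)

omit [IsManifold (𝓡 3) ∞ M] [IsManifold (𝓡 2) ∞ S] in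
theorem IsCollar.contDiffAt_pushOffFun (hN : IsCollar α o f D N z h) {φ : ℝ → ℝ → M} {t s : ℝ}
    (hφ : ContMDiffAt 𝓘(ℝ, ℝ × ℝ) 𝓘(ℝ, E3) ∞ (fun x : ℝ × ℝ => φ x.1 x.2) (t, s))
    (hx : φ t s ∈ N) : ContDiffAt ℝ 1 (pushOffFun z h φ) (t, s) := by
  have h1 : ∀ k : M → ℝ, ContMDiffAt 𝓘(ℝ, E3) 𝓘(ℝ, ℝ) 1 k (φ t s) →
      ContDiffAt ℝ 1 (fun x : ℝ × ℝ => k (φ x.1 x.2)) (t, s) := fun k hk =>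
    contMDiffAt_iff_contDiffAt.mp (ContMDiffAt.comp (g := k)
      (f := fun x : ℝ × ℝ => φ x.1 x.2) (t, s) hk (hφ.of_le (by norm_cast)))
  have h2 := h1 z (hN.smooth_z _ hx)
  have h3 := h1 h (hN.smooth_h _ hx)
  exact Complex.equivRealProdCLM.symm.contDiff.contDiffAt.comp (t, s) (h2.prodMk h3)

omit [IsManifold (𝓡 3) ∞ M] in
theorem mdifferentiableAt_curves {φ : ℝ → ℝ → M} {t s : ℝ}
    (hφ : ContMDiffAt 𝓘(ℝ, ℝ × ℝ) 𝓘(ℝ, E3) ∞ (fun x : ℝ × ℝ => φ x.1 x.2) (t, s)) :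
    MDifferentiableAt 𝓘(ℝ, ℝ) 𝓘(ℝ, E3) (fun t => φ t s) t ∧
      MDifferentiableAt 𝓘(ℝ, ℝ) 𝓘(ℝ, E3) (fun s => φ t s) s := by
  have h := hφ.mdifferentiableAt (by simp)
  constructor
  · exact MDifferentiableAt.comp (g := fun x : ℝ × ℝ => φ x.1 x.2) (f := fun t : ℝ => (t, s)) t h
      (by fun_prop : DifferentiableAt ℝ (fun t : ℝ => (t, s)) t).mdifferentiableAt
  · exact MDifferentiableAt.comp (g := fun x : ℝ × ℝ => φ x.1 x.2) (f := fun s : ℝ => (t, s)) s h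
      (by fun_prop : DifferentiableAt ℝ (fun s : ℝ => (t, s)) s).mdifferentiableAt

omit [IsManifold (𝓡 3) ∞ M] [IsManifold (𝓡 2) ∞ S] in
theorem IsCollar.fderiv_pushOffFun (hN : IsCollar α o f D N z h)
    (hN' : ∀ q ∈ frontier D, f q ∈ N) (hγ : IsOrientedBoundary o D γ) (hφ : IsPushOff f γ v φ)
    (i : Fin m) (s : ℝ) :
    ContDiffAt ℝ 1 (pushOffFun z h (φ i)) (0, s) ∧
      fderiv ℝ (pushOffFun z h (φ i)) (0, s) (1, 0) = collarDeriv z h f v (γ i s) := by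
  have hx : φ i 0 s ∈ N := by rw [hφ.start]; exact hN' _ (hγ.mem_frontier i s)
  have hs := (contMDiffAt_pushOff hφ i).self_of_nhds s
  have hd := hN.contDiffAt_pushOffFun hs hx
  refine ⟨hd, ?_⟩
  have h1 : HasDerivAt (fun t => pushOffFun z h (φ i) (t, s))
      (fderiv ℝ (pushOffFun z h (φ i)) (0, s) (1, 0)) 0 := by
    have h2 : HasDerivAt (fun t : ℝ => (t, s)) ((1 : ℝ), (0 : ℝ)) 0 :=
      (hasDerivAt_id (0 : ℝ)).prodMk (hasDerivAt_const 0 s)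
    exact (hd.differentiableAt (by simp)).hasFDerivAt.comp_hasDerivAt 0 h2
  have hvel : (velocity (fun t => φ i t s) 0 : E3) = v (γ i s) := hφ.direction i s
  have h3 : ∀ k : M → ℝ, ContMDiffAt 𝓘(ℝ, E3) 𝓘(ℝ, ℝ) 1 k (φ i 0 s) →
      HasDerivAt (fun t => k (φ i t s)) (tD E3 ℝ k (f (γ i s)) (v (γ i s))) 0 := by
    intro k hk
    have h4 := hasDerivAt_comp (κ := fun t => φ i t s) (hk.mdifferentiableAt (by simp))
      (mdifferentiableAt_curves hs).1
    have e : tD E3 ℝ k (φ i 0 s) = tD E3 ℝ k (f (γ i s)) := by rw [hφ.start]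
    have e2 : tD E3 ℝ k (φ i 0 s) (velocity (fun t => φ i t s) 0 : E3) =
      tD E3 ℝ k (f (γ i s)) (v (γ i s)) := by rw [e, hvel]
    rw [← e2]
    exact h4
  have h5 := h3 z (hN.smooth_z _ hx)
  have h6 := h3 h (hN.smooth_h _ hx)
  have h7 : HasDerivAt (fun t => pushOffFun z h (φ i) (t, s)) (collarDeriv z h f v (γ i s)) 0 :=
    Complex.equivRealProdCLM.symm.hasFDerivAt.comp_hasDerivAt (0 : ℝ) (h5.prodMk h6)
  exact h1.unique h7

omit [IsManifold (𝓡 3) ∞ M] [IsManifold (𝓡 2) ∞ S] in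
theorem IsCollar.continuous_collarDeriv (hN : IsCollar α o f D N z h)
    (hN' : ∀ q ∈ frontier D, f q ∈ N) (hγ : IsOrientedBoundary o D γ) (hφ : IsPushOff f γ v φ)
    (i : Fin m) : Continuous fun s => collarDeriv z h f v (γ i s) := by
  have h1 : (fun s => collarDeriv z h f v (γ i s)) =
      fun s => fderiv ℝ (pushOffFun z h (φ i)) (0, s) (1, 0) :=
    funext fun s => (hN.fderiv_pushOffFun hN' hγ hφ i s).2.symm
  rw [h1, continuous_iff_continuousAt]
  intro s
  have h2 := ((hN.fderiv_pushOffFun hN' hγ hφ i s).1.fderiv_right (m := 0) (by simp)).continuousAt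
  have h3 : ContinuousAt (fun s : ℝ => ((0 : ℝ), s)) s := by fun_prop
  exact (ContinuousAt.comp (f := fun s : ℝ => ((0 : ℝ), s)) h2 h3).clm_apply continuousAt_const

end PushOff

end

end LegendrianRibbon

namespace LegendrianRibbon

noncomputable section

section Count

variable {M : Type*} [TopologicalSpace M] [ChartedSpace E3 M] [IsManifold (𝓡 3) ∞ M]
  {S : Type*} [TopologicalSpace S] [ChartedSpace E2 S] [IsManifold (𝓡 2) ∞ S] {f : S → M}
  {α : ∀ x : M, TangentSpace (𝓡 3) x →L[ℝ] ℝ}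
  {o : ∀ p : S, Orientation ℝ (TangentSpace (𝓡 2) p) (Fin 2)} {D : Set S} {N : Set M} {z h : M → ℝ}
  {m : ℕ} {γ : Fin m → ℝ → S} {v : ∀ p : S, TangentSpace (𝓡 3) (f p)} {φ : Fin m → ℝ → ℝ → M}

omit [IsManifold (𝓡 3) ∞ M] [IsManifold (𝓡 2) ∞ S] in
/-- Signs of crossings are the signs of the derivative of `z` along the curve. -/
theorem IsCollar.crossing_sign (hN : IsCollar α o f D N z h)
    (hf : Manifold.IsSmoothEmbedding (𝓡 2) (𝓡 3) ∞ f) (hα : IsContactForm α) {q : S}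
    (hq : f q ∈ N) {n : E3} (hn : ∀ w, tD E2 E3 f q w ≠ n) {ε : ℝ} (hε : ε = 1 ∨ ε = -1) :
    (∀ a b : E2, IsPositivePair (o q) a b →
      0 < ε * contactVolume α (f q) n (tD E2 E3 f q a) (tD E2 E3 f q b)) ↔
      0 < ε * tD E3 ℝ z (f q) n := by
  have hpos : ∀ a b : E2, IsPositivePair (o q) a b → ∀ n : E3,
    0 < contactVolume α (f q) n (tD E2 E3 f q a) (tD E2 E3 f q b) → 0 < tD E3 ℝ z (f q) n :=
    hN.pos_z q hq
  have hneg : ∀ a b : E2, IsPositivePair (o q) a b → ∀ n : E3,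
      contactVolume α (f q) n (tD E2 E3 f q a) (tD E2 E3 f q b) < 0 → tD E3 ℝ z (f q) n < 0 := by
    intro a b hab n h
    have h2 := hpos a b hab (-n) (by rw [contactVolume_neg]; exact neg_pos.mpr h)
    rw [map_neg] at h2
    exact neg_pos.mp h2
  constructor
  · intro H
    obtain ⟨a, b, hab⟩ := exists_isPositivePair (o q)
    have h1 := H a b hab
    rcases hε with rfl | rfl
    · rw [one_mul] at h1 ⊢
      exact hpos a b hab n h1
    · rw [neg_one_mul] at h1 ⊢
      exact neg_pos.mpr (hneg a b hab n (neg_pos.mp h1))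
  · intro H a b hab
    have hne := contactVolume_ne_zero hf hα hab hn
    rcases hε with rfl | rfl
    · rw [one_mul] at H ⊢
      rcases hne.lt_or_gt with h1 | h1
      · exact absurd (hneg a b hab n h1) (not_lt.mpr H.le)
      · exact h1
    · rw [neg_one_mul] at H ⊢
      rcases hne.lt_or_gt with h1 | h1
      · exact neg_pos.mpr h1
      · exact absurd (hpos a b hab n h1) (not_lt.mpr (neg_pos.mp H).le)

/-- For small `t`, the push-off stays where the surface is cut out by the two functions, and these
functions are close along it to `t` times their derivatives. -/
theorem IsCollar.eventually_pushOff (hN : IsCollar α o f D N z h)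
    (hN' : ∀ q ∈ frontier D, f q ∈ N) (hf : Manifold.IsSmoothEmbedding (𝓡 2) (𝓡 3) ∞ f)
    (hα : IsContactForm α) (hγ : IsOrientedBoundary o D γ) (hφ : IsPushOff f γ v φ)
    (hc0 : ∀ i s, collarDeriv z h f v (γ i s) ≠ 0) (i : Fin m) :
    ∀ᶠ t in 𝓝 (0 : ℝ), ∀ s ∈ Icc (0 : ℝ) 1,
      (φ i t s ∈ N ∧ (z (φ i t s) = 0 → ∃ q, f q = φ i t s)) ∧
      (0 < t → pushOffFun z h (φ i) (t, s) / collarDeriv z h f v (γ i s) ∈ Complex.slitPlane) := by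
  refine isCompact_Icc.eventually_forall_of_forall_eventually fun s _ => ?_
  have hx : φ i 0 s = f (γ i s) := hφ.start i s
  have hxN := hN' _ (hγ.mem_frontier i s)
  have hcont : Tendsto (fun x : ℝ × ℝ => φ i x.1 x.2) (𝓝 (0, s)) (𝓝 (f (γ i s))) := by
    have := ((contMDiffAt_pushOff hφ i).self_of_nhds s).continuousAt.tendsto
    rwa [hx] at this
  have h1 : ∀ᶠ x in 𝓝 (f (γ i s)), x ∈ N ∧ (z x = 0 → ∃ q, f q = x) := by
    filter_upwards [hN.isOpen.mem_nhds hxN, hN.eventually_exists_eq hf hα hxN] with x h1 h2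
      using ⟨h1, h2⟩
  obtain ⟨h2, h3⟩ := hN.fderiv_pushOffFun hN' hγ hφ i s
  have h0 : ∀ s', pushOffFun z h (φ i) (0, s') = 0 := by
    intro s'
    have hs' := hγ.mem_frontier i s'
    apply Complex.ext
    · show z (φ i 0 s') = 0
      rw [hφ.start]; exact hN.z_eq _ (hN' _ hs')
    · show h (φ i 0 s') = 0
      rw [hφ.start]; exact hN.h_eq _ hs' (hN' _ hs')
  have h4 := eventually_div_mem_slitPlane (c := fun s => collarDeriv z h f v (γ i s))
    (h2.hasStrictFDerivAt (by simp)) h0 (hN.continuous_collarDeriv hN' hγ hφ i).continuousAt h3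
    (hc0 i s)
  filter_upwards [hcont.eventually h1, h4] with x h5 h6 using ⟨h5, h6⟩

/-- The number of intersections of a small push-off with the surface is a winding number. -/
theorem IsCollar.intersectionNumber_eq (hN : IsCollar α o f D N z h)
    (hN' : ∀ q ∈ frontier D, f q ∈ N) (hf : Manifold.IsSmoothEmbedding (𝓡 2) (𝓡 3) ∞ f)
    (hα : IsContactForm α) (hγ : IsOrientedBoundary o D γ) (hφ : IsPushOff f γ v φ)
    (hc0 : ∀ i s, collarDeriv z h f v (γ i s) ≠ 0) {n : ℤ}
    (hn : ∃ᶠ t in 𝓝[>] (0 : ℝ), IsIntersectionNumber α o f D (fun i => φ i t) n) :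
    (n : ℝ) * (2 * Real.pi) = ∑ i, argVar (fun s => collarDeriv z h f v (γ i s)) 0 1 := by
  have hev := eventually_all.mpr fun i => hN.eventually_pushOff hN' hf hα hγ hφ hc0 i
  have hsm : ∀ᶠ t in 𝓝 (0 : ℝ), ∀ i s, ContMDiffAt 𝓘(ℝ, ℝ × ℝ) 𝓘(ℝ, E3) ∞
      (fun x : ℝ × ℝ => φ i x.1 x.2) (t, s) := eventually_all.mpr fun i => contMDiffAt_pushOff hφ i
  obtain ⟨t, ⟨-, htr, hcount⟩, ⟨hgood, hsmooth⟩, ht⟩ := (hn.and_eventually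
    (((hev.and hsm).filter_mono nhdsWithin_le_nhds).and self_mem_nhdsWithin)).exists
  have ht : 0 < t := ht
  have hfr : ∀ i s, φ i t (Int.fract s) = φ i t s := fun i s => by
    have := ((hφ.periodic i t).int_mul ⌊s⌋).sub_eq s
    rwa [mul_one] at this
  have hmem : ∀ s : ℝ, Int.fract s ∈ Icc (0 : ℝ) 1 := fun s =>
    ⟨Int.fract_nonneg s, (Int.fract_lt_one s).le⟩
  have hφN : ∀ i s, φ i t s ∈ N ∧ (z (φ i t s) = 0 → ∃ q, f q = φ i t s) := fun i s => by
    rw [← hfr i s]; exact (hgood i _ (hmem s)).1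
  set U : Fin m → ℝ → ℂ := fun i s => pushOffFun z h (φ i) (t, s) with hU
  have hUfr : ∀ i s, U i (Int.fract s) = U i s := fun i s => by
    simp only [hU, pushOffFun, hfr]
  have hU0 : ∀ i s, U i s ≠ 0 := by
    intro i s h0
    have := (hgood i _ (hmem s)).2 ht
    rw [show pushOffFun z h (φ i) (t, Int.fract s) = U i (Int.fract s) from rfl, hUfr, h0,
      zero_div] at this
    exact Complex.slitPlane_ne_zero this rfl
  have hUc : ∀ i, Continuous (U i) := fun i => continuous_iff_continuousAt.mpr fun s => by
    have h1 := (hN.contDiffAt_pushOffFun (hsmooth i s) (hφN i s).1).continuousAt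
    have h2 : ContinuousAt (fun s : ℝ => (t, s)) s := by fun_prop
    exact ContinuousAt.comp (f := fun s : ℝ => (t, s)) h1 h2
  have hUper : ∀ i, Function.Periodic (U i) 1 := fun i s => by
    simp only [hU, pushOffFun, (hφ.periodic i t) s]
  have hUd : ∀ i s, deriv (fun s => (U i s).re) s =
      tD E3 ℝ z (φ i t s) (velocity (φ i t) s) := fun i s =>
    (hasDerivAt_comp ((hN.smooth_z _ (hφN i s).1).mdifferentiableAt (by simp))
      (mdifferentiableAt_curves (hsmooth i s)).2).deriv
  have hcross : ∀ i s, (U i s).re = 0 → (U i s).im < 0 → ∃ q ∈ D, f q = φ i t s := by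
    intro i s h1 h2
    obtain ⟨q, hq⟩ := (hφN i s).2 h1
    refine ⟨q, (hN.mem_iff q (by rw [hq]; exact (hφN i s).1)).mpr ?_, hq⟩
    rw [hq]; exact h2.le
  have htrans : ∀ i s, ∀ q ∈ D, f q = φ i t s → ∀ w, tD E2 E3 f q w ≠ (velocity (φ i t) s : E3) :=
    fun i s q hq hqs w => htr i s q hq hqs w
  have hset : ∀ ε : ℝ, ε = 1 ∨ ε = -1 → ∀ i,
      {s | (i, s) ∈ crossings α o f D (fun i => φ i t) ε} =
        {s ∈ Ico (0 : ℝ) 1 | (U i s).re = 0 ∧ (U i s).im < 0 ∧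
          0 < ε * deriv (fun s => (U i s).re) s} := by
    intro ε hε i
    ext s
    constructor
    · rintro ⟨hs, q, hq, hqs, hab⟩
      have hqs : f q = φ i t s := hqs
      have hqN : f q ∈ N := by rw [hqs]; exact (hφN i s).1
      have h1 : (U i s).re = 0 := by
        show z (φ i t s) = 0
        rw [← hqs]; exact hN.z_eq q hqN
      have h2 : (U i s).im ≤ 0 := by
        show h (φ i t s) ≤ 0
        rw [← hqs]; exact (hN.mem_iff q hqN).mp hq
      refine ⟨hs, h1, lt_of_le_of_ne h2 fun h3 => hU0 i s (Complex.ext h1 h3), ?_⟩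
      rw [hUd, ← hqs]
      exact (hN.crossing_sign hf hα hqN (htrans i s q hq hqs) hε).mp hab
    · rintro ⟨hs, h1, h2, h3⟩
      obtain ⟨q, hq, hqs⟩ := hcross i s h1 h2
      have hqN : f q ∈ N := by rw [hqs]; exact (hφN i s).1
      refine ⟨hs, q, hq, hqs, ?_⟩
      rw [hUd, ← hqs] at h3
      exact (hN.crossing_sign hf hα hqN (htrans i s q hq hqs) hε).mpr h3
  have hmain := fun i => ncard_crossings_eq_argVar (hUc i) (hU0 i) (hUper i) fun s h1 h2 => by
    obtain ⟨q, hq, hqs⟩ := hcross i s h1 h2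
    rw [hUd, ← hqs]
    exact hN.tD_ne_zero hf hα (by rw [hqs]; exact (hφN i s).1) (htrans i s q hq hqs)
  have hset1 := hset 1 (Or.inl rfl)
  have hset2 := hset (-1) (Or.inr rfl)
  simp only [one_mul, neg_one_mul, neg_pos] at hset1 hset2
  have hc1 := ncard_eq_sum_fiber (A := crossings α o f D (fun i => φ i t) 1) fun i => by
    rw [hset1]; exact (hmain i).1
  have hc2 := ncard_eq_sum_fiber (A := crossings α o f D (fun i => φ i t) (-1)) fun i => by
    rw [hset2]; exact (hmain i).2.1
  rw [hcount, hc1, hc2]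
  push_cast
  rw [← Finset.sum_sub_distrib, Finset.sum_mul]
  refine Finset.sum_congr rfl fun i _ => ?_
  rw [hset1, hset2, (hmain i).2.2]
  have h01 : γ i 0 = γ i 1 := by
    have := hγ.periodic i 0
    rw [zero_add] at this
    exact this.symm
  have hU01 : U i 0 = U i 1 := by
    have := hUper i 0
    rw [zero_add] at this
    exact this.symm
  exact argVar_eq_of_slitPlane zero_le_one
    (hN.continuous_collarDeriv hN' hγ hφ i).continuousOn (hUc i).continuousOn
    (fun s _ => hc0 i s) (fun s hs => (hgood i s hs).2 ht) (by rw [h01]) hU01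

end Count

end

end LegendrianRibbon

namespace LegendrianRibbon

noncomputable section

/-! ### The winding number of the section along the boundary -/

section Compare

/-- Complex numbers with the same real part are not opposite to each other if their imaginary parts
have the same sign whenever the real part vanishes. -/
theorem div_mem_slitPlane_of_re_eq {x y y' : ℝ} (h : x = 0 → 0 < y * y') :
    (⟨x, y'⟩ : ℂ) / ⟨x, y⟩ ∈ Complex.slitPlane := by
  have hn : 0 < Complex.normSq ⟨x, y⟩ := by
    rw [Complex.normSq_pos]
    intro h0
    have hx : x = 0 := congrArg Complex.re h0
    have hy : y = 0 := congrArg Complex.im h0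
    have := h hx
    rw [hy, zero_mul] at this
    exact lt_irrefl _ this
  rw [Complex.mem_slitPlane_iff]
  by_cases hx : x = 0
  · left
    rw [Complex.div_re, ← add_div]
    refine div_pos ?_ hn
    have := h hx
    simp only [hx]
    linarith
  · by_cases hy : y = y'
    · left
      rw [Complex.div_re, ← add_div]
      refine div_pos ?_ hn
      simp only [hy]
      exact add_pos_of_pos_of_nonneg (mul_self_pos.mpr hx) (mul_self_nonneg y')
    · right
      rw [Complex.div_im, ← sub_div]
      refine div_ne_zero ?_ hn.ne'
      simp only
      rw [show y' * x - x * y = x * (y' - y) by ring]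
      exact mul_ne_zero hx (sub_ne_zero.mpr (Ne.symm hy))

theorem div_mem_slitPlane_of_im_eq {x x' y : ℝ} (h : y = 0 → 0 < x * x') :
    (⟨x', y⟩ : ℂ) / ⟨x, y⟩ ∈ Complex.slitPlane := by
  have h1 := div_mem_slitPlane_of_re_eq (x := y) (y := -x) (y' := -x') fun hy => by
    rw [neg_mul_neg]; exact h hy
  have e1 : (⟨y, -x'⟩ : ℂ) = -Complex.I * ⟨x', y⟩ := by apply Complex.ext <;> simp
  have e2 : (⟨y, -x⟩ : ℂ) = -Complex.I * ⟨x, y⟩ := by apply Complex.ext <;> simp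
  rwa [e1, e2, mul_div_mul_left _ _ (neg_ne_zero.mpr Complex.I_ne_zero)] at h1

theorem vol3_smul_of_eq_zero {β : E3 →L[ℝ] ℝ} {B : E3 →L[ℝ] E3 →L[ℝ] ℝ} {v x y : E3} (hv : β v = 0)
    (h0 : B v y - B y v = 0) (c : ℝ) :
    vol3 β B (c • v) x y = c * (β y * (B v x - B x v)) := by
  simp only [vol3, map_smul, _root_.smul_apply, smul_eq_mul, hv]
  linear_combination -β x * c * h0

variable {M : Type*} [TopologicalSpace M] [ChartedSpace E3 M] [IsManifold (𝓡 3) ∞ M]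
  {S : Type*} [TopologicalSpace S] [ChartedSpace E2 S] [IsManifold (𝓡 2) ∞ S] {f : S → M}
  {α : ∀ x : M, TangentSpace (𝓡 3) x →L[ℝ] ℝ}
  {o : ∀ p : S, Orientation ℝ (TangentSpace (𝓡 2) p) (Fin 2)} {D : Set S} {N : Set M} {z h : M → ℝ}

omit [IsManifold (𝓡 3) ∞ M] [IsManifold (𝓡 2) ∞ S] in
/-- The position of a vector `v` of the contact plane at a boundary point: if `v` is tangent to the
surface, its outward component and `dα(v, e)` have the same sign. -/
theorem IsCollar.mul_pos_of_tD_eq_zero (hN : IsCollar α o f D N z h)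
    (hf : Manifold.IsSmoothEmbedding (𝓡 2) (𝓡 3) ∞ f) (hα : IsContactForm α) {q : S}
    (hqD : q ∈ frontier D) (hq : f q ∈ N) {w e : E2} (hw : IsOutward D q w)
    (hwe : IsPositivePair (o q) w e) (he : tD E3 ℝ h (f q) (tD E2 E3 f q e) = 0)
    (hpos : 0 < extDer α (f q) (tD E2 E3 f q w) (tD E2 E3 f q e))
    (hβ : 0 < (α (f q) : E3 →L[ℝ] ℝ) (tD E2 E3 f q e)) {v : E3}
    (hv : (α (f q) : E3 →L[ℝ] ℝ) v = 0) (hv0 : v ≠ 0) (hz : tD E3 ℝ z (f q) v = 0) :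
    0 < tD E3 ℝ h (f q) v * extDer α (f q) v (tD E2 E3 f q e) := by
  obtain ⟨u, rfl⟩ : ∃ u, tD E2 E3 f q u = v := by
    by_contra! hcon
    exact hN.tD_ne_zero hf hα hq hcon hz
  obtain ⟨a, b, rfl⟩ : ∃ a b : ℝ, u = a • w + b • e := by
    obtain ⟨B, rfl, rfl, -⟩ := hwe
    refine ⟨B.repr u 0, B.repr u 1, ?_⟩
    have := B.sum_repr u
    rw [Fin.sum_univ_two] at this
    exact this.symm
  have ha : a ≠ 0 := by
    rintro rfl
    rw [zero_smul, zero_add, map_smul] at hv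
    have hv : b * (α (f q) : E3 →L[ℝ] ℝ) (tD E2 E3 f q e) = 0 :=
      ((α (f q) : E3 →L[ℝ] ℝ).map_smul b _).symm.trans hv
    rcases mul_eq_zero.mp hv with h0 | h0
    · rw [h0] at hv0
      simp at hv0
    · exact hβ.ne' h0
  have hh := hN.pos_h q hqD hq w hw
  set Fw := tD E2 E3 f q w with hFw
  set Fe := tD E2 E3 f q e with hFe
  have e1 : tD E2 E3 f q (a • w + b • e) = a • Fw + b • Fe := by
    rw [map_add, map_smul, map_smul]
  have e2 : extDer α (f q) (a • Fw + b • Fe : E3) Fe = a * extDer α (f q) Fw Fe := by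
    have e3 : ∀ x y : E3, extDer α (f q) x y =
      fderiv ℝ (localForm α (f q)) (extChartAt (𝓡 3) (f q) (f q)) x y -
      fderiv ℝ (localForm α (f q)) (extChartAt (𝓡 3) (f q) (f q)) y x := fun _ _ => rfl
    rw [e3, e3]
    simp only [map_add, map_smul, _root_.add_apply, _root_.smul_apply, smul_eq_mul]
    ring
  rw [e1, e2, map_add, map_smul, map_smul, he, smul_zero, add_zero, smul_eq_mul]
  have e4 : ∀ x y : ℝ, a * x * (a * y) = a * a * (x * y) := fun x y => by ring
  rw [e4]
  exact mul_pos (mul_self_pos.mpr ha) (mul_pos hh hpos)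

omit [IsManifold (𝓡 3) ∞ M] [IsManifold (𝓡 2) ∞ S] in
/-- If `v` is parallel to the characteristic direction, in the sense that `dα(v, e) = 0`, the side
of the surface to which `v` points is determined by the positive frame. -/
theorem IsCollar.mul_pos_of_extDer_eq_zero (hN : IsCollar α o f D N z h) {q : S}
    (hq : f q ∈ N) {w e : E2} (hwe : IsPositivePair (o q) w e)
    (hβ : 0 < (α (f q) : E3 →L[ℝ] ℝ) (tD E2 E3 f q e)) {v : E3}
    (hv : (α (f q) : E3 →L[ℝ] ℝ) v = 0) (h0 : extDer α (f q) v (tD E2 E3 f q e) = 0)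
    {x : ℝ} (hx : 0 < x * extDer α (f q) v (tD E2 E3 f q w)) :
    0 < tD E3 ℝ z (f q) v * x := by
  set k := extDer α (f q) v (tD E2 E3 f q w) with hk
  have hvol : ∀ c : ℝ, contactVolume α (f q) (c • v : E3) (tD E2 E3 f q w) (tD E2 E3 f q e) =
      c * ((α (f q) : E3 →L[ℝ] ℝ) (tD E2 E3 f q e) * k) := by
    exact fun c => vol3_smul_of_eq_zero hv h0 c
  have key : ∀ c : ℝ, 0 < c * k → 0 < c * tD E3 ℝ z (f q) v := by
    intro c hc
    have h1 := hN.pos_z q hq w e hwe (c • v) (by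
      rw [hvol, mul_left_comm]
      exact mul_pos hβ hc)
    rwa [map_smul, smul_eq_mul] at h1
  have h1 := key x hx
  rwa [mul_comm]

variable {m : ℕ} {γ : Fin m → ℝ → S} {v : ∀ p : S, TangentSpace (𝓡 3) (f p)}
  {φ : Fin m → ℝ → ℝ → M}

omit [IsManifold (𝓡 3) ∞ M] [IsManifold (𝓡 2) ∞ S] in
theorem velocity_comp (hf : ContMDiff (𝓡 2) (𝓡 3) ∞ f) {c : ℝ → S} {s : ℝ}
    (hc : MDifferentiableAt 𝓘(ℝ, ℝ) 𝓘(ℝ, E2) c s) :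
    (velocity (fun s => f (c s)) s : E3) = tD E2 E3 f (c s) (tD ℝ E2 c s 1) :=
  congrArg (fun L : ℝ →L[ℝ] E3 => L 1) (tD_comp (hf.mdifferentiableAt (by simp)) hc)

/-- The winding number of the section `v` along a boundary component, measured in the normal plane,
is opposite to that of the tangent vector, measured in the positive frame `(μ, dα(v, ·))`. -/
theorem IsCollar.argVar_collarDeriv (hN : IsCollar α o f D N z h)
    (hN' : ∀ q ∈ frontier D, f q ∈ N) (hf : Manifold.IsSmoothEmbedding (𝓡 2) (𝓡 3) ∞ f)
    (hα : IsContactForm α) (hD : IsCompactSubsurface D) (hDc : IsClosed D)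
    (hγ : IsOrientedBoundary o D γ) (hφ : IsPushOff f γ v φ)
    (hv : IsNonvanishingSection α f D v)
    (htr : ∀ i s, 0 < α (f (γ i s)) (velocity (fun s' => f (γ i s')) s))
    (hpos : ∀ p ∈ D, ∀ a b : E2, IsPositivePair (o p) a b →
      0 < extDer α (f p) (tD E2 E3 f p a) (tD E2 E3 f p b))
    {Φ : S → E2 →L[ℝ] ℂ} (hΦ : IsContForm D Φ)
    (hΦim : ∀ p a, (Φ p a).im = extDer α (f p) (v p) (tD E2 E3 f p a))
    (hΦpos : ∀ p ∈ D, ∀ a b : E2, IsPositivePair (o p) a b → 0 < cross (Φ p a) (Φ p b))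
    (i : Fin m) :
    (∀ s, collarDeriv z h f v (γ i s) ≠ 0) ∧ argVar (fun s => collarDeriv z h f v (γ i s)) 0 1 =
      - argVar (fun s => Φ (γ i s) (tD ℝ E2 (γ i) s 1)) 0 1 := by
  have hfc : ContMDiff 𝓘(ℝ, E2) 𝓘(ℝ, E3) ∞ f := hf.isImmersion.contMDiff
  set e : ℝ → E2 := fun s => tD ℝ E2 (γ i) s 1 with he
  set κ : ℝ → ℂ := fun s => Φ (γ i s) (e s) with hκ
  set c : ℝ → ℂ := fun s => collarDeriv z h f v (γ i s) with hc
  have hmem : ∀ s, γ i s ∈ D := fun s => hDc.frontier_subset (hγ.mem_frontier i s)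
  have hγd : ∀ s, MDifferentiableAt 𝓘(ℝ, ℝ) 𝓘(ℝ, E2) (γ i) s := fun s =>
    (hγ.smooth i).mdifferentiableAt (by simp)
  have hvel : ∀ s, (velocity (fun s => f (γ i s)) s : E3) = tD E2 E3 f (γ i s) (e s) := fun s =>
    velocity_comp hfc (hγd s)
  have hpt : ∀ s, ((c s).re = 0 → 0 < (c s).im * (κ s).im) ∧
      ((κ s).im = 0 → 0 < (c s).re * -(κ s).re) := by
    intro s
    have hqD := hγ.mem_frontier i s
    have hqN := hN' _ hqD
    obtain ⟨g, hg⟩ := hD.2 _ hqD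
    obtain ⟨w, hw⟩ : ∃ w : E2, IsOutward D (γ i s) w := by
      have hd : tD E2 ℝ g (γ i s) ≠ 0 := hg.2.2.1
      obtain ⟨u, hu⟩ : ∃ u, 0 < tD E2 ℝ g (γ i s) u := by
        by_contra! hcon
        refine hd (ContinuousLinearMap.ext fun u => le_antisymm (hcon u) ?_)
        have := hcon (-u)
        rw [map_neg] at this
        simpa using this
      exact ⟨u, g, hg, hu⟩
    have hwe : IsPositivePair (o (γ i s)) w (e s) := hγ.oriented i s w hw
    have hβ : 0 < (α (f (γ i s)) : E3 →L[ℝ] ℝ) (tD E2 E3 f (γ i s) (e s)) := by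
      have h1 := htr i s
      rw [← hvel s]
      exact h1
    have hve := hv.mem_ker _ (hmem s)
    constructor
    · intro hz
      have he0 : tD E3 ℝ h (f (γ i s)) (tD E2 E3 f (γ i s) (e s)) = 0 := by
        have h1 := hasDerivAt_comp (κ := fun s => f (γ i s))
          ((hN.smooth_h _ hqN).mdifferentiableAt (by simp))
          ((hfc.mdifferentiableAt (by simp)).comp s (hγd s))
        have h2 : (fun s => h (f (γ i s))) = fun _ => (0 : ℝ) := funext fun s =>
          hN.h_eq _ (hγ.mem_frontier i s) (hN' _ (hγ.mem_frontier i s))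
        rw [h2] at h1
        rw [← hvel s]
        exact h1.unique (hasDerivAt_const s (0 : ℝ))
      rw [hκ]
      simp only [hΦim]
      exact hN.mul_pos_of_tD_eq_zero hf hα hqD hqN hw hwe he0 (hpos _ (hmem s) _ _ hwe) hβ hve
        (hv.ne_zero _ (hmem s)) hz
    · intro h0
      have h1 := hΦpos _ (hmem s) w (e s) hwe
      have h2 : (Φ (γ i s) (e s)).im = 0 := h0
      rw [cross, h2, mul_zero, zero_sub, mul_comm, ← neg_mul, hΦim] at h1
      exact hN.mul_pos_of_extDer_eq_zero hqN hwe hβ hve ((hΦim _ _).symm.trans h2) h1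
  have hc0 : ∀ s, c s ≠ 0 := by
    intro s h0
    have := (hpt s).1 (by rw [h0]; rfl)
    rw [h0] at this
    simp at this
  refine ⟨hc0, ?_⟩
  have hcc : Continuous c := hN.continuous_collarDeriv hN' hγ hφ i
  have hκc : Continuous κ := by
    have h1 := hΦ.continuousOn_comp_tDW uniqueDiffOn_univ (hγ.smooth i).contMDiffOn
      (fun s _ => hmem s)
    rw [← continuousOn_univ]
    refine (h1.clm_apply continuousOn_const (g := fun _ => (1 : ℝ))).congr fun s _ => ?_
    simp only [hκ, he, tDW_univ, ContinuousLinearMap.comp_apply]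
  have hκ0 : ∀ s, κ s ≠ 0 := by
    intro s h0
    have := (hpt s).2 (by rw [h0]; rfl)
    rw [h0] at this
    simp at this
  have h01 : γ i 0 = γ i 1 := by
    have := hγ.periodic i 0
    rw [zero_add] at this
    exact this.symm
  have hc01 : c 0 = c 1 := by simp only [hc, h01]
  have hκ01 : κ 0 = κ 1 := by
    have h1 : e 0 = e 1 := by
      have h2 : γ i = γ i ∘ fun s => s + 1 := funext fun s => (hγ.periodic i s).symm
      have h3 : tD ℝ ℝ (fun s : ℝ => s + 1) 0 = ContinuousLinearMap.id ℝ ℝ := by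
        rw [tD_eq_fderiv]
        exact ((hasFDerivAt_id (0 : ℝ)).add_const 1).fderiv
      have h4 := tD_comp (g := γ i) (f := fun s : ℝ => s + 1) (x := 0) (hγd _)
        (by fun_prop : DifferentiableAt ℝ (fun s : ℝ => s + 1) 0).mdifferentiableAt
      rw [← h2, h3, ContinuousLinearMap.comp_id, zero_add] at h4
      simp only [he, h4]
    simp only [hκ, h1, h01]
  set d : ℝ → ℂ := fun s => ⟨(c s).re, (κ s).im⟩ with hd
  have hdc : Continuous d := Complex.equivRealProdCLM.symm.continuous.comp
    ((Complex.continuous_re.comp hcc).prodMk (Complex.continuous_im.comp hκc))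
  have hd01 : d 0 = d 1 := by simp only [hd, hc01, hκ01]
  have e1 := argVar_eq_of_slitPlane zero_le_one hcc.continuousOn hdc.continuousOn
    (fun s _ => hc0 s) (fun s _ => div_mem_slitPlane_of_re_eq (hpt s).1) hc01 hd01
  have hconj : (fun s => -(starRingEnd ℂ) (κ s)) = fun s => ⟨-(κ s).re, (κ s).im⟩ := by
    funext s
    apply Complex.ext <;> simp
  have hcκ : Continuous fun s => (starRingEnd ℂ) (κ s) := Complex.continuous_conj.comp hκc
  have e2 := argVar_eq_of_slitPlane (c := d) (d := fun s => -(starRingEnd ℂ) (κ s)) zero_le_one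
    hdc.continuousOn hcκ.neg.continuousOn (fun s _ h0 => by
      have h1 : (c s).re = 0 := congrArg Complex.re h0
      have h2 : (κ s).im = 0 := congrArg Complex.im h0
      have := (hpt s).1 h1
      rw [h2, mul_zero] at this
      exact lt_irrefl _ this)
    (fun s _ => by
      rw [congrFun hconj s]
      exact div_mem_slitPlane_of_im_eq (hpt s).2) hd01 (by simp only [hκ01])
  rw [← e1, ← e2, argVar_neg zero_lt_one hcκ.continuousOn (fun s _ => by simpa using hκ0 s),
    argVar_conj zero_le_one hκc.continuousOn fun s _ => hκ0 s]

end Compare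

end

end LegendrianRibbon

theorem lemmal
    {M : Type*} [TopologicalSpace M] [T2Space M] [SecondCountableTopology M]
    [ChartedSpace LegendrianRibbon.E3 M] [IsManifold (𝓡 3) ∞ M]
    (α : ∀ x : M, TangentSpace (𝓡 3) x →L[ℝ] ℝ) (hα : LegendrianRibbon.IsContactForm α)
    (Γ : LegendrianRibbon.LegendrianGraph α)
    {S : Type*} [TopologicalSpace S] [ChartedSpace LegendrianRibbon.E2 S] [IsManifold (𝓡 2) ∞ S]
    (o : ∀ p : S, Orientation ℝ (TangentSpace (𝓡 2) p) (Fin 2))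
    (ho : LegendrianRibbon.IsSurfaceOrientation o)
    (f : S → M) (hf : Manifold.IsSmoothEmbedding (𝓡 2) (𝓡 3) ∞ f)
    (hΓ : LegendrianRibbon.IsTangentAlong Γ o f) :
    ∃ V : Set S, IsOpen V ∧ f ⁻¹' Γ.carrier ⊆ V ∧
      ∀ (D : Set S) (m : ℕ) (γ : Fin m → ℝ → S), D ⊆ V →
        LegendrianRibbon.IsRibbonNeighbourhood Γ o f D γ →
        ∀ s χ : ℤ, LegendrianRibbon.IsSelfLinkingNumber α o f D γ s →
          LegendrianRibbon.IsEulerCharacteristic D χ → s = -χ := by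
  open LegendrianRibbon in
  have hfc : ContMDiff 𝓘(ℝ, E2) 𝓘(ℝ, E3) ∞ f := hf.isImmersion.contMDiff
  have : T2Space S := hf.isEmbedding.t2Space
  refine ⟨{p | ∀ᶠ q in 𝓝 p, ∀ a b : E2, IsPositivePair (o q) a b →
    0 < extDer α (f q) (tD E2 E3 f q a) (tD E2 E3 f q b)}, isOpen_setOfPred_eventually_nhds,
    fun p hp => eventually_extDer_pos hfc hα.1 ho (hΓ.oriented p hp), ?_⟩
  rintro D m γ hDV hR s χ ⟨v, φ, hv, hφ, hn⟩ ⟨n, σ, hσ, rfl⟩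
  have hD := hR.subsurface
  have hγ := hR.boundary
  have hpos : ∀ p ∈ D, ∀ a b : E2, IsPositivePair (o p) a b →
      0 < extDer α (f p) (tD E2 E3 f p a) (tD E2 E3 f p b) := fun p hp =>
    (hDV hp : ∀ᶠ q in 𝓝 p, _).self_of_nhds
  obtain ⟨μ, hμ, hμpos⟩ := hv.exists_frame hα hfc ho hD.1 hpos
  set η : S → E2 →L[ℝ] ℝ := fun q => (contractDer α (f q) (v q)).comp (tD E2 E3 f q) with hη
  set Φ : S → E2 →L[ℝ] ℂ := fun q =>
    Complex.ofRealCLM.comp (μ q) + (Complex.I • Complex.ofRealCLM).comp (η q) with hΦ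
  have hΦre : ∀ p a, (Φ p a).re = μ p a := fun p a => by simp [hΦ]
  have hΦim : ∀ p a, (Φ p a).im = extDer α (f p) (v p) (tD E2 E3 f p a) := fun p a => by
    have : (Φ p a).im = η p a := by simp [hΦ]
    exact this
  have hΦc : IsContForm D Φ := (hμ.postcomp _).add ((hv.isContForm hα.1 hfc).postcomp _)
  have hΦpos : ∀ p ∈ D, ∀ a b : E2, IsPositivePair (o p) a b → 0 < cross (Φ p a) (Φ p b) := by
    intro p hp a b hab
    have := hμpos p hp a b hab
    simp only [cross, hΦre, hΦim]
    linarith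
  have hΦinj : ∀ p ∈ D, Function.Injective (Φ p) := by
    intro p hp
    rw [injective_iff_map_eq_zero]
    intro u hu
    obtain ⟨a, b, hab⟩ := exists_isPositivePair (o p)
    have hc := (hΦpos p hp a b hab).ne'
    obtain ⟨B, rfl, rfl, -⟩ := hab
    have hsum := B.sum_repr u
    rw [Fin.sum_univ_two] at hsum
    rw [← hsum, map_add, map_smul, map_smul] at hu
    have hre := congrArg Complex.re hu
    have him := congrArg Complex.im hu
    simp at hre him
    have h0 : B.repr u 0 * cross (Φ p (B 0)) (Φ p (B 1)) = 0 := by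
      simp only [cross]
      linear_combination (Φ p (B 1)).im * hre - (Φ p (B 1)).re * him
    have h1 : B.repr u 1 * cross (Φ p (B 0)) (Φ p (B 1)) = 0 := by
      simp only [cross]
      linear_combination (Φ p (B 0)).re * him - (Φ p (B 0)).im * hre
    rw [← hsum, (mul_eq_zero.mp h0).resolve_right hc, (mul_eq_zero.mp h1).resolve_right hc,
      zero_smul, zero_smul, add_zero]
  have hGB := hσ.sum_argVar_boundary hD hγ hΦc hΦinj fun i s g u hg hu =>
    hΦpos _ (hγ.mem hD i s) u _ (hγ.oriented i s u ⟨g, hg, hu⟩)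
  obtain ⟨N, z, h, hN', hN⟩ := exists_isCollar_frontier hf hα ho hD
  have hcomp := hN.argVar_collarDeriv hN' hf hα hD hD.1.isClosed hγ hφ hv hR.transverse hpos hΦc
    hΦim hΦpos
  have hcount := hN.intersectionNumber_eq hN' hf hα hγ hφ (fun i => (hcomp i).1) hn
  rw [Finset.sum_congr rfl fun i _ => (hcomp i).2, Finset.sum_neg_distrib, hGB] at hcount
  have h2π : (2 * Real.pi) ≠ 0 := Real.two_pi_pos.ne'
  have hs : (s : ℝ) = -((numVertices σ : ℝ) - numEdges σ + n) := by
    apply mul_right_cancel₀ h2π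
    rw [hcount]; ring
  exact_mod_cast hs
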